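/- **Model.** A quadrotor (mass $m>0$, symmetric positive definite inertia matrix $J$, position $x\in\mathbb R^3$, attitude $R\in SO(3)$, body angular velocity $\Omega$) carries a payload on a chain of $n$ links with directions $q_i\in S^2$, angular velocities $\omega_i\perp q_i$, lengths $l_i>0$ and masses $m_i>0$ at their outboard ends. The axis $e_3$ is the direction of gravity, $g>0$, and $\hat v w=v\times w$ with inverse $^\vee$. Put $M_{00}=m+\sum_i m_i$, $M_{0i}=M_{i0}=l_i\sum_{a\ge i}m_a$, $M_{ij}=l_il_j\sum_{a\ge\max(i,j)}m_a$. With thrust $f$, moment $M$ and constant disturbances $\Delta_x,\Delta_R\in\mathbb R^3$ the dynamics is $$\dot R=R\hat\Omega,\qquad \dot q_i=\omega_i\times q_i,\qquad M_{00}\ddot x+\sum_i M_{0i}\ddot q_i=-fRe_3+M_{00}ge_3+\Delta_x,$$ $$M_{ii}\ddot q_i-\hat q_i^2\Big(M_{i0}\ddot x+\sum_{j\ne i}M_{ij}\ddot q_j\Big)=-M_{ii}\|\dot q_i\|^2q_i-\sum_{a\ge i}m_agl_i\,\hat q_i^2e_3,\qquad J\dot\Omega+\hat\Omega J\Omega=M+\Delta_R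 .$$ **Controller.** Let $x_d\in\mathbb R^3$, $b_{1d}\in S^2$, $C=[e_1,e_2]$, $\mathbf x=[x-x_d;C^T(e_3\times q_1);\dots;C^T(e_3\times q_n)]$, $\dot{\mathbf x}=[\dot x;C^T\omega_1;\dots;C^T\omega_n]$ in $\mathbb R^{2n+3}$, $z_1=[\mathbf x;\dot{\mathbf x}]$. Let $$\mathbf M=\begin{bmatrix}M_{00}I_3&\mathbf M_{xq}\\ \mathbf M_{xq}^T&(M_{ij}I_2)_{ij}\end{bmatrix},\quad \mathbf M_{xq}=[-M_{01}\hat e_3C,\dots,-M_{0n}\hat e_3C],\quad \mathbf G=\mathrm{diag}\Big(0_3,\Big(\sum_{a\ge i}m_agl_iI_2\Big)_{i}\Big),\quad \mathbf B=\begin{bmatrix}I_3\\0\end{bmatrix}.$$ For gain matrices $K_x=[k_xI_3,k_{q_1}I_{3\times2},\dots,k_{q_n}I_{3\times2}]$ and $K_{\dot x}$, $K_z$ of the same form (with scalars $k_{\dot x},k_{\omega_i}$ and $k_z,k_{z_i}$) put $$\mathbb A=\begin{bmatrix}0&I\\-\mathbf M^{-1}(\mathbf G+\mathbf BK_x)&-\mathbf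 M^{-1}\mathbf BK_{\dot x}\end{bmatrix},\qquad \mathbb B=\begin{bmatrix}0\\\mathbf M^{-1}\end{bmatrix}.$$ With symmetric positive definite $P,Q$ such that $\mathbb A^TP+P\mathbb A=-Q$, and with the componentwise saturation $\mathrm{sat}_\sigma$ at level $\sigma$, the ideal thrust and the thrust are $$A=-K_x\mathbf x-K_{\dot x}\dot{\mathbf x}-K_z\,\mathrm{sat}_\sigma(e_{\mathbf x})-M_{00}ge_3,\qquad \dot e_{\mathbf x}=(P\mathbb B)^Tz_1,\qquad f=-A\cdot Re_3 .$$ Let $b_{3c}=-A/\|A\|$, $R_c=\big[-\hat b_{3c}^2b_{1d}/\|\hat b_{3c}^2b_{1d}\|,\ \hat b_{3c}b_{1d}/\|\hat b_{3c}b_{1d}\|,\ b_{3c}\big]$, $\Omega_c=(R_c^T\dot R_c)^\vee$, $\Psi=\frac12\mathrm{tr}(I-R_c^TR)$, $e_R=\frac12(R_c^TR-R^TR_c)^\vee$, $e_\Omega=\Omega-R^TR_c\Omega_c$. The moment is $$M=-k_Re_R-k_\Omega e_\Omega-k_Ie_I+\Omega\times J\Omega-J(\hat\Omega R^TR_c\Omega_c-R^TR_c\dot\Omega_c),\qquad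 \dot e_I=e_\Omega+c_2e_R .$$ **Proposition.** Let $\delta,\delta_R>0$. There exist gains with $k_R,k_\Omega,k_I,c_2,\sigma,k_z>0$, $\delta<k_z\sigma$ and matrices $P,Q$ as above, depending only on the data of the model, $x_d$, $b_{1d}$, $\delta$ and $\delta_R$, such that for all $\Delta_x,\Delta_R$ with $\|\Delta_x\|_\infty\le\delta$ and $b_{1d}\times(M_{00}ge_3+\Delta_x)\ne0$ (that is, at the equilibrium $A\neq 0$ and $b_{1d}$ is not parallel to $b_{3c}$) the following holds for the closed loop. (i) The equilibrium at which all tracking errors vanish ($x=x_d$, $\dot x=0$, $q_i=e_3$, $\omega_i=0$, $R=R_c$, $e_\Omega=0$), with integral terms $e_{\mathbf x}=[\Delta_x/k_z;0;\dots;0]$ and $e_I=\Delta_R/k_I$, is stable in the sense of Lyapunov; in particular the solutions that start near it exist for all $t\ge0$. (ii) For every solution that starts sufficiently near this equilibrium, $e_R,e_\Omega,\mathbf x,\dot{\mathbf x}\to0$ as $t\to\infty$; moreover $q_i\to e_3$ and $\Psi\to0$. (iii) The integral terms $e_I$ and $e_{\mathbf x}$ of the solutions in (ii) are bounded, uniformly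 in $t\ge 0$ and in these solutions. If moreover $\max_i|(\Delta_R)_i|\le\delta_R$, and $b_{1d}\times(M_{00}ge_3+d)\ne0$ for every $d$ with $\|d\|_\infty\le\delta$, then global existence, (ii) and (iii) also hold for the solutions whose integral terms start at zero, $e_{\mathbf x}=\int_0^t(P\mathbb B)^Tz_1\,d\tau$ and $e_I=\int_0^t(e_\Omega+c_2e_R)\,d\tau$, and whose initial tracking errors (differences of position, velocity, link directions and link angular velocities to the equilibrium, $\Psi$, and $e_\Omega$) are sufficiently small. -/

import Mathlib

open Filter Topology Set Matrix

noncomputable section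

namespace QuadCable

/-- Vectors of `ℝ³`. The ambient norm `‖·‖` of this type is the maximum norm; the Euclidean norm is
`len` below. -/
abbrev V3 := Fin 3 → ℝ

abbrev Mat3 := Matrix (Fin 3) (Fin 3) ℝ

/-- Euclidean length. -/
def len (v : V3) : ℝ := Real.sqrt (v ⬝ᵥ v)

/-- The third inertial axis, which is the direction of gravity. -/
def e3 : V3 := ![0, 0, 1]

/-- The matrix of `w ↦ v × w`. -/
def hat (v : V3) : Mat3 := !![0, -v 2, v 1; v 2, 0, -v 0; -v 1, v 0, 0]

/-- The inverse of `hat` on skew-symmetric matrices. -/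
def vee (S : Mat3) : V3 := ![S 2 1, S 0 2, S 1 0]

/-- `C = [e₁, e₂]`, which is also the matrix `I_{3×2}`. -/
def C : Matrix (Fin 3) (Fin 2) ℝ := !![1, 0; 0, 1; 0, 0]

/-- The componentwise saturation at level `σ`. -/
def sat {ι : Type} (σ : ℝ) (y : ι → ℝ) : ι → ℝ := fun i => max (-σ) (min (y i) σ)

/-- Indices of the linearized coordinates: three for the position of the quadrotor, two for each
link. -/
abbrev XIdx (n : ℕ) := Fin 3 ⊕ (Fin n × Fin 2)

/-- Indices of `z₁ = [𝐱, 𝐱̇]`. -/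
abbrev ZIdx (n : ℕ) := XIdx n ⊕ XIdx n

/-- Data of the quadrotor, of the `n` links and of the command. -/
structure Params (n : ℕ) where
  /-- mass of the quadrotor -/
  m : ℝ
  /-- inertia matrix of the quadrotor -/
  J : Mat3
  /-- mass at the outboard end of each link; the last one is the payload -/
  mL : Fin n → ℝ
  /-- length of each link -/
  l : Fin n → ℝ
  /-- gravitational acceleration -/
  g : ℝ
  /-- desired position of the quadrotor -/
  xd : V3
  /-- desired direction of the first body-fixed axis -/
  b1d : V3

/-- Controller gains and parameters. -/
structure Gains (n : ℕ) where
  kx : ℝ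
  kq : Fin n → ℝ
  kxdot : ℝ
  kω : Fin n → ℝ
  kz : ℝ
  kzq : Fin n → ℝ
  σ : ℝ
  Q : Matrix (ZIdx n) (ZIdx n) ℝ
  P : Matrix (ZIdx n) (ZIdx n) ℝ
  kR : ℝ
  kΩ : ℝ
  kI : ℝ
  c2 : ℝ

section Model

variable {n : ℕ} (p : Params n)

/-! ### Inertia values -/

def M00 : ℝ := p.m + ∑ a, p.mL a

/-- Total mass carried by link `i`. -/
def outerMass (i : Fin n) : ℝ := ∑ a ∈ Finset.Ici i, p.mL a

def M0 (i : Fin n) : ℝ := outerMass p i * p.l i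

def Mij (i j : Fin n) : ℝ := outerMass p (max i j) * p.l i * p.l j

/-! ### Linearization at the hanging equilibrium -/

def linMxq : Matrix (Fin 3) (Fin n × Fin 2) ℝ :=
  Matrix.of fun r ic => -(M0 p ic.1) * (hat e3 * C) r ic.2

def linMqq : Matrix (Fin n × Fin 2) (Fin n × Fin 2) ℝ :=
  Matrix.of fun ic jd => Mij p ic.1 jd.1 * (1 : Matrix (Fin 2) (Fin 2) ℝ) ic.2 jd.2

def linM : Matrix (XIdx n) (XIdx n) ℝ :=
  Matrix.fromBlocks (M00 p • (1 : Mat3)) (linMxq p) (linMxq p)ᵀ (linMqq p)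

def linG : Matrix (XIdx n) (XIdx n) ℝ :=
  Matrix.fromBlocks 0 0 0
    (Matrix.diagonal fun ic : Fin n × Fin 2 => outerMass p ic.1 * p.g * p.l ic.1)

def linB (n : ℕ) : Matrix (XIdx n) (Fin 3) ℝ :=
  Matrix.fromRows (1 : Mat3) (0 : Matrix (Fin n × Fin 2) (Fin 3) ℝ)

/-- The gain matrix `[a I₃, b₁ I_{3×2}, …, bₙ I_{3×2}]`. -/
def gainMat (a : ℝ) (b : Fin n → ℝ) : Matrix (Fin 3) (XIdx n) ℝ :=
  Matrix.fromCols (a • (1 : Mat3)) (Matrix.of fun r (ic : Fin n × Fin 2) => b ic.1 * C r ic.2)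

/-- The closed-loop matrix of the linearized system. -/
def clA (k : Gains n) : Matrix (ZIdx n) (ZIdx n) ℝ :=
  Matrix.fromBlocks 0 1
    (-((linM p)⁻¹ * (linG p + linB n * gainMat k.kx k.kq)))
    (-((linM p)⁻¹ * linB n * gainMat k.kxdot k.kω))

/-- The input matrix of the linearized system. -/
def clB : Matrix (ZIdx n) (XIdx n) ℝ :=
  Matrix.fromRows (0 : Matrix (XIdx n) (XIdx n) ℝ) (linM p)⁻¹

/-- Requirements on the gains, for a known bound `δ` on the maximum norm of the disturbance force.
The matrix `P` is the solution of the Lyapunov equation that belongs to `Q`. -/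
structure Gains.Admissible (k : Gains n) (δ : ℝ) : Prop where
  kR_pos : 0 < k.kR
  kΩ_pos : 0 < k.kΩ
  kI_pos : 0 < k.kI
  c2_pos : 0 < k.c2
  σ_pos : 0 < k.σ
  kz_pos : 0 < k.kz
  kz_σ : δ < k.kz * k.σ
  Q_pos : k.Q.PosDef
  P_pos : k.P.PosDef
  lyapunov : (clA p k)ᵀ * k.P + k.P * clA p k = -k.Q

end Model

/-! ### States and feedback -/

/-- State of the quadrotor, of the links and of the two integrators, apart from the angular velocity
of the quadrotor. -/
structure State (n : ℕ) where
  /-- position of the quadrotor -/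
  x : V3
  /-- velocity of the quadrotor -/
  v : V3
  /-- directions of the links -/
  q : Fin n → V3
  /-- angular velocities of the links -/
  ω : Fin n → V3
  /-- attitude of the quadrotor -/
  R : Mat3
  /-- integral term of the thrust -/
  ex : XIdx n → ℝ
  /-- integral term of the moment -/
  eI : V3

/-- `R ∈ SO(3)`, `qᵢ ∈ S²` and `ωᵢ ⊥ qᵢ`. -/
structure State.Valid {n : ℕ} (st : State n) : Prop where
  R_mem : st.R ∈ Matrix.specialOrthogonalGroup (Fin 3) ℝ
  q_unit : ∀ i, st.q i ⬝ᵥ st.q i = 1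
  q_perp : ∀ i, st.q i ⬝ᵥ st.ω i = 0

section Feedback

variable {n : ℕ} (p : Params n) (k : Gains n)

/-- `𝐱 = [x - x_d; Cᵀ(e₃ × q₁); …; Cᵀ(e₃ × qₙ)]`. -/
def posErr (st : State n) : XIdx n → ℝ :=
  Sum.elim (st.x - p.xd) fun ic => (Cᵀ *ᵥ (crossProduct e3 (st.q ic.1))) ic.2

/-- `𝐱̇ = [ẋ; Cᵀω₁; …; Cᵀωₙ]`. -/
def velErr (st : State n) : XIdx n → ℝ :=
  Sum.elim st.v fun ic => (Cᵀ *ᵥ (st.ω ic.1)) ic.2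

/-- `z₁ = [𝐱, 𝐱̇]`. -/
def z1 (st : State n) : ZIdx n → ℝ := Sum.elim (posErr p st) (velErr st)

/-- The ideal total thrust `A`. -/
def idealThrust (st : State n) : V3 :=
  -(gainMat k.kx k.kq *ᵥ posErr p st) - gainMat k.kxdot k.kω *ᵥ velErr st
    - gainMat k.kz k.kzq *ᵥ sat k.σ st.ex - (M00 p * p.g) • e3

/-- The thrust magnitude `f = -A · R e₃`. -/
def thrust (st : State n) : ℝ := -(idealThrust p k st ⬝ᵥ (st.R *ᵥ e3))

/-- The desired direction `b_{3c} = -A / |A|` of the third body-fixed axis. -/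
def b3c (st : State n) : V3 := -((len (idealThrust p k st))⁻¹ • idealThrust p k st)

/-- The matrix with columns `-b̂²b₁ / |b̂²b₁|`, `b̂b₁ / |b̂b₁|`, `b`. -/
def frame (b b1 : V3) : Mat3 :=
  (Matrix.of ![-((len (crossProduct b (crossProduct b b1)))⁻¹ •
        crossProduct b (crossProduct b b1)),
      (len (crossProduct b b1))⁻¹ • crossProduct b b1,
      b])ᵀ

/-- The desired attitude `R_c`. -/
def Rc (st : State n) : Mat3 := frame (b3c p k st) p.b1d

/-- The attitude error function `Ψ = ½ tr(I - R_cᵀR)`. -/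
def attFun (st : State n) : ℝ := (1 / 2) * (1 - (Rc p k st)ᵀ * st.R).trace

/-- The attitude error vector `e_R`. -/
def eR (st : State n) : V3 :=
  (1 / 2 : ℝ) • vee ((Rc p k st)ᵀ * st.R - st.Rᵀ * Rc p k st)

/-- The angular velocity error `e_Ω = Ω - RᵀR_cΩ_c`. -/
def eΩ (st : State n) (Ω Ωc : V3) : V3 := Ω - (st.Rᵀ * Rc p k st) *ᵥ Ωc

/-- The control moment. -/
def moment (st : State n) (Ω Ωc Ωc' : V3) : V3 :=
  -(k.kR • eR p k st) - k.kΩ • eΩ p k st Ω Ωc - k.kI • st.eI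
    + crossProduct Ω (p.J *ᵥ Ω)
    - p.J *ᵥ (hat Ω *ᵥ ((st.Rᵀ * Rc p k st) *ᵥ Ωc) - (st.Rᵀ * Rc p k st) *ᵥ Ωc')

/-- `s`, `Ω` is a trajectory on `[0, ∞)` of the full nonlinear dynamics under the feedback, with the
constant disturbances `Δx` and `ΔR`; `Ωc` is the desired angular velocity and `Ωc'` its derivative.
Time derivatives are one-sided at `t = 0`. The integral terms satisfy `ėₓ = (P𝔹)ᵀz₁` and
`ė_I = e_Ω + c₂e_R`, so that they are the integrals from `0` to `t` plus their values at `0`. -/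
structure IsTrajectory (Δx ΔR : V3) (s : ℝ → State n) (Ω Ωc Ωc' : ℝ → V3) : Prop where
  valid : ∀ t, 0 ≤ t → (s t).Valid
  /-- the ideal thrust is not zero and not parallel to `b_{1d}`, so that `R_c` is well defined -/
  command : ∀ t, 0 ≤ t → crossProduct p.b1d (idealThrust p k (s t)) ≠ 0
  /-- kinematics -/
  x_deriv : ∀ t, 0 ≤ t → HasDerivWithinAt (fun τ => (s τ).x) (s t).v (Ici 0) t
  q_deriv : ∀ t, 0 ≤ t → ∀ i,
    HasDerivWithinAt (fun τ => (s τ).q i) (crossProduct ((s t).ω i) ((s t).q i)) (Ici 0) t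
  R_deriv : ∀ t, 0 ≤ t → ∀ a b,
    HasDerivWithinAt (fun τ => (s τ).R a b) (((s t).R * hat (Ω t)) a b) (Ici 0) t
  /-- translational dynamics and dynamics of the links, where `a` is `ẍ` and `b i` is `q̈ᵢ` -/
  dynamics : ∀ t, 0 ≤ t → ∃ (a : V3) (b : Fin n → V3),
    HasDerivWithinAt (fun τ => (s τ).v) a (Ici 0) t ∧
    (∀ i, HasDerivWithinAt (fun τ => crossProduct ((s τ).ω i) ((s τ).q i)) (b i) (Ici 0) t) ∧
    M00 p • a + ∑ i, M0 p i • b i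
      = -(thrust p k (s t) • ((s t).R *ᵥ e3)) + (M00 p * p.g) • e3 + Δx ∧
    ∀ i, Mij p i i • b i
        - (hat ((s t).q i) ^ 2) *ᵥ (M0 p i • a + ∑ j ∈ Finset.univ.erase i, Mij p i j • b j)
      = -((Mij p i i * len (crossProduct ((s t).ω i) ((s t).q i)) ^ 2) • (s t).q i)
        - (outerMass p i * p.g * p.l i) • ((hat ((s t).q i) ^ 2) *ᵥ e3)
  /-- rotational dynamics -/
  rotation : ∀ t, 0 ≤ t → ∃ w : V3, HasDerivWithinAt Ω w (Ici 0) t ∧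
    p.J *ᵥ w + hat (Ω t) *ᵥ (p.J *ᵥ Ω t) = moment p k (s t) (Ω t) (Ωc t) (Ωc' t) + ΔR
  /-- `Ω_c = (R_cᵀṘ_c)^∨` -/
  Ωc_eq : ∀ t, 0 ≤ t → ∃ D : Mat3,
    (∀ a b, HasDerivWithinAt (fun τ => Rc p k (s τ) a b) (D a b) (Ici 0) t) ∧
    Ωc t = vee ((Rc p k (s t))ᵀ * D)
  Ωc_deriv : ∀ t, 0 ≤ t → HasDerivWithinAt Ωc (Ωc' t) (Ici 0) t
  /-- integral terms -/
  ex_deriv : ∀ t, 0 ≤ t →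
    HasDerivWithinAt (fun τ => (s τ).ex) ((k.P * clB p)ᵀ *ᵥ z1 p (s t)) (Ici 0) t
  eI_deriv : ∀ t, 0 ≤ t →
    HasDerivWithinAt (fun τ => (s τ).eI)
      (eΩ p k (s t) (Ω t) (Ωc t) + k.c2 • eR p k (s t)) (Ici 0) t

/-- Size of the tracking errors, where `w` is the angular velocity error. The attitude error is
measured by `Ψ` and the link errors by `qᵢ - e₃`: near the equilibrium this is the same as `e_R` and
`Cᵀ(e₃ × qᵢ)`, but these also vanish at rotations by `π` and at inverted links. -/
def trackSize (st : State n) (w : V3) : ℝ :=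
  ‖st.x - p.xd‖ + ‖st.v‖ + ‖st.q - fun _ => e3‖ + ‖st.ω‖ + attFun p k st + ‖w‖

/-- Distance of the integral terms to their equilibrium values `[Δx / k_z, 0, …, 0]` and
`ΔR / k_I`. -/
def integralDist (Δx ΔR : V3) (st : State n) : ℝ :=
  ‖st.ex - Sum.elim (k.kz⁻¹ • Δx) 0‖ + ‖st.eI - k.kI⁻¹ • ΔR‖

/-- A trajectory with initial state `s₀` and initial angular velocity error `w₀`. -/
def IsTrajectoryFrom (Δx ΔR : V3) (s₀ : State n) (w₀ : V3) (s : ℝ → State n)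
    (Ω Ωc Ωc' : ℝ → V3) : Prop :=
  IsTrajectory p k Δx ΔR s Ω Ωc Ωc' ∧ s 0 = s₀ ∧ eΩ p k (s 0) (Ω 0) (Ωc 0) = w₀

/-- Lyapunov stability of the equilibrium of the closed loop at which the tracking errors vanish. -/
def LyapunovStable (Δx ΔR : V3) : Prop :=
  ∀ ε > 0, ∃ ρ > 0, ∀ (s₀ : State n) (w₀ : V3), s₀.Valid →
    trackSize p k s₀ w₀ + integralDist k Δx ΔR s₀ < ρ →
    (∃ s Ω Ωc Ωc', IsTrajectoryFrom p k Δx ΔR s₀ w₀ s Ω Ωc Ωc') ∧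
    ∀ s Ω Ωc Ωc', IsTrajectoryFrom p k Δx ΔR s₀ w₀ s Ω Ωc Ωc' →
      ∀ t, 0 ≤ t →
        trackSize p k (s t) (eΩ p k (s t) (Ω t) (Ωc t)) + integralDist k Δx ΔR (s t) < ε

/-- For all sufficiently small initial tracking errors, with initial integral terms as allowed by
`start`, a trajectory exists, and along each trajectory the tracking errors converge to zero and the
integral terms are bounded, with a bound common to all these trajectories. -/
def ConvergesFrom (start : ℝ → State n → Prop) (Δx ΔR : V3) : Prop :=
  ∃ ρ > 0, ∃ β : ℝ, ∀ (s₀ : State n) (w₀ : V3), s₀.Valid → trackSize p k s₀ w₀ < ρ → start ρ s₀ →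
    (∃ s Ω Ωc Ωc', IsTrajectoryFrom p k Δx ΔR s₀ w₀ s Ω Ωc Ωc') ∧
    ∀ s Ω Ωc Ωc', IsTrajectoryFrom p k Δx ΔR s₀ w₀ s Ω Ωc Ωc' →
      Tendsto (fun t => eR p k (s t)) atTop (𝓝 0) ∧
      Tendsto (fun t => eΩ p k (s t) (Ω t) (Ωc t)) atTop (𝓝 0) ∧
      Tendsto (fun t => posErr p (s t)) atTop (𝓝 0) ∧
      Tendsto (fun t => velErr (s t)) atTop (𝓝 0) ∧
      Tendsto (fun t => trackSize p k (s t) (eΩ p k (s t) (Ω t) (Ωc t))) atTop (𝓝 0) ∧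
      ∀ t, 0 ≤ t → ‖(s t).ex‖ ≤ β ∧ ‖(s t).eI‖ ≤ β

end Feedback

end QuadCable

end

/-! The gains of `design` feed back only the position and the velocity of the quadrotor; gravity and
the coupling to the quadrotor stabilize the links. The linearization splits into two horizontal
copies of a scalar chain of masses and one vertical coordinate. Damping acts on the velocity of the
quadrotor alone, but a cross term 𝐱ᵀ Y 𝐌 𝐱̇, built link by link, makes all other coordinates
dissipate (`exists_cross`, `Params.Physical.exists_crossDiss`). `P` is the matrix of the energy plus
ε₀ / κ times this cross term, where κ is the damping gain, and `Q` is defined by the Lyapunov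
equation (`Params.Physical.exists_admissible`).

With this `P` the rate (P𝔹)ᵀz₁ of the integrator is 𝐱̇ + (ε₀ / κ) Yᵀ𝐱, exactly the quantity that
multiplies a force on the quadrotor in the rate of energy plus cross term. Hence the nonlinear
energy, with the cross term written in the true momenta, plus the squared deviation of the integral
force from `Δx`, has a rate free of that deviation (`ReducedAt.hasDerivWithinAt_transLyap`). The
nonlinear remainder is of third order. The error of the thrust that is due to the attitude is
absorbed by a large multiple of an attitude Lyapunov function (`exists_attLyap_bounds`).

Two things escape this function. The link components of the integral term do not enter the thrust;
but the linear part of their rate is a total derivative, and after subtracting it (`Tuning.drift`)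
the rate is quadratic in the errors and thus integrable by the dissipation
(`Tuning.Good.exists_confinement`). For solutions whose integral terms start at zero, the ideal
thrust must remain away from the direction of `b1d` although it contains κ times the velocity; for
large κ each component of the resultant force is driven towards zero outside a small interval, which
confines the thrust to a box. `Params.Physical.exists_tuning` chooses the parameters in an order
that avoids circularity, with κ last.

In terms of the attitude error R_cᵀR and of e_Ω, the desired angular velocity disappears and the
closed loop is an ordinary differential equation, smooth where the saturation is inactive and the
command is well defined. Cutting off its field gives global curves, and a first-exit argument keeps
them in a compact set on which the cutoff is one (`Tuning.Trap`). Convergence follows by Barbalat's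
argument, and the trajectories of the original system are recovered from the reduced ones
(`exists_isTrajectory`). -/

namespace QuadCable

/-! ### Global solutions of differential equations, first exit, and Barbalat's argument -/

section Tools

/-- A bounded, globally Lipschitz vector field has global integral curves. -/
theorem exists_global_integral_curve {E : Type*} [NormedAddCommGroup E] [NormedSpace ℝ E]
    [CompleteSpace E] {F : E → E} {K L : NNReal} (hF : LipschitzWith K F) (hL : ∀ x, ‖F x‖ ≤ L)
    (x₀ : E) : ∃ Y : ℝ → E, Y 0 = x₀ ∧ ∀ t, HasDerivAt Y (F (Y t)) t := by
  have loc : ∀ N : ℕ, ∃ α : ℝ → E, α 0 = x₀ ∧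
      ∀ t ∈ Ioo (-(N + 1 : ℝ)) (N + 1), HasDerivAt α (F (α t)) t := by
    intro N
    have hN : (0 : ℝ) < N + 1 := by positivity
    have h0 : (0 : ℝ) ∈ Icc (-(N + 1 : ℝ)) (N + 1) := ⟨by linarith, hN.le⟩
    -- The radius `L * (N + 1)` is the distance that a curve of speed at most `L` can cover in time
    -- `N + 1`, so Picard-Lindelöf applies on the whole interval.
    have hP : IsPicardLindelof (fun _ ↦ F) (⟨0, h0⟩ : Icc (-(N + 1 : ℝ)) (N + 1)) x₀
        (L * (N + 1)) 0 L K := by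
      refine IsPicardLindelof.of_time_independent (fun x _ ↦ hL x) hF.lipschitzOnWith ?_
      simp
    obtain ⟨α, hα0, hα⟩ := hP.exists_eq_forall_mem_Icc_hasDerivWithinAt₀
    exact ⟨α, hα0, fun t ht ↦ (hα t (Ioo_subset_Icc_self ht)).hasDerivAt (Icc_mem_nhds ht.1 ht.2)⟩
  choose α hα0 hα using loc
  have agree : ∀ M N : ℕ, M ≤ N → EqOn (α M) (α N) (Ioo (-(M + 1 : ℝ)) (M + 1)) := by
    intro M N hMN
    have hMN' : (M : ℝ) ≤ N := by exact_mod_cast hMN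
    refine ODE_solution_unique_of_mem_Ioo (v := fun _ ↦ F) (s := fun _ ↦ univ) (t₀ := 0)
      (fun _ _ ↦ hF.lipschitzOnWith) ⟨by linarith [M.cast_nonneg (α := ℝ)], by positivity⟩
      (fun t ht ↦ ⟨hα M t ht, trivial⟩)
      (fun t ht ↦ ⟨hα N t ⟨by linarith [ht.1], by linarith [ht.2]⟩, trivial⟩) ?_
    rw [hα0, hα0]
  -- The piece of index `⌈|t|⌉₊` is a solution for `|s| < ⌈|t|⌉₊ + 1`, so `t` is interior to its
  -- interval. Near `t` the index rises by at most one, and the pieces agree on overlaps.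
  refine ⟨fun t ↦ α ⌈|t|⌉₊ t, by simp [hα0], fun t ↦ ?_⟩
  have hmem : ∀ s : ℝ, s ∈ Ioo (-(⌈|s|⌉₊ + 1 : ℝ)) (⌈|s|⌉₊ + 1) := by
    intro s
    have h1 := Nat.le_ceil |s|
    have h2 := neg_abs_le s
    have h3 := le_abs_self s
    exact ⟨by linarith, by linarith⟩
  have key : (fun s ↦ α ⌈|s|⌉₊ s) =ᶠ[𝓝 t] α (⌈|t|⌉₊ + 1) := by
    have h1 : ∀ᶠ s : ℝ in 𝓝 t, |s| < (⌈|t|⌉₊ : ℝ) + 1 :=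
      (continuous_abs.tendsto t).eventually_lt_const
        (lt_of_le_of_lt (Nat.le_ceil |t|) (by linarith))
    filter_upwards [h1] with s hs
    have h2 : ⌈|s|⌉₊ ≤ ⌈|t|⌉₊ + 1 := by
      apply Nat.ceil_le.2
      push_cast
      exact hs.le
    exact agree _ _ h2 (hmem s)
  have h3 := hα (⌈|t|⌉₊ + 1) t (by
    have := hmem t
    push_cast
    exact ⟨by linarith [this.1], by linarith [this.2]⟩)
  have h4 : α ⌈|t|⌉₊ t = α (⌈|t|⌉₊ + 1) t := key.self_of_nhds
  rw [← h4] at h3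
  exact h3.congr_of_eventuallyEq key

/-- A vector field that is `C²` near the compact set `K` has, from each point, a global curve that
follows a multiple of the field everywhere and the field itself on `K`. -/
theorem exists_cutoff_integral_curve {E : Type*} [NormedAddCommGroup E] [NormedSpace ℝ E]
    [FiniteDimensional ℝ E] {F : E → E} {K : Set E} (hK : IsCompact K)
    (hF : ∀ x ∈ K, ContDiffAt ℝ 2 F x) (x₀ : E) :
    ∃ (Y : ℝ → E) (c : E → ℝ), Y 0 = x₀ ∧ (∀ x ∈ K, c x = 1) ∧
      ∀ t, HasDerivAt Y (c (Y t) • F (Y t)) t := by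
  set D : Set E := interior {x | ContDiffAt ℝ 2 F x} with hD
  have hKD : K ⊆ D := by
    intro x hx
    rw [hD, mem_interior_iff_mem_nhds]
    exact (hF x hx).eventually (by simp)
  obtain ⟨V, hV, hKV, hVD, hVc⟩ := exists_open_between_and_isCompact_closure hK isOpen_interior hKD
  -- The cutoff is one on `K`, and the closure of its support is a compact subset of the region
  -- where `F` is `C²`. So `c • F` is `C²` with compact support, hence bounded and globally
  -- Lipschitz.
  obtain ⟨c, hc, -, hcs, hc1⟩ := exists_contMDiff_support_eq_eq_one_iff (modelWithCornersSelf ℝ E)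
    (n := 2) hV hK.isClosed hKV
  have hcd : ContDiff ℝ 2 c := hc.contDiff
  have hts : tsupport c = closure V := by rw [tsupport, hcs]
  have hcF : ContDiff ℝ 2 (fun x ↦ c x • F x) := by
    rw [contDiff_iff_contDiffAt]
    intro x
    by_cases hx : x ∈ tsupport c
    · exact hcd.contDiffAt.smul (interior_subset (hVD (hts ▸ hx)))
    · refine contDiffAt_const (c := (0 : E)) |>.congr_of_eventuallyEq ?_
      filter_upwards [notMem_tsupport_iff_eventuallyEq.1 hx] with y hy
      simp [hy]
  have hsupp : HasCompactSupport (fun x ↦ c x • F x) := by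
    have : HasCompactSupport c := by rw [HasCompactSupport, hts]; exact hVc
    exact this.smul_right
  obtain ⟨Lc, hLc⟩ := hcF.lipschitzWith_of_hasCompactSupport hsupp (by simp)
  obtain ⟨B, hB⟩ := hsupp.exists_bound_of_continuous hcF.continuous
  obtain ⟨Y, hY0, hY⟩ := exists_global_integral_curve (L := B.toNNReal) hLc
    (fun x ↦ (hB x).trans (Real.le_coe_toNNReal B)) x₀
  exact ⟨Y, c, hY0, fun x hx ↦ (hc1 x).1 hx, hY⟩

/-- First exit: a continuous curve does not leave an open set if it cannot reach the boundary. -/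
theorem forall_mem_of_forall_Ico {E : Type*} [TopologicalSpace E] {Y : ℝ → E} {G : Set E}
    (hY : ContinuousOn Y (Ici 0)) (hG : IsOpen G)
    (h : ∀ T, 0 ≤ T → (∀ t, 0 ≤ t → t < T → Y t ∈ G) → Y T ∈ G) : ∀ t, 0 ≤ t → Y t ∈ G := by
  by_contra! hcon
  set S : Set ℝ := Ici 0 ∩ Y ⁻¹' Gᶜ with hS
  have hSc : IsClosed S := hY.preimage_isClosed_of_isClosed isClosed_Ici hG.isClosed_compl
  obtain ⟨t, ht, htG⟩ := hcon
  have hne : S.Nonempty := ⟨t, ht, htG⟩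
  have hbd : BddBelow S := ⟨0, fun s hs ↦ hs.1⟩
  have hm := hSc.csInf_mem hne hbd
  -- The times outside of `G` form a closed set, so their infimum is attained. Before it the curve
  -- lies in `G`, which by hypothesis puts it into `G` at the infimum as well.
  refine hm.2 (h _ hm.1 fun s hs0 hs ↦ ?_)
  by_contra hsG
  exact absurd (csInf_le hbd ⟨hs0, hsG⟩) (not_le.2 hs)

theorem antitoneOn_of_hasDerivWithinAt_Ici {f f' : ℝ → ℝ} {T : ℝ} (hc : ContinuousOn f (Ici 0))
    (hf : ∀ t, 0 ≤ t → t < T → HasDerivWithinAt f (f' t) (Ici 0) t)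
    (hf' : ∀ t, 0 ≤ t → t < T → f' t ≤ 0) : AntitoneOn f (Icc 0 T) := by
  have hd : ∀ t ∈ interior (Icc 0 T), HasDerivAt f (f' t) t := by
    intro t ht
    rw [interior_Icc] at ht
    exact (hf t ht.1.le ht.2).hasDerivAt (Ici_mem_nhds ht.1)
  refine antitoneOn_of_deriv_nonpos (convex_Icc 0 T) (hc.mono Icc_subset_Ici_self)
    (fun t ht ↦ (hd t ht).differentiableAt.differentiableWithinAt) fun t ht ↦ ?_
  rw [(hd t ht).deriv]
  rw [interior_Icc] at ht
  exact hf' t ht.1.le ht.2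

/-- A function whose derivative is negative where it takes the value `c` stays below `c`. -/
theorem le_of_deriv_neg_at_level {f f' : ℝ → ℝ} {T c : ℝ} (hT : 0 ≤ T)
    (hc : ContinuousOn f (Ici 0))
    (hf : ∀ t, 0 ≤ t → t < T → HasDerivWithinAt f (f' t) (Ici 0) t) (h0 : f 0 ≤ c)
    (hf' : ∀ t, 0 ≤ t → t < T → f t = c → f' t < 0) : f T ≤ c := by
  refine image_le_of_deriv_right_lt_deriv_boundary' (f := f) (f' := f') (B := fun _ ↦ c)
    (B' := fun _ ↦ 0) (a := 0) (b := T) (hc.mono Icc_subset_Ici_self) ?_ h0 continuousOn_const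
    (fun x _ ↦ hasDerivWithinAt_const _ _ _) (fun t ht heq ↦ hf' t ht.1 ht.2 heq)
    (right_mem_Icc.2 hT)
  exact fun t ht ↦ (hf t ht.1 ht.2).mono (Ici_subset_Ici.2 ht.1)

/-- A version of Barbalat's lemma: if `V ≥ 0` decreases at least at the rate `f ≥ 0`, and `f` has a
bounded derivative, then `f` tends to zero. -/
theorem tendsto_zero_of_dissipation {V V' f f' : ℝ → ℝ} {L : ℝ}
    (hV : ∀ t, 0 ≤ t → HasDerivWithinAt V (V' t) (Ici 0) t) (hV0 : ∀ t, 0 ≤ t → 0 ≤ V t)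
    (hV' : ∀ t, 0 ≤ t → V' t ≤ -f t) (hf0 : ∀ t, 0 ≤ t → 0 ≤ f t)
    (hf : ∀ t, 0 ≤ t → HasDerivWithinAt f (f' t) (Ici 0) t) (hf' : ∀ t, 0 ≤ t → |f' t| ≤ L) :
    Tendsto f atTop (𝓝 0) := by
  have hVc : ContinuousOn V (Ici 0) := fun t ht ↦ (hV t ht).continuousWithinAt
  have hanti : AntitoneOn V (Ici 0) := by
    intro a ha b hb hab
    exact antitoneOn_of_hasDerivWithinAt_Ici (T := b) hVc (fun t ht _ ↦ hV t ht)
      (fun t ht _ ↦ by linarith [hV' t ht, hf0 t ht]) ⟨ha, hab⟩ ⟨hb, le_rfl⟩ hab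
  have hL0 : 0 ≤ L := (abs_nonneg _).trans (hf' 0 le_rfl)
  have hlip : ∀ a b, 0 ≤ a → a ≤ b → f a - L * (b - a) ≤ f b := by
    intro a b ha hab
    have := Convex.norm_image_sub_le_of_norm_hasDerivWithin_le (f := f) (f' := f') (s := Ici 0)
      (C := L) (x := a) (y := b) (fun t ht ↦ hf t ht) (fun t ht ↦ by simpa using hf' t ht)
      (convex_Ici 0) ha (ha.trans hab)
    rw [Real.norm_eq_abs, Real.norm_eq_abs, abs_of_nonneg (sub_nonneg.2 hab)] at this
    linarith [(abs_le.1 this).1]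
  set m := sInf (V '' Ici 0) with hm
  have hbd : BddBelow (V '' Ici 0) := ⟨0, by rintro _ ⟨t, ht, rfl⟩; exact hV0 t ht⟩
  have hne : (V '' Ici 0).Nonempty := ⟨V 0, 0, self_mem_Ici, rfl⟩
  rw [Metric.tendsto_atTop]
  intro e he
  -- Where `f` is at least `e`, the Lipschitz bound keeps it above `e / 2` for a time `h`, during
  -- which `V` drops by `e / 2 * h`. This is impossible once `V` is within that amount of its
  -- infimum.
  set h : ℝ := e / (2 * (L + 1)) with hh
  have hh0 : 0 < h := by positivity
  obtain ⟨_, ⟨t₀, ht₀, rfl⟩, hlt⟩ := exists_lt_of_csInf_lt hne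
    (show m < m + e / 2 * h by have := mul_pos (half_pos he) hh0; linarith)
  refine ⟨t₀, fun t ht ↦ ?_⟩
  have ht0 : 0 ≤ t := le_trans ht₀ ht
  rw [Real.dist_eq, sub_zero, abs_of_nonneg (hf0 t ht0)]
  by_contra! hcon
  have hLh : L * h ≤ e / 2 := by
    rw [hh, mul_div_assoc', div_le_div_iff₀ (by positivity) (by norm_num)]
    nlinarith
  have hdrop : V (t + h) ≤ V t - e / 2 * h := by
    have hbase : AntitoneOn (fun s ↦ V (t + s) + e / 2 * s) (Icc 0 h) := by
      have hd : ∀ s, 0 ≤ s → HasDerivWithinAt (fun s ↦ V (t + s) + e / 2 * s)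
          (V' (t + s) + e / 2) (Ici 0) s := by
        intro s hs
        have h1 : HasDerivWithinAt (fun s : ℝ ↦ t + s) 1 (Ici 0) s :=
          ((hasDerivAt_id s).const_add t).hasDerivWithinAt
        have h2 := (hV (t + s) (by linarith)).comp s h1
          (fun y (hy : 0 ≤ y) ↦ (by linarith : (0 : ℝ) ≤ t + y))
        have h3 : HasDerivWithinAt (fun s : ℝ ↦ e / 2 * s) (e / 2) (Ici 0) s := by
          simpa using ((hasDerivAt_id s).const_mul (e / 2)).hasDerivWithinAt
        simpa [Function.comp_def] using h2.fun_add h3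
      refine antitoneOn_of_hasDerivWithinAt_Ici (fun s hs ↦ (hd s hs).continuousWithinAt)
        (fun s hs _ ↦ hd s hs) fun s hs hsh ↦ ?_
      have h1 := hV' (t + s) (by linarith)
      have h2 := hlip t (t + s) ht0 (by linarith)
      have h3 : L * s ≤ L * h := mul_le_mul_of_nonneg_left hsh.le hL0
      have h4 : t + s - t = s := by ring
      rw [h4] at h2
      linarith
    have := hbase ⟨le_rfl, hh0.le⟩ ⟨hh0.le, le_rfl⟩ hh0.le
    simp only [add_zero, mul_zero] at this
    linarith
  have h1 : m ≤ V (t + h) := csInf_le hbd ⟨t + h, by simp only [mem_Ici]; linarith, rfl⟩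
  have h2 : V t ≤ V t₀ := hanti ht₀ ht0 ht
  linarith

end Tools

end QuadCable

namespace QuadCable

/-! ### Dissipation along a scalar chain of masses -/

section Chain

/-- This is how dissipation spreads through the chain. When a small multiple `r` of `F` is added to
`G`, the errors of `F` with the factor `b` are absorbed: `b * d` goes by Young's inequality into
half of the gain in `d ^ 2`, and the total `q * b ^ 2` into half of the gain of `G`. Only errors
with the factor `a` remain. -/
theorem exists_dissipation_add {ι : Type*} {a b d F G : ι → ℝ} (ha : ∀ z, 0 ≤ a z)
    (hb : ∀ z, 0 ≤ b z) (hd : ∀ z, 0 ≤ d z) {c₁ C₁ c₂ C₂ : ℝ} (hc₁ : 0 < c₁) (hC₁ : 0 ≤ C₁)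
    (hc₂ : 0 < c₂) (hC₂ : 0 ≤ C₂)
    (hF : ∀ z, c₁ * d z ^ 2 - C₁ * ((a z + b z) * (a z + b z + d z)) ≤ F z)
    (hG : ∀ z, c₂ * b z ^ 2 - C₂ * (a z * (a z + b z + d z)) ≤ G z) :
    ∃ r > 0, ∃ c > 0, ∃ C ≥ 0, ∀ z,
      c * (b z + d z) ^ 2 - C * (a z * (a z + b z + d z)) ≤ G z + r * F z := by
  set q : ℝ := C₁ + C₁ ^ 2 / (2 * c₁) with hq
  have hq0 : 0 ≤ q := by positivity
  set r : ℝ := c₂ / (2 * (q + 1)) with hr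
  have hr0 : 0 < r := by positivity
  have hrq : r * q ≤ c₂ / 2 := by
    rw [hr, div_mul_eq_mul_div, div_le_div_iff₀ (by positivity) (by norm_num)]
    nlinarith
  set c : ℝ := min (c₂ / 4) (r * c₁ / 4) with hc
  have hc0 : 0 < c := by positivity
  refine ⟨r, hr0, c, hc0, C₂ + 2 * (r * C₁), by positivity, fun z ↦ ?_⟩
  have h1 := hF z
  have h2 := hG z
  have hc2 : c ≤ c₂ / 4 := min_le_left _ _
  have hc3 : c ≤ r * c₁ / 4 := min_le_right _ _
  have hA := ha z
  have hB := hb z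
  have hE := hd z
  generalize a z = A at h1 h2 hA ⊢
  generalize b z = B at h1 h2 hB ⊢
  generalize d z = E at h1 h2 hE ⊢
  have h3 := mul_le_mul_of_nonneg_left h1 hr0.le
  have h4 : C₁ * (B * E) ≤ c₁ / 2 * E ^ 2 + C₁ ^ 2 / (2 * c₁) * B ^ 2 := by
    have : c₁ / 2 * E ^ 2 + C₁ ^ 2 / (2 * c₁) * B ^ 2 - C₁ * (B * E)
        = (c₁ * E - C₁ * B) ^ 2 / (2 * c₁) := by
      field_simp
      ring
    have h5 : 0 ≤ (c₁ * E - C₁ * B) ^ 2 / (2 * c₁) := by positivity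
    linarith
  have h5 := mul_le_mul_of_nonneg_left h4 hr0.le
  have h6 : r * q * B ^ 2 ≤ c₂ / 2 * B ^ 2 := mul_le_mul_of_nonneg_right hrq (sq_nonneg B)
  have h7 : c * (B + E) ^ 2 ≤ c₂ / 2 * B ^ 2 + r * c₁ / 2 * E ^ 2 := by
    have h8 : (B + E) ^ 2 ≤ 2 * B ^ 2 + 2 * E ^ 2 := by nlinarith [sq_nonneg (B - E)]
    have h9 := mul_le_mul_of_nonneg_left h8 hc0.le
    nlinarith [mul_le_mul_of_nonneg_right hc2 (sq_nonneg B),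
      mul_le_mul_of_nonneg_right hc3 (sq_nonneg E)]
  have h8 : 0 ≤ r * C₁ * (A * (A + E)) := by positivity
  rw [hq] at h6
  nlinarith

variable (N : ℕ) (mu la K : ℕ → ℝ)

/-- Velocity of the mass at the inner end of link `k`. -/
def chainVel (v : ℕ → ℝ) (k : ℕ) : ℝ := ∑ j ∈ Finset.range k, la j * v j

/-- Momentum of the part of the chain that begins with link `k`. -/
def chainMom (v : ℕ → ℝ) (k : ℕ) : ℝ := ∑ a ∈ Finset.Ico k N, mu a * chainVel la v (a + 1)

/-- Dissipation generated by the cross term with coefficients `Y`. -/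
def crossForm (Y : ℕ → ℕ → ℝ) (x v : ℕ → ℝ) : ℝ :=
  ∑ i ∈ Finset.range N, ∑ j ∈ Finset.range N,
    Y i j * (K j * x i * x j - v i * (la j * chainMom N mu la v j))

theorem crossForm_add_smul (Y Z : ℕ → ℕ → ℝ) (r : ℝ) (x v : ℕ → ℝ) :
    crossForm N mu la K (fun i j ↦ Y i j + r * Z i j) x v
      = crossForm N mu la K Y x v + r * crossForm N mu la K Z x v := by
  simp only [crossForm, Finset.mul_sum, ← Finset.sum_add_distrib]
  exact Finset.sum_congr rfl fun i _ ↦ Finset.sum_congr rfl fun j _ ↦ by ring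

/-- These are the elementary cross terms. The coefficient removes the length in front of the
momentum, so that two of them with neighbouring `j` differ by the momentum of a single mass
(`chainMom_succ`). -/
theorem crossForm_single {i j : ℕ} (hi : i < N) (hj : j < N) (hla : la j ≠ 0) (x v : ℕ → ℝ) :
    crossForm N mu la K (fun i' j' ↦ if i' = i ∧ j' = j then (la j)⁻¹ else 0) x v
      = K j / la j * x i * x j - v i * chainMom N mu la v j := by
  rw [crossForm, Finset.sum_eq_single_of_mem i (Finset.mem_range.2 hi),
    Finset.sum_eq_single_of_mem j (Finset.mem_range.2 hj)]
  · simp only [and_self, if_true]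
    field_simp
  · intro b _ hb
    simp [hb]
  · intro b _ hb
    exact Finset.sum_eq_zero fun c _ ↦ by simp [hb]

/-- Size of the part of the chain below link `k`. -/
def tailSize (x v : ℕ → ℝ) (k : ℕ) : ℝ := ∑ j ∈ Finset.Ico k N, (|x j| + |v j|)

/-- Size of the part of the chain above link `k`. -/
def headSize (x v : ℕ → ℝ) (k : ℕ) : ℝ := |v 0| + |x 0| + ∑ j ∈ Finset.Ico 1 k, (|x j| + |v j|)

theorem tailSize_nonneg (x v : ℕ → ℝ) (k : ℕ) : 0 ≤ tailSize N x v k :=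
  Finset.sum_nonneg fun _ _ ↦ by positivity

theorem headSize_nonneg (x v : ℕ → ℝ) (k : ℕ) : 0 ≤ headSize x v k := by
  have : 0 ≤ ∑ j ∈ Finset.Ico 1 k, (|x j| + |v j|) := Finset.sum_nonneg fun _ _ ↦ by positivity
  rw [headSize]
  positivity

theorem abs_le_headSize (x v : ℕ → ℝ) {j k : ℕ} (hjk : j < k) :
    |x j| + |v j| ≤ headSize x v k := by
  have h0 : ∀ i ∈ Finset.Ico 1 k, 0 ≤ |x i| + |v i| := fun _ _ ↦ by positivity
  rw [headSize]
  rcases Nat.eq_zero_or_pos j with rfl | hj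
  · have := Finset.sum_nonneg h0
    linarith
  · have := Finset.single_le_sum h0 (Finset.mem_Ico.2 ⟨hj, hjk⟩)
    have h1 : 0 ≤ |v 0| + |x 0| := by positivity
    linarith

theorem abs_chainVel_le (x v : ℕ → ℝ) {k : ℕ} (hk : k ≤ N) :
    |chainVel la v k| ≤ (∑ j ∈ Finset.range N, |la j|) * headSize x v k := by
  have h1 : |chainVel la v k| ≤ ∑ j ∈ Finset.range k, |la j| * headSize x v k := by
    refine (Finset.abs_sum_le_sum_abs _ _).trans (Finset.sum_le_sum fun j hj ↦ ?_)
    rw [abs_mul]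
    have := abs_le_headSize x v (Finset.mem_range.1 hj)
    exact mul_le_mul_of_nonneg_left (by linarith [abs_nonneg (x j)]) (abs_nonneg _)
  refine h1.trans ?_
  rw [← Finset.sum_mul]
  refine mul_le_mul_of_nonneg_right ?_ (headSize_nonneg x v k)
  exact Finset.sum_le_sum_of_subset_of_nonneg (Finset.range_mono hk) fun _ _ _ ↦ abs_nonneg _

theorem headSize_add_tailSize (x v : ℕ → ℝ) {k : ℕ} (h1 : 1 ≤ k) (hk : k ≤ N) :
    headSize x v k + tailSize N x v k = headSize x v N := by
  rw [headSize, headSize, tailSize, add_assoc, Finset.sum_Ico_consecutive _ h1 hk]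

theorem abs_chainMom_le (x v : ℕ → ℝ) (k : ℕ) :
    |chainMom N mu la v k| ≤ (∑ a ∈ Finset.Ico k N, |mu a|) *
      ((∑ j ∈ Finset.range N, |la j|) * headSize x v N) := by
  rw [chainMom, Finset.sum_mul]
  refine (Finset.abs_sum_le_sum_abs _ _).trans (Finset.sum_le_sum fun a ha ↦ ?_)
  rw [abs_mul]
  have h1 : a + 1 ≤ N := (Finset.mem_Ico.1 ha).2
  refine mul_le_mul_of_nonneg_left ((abs_chainVel_le N la x v h1).trans ?_) (abs_nonneg _)
  refine mul_le_mul_of_nonneg_left ?_ (Finset.sum_nonneg fun _ _ ↦ abs_nonneg _)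
  have h2 := headSize_add_tailSize N x v (show 1 ≤ a + 1 by omega) h1
  linarith [tailSize_nonneg N x v (a + 1)]

theorem chainMom_succ (v : ℕ → ℝ) {k : ℕ} (hk : k < N) :
    chainMom N mu la v k = mu k * chainVel la v (k + 1) + chainMom N mu la v (k + 1) := by
  rw [chainMom, Finset.sum_eq_sum_Ico_succ_bot hk, ← chainMom]

theorem chainVel_succ (v : ℕ → ℝ) (k : ℕ) :
    chainVel la v (k + 1) = chainVel la v k + la k * v k := by
  rw [chainVel, Finset.sum_range_succ, ← chainVel]

variable {mu la K}

/-- A cross term that makes the angle of link `k` dissipate. -/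
theorem exists_cross_angle (hmu : ∀ i < N, 0 < mu i) (hla : ∀ i < N, 0 < la i)
    (hK : ∀ i < N, 0 < K i) {k : ℕ} (hk1 : 1 ≤ k) (hk : k < N) :
    ∃ Y, ∃ c > 0, ∃ C ≥ 0, ∀ x v : ℕ → ℝ,
      c * |x k| ^ 2 - C * (headSize x v k * headSize x v N) ≤ crossForm N mu la K Y x v := by
  obtain ⟨i, rfl⟩ : ∃ i, k = i + 1 := ⟨k - 1, by omega⟩
  have hi : i < N := by omega
  set Λ := ∑ j ∈ Finset.range N, |la j| with hΛ
  have hΛ0 : 0 ≤ Λ := Finset.sum_nonneg fun _ _ ↦ abs_nonneg _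
  have hk0 : 0 < K i / la i := div_pos (hK i hi) (hla i hi)
  -- The two momenta differ by that of the mass `i`, whose velocity involves only links above `i +
  -- 1`. So the velocity terms are errors with the factor `headSize`, and `K (i + 1) / la (i + 1) *
  -- x (i + 1) ^ 2` is gained.
  refine ⟨fun i' j' ↦ (if i' = i + 1 ∧ j' = i + 1 then (la (i + 1))⁻¹ else 0)
      + (-1) * (if i' = i + 1 ∧ j' = i then (la i)⁻¹ else 0),
    K (i + 1) / la (i + 1), div_pos (hK _ hk) (hla _ hk), K i / la i + mu i * Λ,
    add_nonneg hk0.le (mul_nonneg (hmu i hi).le hΛ0), fun x v ↦ ?_⟩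
  rw [crossForm_add_smul, crossForm_single N mu la K hk hk (hla _ hk).ne',
    crossForm_single N mu la K hk hi (hla _ hi).ne', chainMom_succ N mu la v hi]
  have h1 := abs_chainVel_le N la x v hk.le
  have h2 := abs_le_headSize x v (Nat.lt_succ_self i)
  have h3 := abs_le_headSize x v hk
  have hH := headSize_nonneg x v (i + 1)
  have hS := headSize_nonneg x v N
  have h4 : |x (i + 1) * x i| ≤ headSize x v (i + 1) * headSize x v N := by
    rw [abs_mul, mul_comm]
    exact mul_le_mul (by linarith [abs_nonneg (v i)]) (by linarith [abs_nonneg (v (i + 1))])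
      (abs_nonneg _) hH
  have h5 : |v (i + 1) * chainVel la v (i + 1)| ≤ Λ * (headSize x v (i + 1) * headSize x v N) := by
    rw [abs_mul, mul_comm, ← mul_assoc]
    exact mul_le_mul h1 (by linarith [abs_nonneg (x (i + 1))]) (abs_nonneg _)
      (mul_nonneg hΛ0 hH)
  have h6 := mul_le_mul_of_nonneg_left ((le_abs_self _).trans h4) hk0.le
  have h7 := mul_le_mul_of_nonneg_left ((neg_abs_le _).trans' (neg_le_neg h5)) (hmu i hi).le
  rw [sq_abs]
  nlinarith

/-- A cross term that makes the angular velocity of link `k` dissipate. -/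
theorem exists_cross_velocity (hmu : ∀ i < N, 0 < mu i) (hla : ∀ i < N, 0 < la i)
    (hK : ∀ i < N, 0 < K i) {k : ℕ} (hk : k < N) :
    ∃ Y, ∃ c > 0, ∃ C ≥ 0, ∀ x v : ℕ → ℝ,
      c * |v k| ^ 2 - C * ((headSize x v k + |x k|) * headSize x v N)
        ≤ crossForm N mu la K Y x v := by
  set Λ := ∑ j ∈ Finset.range N, |la j| with hΛ
  have hΛ0 : 0 ≤ Λ := Finset.sum_nonneg fun _ _ ↦ abs_nonneg _
  have hk0 : 0 < K k / la k := div_pos (hK k hk) (hla k hk)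
  have main : ∀ Y, ∀ C' ≥ 0, (∀ x v : ℕ → ℝ,
      -(C' * ((headSize x v k + |x k|) * headSize x v N))
        + v k * (mu k * chainVel la v (k + 1)) ≤ crossForm N mu la K Y x v) →
      ∃ Y, ∃ c > 0, ∃ C ≥ 0, ∀ x v : ℕ → ℝ,
      c * |v k| ^ 2 - C * ((headSize x v k + |x k|) * headSize x v N)
        ≤ crossForm N mu la K Y x v := by
    intro Y C' hC' hY
    refine ⟨Y, mu k * la k, mul_pos (hmu k hk) (hla k hk), C' + mu k * Λ,
      add_nonneg hC' (mul_nonneg (hmu k hk).le hΛ0), fun x v ↦ (hY x v).trans' ?_⟩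
    rw [chainVel_succ]
    have h1 := abs_chainVel_le N la x v hk.le
    have h3 := abs_le_headSize x v hk
    have hH := headSize_nonneg x v k
    have hS := headSize_nonneg x v N
    have h5 : |v k * chainVel la v k| ≤ Λ * ((headSize x v k + |x k|) * headSize x v N) := by
      rw [abs_mul, mul_comm, ← mul_assoc]
      refine mul_le_mul (h1.trans ?_) (by linarith [abs_nonneg (x k)]) (abs_nonneg _)
        (mul_nonneg hΛ0 (by positivity))
      exact mul_le_mul_of_nonneg_left (by linarith [abs_nonneg (x k)]) hΛ0
    have h7 := mul_le_mul_of_nonneg_left ((neg_abs_le _).trans' (neg_le_neg h5)) (hmu k hk).le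
    rw [sq_abs]
    nlinarith
  have hx : ∀ x v : ℕ → ℝ, |x k| ^ 2 ≤ (headSize x v k + |x k|) * headSize x v N := by
    intro x v
    have h3 := abs_le_headSize x v hk
    have hH := headSize_nonneg x v k
    rw [sq]
    exact mul_le_mul (by linarith) (by linarith [abs_nonneg (v k)]) (abs_nonneg _) (by positivity)
  by_cases hk' : k + 1 < N
  · have hk1 : 0 < K (k + 1) / la (k + 1) := div_pos (hK _ hk') (hla _ hk')
    -- The two momenta differ by that of the mass `k`, whose velocity contains `la k * v k`;
    -- multiplied by `v k` this gives the desired square. All products of angles contain `x k`.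
    refine main (fun i' j' ↦ (if i' = k ∧ j' = k + 1 then (la (k + 1))⁻¹ else 0)
      + (-1) * (if i' = k ∧ j' = k then (la k)⁻¹ else 0))
      (K (k + 1) / la (k + 1) + K k / la k) (by positivity) fun x v ↦ ?_
    rw [crossForm_add_smul, crossForm_single N mu la K hk hk' (hla _ hk').ne',
      crossForm_single N mu la K hk hk (hla _ hk).ne', chainMom_succ N mu la v hk]
    have h3 := abs_le_headSize x v hk'
    have hH := headSize_nonneg x v k
    have h4 : |x k * x (k + 1)| ≤ (headSize x v k + |x k|) * headSize x v N := by
      rw [abs_mul]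
      exact mul_le_mul (by linarith) (by linarith [abs_nonneg (v (k + 1))]) (abs_nonneg _)
        (by positivity)
    have h6 := mul_le_mul_of_nonneg_left ((neg_abs_le _).trans' (neg_le_neg h4)) hk1.le
    have h8 := mul_le_mul_of_nonneg_left (hx x v) hk0.le
    rw [sq_abs] at h8
    nlinarith
  -- Below the last link there is no momentum to be subtracted.
  · refine main (fun i' j' ↦ 0 + (-1) * (if i' = k ∧ j' = k then (la k)⁻¹ else 0))
      (K k / la k) hk0.le fun x v ↦ ?_
    have h0 : crossForm N mu la K (fun _ _ ↦ 0) x v = 0 := by simp [crossForm]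
    have hm : chainMom N mu la v (k + 1) = 0 := by
      rw [chainMom, Finset.Ico_eq_empty (by omega), Finset.sum_empty]
    rw [crossForm_add_smul N mu la K (fun _ _ ↦ 0), h0, crossForm_single N mu la K hk hk
      (hla _ hk).ne', chainMom_succ N mu la v hk, hm]
    have h8 := mul_le_mul_of_nonneg_left (hx x v) hk0.le
    rw [sq_abs] at h8
    nlinarith

/-- Some cross term makes the whole chain dissipate, apart from its first velocity. -/
theorem exists_cross (hN : 0 < N) (hmu : ∀ i < N, 0 < mu i) (hla : ∀ i < N, 0 < la i)
    (hK : ∀ i < N, 0 < K i) :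
    ∃ Y, ∃ c > 0, ∃ C ≥ 0, ∀ x v : ℕ → ℝ,
      c * (∑ j ∈ Finset.range N, (|x j| + |v j|)) ^ 2
        - C * (|v 0| * ∑ j ∈ Finset.range N, (|x j| + |v j|)) ≤ crossForm N mu la K Y x v := by
  -- Induction upwards from the free end. First the velocity of link `k` is joined to the tail below
  -- it, which leaves errors with the factor `|x k|`; joining the angle of link `k` then removes
  -- these.
  have tail : ∀ d k, k + d = N → 1 ≤ k → ∃ Y, ∃ c > 0, ∃ C ≥ 0, ∀ x v : ℕ → ℝ,
      c * tailSize N x v k ^ 2 - C * (headSize x v k * headSize x v N)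
        ≤ crossForm N mu la K Y x v := by
    intro d
    induction d with
    | zero =>
      intro k hk hk1
      refine ⟨fun _ _ ↦ 0, 1, one_pos, 0, le_rfl, fun x v ↦ ?_⟩
      have : tailSize N x v k = 0 := by
        rw [tailSize, Finset.Ico_eq_empty (by omega), Finset.sum_empty]
      simp [this, crossForm]
    | succ d ih =>
      intro k hk hk1
      have hkN : k < N := by omega
      obtain ⟨Y₁, c₁, hc₁, C₁, hC₁, h₁⟩ := ih (k + 1) (by omega) (by omega)
      obtain ⟨Y₂, c₂, hc₂, C₂, hC₂, h₂⟩ := exists_cross_velocity N hmu hla hK hkN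
      obtain ⟨Y₃, c₃, hc₃, C₃, hC₃, h₃⟩ := exists_cross_angle N hmu hla hK hk1 hkN
      have hh : ∀ x v : ℕ → ℝ, headSize x v (k + 1) = headSize x v k + |x k| + |v k| := by
        intro x v
        rw [headSize, headSize, Finset.sum_Ico_succ_top hk1]
        ring
      have ht : ∀ x v : ℕ → ℝ, tailSize N x v k = |x k| + |v k| + tailSize N x v (k + 1) := by
        intro x v
        rw [tailSize, tailSize, Finset.sum_eq_sum_Ico_succ_bot hkN]
      have hs : ∀ x v : ℕ → ℝ, headSize x v N
          = headSize x v k + |x k| + |v k| + tailSize N x v (k + 1) := by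
        intro x v
        rw [← hh, headSize_add_tailSize N x v (by omega) (by omega)]
      obtain ⟨r, -, c, hc, C, hC, h⟩ := exists_dissipation_add (ι := (ℕ → ℝ) × (ℕ → ℝ))
        (a := fun z ↦ headSize z.1 z.2 k + |z.1 k|) (b := fun z ↦ |z.2 k|)
        (d := fun z ↦ tailSize N z.1 z.2 (k + 1))
        (F := fun z ↦ crossForm N mu la K Y₁ z.1 z.2) (G := fun z ↦ crossForm N mu la K Y₂ z.1 z.2)
        (fun z ↦ add_nonneg (headSize_nonneg _ _ _) (abs_nonneg _)) (fun z ↦ abs_nonneg _)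
        (fun z ↦ tailSize_nonneg _ _ _ _) hc₁ hC₁ hc₂ hC₂
        (fun z ↦ by have := h₁ z.1 z.2; rwa [hs, hh] at this)
        (fun z ↦ by have := h₂ z.1 z.2; rwa [hs] at this)
      obtain ⟨r', -, c', hc', C', hC', h'⟩ := exists_dissipation_add (ι := (ℕ → ℝ) × (ℕ → ℝ))
        (a := fun z ↦ headSize z.1 z.2 k) (b := fun z ↦ |z.1 k|)
        (d := fun z ↦ |z.2 k| + tailSize N z.1 z.2 (k + 1))
        (F := fun z ↦ crossForm N mu la K Y₂ z.1 z.2 + r * crossForm N mu la K Y₁ z.1 z.2)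
        (G := fun z ↦ crossForm N mu la K Y₃ z.1 z.2)
        (fun z ↦ headSize_nonneg _ _ _) (fun z ↦ abs_nonneg _)
        (fun z ↦ add_nonneg (abs_nonneg _) (tailSize_nonneg _ _ _ _)) hc hC hc₃ hC₃
        (fun z ↦ by have := h z; simpa only [add_assoc] using this)
        (fun z ↦ by have := h₃ z.1 z.2; rw [hs] at this; simpa only [add_assoc] using this)
      refine ⟨fun i j ↦ Y₃ i j + r' * (Y₂ i j + r * Y₁ i j), c', hc', C', hC', fun x v ↦ ?_⟩
      have := h' (x, v)
      rw [crossForm_add_smul N mu la K Y₃ (fun i j ↦ Y₂ i j + r * Y₁ i j), crossForm_add_smul, ht,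
        hs]
      simpa only [add_assoc] using this
  obtain ⟨Y₁, c₁, hc₁, C₁, hC₁, h₁⟩ := tail (N - 1) 1 (by omega) le_rfl
  have hS : ∀ x v : ℕ → ℝ, ∑ j ∈ Finset.range N, (|x j| + |v j|)
      = |v 0| + |x 0| + tailSize N x v 1 := by
    intro x v
    rw [Finset.range_eq_Ico, Finset.sum_eq_sum_Ico_succ_bot hN, tailSize]
    ring
  have hS' : ∀ x v : ℕ → ℝ, headSize x v N = |v 0| + |x 0| + tailSize N x v 1 := fun x v ↦ rfl
  have h1 : ∀ x v : ℕ → ℝ, headSize x v 1 = |v 0| + |x 0| := fun x v ↦ by simp [headSize]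
  set Λ := (∑ a ∈ Finset.Ico 0 N, |mu a|) * ∑ j ∈ Finset.range N, |la j| with hΛ
  have hΛ0 : 0 ≤ Λ := mul_nonneg (Finset.sum_nonneg fun _ _ ↦ abs_nonneg _)
    (Finset.sum_nonneg fun _ _ ↦ abs_nonneg _)
  -- At the top, the elementary term of `(0, 0)` gains `x 0 ^ 2`, and its momentum term has the
  -- factor `v 0`, the one velocity that is damped directly.
  obtain ⟨r, -, c, hc, C, hC, h⟩ := exists_dissipation_add (ι := (ℕ → ℝ) × (ℕ → ℝ))
    (a := fun z ↦ |z.2 0|) (b := fun z ↦ |z.1 0|) (d := fun z ↦ tailSize N z.1 z.2 1)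
    (F := fun z ↦ crossForm N mu la K Y₁ z.1 z.2)
    (G := fun z ↦ crossForm N mu la K
      (fun i' j' ↦ if i' = 0 ∧ j' = 0 then (la 0)⁻¹ else 0) z.1 z.2)
    (c₂ := K 0 / la 0) (C₂ := Λ)
    (fun z ↦ abs_nonneg _) (fun z ↦ abs_nonneg _) (fun z ↦ tailSize_nonneg _ _ _ _) hc₁ hC₁
    (div_pos (hK 0 hN) (hla 0 hN)) hΛ0
    (fun z ↦ by have := h₁ z.1 z.2; rwa [h1, hS'] at this)
    (fun z ↦ by
      rw [crossForm_single N mu la K hN hN (hla _ hN).ne', ← hS']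
      have h2 := abs_chainMom_le N mu la z.1 z.2 0
      have h3 : |z.2 0 * chainMom N mu la z.2 0| ≤ Λ * (|z.2 0| * headSize z.1 z.2 N) := by
        rw [abs_mul]
        calc _ ≤ |z.2 0| * _ := mul_le_mul_of_nonneg_left h2 (abs_nonneg _)
          _ = _ := by rw [hΛ]; ring
      rw [sq_abs]
      have := le_abs_self (z.2 0 * chainMom N mu la z.2 0)
      nlinarith)
  -- Including `|v 0|` in the square adds at most twice `|v 0|` times the full sum; with half of `c`
  -- this costs the extra `c` in `C + c`.
  refine ⟨fun i j ↦ (if i = 0 ∧ j = 0 then (la 0)⁻¹ else 0) + r * Y₁ i j,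
    c / 2, by positivity, C + c, by positivity, fun x v ↦ ?_⟩
  have := h (x, v)
  rw [crossForm_add_smul N mu la K (fun i j ↦ if i = 0 ∧ j = 0 then (la 0)⁻¹ else 0), hS]
  refine this.trans' ?_
  simp only
  have hb := abs_nonneg (x 0)
  have ha := abs_nonneg (v 0)
  have hd := tailSize_nonneg N x v 1
  nlinarith [mul_nonneg ha hb, mul_nonneg ha hd, mul_nonneg hc.le (sq_nonneg (|x 0| + tailSize N x v 1)),
    mul_nonneg hc.le (mul_nonneg ha hb), mul_nonneg hc.le (mul_nonneg ha hd),
    mul_nonneg hc.le (sq_nonneg |v 0|)]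

end Chain

end QuadCable

namespace QuadCable

/-! ### The linearization as two horizontal chains and a vertical coordinate -/

section Lift

/-- The sequence `a, f 0, …, f (n - 1), 0, …`. -/
def extSeq {n : ℕ} (a : ℝ) (f : Fin n → ℝ) : ℕ → ℝ
  | 0 => a
  | i + 1 => if h : i < n then f ⟨i, h⟩ else 0

variable {n : ℕ}

@[simp] theorem extSeq_zero (a : ℝ) (f : Fin n → ℝ) : extSeq a f 0 = a := rfl

@[simp] theorem extSeq_succ (a : ℝ) (f : Fin n → ℝ) (i : Fin n) :
    extSeq a f (i + 1) = f i := by simp [extSeq]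

theorem sum_range_succ_fin (F : ℕ → ℝ) :
    ∑ j ∈ Finset.range (n + 1), F j = F 0 + ∑ i : Fin n, F (i + 1) := by
  rw [Finset.sum_range_succ', Finset.sum_range, add_comm]

theorem forall_lt_succ_iff {P : ℕ → Prop} : (∀ i < n + 1, P i) ↔ P 0 ∧ ∀ i : Fin n, P (i + 1) := by
  constructor
  · exact fun h ↦ ⟨h 0 (by omega), fun i ↦ h _ (by omega)⟩
  · rintro ⟨h0, h1⟩ (_ | i) hi
    · exact h0
    · exact h1 ⟨i, by omega⟩

/-- First horizontal component of a vector of linearized coordinates. -/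
def dirX (z : XIdx n → ℝ) : ℕ → ℝ := extSeq (z (Sum.inl 0)) fun i ↦ z (Sum.inr (i, 1))

/-- Second horizontal component of a vector of linearized coordinates. -/
def dirY (z : XIdx n → ℝ) : ℕ → ℝ := extSeq (z (Sum.inl 1)) fun i ↦ -z (Sum.inr (i, 0))

@[simp] theorem dirX_zero (z : XIdx n → ℝ) : dirX z 0 = z (Sum.inl 0) := rfl
@[simp] theorem dirY_zero (z : XIdx n → ℝ) : dirY z 0 = z (Sum.inl 1) := rfl
@[simp] theorem dirX_succ (z : XIdx n → ℝ) (i : Fin n) : dirX z (i + 1) = z (Sum.inr (i, 1)) := by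
  simp [dirX]
@[simp] theorem dirY_succ (z : XIdx n → ℝ) (i : Fin n) :
    dirY z (i + 1) = -z (Sum.inr (i, 0)) := by
  simp [dirY]

/-- The matrix of linearized coordinates with the coefficients `Y` in both horizontal directions. -/
def crossMat (n : ℕ) (Y : ℕ → ℕ → ℝ) : Matrix (XIdx n) (XIdx n) ℝ :=
  Matrix.fromBlocks (Y 0 0 • (1 : Mat3))
    (Matrix.of fun r (ic : Fin n × Fin 2) => -(Y 0 (ic.1 + 1)) * (hat e3 * C) r ic.2)
    (Matrix.of fun (ic : Fin n × Fin 2) r => -(Y (ic.1 + 1) 0) * (hat e3 * C) r ic.2)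
    (Matrix.of fun (ic jd : Fin n × Fin 2) =>
      Y (ic.1 + 1) (jd.1 + 1) * (1 : Matrix (Fin 2) (Fin 2) ℝ) ic.2 jd.2)

/-- The product with `e3` is a quarter turn of the horizontal plane: the angles of a link are `-q 1`
and `q 0`. Therefore `dirX` reads the second angle and `dirY` the negative of the first, in
agreement with the position components. -/
theorem hat_e3_mul_C : hat e3 * C = !![0, -1; 1, 0; 0, 0] := by
  ext i j
  fin_cases i <;> fin_cases j <;> simp [hat, e3, C, Matrix.mul_apply, Fin.sum_univ_three]

/-- The matrices of the model respect this splitting, so that the quadratic forms below reduce to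
those of the scalar chain. -/
theorem dotProduct_eq_dir (z z' : XIdx n → ℝ) :
    z ⬝ᵥ z' = ∑ j ∈ Finset.range (n + 1), dirX z j * dirX z' j
      + ∑ j ∈ Finset.range (n + 1), dirY z j * dirY z' j + z (Sum.inl 2) * z' (Sum.inl 2) := by
  simp only [dotProduct, Fintype.sum_sum_type, Fintype.sum_prod_type, Fin.sum_univ_three,
    Fin.sum_univ_two, sum_range_succ_fin, dirX_zero, dirY_zero, dirX_succ, dirY_succ,
    Finset.sum_add_distrib, neg_mul_neg]
  ring

theorem dirX_crossMat_mulVec (Y : ℕ → ℕ → ℝ) (z : XIdx n → ℝ) {j : ℕ} (hj : j < n + 1) :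
    dirX (crossMat n Y *ᵥ z) j = ∑ k ∈ Finset.range (n + 1), Y j k * dirX z k := by
  revert j
  rw [forall_lt_succ_iff]
  constructor
  · simp [mulVec, dotProduct, crossMat, hat_e3_mul_C, sum_range_succ_fin, Fintype.sum_prod_type,
      Fin.sum_univ_two, Matrix.one_apply]
  · intro i
    simp [mulVec, dotProduct, crossMat, hat_e3_mul_C, sum_range_succ_fin, Fintype.sum_prod_type,
      Fin.sum_univ_three, Matrix.one_apply]

theorem dirY_crossMat_mulVec (Y : ℕ → ℕ → ℝ) (z : XIdx n → ℝ) {j : ℕ} (hj : j < n + 1) :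
    dirY (crossMat n Y *ᵥ z) j = ∑ k ∈ Finset.range (n + 1), Y j k * dirY z k := by
  revert j
  rw [forall_lt_succ_iff]
  constructor
  · simp [mulVec, dotProduct, crossMat, hat_e3_mul_C, sum_range_succ_fin, Fintype.sum_prod_type,
      Fin.sum_univ_two, Matrix.one_apply]
  · intro i
    simp [mulVec, dotProduct, crossMat, hat_e3_mul_C, sum_range_succ_fin, Fintype.sum_prod_type,
      Fin.sum_univ_three, Matrix.one_apply, add_comm]

theorem crossMat_mulVec_two (Y : ℕ → ℕ → ℝ) (z : XIdx n → ℝ) :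
    (crossMat n Y *ᵥ z) (Sum.inl 2) = Y 0 0 * z (Sum.inl 2) := by
  simp [mulVec, dotProduct, crossMat, hat_e3_mul_C, Fintype.sum_prod_type, Fin.sum_univ_two,
    Matrix.one_apply]

variable (p : Params n)

/-- Masses along the chain, beginning with the quadrotor. -/
def massSeq : ℕ → ℝ := extSeq p.m p.mL

/-- Lengths along the chain, where the quadrotor counts as a link of length one. -/
def lenSeq : ℕ → ℝ := extSeq 1 p.l

/-- Moments `gᵢ` of the weight of the links. -/
def weight (i : Fin n) : ℝ := outerMass p i * p.g * p.l i

/-- Stiffness along the chain, with unit position gain. -/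
def stiffSeq : ℕ → ℝ := extSeq 1 (weight p)

theorem sum_Ico_massSeq_zero : ∑ a ∈ Finset.Ico 0 (n + 1), massSeq p a = M00 p := by
  rw [← Finset.range_eq_Ico, sum_range_succ_fin]
  simp [massSeq, M00]

theorem sum_Ico_massSeq_succ (i : Fin n) :
    ∑ a ∈ Finset.Ico ((i : ℕ) + 1) (n + 1), massSeq p a = outerMass p i := by
  have h1 : Finset.Ico ((i : ℕ) + 1) (n + 1)
      = (Finset.range (n + 1)).filter fun a ↦ (i : ℕ) + 1 ≤ a := by
    ext a
    simp only [Finset.mem_Ico, Finset.mem_filter, Finset.mem_range]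
    tauto
  have h2 : Finset.Ici i = Finset.univ.filter fun a ↦ i ≤ a := by ext; simp
  rw [h1, Finset.sum_filter, sum_range_succ_fin, outerMass, h2, Finset.sum_filter]
  simp [massSeq]

/-- The mass matrix of the chain in one direction. -/
def massCoeff (i j : ℕ) : ℝ :=
  (∑ a ∈ Finset.Ico (max i j) (n + 1), massSeq p a) * lenSeq p i * lenSeq p j

theorem massCoeff_zero_zero : massCoeff p 0 0 = M00 p := by
  simp only [massCoeff, max_self, sum_Ico_massSeq_zero, lenSeq, extSeq_zero, mul_one]

theorem massCoeff_zero_succ (i : Fin n) : massCoeff p 0 (i + 1) = M0 p i := by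
  simp only [massCoeff, zero_le, sup_of_le_right, sum_Ico_massSeq_succ, lenSeq, extSeq_zero,
    extSeq_succ, mul_one, M0]

theorem massCoeff_succ_zero (i : Fin n) : massCoeff p (i + 1) 0 = M0 p i := by
  simp only [massCoeff, zero_le, sup_of_le_left, sum_Ico_massSeq_succ, lenSeq, extSeq_zero,
    extSeq_succ, mul_one, M0]

theorem massCoeff_succ_succ (i j : Fin n) : massCoeff p (i + 1) (j + 1) = Mij p i j := by
  have h : max ((i : ℕ) + 1) ((j : ℕ) + 1) = ((max i j : Fin n) : ℕ) + 1 := by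
    rcases le_total i j with h | h
    · rw [max_eq_right h, max_eq_right (by simpa using h)]
    · rw [max_eq_left h, max_eq_left (by simpa using h)]
  simp only [massCoeff, h, sum_Ico_massSeq_succ, lenSeq, extSeq_succ, Mij]

theorem linM_eq_crossMat : linM p = crossMat n (massCoeff p) := by
  rw [linM, crossMat]
  congr 1
  · rw [massCoeff_zero_zero]
  · ext r ic
    simp [linMxq, massCoeff_zero_succ]
  · ext ic r
    simp [linMxq, massCoeff_succ_zero]
  · ext ic jd
    simp [linMqq, massCoeff_succ_succ]

/-- Momentum along the chain in one direction. -/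
def momSeq (v : ℕ → ℝ) (j : ℕ) : ℝ :=
  lenSeq p j * chainMom (n + 1) (massSeq p) (lenSeq p) v j

/-- The mass `a` contributes to the coefficient of `j` and `k` exactly if `j ≤ a` and `k ≤ a`.
Exchanging the sums collects the links `k ≤ a` into the velocity of that mass. -/
theorem sum_massCoeff_mul (v : ℕ → ℝ) (j : ℕ) :
    ∑ k ∈ Finset.range (n + 1), massCoeff p j k * v k = momSeq p v j := by
  simp only [momSeq, chainMom, chainVel, massCoeff, Finset.mul_sum, Finset.sum_mul]
  have h1 : ∀ k ∈ Finset.range (n + 1),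
      ∑ a ∈ Finset.Ico (max j k) (n + 1), massSeq p a * lenSeq p j * lenSeq p k * v k
        = ∑ a ∈ Finset.Ico j (n + 1), if k ≤ a then lenSeq p j * (massSeq p a * (lenSeq p k * v k))
          else 0 := by
    intro k _
    rw [← Finset.sum_filter]
    refine Finset.sum_congr ?_ fun a _ ↦ by ring
    ext a
    simp only [Finset.mem_Ico, Finset.mem_filter, max_le_iff]
    tauto
  rw [Finset.sum_congr rfl h1, Finset.sum_comm]
  refine Finset.sum_congr rfl fun a ha ↦ ?_
  rw [← Finset.sum_filter]
  refine Finset.sum_congr ?_ fun _ _ ↦ rfl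
  ext k
  simp only [Finset.mem_filter, Finset.mem_range, Finset.mem_Ico] at ha ⊢
  omega

theorem dirX_linM_mulVec (z : XIdx n → ℝ) {j : ℕ} (hj : j < n + 1) :
    dirX (linM p *ᵥ z) j = momSeq p (dirX z) j := by
  rw [linM_eq_crossMat, dirX_crossMat_mulVec _ _ hj, sum_massCoeff_mul]

theorem dirY_linM_mulVec (z : XIdx n → ℝ) {j : ℕ} (hj : j < n + 1) :
    dirY (linM p *ᵥ z) j = momSeq p (dirY z) j := by
  rw [linM_eq_crossMat, dirY_crossMat_mulVec _ _ hj, sum_massCoeff_mul]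

theorem linM_mulVec_two (z : XIdx n → ℝ) :
    (linM p *ᵥ z) (Sum.inl 2) = M00 p * z (Sum.inl 2) := by
  rw [linM_eq_crossMat, crossMat_mulVec_two, massCoeff_zero_zero]

/-- The stiffness matrix of the linearized system with unit position gain. -/
def stiff : Matrix (XIdx n) (XIdx n) ℝ := linG p + linB n * gainMat 1 0

theorem stiff_mulVec (z : XIdx n → ℝ) :
    stiff p *ᵥ z
      = Sum.elim (fun a ↦ z (Sum.inl a)) fun ic ↦ weight p ic.1 * z (Sum.inr ic) := by
  ext (a | ic)
  · rw [stiff, add_mulVec, ← mulVec_mulVec]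
    simp [linG, linB, gainMat, mulVec, dotProduct]
  · rw [stiff, add_mulVec, ← mulVec_mulVec]
    simp [linG, linB, gainMat, mulVec, dotProduct, Matrix.diagonal_apply, weight]

theorem dirX_stiff_mulVec (z : XIdx n → ℝ) {j : ℕ} (hj : j < n + 1) :
    dirX (stiff p *ᵥ z) j = stiffSeq p j * dirX z j := by
  revert j
  rw [forall_lt_succ_iff]
  simp [stiff_mulVec, stiffSeq]

theorem dirY_stiff_mulVec (z : XIdx n → ℝ) {j : ℕ} (hj : j < n + 1) :
    dirY (stiff p *ᵥ z) j = stiffSeq p j * dirY z j := by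
  revert j
  rw [forall_lt_succ_iff]
  simp [stiff_mulVec, stiffSeq]

/-- Physical admissibility of the data. -/
structure Params.Physical : Prop where
  m_pos : 0 < p.m
  J_pos : p.J.PosDef
  mL_pos : ∀ i, 0 < p.mL i
  l_pos : ∀ i, 0 < p.l i
  g_pos : 0 < p.g
  b1d_unit : p.b1d ⬝ᵥ p.b1d = 1

variable {p}

theorem Params.Physical.outerMass_pos (hp : p.Physical) (i : Fin n) : 0 < outerMass p i :=
  Finset.sum_pos (fun a _ ↦ hp.mL_pos a) ⟨i, Finset.mem_Ici.2 le_rfl⟩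

theorem Params.Physical.weight_pos (hp : p.Physical) (i : Fin n) : 0 < weight p i :=
  mul_pos (mul_pos (hp.outerMass_pos i) hp.g_pos) (hp.l_pos i)

theorem Params.Physical.M00_pos (hp : p.Physical) : 0 < M00 p :=
  add_pos_of_pos_of_nonneg hp.m_pos (Finset.sum_nonneg fun a _ ↦ (hp.mL_pos a).le)

theorem Params.Physical.massSeq_pos (hp : p.Physical) : ∀ i < n + 1, 0 < massSeq p i := by
  rw [forall_lt_succ_iff]
  simpa [massSeq] using ⟨hp.m_pos, hp.mL_pos⟩

theorem Params.Physical.lenSeq_pos (hp : p.Physical) : ∀ i < n + 1, 0 < lenSeq p i := by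
  rw [forall_lt_succ_iff]
  simpa [lenSeq] using hp.l_pos

theorem Params.Physical.stiffSeq_pos (hp : p.Physical) : ∀ i < n + 1, 0 < stiffSeq p i := by
  rw [forall_lt_succ_iff]
  simpa [stiffSeq] using hp.weight_pos

variable (p)

/-- The same exchange of sums diagonalizes the kinetic energy: each mass contributes the square of
its own velocity, which makes positivity evident. -/
theorem sum_mul_momSeq (v : ℕ → ℝ) :
    ∑ j ∈ Finset.range (n + 1), v j * momSeq p v j
      = ∑ a ∈ Finset.range (n + 1), massSeq p a * chainVel (lenSeq p) v (a + 1) ^ 2 := by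
  have h1 : ∀ j ∈ Finset.range (n + 1), v j * momSeq p v j
      = ∑ a ∈ Finset.range (n + 1), if j ≤ a then
          lenSeq p j * v j * (massSeq p a * chainVel (lenSeq p) v (a + 1)) else 0 := by
    intro j _
    rw [momSeq, chainMom, ← Finset.sum_filter, ← mul_assoc, Finset.mul_sum]
    refine Finset.sum_congr ?_ fun a _ ↦ by ring
    ext a
    simp only [Finset.mem_Ico, Finset.mem_filter, Finset.mem_range]
    tauto
  rw [Finset.sum_congr rfl h1, Finset.sum_comm]
  refine Finset.sum_congr rfl fun a ha ↦ ?_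
  have h2 : (Finset.range (n + 1)).filter (fun k ↦ k ≤ a) = Finset.range (a + 1) := by
    ext k
    simp only [Finset.mem_filter, Finset.mem_range] at ha ⊢
    omega
  rw [← Finset.sum_filter, ← Finset.sum_mul, h2]
  change chainVel (lenSeq p) v (a + 1) * _ = _
  ring

variable {p}

/-- The kinetic energy of the chain in one direction is positive definite. -/
theorem Params.Physical.exists_kinetic_bound (hp : p.Physical) :
    ∃ c > 0, ∀ v : ℕ → ℝ, c * (∑ j ∈ Finset.range (n + 1), |v j|) ^ 2
      ≤ ∑ j ∈ Finset.range (n + 1), v j * momSeq p v j := by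
  have hU : ∀ k, k ≤ n + 1 → ∃ C ≥ 0, ∀ v : ℕ → ℝ, chainVel (lenSeq p) v k ^ 2
      ≤ C * ∑ j ∈ Finset.range (n + 1), v j * momSeq p v j := by
    rintro (_ | k) hk
    · exact ⟨0, le_rfl, fun v ↦ by simp [chainVel]⟩
    · have hmk := hp.massSeq_pos k (by omega)
      refine ⟨(massSeq p k)⁻¹, by positivity, fun v ↦ ?_⟩
      rw [sum_mul_momSeq, ← div_eq_inv_mul, le_div_iff₀ hmk, mul_comm]
      exact Finset.single_le_sum (f := fun a ↦ massSeq p a * chainVel (lenSeq p) v (a + 1) ^ 2)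
        (fun a ha ↦ mul_nonneg (hp.massSeq_pos a (Finset.mem_range.1 ha)).le (sq_nonneg _))
        (Finset.mem_range.2 (by omega))
  -- The velocity of a link is the difference of the velocities of its two ends, both of which are
  -- controlled by the energy.
  have hV : ∀ k, ∃ C ≥ 0, k < n + 1 → ∀ v : ℕ → ℝ, v k ^ 2
      ≤ C * ∑ j ∈ Finset.range (n + 1), v j * momSeq p v j := by
    intro k
    by_cases hk : k < n + 1
    swap
    · exact ⟨0, le_rfl, fun h ↦ absurd h hk⟩
    obtain ⟨C₁, hC₁, h₁⟩ := hU k hk.le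
    obtain ⟨C₂, hC₂, h₂⟩ := hU (k + 1) hk
    have hl := hp.lenSeq_pos k hk
    refine ⟨2 * (C₁ + C₂) / lenSeq p k ^ 2, by positivity, fun _ v ↦ ?_⟩
    rw [div_mul_eq_mul_div, le_div_iff₀ (by positivity)]
    have h3 := h₁ v
    have h4 := h₂ v
    rw [chainVel_succ] at h4
    nlinarith [sq_nonneg (2 * chainVel (lenSeq p) v k + lenSeq p k * v k)]
  choose C hC0 hC using hV
  have hS : 0 ≤ ∑ k ∈ Finset.range (n + 1), C k := Finset.sum_nonneg fun k _ ↦ hC0 k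
  refine ⟨((n + 1 : ℝ) * (∑ k ∈ Finset.range (n + 1), C k + 1))⁻¹, by positivity, fun v ↦ ?_⟩
  have h1 : (∑ j ∈ Finset.range (n + 1), |v j|) ^ 2
      ≤ (n + 1 : ℝ) * ∑ j ∈ Finset.range (n + 1), v j ^ 2 := by
    have := sq_sum_le_card_mul_sum_sq (s := Finset.range (n + 1)) (f := fun j ↦ |v j|)
    simpa using this
  have h2 : ∑ j ∈ Finset.range (n + 1), v j ^ 2 ≤ (∑ k ∈ Finset.range (n + 1), C k) *
      ∑ j ∈ Finset.range (n + 1), v j * momSeq p v j := by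
    rw [Finset.sum_mul]
    exact Finset.sum_le_sum fun k hk ↦ hC k (Finset.mem_range.1 hk) v
  have hk0 : 0 ≤ ∑ j ∈ Finset.range (n + 1), v j * momSeq p v j := by
    rw [sum_mul_momSeq]
    exact Finset.sum_nonneg fun a ha ↦
      mul_nonneg (hp.massSeq_pos a (Finset.mem_range.1 ha)).le (sq_nonneg _)
  rw [inv_mul_le_iff₀ (by positivity)]
  refine h1.trans ?_
  rw [mul_assoc]
  exact mul_le_mul_of_nonneg_left (by nlinarith) (by positivity)

/-- Sum of the absolute values of the entries. -/
def absSum {ι : Type} [Fintype ι] (z : ι → ℝ) : ℝ := ∑ j, |z j|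

theorem absSum_nonneg {ι : Type} [Fintype ι] (z : ι → ℝ) : 0 ≤ absSum z :=
  Finset.sum_nonneg fun _ _ ↦ abs_nonneg _

theorem abs_le_absSum {ι : Type} [Fintype ι] (z : ι → ℝ) (j : ι) : |z j| ≤ absSum z :=
  Finset.single_le_sum (f := fun j ↦ |z j|) (fun _ _ ↦ abs_nonneg _) (Finset.mem_univ j)

theorem absSum_eq_dir (z : XIdx n → ℝ) :
    absSum z = ∑ j ∈ Finset.range (n + 1), |dirX z j| + ∑ j ∈ Finset.range (n + 1), |dirY z j|
      + |z (Sum.inl 2)| := by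
  simp only [absSum, Fintype.sum_sum_type, Fintype.sum_prod_type, Fin.sum_univ_three,
    Fin.sum_univ_two, sum_range_succ_fin, dirX_zero, dirY_zero, dirX_succ, dirY_succ,
    Finset.sum_add_distrib, abs_neg]
  ring

theorem Params.Physical.exists_linM_bound (hp : p.Physical) :
    ∃ c > 0, ∀ z : XIdx n → ℝ, c * absSum z ^ 2 ≤ z ⬝ᵥ (linM p *ᵥ z) := by
  obtain ⟨c, hc, h⟩ := hp.exists_kinetic_bound
  refine ⟨min c (M00 p) / 3, div_pos (lt_min hc hp.M00_pos) (by norm_num), fun z ↦ ?_⟩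
  rw [dotProduct_eq_dir, absSum_eq_dir, linM_mulVec_two]
  have hX := h (dirX z)
  have hY := h (dirY z)
  have eX : ∑ j ∈ Finset.range (n + 1), dirX z j * dirX (linM p *ᵥ z) j
      = ∑ j ∈ Finset.range (n + 1), dirX z j * momSeq p (dirX z) j :=
    Finset.sum_congr rfl fun j hj ↦ by rw [dirX_linM_mulVec p z (Finset.mem_range.1 hj)]
  have eY : ∑ j ∈ Finset.range (n + 1), dirY z j * dirY (linM p *ᵥ z) j
      = ∑ j ∈ Finset.range (n + 1), dirY z j * momSeq p (dirY z) j :=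
    Finset.sum_congr rfl fun j hj ↦ by rw [dirY_linM_mulVec p z (Finset.mem_range.1 hj)]
  rw [eX, eY]
  have h3 := sq_abs (z (Sum.inl 2))
  have h1 : 0 < min c (M00 p) := lt_min hc hp.M00_pos
  have h2 := min_le_left c (M00 p)
  have h4 := min_le_right c (M00 p)
  generalize min c (M00 p) = k at *
  generalize ∑ j ∈ Finset.range (n + 1), |dirX z j| = a at *
  generalize ∑ j ∈ Finset.range (n + 1), |dirY z j| = b at *
  generalize |z (Sum.inl 2)| = d at *
  have h5 : (a + b + d) ^ 2 ≤ 3 * (a ^ 2 + b ^ 2 + d ^ 2) := by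
    nlinarith [sq_nonneg (a - b), sq_nonneg (b - d), sq_nonneg (a - d)]
  nlinarith [mul_le_mul_of_nonneg_right h2 (sq_nonneg a), mul_le_mul_of_nonneg_right h2 (sq_nonneg b),
    mul_le_mul_of_nonneg_right h4 (sq_nonneg d)]

theorem Params.Physical.exists_stiff_bound (hp : p.Physical) :
    ∃ c > 0, ∀ z : XIdx n → ℝ, c * absSum z ^ 2 ≤ z ⬝ᵥ (stiff p *ᵥ z) := by
  obtain ⟨c, hc, hcw⟩ : ∃ c > 0, ∀ j : XIdx n, c ≤ Sum.elim (fun _ : Fin 3 ↦ (1 : ℝ))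
      (fun ic : Fin n × Fin 2 ↦ weight p ic.1) j := by
    obtain ⟨j, hj⟩ := Finite.exists_min (Sum.elim (fun _ : Fin 3 ↦ (1 : ℝ))
      (fun ic : Fin n × Fin 2 ↦ weight p ic.1))
    refine ⟨_, ?_, hj⟩
    rcases j with a | ic
    · exact one_pos
    · exact hp.weight_pos _
  refine ⟨c / (Fintype.card (XIdx n) + 1), by positivity, fun z ↦ ?_⟩
  have h1 : absSum z ^ 2 ≤ (Fintype.card (XIdx n) : ℝ) * ∑ j, z j ^ 2 := by
    have := sq_sum_le_card_mul_sum_sq (s := Finset.univ) (f := fun j ↦ |z j|)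
    simpa [absSum] using this
  have h2 : c * ∑ j, z j ^ 2 ≤ z ⬝ᵥ (stiff p *ᵥ z) := by
    rw [stiff_mulVec, dotProduct, Finset.mul_sum]
    refine Finset.sum_le_sum fun j _ ↦ ?_
    have := mul_le_mul_of_nonneg_right (hcw j) (sq_nonneg (z j))
    rcases j with a | ic
    · simp only [Sum.elim_inl] at this ⊢
      nlinarith
    · simp only [Sum.elim_inr] at this ⊢
      nlinarith
  have h3 : 0 ≤ ∑ j, z j ^ 2 := Finset.sum_nonneg fun _ _ ↦ sq_nonneg _
  rw [div_mul_eq_mul_div, div_le_iff₀ (by positivity)]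
  have h4 : 0 ≤ c * ∑ j, z j ^ 2 := by positivity
  nlinarith [mul_le_mul_of_nonneg_left h1 hc.le, (Fintype.card (XIdx n)).cast_nonneg (α := ℝ),
    mul_le_mul_of_nonneg_right h2 ((Fintype.card (XIdx n)).cast_nonneg (α := ℝ))]

/-- The dissipation generated by the cross term with matrix `Y` in the undamped system. -/
def crossDiss (p : Params n) (Y : Matrix (XIdx n) (XIdx n) ℝ) (pos vel : XIdx n → ℝ) : ℝ :=
  pos ⬝ᵥ (Y *ᵥ (stiff p *ᵥ pos)) - vel ⬝ᵥ (Y *ᵥ (linM p *ᵥ vel))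

theorem dotProduct_crossMat_mulVec (Y : ℕ → ℕ → ℝ) (z w : XIdx n → ℝ) :
    z ⬝ᵥ (crossMat n Y *ᵥ w)
      = ∑ i ∈ Finset.range (n + 1), ∑ j ∈ Finset.range (n + 1), Y i j * (dirX z i * dirX w j)
        + ∑ i ∈ Finset.range (n + 1), ∑ j ∈ Finset.range (n + 1), Y i j * (dirY z i * dirY w j)
        + Y 0 0 * (z (Sum.inl 2) * w (Sum.inl 2)) := by
  rw [dotProduct_eq_dir, crossMat_mulVec_two]
  congr 1
  · congr 1
    · refine Finset.sum_congr rfl fun i hi ↦ ?_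
      rw [dirX_crossMat_mulVec _ _ (Finset.mem_range.1 hi), Finset.mul_sum]
      exact Finset.sum_congr rfl fun j _ ↦ by ring
    · refine Finset.sum_congr rfl fun i hi ↦ ?_
      rw [dirY_crossMat_mulVec _ _ (Finset.mem_range.1 hi), Finset.mul_sum]
      exact Finset.sum_congr rfl fun j _ ↦ by ring
  · ring

theorem crossDiss_eq (Y : ℕ → ℕ → ℝ) (pos vel : XIdx n → ℝ) :
    crossDiss p (crossMat n Y) pos vel
      = crossForm (n + 1) (massSeq p) (lenSeq p) (stiffSeq p) Y (dirX pos) (dirX vel)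
        + crossForm (n + 1) (massSeq p) (lenSeq p) (stiffSeq p) Y (dirY pos) (dirY vel)
        + Y 0 0 * (pos (Sum.inl 2) ^ 2 - M00 p * vel (Sum.inl 2) ^ 2) := by
  have hs2 : (stiff p *ᵥ pos) (Sum.inl 2) = pos (Sum.inl 2) := by rw [stiff_mulVec]; rfl
  have key : ∀ (z w z' w' a b a' b' : ℕ → ℝ), (∀ j < n + 1, w j = a j) →
      (∀ j < n + 1, w' j = a' j) →
      ∑ i ∈ Finset.range (n + 1), ∑ j ∈ Finset.range (n + 1), Y i j * (z i * w j)
        - ∑ i ∈ Finset.range (n + 1), ∑ j ∈ Finset.range (n + 1), Y i j * (z' i * w' j)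
      = ∑ i ∈ Finset.range (n + 1), ∑ j ∈ Finset.range (n + 1),
          Y i j * (z i * a j - z' i * a' j) := by
    intro z w z' w' a b a' b' h h'
    rw [← Finset.sum_sub_distrib]
    refine Finset.sum_congr rfl fun i _ ↦ ?_
    rw [← Finset.sum_sub_distrib]
    refine Finset.sum_congr rfl fun j hj ↦ ?_
    rw [h j (Finset.mem_range.1 hj), h' j (Finset.mem_range.1 hj)]
    ring
  rw [crossDiss, dotProduct_crossMat_mulVec, dotProduct_crossMat_mulVec, hs2, linM_mulVec_two]
  have hX := key (dirX pos) _ (dirX vel) _ _ 0 _ 0 (fun j hj ↦ dirX_stiff_mulVec p pos hj)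
    (fun j hj ↦ dirX_linM_mulVec p vel hj)
  have hY := key (dirY pos) _ (dirY vel) _ _ 0 _ 0 (fun j hj ↦ dirY_stiff_mulVec p pos hj)
    (fun j hj ↦ dirY_linM_mulVec p vel hj)
  have hf : ∀ x v : ℕ → ℝ, crossForm (n + 1) (massSeq p) (lenSeq p) (stiffSeq p) Y x v
      = ∑ i ∈ Finset.range (n + 1), ∑ j ∈ Finset.range (n + 1),
        Y i j * (x i * (stiffSeq p j * x j) - v i * momSeq p v j) := by
    intro x v
    exact Finset.sum_congr rfl fun i _ ↦ Finset.sum_congr rfl fun j _ ↦ by rw [momSeq]; ring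
  rw [hf, hf, ← hX, ← hY]
  ring

/-- There is a cross term that makes all coordinates dissipate, apart from the velocity of the
quadrotor. -/
theorem Params.Physical.exists_crossDiss (hp : p.Physical) :
    ∃ Y : ℕ → ℕ → ℝ, 0 < Y 0 0 ∧ ∃ c > 0, ∃ C ≥ 0, ∀ pos vel : XIdx n → ℝ,
      c * (absSum pos + absSum vel) ^ 2
        - C * ((∑ a, |vel (Sum.inl a)|) * (absSum pos + absSum vel))
        ≤ crossDiss p (crossMat n Y) pos vel := by
  obtain ⟨Y, c, hc, C, hC, h⟩ := exists_cross (n + 1) (by omega) hp.massSeq_pos hp.lenSeq_pos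
    hp.stiffSeq_pos
  -- The bound is evaluated at a unit displacement of the quadrotor, everything else being zero.
  -- This positivity serves the vertical coordinate here, and the recovery of the integral of the
  -- position error in `Tuning.posEst`.
  have hY0 : 0 < Y 0 0 := by
    have h1 := h (extSeq (n := n) 1 0) (fun _ ↦ 0)
    have h2 : crossForm (n + 1) (massSeq p) (lenSeq p) (stiffSeq p) Y (extSeq (n := n) 1 0)
        (fun _ ↦ 0) = Y 0 0 := by
      simp [crossForm, sum_range_succ_fin, stiffSeq]
    rw [h2, sum_range_succ_fin] at h1
    simp at h1
    linarith
  -- The vertical coordinate contributes `Y 0 0 * (x ^ 2 - M00 * v ^ 2)`, whose negative part has a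
  -- velocity of the quadrotor as a factor. The divisor 3 comes from the square of a sum of three
  -- terms.
  refine ⟨Y, hY0, min c (Y 0 0) / 3, by positivity, C + Y 0 0 * M00 p + Y 0 0 + c, by
    have := hp.M00_pos; positivity, fun pos vel ↦ ?_⟩
  rw [crossDiss_eq, absSum_eq_dir pos, absSum_eq_dir vel, Fin.sum_univ_three]
  have hX := h (dirX pos) (dirX vel)
  have hY := h (dirY pos) (dirY vel)
  simp only [Finset.sum_add_distrib, dirX_zero, dirY_zero] at hX hY
  have h1 : 0 < min c (Y 0 0) := lt_min hc hY0
  have h2 := min_le_left c (Y 0 0)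
  have h4 := min_le_right c (Y 0 0)
  have hM := hp.M00_pos
  have e1 := sq_abs (pos (Sum.inl 2))
  have e2 := sq_abs (vel (Sum.inl 2))
  have a1 : 0 ≤ ∑ j ∈ Finset.range (n + 1), |dirX pos j| := Finset.sum_nonneg fun _ _ ↦ abs_nonneg _
  have a2 : 0 ≤ ∑ j ∈ Finset.range (n + 1), |dirX vel j| := Finset.sum_nonneg fun _ _ ↦ abs_nonneg _
  have a3 : 0 ≤ ∑ j ∈ Finset.range (n + 1), |dirY pos j| := Finset.sum_nonneg fun _ _ ↦ abs_nonneg _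
  have a4 : 0 ≤ ∑ j ∈ Finset.range (n + 1), |dirY vel j| := Finset.sum_nonneg fun _ _ ↦ abs_nonneg _
  have b0 := abs_nonneg (vel (Sum.inl 0))
  have b1 := abs_nonneg (vel (Sum.inl 1))
  have b2 := abs_nonneg (vel (Sum.inl 2))
  have b3 := abs_nonneg (pos (Sum.inl 2))
  rw [← e1, ← e2]
  generalize min c (Y 0 0) = k at *
  generalize crossForm (n + 1) (massSeq p) (lenSeq p) (stiffSeq p) Y (dirX pos) (dirX vel) = F1 at *
  generalize crossForm (n + 1) (massSeq p) (lenSeq p) (stiffSeq p) Y (dirY pos) (dirY vel) = F2 at *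
  generalize Y 0 0 = y at *
  generalize M00 p = M at *
  generalize |pos (Sum.inl 2)| = x2 at *
  generalize |vel (Sum.inl 2)| = v2 at *
  generalize |vel (Sum.inl 1)| = v1 at *
  generalize |vel (Sum.inl 0)| = v0 at *
  obtain ⟨S, hS⟩ : ∃ S, S = ∑ j ∈ Finset.range (n + 1), |dirX pos j|
    + ∑ j ∈ Finset.range (n + 1), |dirX vel j| := ⟨_, rfl⟩
  obtain ⟨S', hS'⟩ : ∃ S, S = ∑ j ∈ Finset.range (n + 1), |dirY pos j|
    + ∑ j ∈ Finset.range (n + 1), |dirY vel j| := ⟨_, rfl⟩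
  have hS0 : 0 ≤ S := by rw [hS]; positivity
  have hS0' : 0 ≤ S' := by rw [hS']; positivity
  rw [← hS] at hX
  rw [← hS'] at hY
  have hT : ∑ j ∈ Finset.range (n + 1), |dirX pos j| + ∑ j ∈ Finset.range (n + 1), |dirY pos j| + x2
      + (∑ j ∈ Finset.range (n + 1), |dirX vel j| + ∑ j ∈ Finset.range (n + 1), |dirY vel j| + v2)
      = S + S' + x2 + v2 := by rw [hS, hS']; ring
  rw [hT]
  clear hT hS hS' a1 a2 a3 a4
  have k1 : k * S ^ 2 ≤ c * S ^ 2 := mul_le_mul_of_nonneg_right h2 (sq_nonneg _)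
  have k2 : k * S' ^ 2 ≤ c * S' ^ 2 := mul_le_mul_of_nonneg_right h2 (sq_nonneg _)
  have k3 : k * x2 ^ 2 ≤ y * x2 ^ 2 := mul_le_mul_of_nonneg_right h4 (sq_nonneg _)
  have k4 : k / 3 * (S + S' + x2) ^ 2 ≤ k * (S ^ 2 + S' ^ 2 + x2 ^ 2) := by
    have : (S + S' + x2) ^ 2 ≤ 3 * (S ^ 2 + S' ^ 2 + x2 ^ 2) := by
      nlinarith [sq_nonneg (S - S'), sq_nonneg (S' - x2), sq_nonneg (S - x2)]
    nlinarith
  have k5 : k / 3 * (S + S' + x2 + v2) ^ 2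
      ≤ k / 3 * (S + S' + x2) ^ 2 + c * (v2 * (S + S' + x2 + v2)) := by
    have e : (S + S' + x2 + v2) ^ 2 = (S + S' + x2) ^ 2 + v2 * (2 * (S + S' + x2) + v2) := by ring
    rw [e, mul_add]
    have : v2 * (2 * (S + S' + x2) + v2) ≤ 2 * (v2 * (S + S' + x2 + v2)) := by nlinarith
    have h0 : 0 ≤ v2 * (S + S' + x2 + v2) := by positivity
    have h8 : k / 3 * (v2 * (2 * (S + S' + x2) + v2)) ≤ k / 3 * (2 * (v2 * (S + S' + x2 + v2))) :=
      mul_le_mul_of_nonneg_left this (by positivity)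
    nlinarith
  have m1 : C * (v0 * S) ≤ C * (v0 * (S + S' + x2 + v2)) := by gcongr; linarith
  have m2 : C * (v1 * S') ≤ C * (v1 * (S + S' + x2 + v2)) := by gcongr; linarith
  have m3 : y * M * v2 ^ 2 ≤ y * M * (v2 * (S + S' + x2 + v2)) := by
    rw [sq]; gcongr; linarith
  have m4 : 0 ≤ C * (v2 * (S + S' + x2 + v2)) := by positivity
  have m5 : 0 ≤ (y * M + y + c) * (v0 * (S + S' + x2 + v2)) := by positivity
  have m6 : 0 ≤ (y * M + y + c) * (v1 * (S + S' + x2 + v2)) := by positivity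
  have m7 : 0 ≤ y * (v2 * (S + S' + x2 + v2)) := by positivity
  linarith

end Lift

end QuadCable

namespace QuadCable

/-! ### Gains, the matrix `P` and the linear dissipation estimate -/

section Design

variable {n : ℕ}

theorem posDef_of_forall_pos {ι : Type} [Fintype ι] {A : Matrix ι ι ℝ} (hA : Aᵀ = A)
    (h : ∀ x, x ≠ 0 → 0 < x ⬝ᵥ (A *ᵥ x)) : A.PosDef :=
  Matrix.PosDef.of_dotProduct_mulVec_pos (by rwa [Matrix.IsHermitian, conjTranspose_eq_transpose_of_trivial])
    fun x hx ↦ by simpa using h x hx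

/-- Sum of the absolute values of the entries of a matrix. -/
def absSumMat {ι κ : Type} [Fintype ι] [Fintype κ] (A : Matrix ι κ ℝ) : ℝ := ∑ i, ∑ j, |A i j|

theorem absSumMat_nonneg {ι κ : Type} [Fintype ι] [Fintype κ] (A : Matrix ι κ ℝ) :
    0 ≤ absSumMat A :=
  Finset.sum_nonneg fun _ _ ↦ Finset.sum_nonneg fun _ _ ↦ abs_nonneg _

theorem abs_dotProduct_mulVec_le {ι κ : Type} [Fintype ι] [Fintype κ] (A : Matrix ι κ ℝ) (z : ι → ℝ)
    (w : κ → ℝ) : |z ⬝ᵥ (A *ᵥ w)| ≤ absSumMat A * (absSum z * absSum w) := by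
  simp only [dotProduct, mulVec, absSumMat, Finset.mul_sum, Finset.sum_mul]
  refine (Finset.abs_sum_le_sum_abs _ _).trans (Finset.sum_le_sum fun i _ ↦ ?_)
  refine (Finset.abs_sum_le_sum_abs _ _).trans (Finset.sum_le_sum fun j _ ↦ ?_)
  rw [abs_mul, abs_mul]
  have h1 := abs_le_absSum z i
  have h2 := abs_le_absSum w j
  calc |z i| * (|A i j| * |w j|) = |A i j| * (|z i| * |w j|) := by ring
    _ ≤ _ := mul_le_mul_of_nonneg_left
      (mul_le_mul h1 h2 (abs_nonneg _) (absSum_nonneg z)) (abs_nonneg _)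

theorem absSum_pos {ι : Type} [Fintype ι] {z : ι → ℝ} (hz : z ≠ 0) : 0 < absSum z := by
  obtain ⟨j, hj⟩ := Function.ne_iff.1 hz
  exact (abs_pos.2 hj).trans_le (abs_le_absSum z j)

/-- A force on the quadrotor as a generalized force. -/
def baseForce (u : V3) : XIdx n → ℝ := Sum.elim u 0

theorem absSum_baseForce (u : V3) : absSum (baseForce (n := n) u) = absSum u := by
  simp [absSum, baseForce]

theorem dotProduct_baseForce (z : XIdx n → ℝ) (u : V3) :
    z ⬝ᵥ baseForce u = (z ∘ Sum.inl) ⬝ᵥ u := by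
  simp [dotProduct, baseForce]

theorem absSum_sq_le_card_mul {ι : Type} [Fintype ι] (z : ι → ℝ) :
    absSum z ^ 2 ≤ Fintype.card ι * (z ⬝ᵥ z) := by
  have := sq_sum_le_card_mul_sum_sq (s := Finset.univ) (f := fun j ↦ |z j|)
  simpa [absSum, dotProduct, sq] using this

variable (p : Params n)

theorem linM_transpose : (linM p)ᵀ = linM p := by
  have h : linMqq p = (linMqq p)ᵀ := by
    ext ic jd
    simp only [linMqq, of_apply, transpose_apply, Mij, Matrix.one_apply, max_comm jd.1 ic.1,
      eq_comm (a := jd.2)]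
    ring
  rw [linM, fromBlocks_transpose, transpose_transpose, ← h]
  simp

theorem stiff_transpose : (stiff p)ᵀ = stiff p := by
  have h : stiff p = Matrix.diagonal (Sum.elim (fun _ : Fin 3 ↦ (1 : ℝ))
      fun ic : Fin n × Fin 2 ↦ weight p ic.1) := by
    refine Matrix.ext_of_mulVec_single fun j ↦ ?_
    rw [stiff_mulVec]
    ext (a | ic) <;> simp [mulVec_diagonal]
  rw [h, diagonal_transpose]

variable {p}

theorem Params.Physical.linM_posDef (hp : p.Physical) : (linM p).PosDef := by
  obtain ⟨c, hc, h⟩ := hp.exists_linM_bound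
  refine posDef_of_forall_pos (linM_transpose p) fun x hx ↦ (h x).trans_lt' ?_
  have := absSum_pos hx
  positivity

theorem Params.Physical.linM_mul_inv (hp : p.Physical) : linM p * (linM p)⁻¹ = 1 :=
  Matrix.mul_nonsing_inv _ ((Matrix.isUnit_iff_isUnit_det _).1 hp.linM_posDef.isUnit)

variable (p)

/-- The closed-loop matrix with unit position gain, velocity gain `κ`, and no link feedback. -/
noncomputable def closedLoop (κ : ℝ) : Matrix (ZIdx n) (ZIdx n) ℝ :=
  Matrix.fromBlocks 0 1 (-((linM p)⁻¹ * stiff p)) (-((linM p)⁻¹ * linB n * gainMat κ 0))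

/-- The quadratic form of the energy with the cross term `ε · 𝐱ᵀ Y 𝐌 𝐱̇`. -/
noncomputable def lyapMat (Y : Matrix (XIdx n) (XIdx n) ℝ) (ε : ℝ) : Matrix (ZIdx n) (ZIdx n) ℝ :=
  Matrix.fromBlocks (stiff p) (ε • (Y * linM p)) (ε • (Y * linM p))ᵀ (linM p)

/-- Gains with damping `κ` of the quadrotor, cross term `ε₀ / κ`, integral gains `kz` and `kI`. -/
noncomputable def design (Y : Matrix (XIdx n) (XIdx n) ℝ) (ε₀ κ kz kI c2 δ : ℝ) : Gains n where
  -- Only the quadrotor is fed back: gravity supplies the stiffness of the links, and the coupling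
  -- to the quadrotor their damping.
  kx := 1
  kq := 0
  kxdot := κ
  kω := 0
  kz := kz
  kzq := 0
  -- In the region of the analysis the components of the integral force are at most `3 * δ`, so they
  -- do not reach `kz * σ = 4 * δ`.
  σ := 4 * δ / kz
  -- The Lyapunov equation holds by definition; what needs proof is that this matrix is positive
  -- definite.
  Q := -((closedLoop p κ)ᵀ * lyapMat p Y (ε₀ / κ) + lyapMat p Y (ε₀ / κ) * closedLoop p κ)
  P := lyapMat p Y (ε₀ / κ)
  kR := 1
  kΩ := 1
  kI := kI
  c2 := c2

variable {p}

theorem gainMat_zero_mulVec (a : ℝ) (z : XIdx n → ℝ) : gainMat a 0 *ᵥ z = a • (z ∘ Sum.inl) := by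
  ext r
  simp [gainMat, mulVec, dotProduct, Matrix.one_apply]

theorem linB_mulVec (u : V3) : linB n *ᵥ u = baseForce u := by
  ext (a | ic)
  · simp [linB, mulVec, dotProduct, baseForce, Matrix.one_apply]
  · simp [linB, mulVec, dotProduct, baseForce]

theorem closedLoop_mulVec (κ : ℝ) (pos vel : XIdx n → ℝ) :
    closedLoop p κ *ᵥ Sum.elim pos vel = Sum.elim vel
      ((linM p)⁻¹ *ᵥ (-(stiff p *ᵥ pos) - κ • baseForce (vel ∘ Sum.inl))) := by
  rw [closedLoop, fromBlocks_mulVec]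
  congr 1
  · simp
  · simp only [Sum.elim_comp_inl, Sum.elim_comp_inr, neg_mulVec, ← mulVec_mulVec,
      gainMat_zero_mulVec, mulVec_sub, mulVec_neg, mulVec_smul, linB_mulVec]
    abel

theorem dotProduct_lyapMat_mulVec (Y : Matrix (XIdx n) (XIdx n) ℝ) (ε : ℝ)
    (pos vel pos' vel' : XIdx n → ℝ) :
    Sum.elim pos vel ⬝ᵥ (lyapMat p Y ε *ᵥ Sum.elim pos' vel')
      = pos ⬝ᵥ (stiff p *ᵥ pos') + vel ⬝ᵥ (linM p *ᵥ vel')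
        + ε * (pos ⬝ᵥ (Y *ᵥ (linM p *ᵥ vel'))) + ε * (pos' ⬝ᵥ (Y *ᵥ (linM p *ᵥ vel))) := by
  rw [lyapMat, fromBlocks_mulVec, sumElim_dotProduct_sumElim]
  simp only [Sum.elim_comp_inl, Sum.elim_comp_inr, dotProduct_add, smul_mulVec, dotProduct_smul,
    smul_eq_mul, ← mulVec_mulVec, transpose_smul, mulVec_transpose]
  rw [dotProduct_comm vel (pos' ᵥ* (Y * linM p)), ← dotProduct_mulVec, ← mulVec_mulVec]
  ring

theorem dotProduct_mulVec_comm {ι : Type} [Fintype ι] {A : Matrix ι ι ℝ} (hA : Aᵀ = A)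
    (z w : ι → ℝ) : z ⬝ᵥ (A *ᵥ w) = w ⬝ᵥ (A *ᵥ z) := by
  rw [dotProduct_mulVec, dotProduct_comm, ← mulVec_transpose, hA]

theorem dotProduct_stiff_comm (z w : XIdx n → ℝ) :
    z ⬝ᵥ (stiff p *ᵥ w) = w ⬝ᵥ (stiff p *ᵥ z) := by
  exact dotProduct_mulVec_comm (stiff_transpose p) z w

/-- Rate of dissipation of the linearized system. -/
noncomputable def dissRate (p : Params n) (Y : Matrix (XIdx n) (XIdx n) ℝ) (ε₀ κ : ℝ) (pos vel : XIdx n → ℝ) : ℝ :=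
  κ * ((vel ∘ Sum.inl) ⬝ᵥ (vel ∘ Sum.inl)) + ε₀ / κ * crossDiss p Y pos vel
    + ε₀ * (pos ⬝ᵥ (Y *ᵥ baseForce (vel ∘ Sum.inl)))

/-- The inverse mass matrix meets only the mass matrix inside `lyapMat` and cancels. The damping `κ`
in the cross term cancels against the weight `ε₀ / κ`, which is the reason for this weight. -/
theorem Params.Physical.lyapMat_closedLoop (hp : p.Physical) (Y : Matrix (XIdx n) (XIdx n) ℝ)
    (ε₀ : ℝ) {κ : ℝ} (hκ : κ ≠ 0) (pos vel : XIdx n → ℝ) :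
    Sum.elim pos vel ⬝ᵥ (lyapMat p Y (ε₀ / κ) *ᵥ (closedLoop p κ *ᵥ Sum.elim pos vel))
      = -dissRate p Y ε₀ κ pos vel := by
  rw [closedLoop_mulVec, dotProduct_lyapMat_mulVec, mulVec_mulVec _ (linM p) (linM p)⁻¹,
    hp.linM_mul_inv, one_mulVec, dissRate, crossDiss, dotProduct_stiff_comm pos vel]
  simp only [dotProduct_sub, dotProduct_neg, mulVec_sub, mulVec_neg, dotProduct_smul, smul_eq_mul,
    mulVec_smul, dotProduct_baseForce]
  field_simp
  ring

/-- The errors with the quadrotor velocity as a factor are absorbed into its damping by Young's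
inequality. Passing to `absSum` costs a factor 3 and Young's inequality a half, which leaves `κ /
6`. Because of the weight `ε₀ / κ`, one bound on `ε₀` serves all `κ ≥ 1`. -/
theorem Params.Physical.exists_dissRate_bound (hp : p.Physical) :
    ∃ Y : ℕ → ℕ → ℝ, 0 < Y 0 0 ∧ ∃ r > 0, ∃ c > 0, ∀ ε₀ κ, 0 < ε₀ → ε₀ ≤ r → 1 ≤ κ →
      ∀ pos vel : XIdx n → ℝ,
      κ / 6 * absSum (vel ∘ Sum.inl) ^ 2 + ε₀ / κ * c * (absSum pos + absSum vel) ^ 2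
        ≤ dissRate p (crossMat n Y) ε₀ κ pos vel := by
  obtain ⟨Y, hY, c, hc, C, hC, h⟩ := hp.exists_crossDiss
  refine ⟨Y, hY, c / (3 * (C + absSumMat (crossMat n Y) + 1) ^ 2),
    by have := absSumMat_nonneg (crossMat n Y); positivity, c / 2, by positivity, ?_⟩
  intro ε₀ κ hε hεr hκ pos vel
  have hB0 := absSumMat_nonneg (crossMat n Y)
  have h1 := h pos vel
  have h2 := abs_dotProduct_mulVec_le (crossMat n Y) pos (baseForce (vel ∘ Sum.inl))
  rw [absSum_baseForce] at h2
  have h3 := absSum_sq_le_card_mul (vel ∘ Sum.inl : V3)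
  rw [Fintype.card_fin] at h3
  have hpos := absSum_nonneg pos
  have hvel := absSum_nonneg vel
  have hν := absSum_nonneg (vel ∘ Sum.inl : V3)
  have h1' : c * (absSum pos + absSum vel) ^ 2
      - C * (absSum (vel ∘ Sum.inl : V3) * (absSum pos + absSum vel))
      ≤ crossDiss p (crossMat n Y) pos vel := h1
  rw [dissRate]
  generalize absSumMat (crossMat n Y) = B at *
  generalize crossDiss p (crossMat n Y) pos vel = D at *
  generalize pos ⬝ᵥ (crossMat n Y *ᵥ baseForce (vel ∘ Sum.inl)) = E at *
  generalize absSum (vel ∘ Sum.inl : V3) = ν at *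
  have hs : absSum pos ≤ absSum pos + absSum vel := by linarith
  obtain ⟨s, hse⟩ : ∃ s, s = absSum pos + absSum vel := ⟨_, rfl⟩
  rw [← hse] at h1' hs ⊢
  have hs0 : 0 ≤ s := by rw [hse]; positivity
  have hκ0 : 0 < κ := by linarith
  have e1 : -(B * (ν * s)) ≤ E := by
    have : |E| ≤ B * (ν * s) := h2.trans (by
      rw [mul_comm (absSum pos)]; gcongr)
    exact (abs_le.1 this).1
  have hεκ : ε₀ / κ ≤ ε₀ := div_le_self hε.le hκ
  have e2 : ε₀ / κ * (c * s ^ 2) - ε₀ * (C * (ν * s)) ≤ ε₀ / κ * D := by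
    have k1 := mul_le_mul_of_nonneg_left h1' (div_pos hε hκ0).le
    have k2 : ε₀ / κ * (C * (ν * s)) ≤ ε₀ * (C * (ν * s)) :=
      mul_le_mul_of_nonneg_right hεκ (by positivity)
    rw [mul_sub] at k1
    linarith
  have e3 : ε₀ * ((C + B + 1) * (ν * s)) ≤ κ / 6 * ν ^ 2 + ε₀ / κ * (c / 2) * s ^ 2 := by
    have k1 : ε₀ * (3 * (C + B + 1) ^ 2) ≤ c := by
      rwa [le_div_iff₀ (by positivity)] at hεr
    have k2 : ε₀ * (3 / 2 * (C + B + 1) ^ 2) * (ε₀ / κ * s ^ 2) ≤ c / 2 * (ε₀ / κ * s ^ 2) :=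
      mul_le_mul_of_nonneg_right (by linarith) (by positivity)
    have k3 : κ / 6 * ν ^ 2 + ε₀ * (3 / 2 * (C + B + 1) ^ 2) * (ε₀ / κ * s ^ 2)
        - ε₀ * ((C + B + 1) * (ν * s)) = (κ * ν - 3 * ε₀ * (C + B + 1) * s) ^ 2 / (6 * κ) := by
      field_simp
      ring
    have k4 : 0 ≤ (κ * ν - 3 * ε₀ * (C + B + 1) * s) ^ 2 / (6 * κ) := by positivity
    linarith
  have e4 : 0 ≤ ε₀ * (ν * s) := by positivity
  have e5 := mul_le_mul_of_nonneg_left e1 hε.le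
  have e6 := mul_le_mul_of_nonneg_left h3 hκ0.le
  push_cast at e6
  linarith

theorem Params.Physical.exists_lyapMat_posDef (hp : p.Physical) (Y : Matrix (XIdx n) (XIdx n) ℝ) :
    ∃ r > 0, ∀ ε, 0 ≤ ε → ε ≤ r → (lyapMat p Y ε).PosDef := by
  obtain ⟨c₁, hc₁, h₁⟩ := hp.exists_linM_bound
  obtain ⟨c₂, hc₂, h₂⟩ := hp.exists_stiff_bound
  set B := absSumMat (Y * linM p) with hB
  have hB0 : 0 ≤ B := absSumMat_nonneg _
  have hc : 0 < min c₁ c₂ := lt_min hc₁ hc₂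
  refine ⟨min c₁ c₂ / (2 * (B + 1)), by positivity, fun ε hε hεr ↦ ?_⟩
  refine posDef_of_forall_pos ?_ fun z hz ↦ ?_
  · rw [lyapMat, fromBlocks_transpose, transpose_transpose, linM_transpose, stiff_transpose]
  · obtain ⟨pos, vel, rfl⟩ : ∃ pos vel : XIdx n → ℝ, z = Sum.elim pos vel :=
      ⟨z ∘ Sum.inl, z ∘ Sum.inr, (Sum.elim_comp_inl_inr z).symm⟩
    rw [dotProduct_lyapMat_mulVec, mulVec_mulVec]
    have h3 := h₁ vel
    have h4 := h₂ pos
    have h5 := abs_dotProduct_mulVec_le (Y * linM p) pos vel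
    have h6 : 0 < absSum pos + absSum vel := by
      have := absSum_pos hz
      simpa [absSum] using this
    have hpos := absSum_nonneg pos
    have hvel := absSum_nonneg vel
    rw [le_div_iff₀ (by positivity)] at hεr
    have h7 := min_le_left c₁ c₂
    have h8 := min_le_right c₁ c₂
    have h9 := (abs_le.1 h5).1
    generalize absSum pos = a at *
    generalize absSum vel = b at *
    generalize min c₁ c₂ = c at *
    have k1 := mul_le_mul_of_nonneg_left h9 hε
    have k2 : ε * (2 * (B + 1)) * (a * b) ≤ c * (a * b) :=
      mul_le_mul_of_nonneg_right hεr (by positivity)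
    have k3 := mul_le_mul_of_nonneg_right h7 (sq_nonneg b)
    have k4 := mul_le_mul_of_nonneg_right h8 (sq_nonneg a)
    have k5 : 0 < c * (a + b) ^ 2 := by positivity
    have k6 : 0 ≤ ε * (a * b) := by positivity
    have k7 : 0 ≤ c * (a - b) ^ 2 := by positivity
    nlinarith

/-- The gains of the design are admissible. -/
theorem Params.Physical.exists_admissible (hp : p.Physical) :
    ∃ Y : ℕ → ℕ → ℝ, 0 < Y 0 0 ∧ ∃ r > 0, ∃ c > 0, ∀ ε₀, 0 < ε₀ → ε₀ ≤ r → ∀ κ, 1 ≤ κ →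
      (∀ pos vel : XIdx n → ℝ,
      κ / 6 * absSum (vel ∘ Sum.inl) ^ 2 + ε₀ / κ * c * (absSum pos + absSum vel) ^ 2
        ≤ dissRate p (crossMat n Y) ε₀ κ pos vel) ∧
      ∀ kz kI c2 δ, 0 < kz → 0 < kI → 0 < c2 → 0 < δ →
        (design p (crossMat n Y) ε₀ κ kz kI c2 δ).Admissible p δ := by
  obtain ⟨Y, hY, r₁, hr₁, c, hc, h₁⟩ := hp.exists_dissRate_bound
  obtain ⟨r₂, hr₂, h₂⟩ := hp.exists_lyapMat_posDef (crossMat n Y)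
  refine ⟨Y, hY, min r₁ r₂, lt_min hr₁ hr₂, c, hc, fun ε₀ hε hεr κ hκ ↦ ?_⟩
  have hd := h₁ ε₀ κ hε (hεr.trans (min_le_left _ _)) hκ
  refine ⟨hd, fun kz kI c2 δ hkz hkI hc2 hδ ↦ ?_⟩
  have hκ0 : 0 < κ := by linarith
  have hP : (lyapMat p (crossMat n Y) (ε₀ / κ)).PosDef :=
    h₂ _ (by positivity) ((div_le_self hε.le hκ).trans (hεr.trans (min_le_right _ _)))
  have hPt : (lyapMat p (crossMat n Y) (ε₀ / κ))ᵀ = lyapMat p (crossMat n Y) (ε₀ / κ) := by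
    simpa [Matrix.IsHermitian, conjTranspose_eq_transpose_of_trivial] using hP.isHermitian
  refine ⟨one_pos, one_pos, hkI, hc2, ?_, hkz, ?_, ?_, hP, ?_⟩
  · change 0 < 4 * δ / kz
    positivity
  · change δ < kz * (4 * δ / kz)
    rw [mul_div_cancel₀ _ hkz.ne']
    linarith
  · change (-((closedLoop p κ)ᵀ * lyapMat p (crossMat n Y) (ε₀ / κ)
      + lyapMat p (crossMat n Y) (ε₀ / κ) * closedLoop p κ)).PosDef
    refine posDef_of_forall_pos ?_ fun z hz ↦ ?_
    · simp only [transpose_neg, transpose_add, transpose_mul, transpose_transpose, hPt, add_comm]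
    · obtain ⟨pos, vel, rfl⟩ : ∃ pos vel : XIdx n → ℝ, z = Sum.elim pos vel :=
        ⟨z ∘ Sum.inl, z ∘ Sum.inr, (Sum.elim_comp_inl_inr z).symm⟩
      have h5 := hp.lyapMat_closedLoop (crossMat n Y) ε₀ hκ0.ne' pos vel
      have h6 : Sum.elim pos vel ⬝ᵥ (((closedLoop p κ)ᵀ * lyapMat p (crossMat n Y) (ε₀ / κ)) *ᵥ
          Sum.elim pos vel) = Sum.elim pos vel ⬝ᵥ (lyapMat p (crossMat n Y) (ε₀ / κ) *ᵥ
            (closedLoop p κ *ᵥ Sum.elim pos vel)) := by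
        rw [← mulVec_mulVec, mulVec_transpose, dotProduct_comm, ← dotProduct_mulVec,
          dotProduct_comm, dotProduct_mulVec_comm hPt, dotProduct_comm]
      rw [neg_mulVec, dotProduct_neg, add_mulVec, dotProduct_add, h6, ← mulVec_mulVec, h5]
      have h7 := hd pos vel
      have h8 : 0 < absSum pos + absSum vel := by
        have := absSum_pos hz
        simpa [absSum] using this
      have h9 : 0 < ε₀ / κ * c * (absSum pos + absSum vel) ^ 2 := by positivity
      have h10 : 0 ≤ κ / 6 * absSum (vel ∘ Sum.inl : V3) ^ 2 := by positivity
      have h7' : κ / 6 * absSum (vel ∘ Sum.inl : V3) ^ 2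
        + ε₀ / κ * c * (absSum pos + absSum vel) ^ 2
        ≤ dissRate p (crossMat n Y) ε₀ κ pos vel := h7
      linarith
  · exact (neg_neg _).symm

/-- The integral action of the design. -/
theorem Params.Physical.integral_action (hp : p.Physical) (Y : Matrix (XIdx n) (XIdx n) ℝ)
    (ε : ℝ) (pos vel : XIdx n → ℝ) :
    (lyapMat p Y ε * clB p)ᵀ *ᵥ Sum.elim pos vel = vel + ε • (Yᵀ *ᵥ pos) := by
  -- The mass matrix in `P` cancels its inverse in `𝔹`. The integrated quantity is thus the factor
  -- of a force in the rate of the Lyapunov function, so the integral energy can cancel the constant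
  -- disturbance.
  have h : lyapMat p Y ε * clB p = Matrix.fromRows (ε • Y) 1 := by
    rw [lyapMat, clB, Matrix.fromBlocks_mul_fromRows]
    simp [Matrix.mul_assoc, hp.linM_mul_inv]
  rw [h, Matrix.transpose_fromRows, Matrix.fromCols_mulVec]
  simp [smul_mulVec, add_comm]

end Design

end QuadCable

namespace QuadCable

/-! ### Vectors of ℝ³ in the maximum norm and the Euclidean product -/

section Vectors

theorem dot_self_nonneg (v : V3) : 0 ≤ v ⬝ᵥ v := by
  rw [dotProduct, Fin.sum_univ_three]
  nlinarith [mul_self_nonneg (v 0), mul_self_nonneg (v 1), mul_self_nonneg (v 2)]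

theorem abs_apply_le_norm (v : V3) (i : Fin 3) : |v i| ≤ ‖v‖ := norm_le_pi_norm v i

theorem norm_sq_le_dot_self (v : V3) : ‖v‖ ^ 2 ≤ v ⬝ᵥ v := by
  obtain ⟨i, -, hi⟩ := Finset.exists_mem_eq_sup' (s := Finset.univ) Finset.univ_nonempty
    (fun i : Fin 3 ↦ ‖v i‖)
  have h1 : ‖v‖ ≤ |v i| := by
    refine (pi_norm_le_iff_of_nonneg (abs_nonneg _)).2 fun j ↦ ?_
    rw [← Real.norm_eq_abs, ← hi]
    exact Finset.le_sup' (fun i : Fin 3 ↦ ‖v i‖) (Finset.mem_univ j)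
  have h2 : v i * v i ≤ v ⬝ᵥ v :=
    Finset.single_le_sum (f := fun i ↦ v i * v i) (fun j _ ↦ mul_self_nonneg _) (Finset.mem_univ i)
  have h3 : ‖v‖ ^ 2 ≤ |v i| ^ 2 := pow_le_pow_left₀ (norm_nonneg _) h1 2
  rw [sq_abs] at h3
  nlinarith

theorem abs_dot_le (a b : V3) : |a ⬝ᵥ b| ≤ 3 * (‖a‖ * ‖b‖) := by
  have h : ∀ i, |a i * b i| ≤ ‖a‖ * ‖b‖ := fun i ↦ by
    rw [abs_mul]
    exact mul_le_mul (abs_apply_le_norm a i) (abs_apply_le_norm b i) (abs_nonneg _) (norm_nonneg _)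
  rw [dotProduct, Fin.sum_univ_three]
  have h1 := abs_add_three (a 0 * b 0) (a 1 * b 1) (a 2 * b 2)
  linarith [h 0, h 1, h 2]

theorem dot_self_le (v : V3) : v ⬝ᵥ v ≤ 3 * ‖v‖ ^ 2 := by
  rw [sq]
  exact (le_abs_self _).trans (abs_dot_le v v)

theorem norm_cross_le (a b : V3) : ‖crossProduct a b‖ ≤ 2 * (‖a‖ * ‖b‖) := by
  have h : ∀ i j, |a i * b j| ≤ ‖a‖ * ‖b‖ := fun i j ↦ by
    rw [abs_mul]
    exact mul_le_mul (abs_apply_le_norm a i) (abs_apply_le_norm b j) (abs_nonneg _) (norm_nonneg _)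
  refine (pi_norm_le_iff_of_nonneg (by positivity)).2 fun i ↦ ?_
  rw [Real.norm_eq_abs, cross_apply]
  fin_cases i
  · exact (abs_sub _ _).trans (by linarith [h 1 2, h 2 1])
  · exact (abs_sub _ _).trans (by linarith [h 2 0, h 0 2])
  · exact (abs_sub _ _).trans (by linarith [h 0 1, h 1 0])

theorem cross_cross_dot (a b c : V3) :
    crossProduct a (crossProduct b c) = (a ⬝ᵥ c) • b - (a ⬝ᵥ b) • c := by
  ext i
  fin_cases i <;> simp [cross_apply, dotProduct, Fin.sum_univ_three] <;> ring

theorem hat_mulVec (v w : V3) : hat v *ᵥ w = crossProduct v w := by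
  ext i
  fin_cases i <;> simp [hat, cross_apply, mulVec, dotProduct, Fin.sum_univ_three] <;> ring

theorem hat_sq_mulVec (q u : V3) :
    (hat q ^ 2) *ᵥ u = crossProduct q (crossProduct q u) := by
  rw [sq, ← mulVec_mulVec, hat_mulVec, hat_mulVec]

theorem hat_vee {S : Mat3} (hS : Sᵀ = -S) : hat (vee S) = S := by
  have h : ∀ i j, S j i = -S i j := fun i j ↦ by
    have := congrFun (congrFun hS i) j
    simpa using this
  ext i j
  fin_cases i <;> fin_cases j <;> simp [hat, vee] <;>
    linarith [h 0 0, h 1 1, h 2 2, h 0 1, h 0 2, h 1 2]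

theorem hat_transpose (v : V3) : (hat v)ᵀ = -hat v := by
  ext i j
  fin_cases i <;> fin_cases j <;> simp [hat]

theorem len_sq (v : V3) : len v ^ 2 = v ⬝ᵥ v := Real.sq_sqrt (dot_self_nonneg v)

theorem len_pos {v : V3} (hv : v ≠ 0) : 0 < len v := by
  refine Real.sqrt_pos.2 ((norm_sq_le_dot_self v).trans_lt' ?_)
  have := norm_pos_iff.2 hv
  positivity

theorem exists_lower_bound_of_posDef {A : Mat3} (hA : A.PosDef) :
    ∃ c > 0, ∀ x : V3, c * (x ⬝ᵥ x) ≤ x ⬝ᵥ (A *ᵥ x) := by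
  have hcont : Continuous fun x : V3 ↦ x ⬝ᵥ (A *ᵥ x) := by
    simp only [dotProduct, mulVec]
    fun_prop
  obtain ⟨u, hu, hmin⟩ := (isCompact_sphere (0 : V3) 1).exists_isMinOn
    (NormedSpace.sphere_nonempty.2 zero_le_one) hcont.continuousOn
  have hu0 : u ≠ 0 := by
    rintro rfl
    simp at hu
  have hm : 0 < u ⬝ᵥ (A *ᵥ u) := by simpa using hA.dotProduct_mulVec_pos hu0
  refine ⟨u ⬝ᵥ (A *ᵥ u) / 3, by positivity, fun x ↦ ?_⟩
  rcases eq_or_ne x 0 with rfl | hx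
  · simp
  have hx0 := norm_pos_iff.2 hx
  have h1 : u ⬝ᵥ (A *ᵥ u) ≤ (‖x‖⁻¹ • x) ⬝ᵥ (A *ᵥ (‖x‖⁻¹ • x)) :=
    hmin (by simp [norm_smul, hx0.ne'])
  rw [mulVec_smul, smul_dotProduct, dotProduct_smul, smul_eq_mul, smul_eq_mul, ← mul_assoc,
    ← mul_inv, ← div_eq_inv_mul, le_div_iff₀ (by positivity)] at h1
  have h2 := dot_self_le x
  nlinarith

end Vectors

/-! ### Rotations, attitude errors and command frames -/

section Rotations

theorem mem_SO3_iff {R : Mat3} :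
    R ∈ Matrix.specialOrthogonalGroup (Fin 3) ℝ ↔ Rᵀ * R = 1 ∧ R.det = 1 := by
  rw [Matrix.mem_specialOrthogonalGroup_iff, Matrix.mem_orthogonalGroup_iff']

theorem SO3_mul_transpose {R : Mat3} (h : R ∈ Matrix.specialOrthogonalGroup (Fin 3) ℝ) :
    R * Rᵀ = 1 := mul_eq_one_comm.1 (mem_SO3_iff.1 h).1

theorem SO3_transpose_mul {R : Mat3} (h : R ∈ Matrix.specialOrthogonalGroup (Fin 3) ℝ) :
    Rᵀ * R = 1 := (mem_SO3_iff.1 h).1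

theorem SO3_mul {R S : Mat3} (h : R ∈ Matrix.specialOrthogonalGroup (Fin 3) ℝ)
    (h' : S ∈ Matrix.specialOrthogonalGroup (Fin 3) ℝ) :
    R * S ∈ Matrix.specialOrthogonalGroup (Fin 3) ℝ := mul_mem h h'

theorem SO3_transpose {R : Mat3} (h : R ∈ Matrix.specialOrthogonalGroup (Fin 3) ℝ) :
    Rᵀ ∈ Matrix.specialOrthogonalGroup (Fin 3) ℝ := by
  rw [mem_SO3_iff, transpose_transpose, det_transpose]
  exact ⟨SO3_mul_transpose h, (mem_SO3_iff.1 h).2⟩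

theorem SO3_adjugate {R : Mat3} (h : R ∈ Matrix.specialOrthogonalGroup (Fin 3) ℝ) :
    R.adjugate = Rᵀ := by
  have h1 : R * R.adjugate = 1 := by rw [mul_adjugate, (mem_SO3_iff.1 h).2, one_smul]
  calc R.adjugate = Rᵀ * R * R.adjugate := by rw [SO3_transpose_mul h, one_mul]
    _ = Rᵀ := by rw [Matrix.mul_assoc, h1, mul_one]

theorem SO3_abs_apply_le {R : Mat3} (h : R ∈ Matrix.specialOrthogonalGroup (Fin 3) ℝ)
    (i j : Fin 3) : |R i j| ≤ 1 := by
  have h1 := congrFun (congrFun (SO3_transpose_mul h) j) j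
  simp only [mul_apply, transpose_apply, one_apply_eq, Fin.sum_univ_three] at h1
  rw [← sq_le_one_iff_abs_le_one]
  revert i
  rw [Fin.forall_fin_succ, Fin.forall_fin_two]
  change R 0 j ^ 2 ≤ 1 ∧ R 1 j ^ 2 ≤ 1 ∧ R 2 j ^ 2 ≤ 1
  refine ⟨?_, ?_, ?_⟩ <;> nlinarith [sq_nonneg (R 0 j), sq_nonneg (R 1 j), sq_nonneg (R 2 j)]

/-- The cofactor identities of a rotation. -/
theorem SO3_cofactor {R : Mat3} (h : R ∈ Matrix.specialOrthogonalGroup (Fin 3) ℝ) :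
    (R 0 0 = R 1 1 * R 2 2 - R 1 2 * R 2 1 ∧ R 1 1 = R 0 0 * R 2 2 - R 0 2 * R 2 0 ∧
      R 2 2 = R 0 0 * R 1 1 - R 0 1 * R 1 0) ∧
    (R 0 1 = R 1 2 * R 2 0 - R 1 0 * R 2 2 ∧ R 0 2 = R 1 0 * R 2 1 - R 1 1 * R 2 0 ∧
      R 1 0 = R 0 2 * R 2 1 - R 0 1 * R 2 2) ∧
    (R 1 2 = R 0 1 * R 2 0 - R 0 0 * R 2 1 ∧ R 2 0 = R 0 1 * R 1 2 - R 0 2 * R 1 1 ∧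
      R 2 1 = R 0 2 * R 1 0 - R 0 0 * R 1 2) := by
  have h1 := SO3_adjugate h
  rw [Matrix.adjugate_fin_three] at h1
  have h2 : ∀ i j, R i j = Rᵀ j i := fun i j ↦ rfl
  refine ⟨⟨?_, ?_, ?_⟩, ⟨?_, ?_, ?_⟩, ⟨?_, ?_, ?_⟩⟩
  all_goals
    conv_lhs => rw [h2, ← h1]
    simp
    try ring

/-- Rotations respect the cross product. -/
theorem SO3_transpose_hat {R : Mat3} (h : R ∈ Matrix.specialOrthogonalGroup (Fin 3) ℝ) (v : V3) :
    Rᵀ * hat v * R = hat (Rᵀ *ᵥ v) := by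
  obtain ⟨⟨a1, a2, a3⟩, ⟨b1, b2, b3⟩, ⟨c1, c2, c3⟩⟩ := SO3_cofactor h
  ext i j
  fin_cases i <;> fin_cases j <;>
    simp [hat, Matrix.mul_apply, mulVec, dotProduct, Fin.sum_univ_three]
  · ring
  · linear_combination v 0 * b2 + v 1 * c1 + v 2 * a3
  · linear_combination -v 0 * b1 - v 1 * a2 - v 2 * c3
  · linear_combination -v 0 * b2 - v 1 * c1 - v 2 * a3
  · ring
  · linear_combination v 0 * a1 + v 1 * b3 + v 2 * c2
  · linear_combination v 0 * b1 + v 1 * a2 + v 2 * c3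
  · linear_combination -v 0 * a1 - v 1 * b3 - v 2 * c2
  · ring

/-- The attitude error function of a rotation. -/
noncomputable def attErr (S : Mat3) : ℝ := (1 / 2) * (1 - S).trace

/-- The attitude error vector of a rotation. -/
noncomputable def attVec (S : Mat3) : V3 := (1 / 2 : ℝ) • vee (S - Sᵀ)

theorem attErr_eq (S : Mat3) : attErr S = (1 / 2) * (3 - S 0 0 - S 1 1 - S 2 2) := by
  rw [attErr, trace, Fin.sum_univ_three]
  simp
  ring

/-- For a rotation by the angle `θ`, `attErr` is `1 - cos θ` and `attVec` has the length `|sin θ|`.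
Algebraically, unit columns and the cofactor identities of the diagonal entries suffice. -/
theorem attVec_dot_self {S : Mat3} (h : S ∈ Matrix.specialOrthogonalGroup (Fin 3) ℝ) :
    attVec S ⬝ᵥ attVec S = attErr S * (2 - attErr S) := by
  obtain ⟨⟨a1, a2, a3⟩, -, -⟩ := SO3_cofactor h
  have h0 := congrFun (congrFun (SO3_transpose_mul h) 0) 0
  have h1 := congrFun (congrFun (SO3_transpose_mul h) 1) 1
  have h2 := congrFun (congrFun (SO3_transpose_mul h) 2) 2
  simp only [mul_apply, transpose_apply, one_apply_eq, Fin.sum_univ_three] at h0 h1 h2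
  rw [attErr_eq]
  simp [attVec, vee, dotProduct, Fin.sum_univ_three]
  linear_combination (1 / 4) * h0 + (1 / 4) * h1 + (1 / 4) * h2 - (1 / 2) * a1 - (1 / 2) * a2
    - (1 / 2) * a3

theorem attErr_nonneg {S : Mat3} (h : S ∈ Matrix.specialOrthogonalGroup (Fin 3) ℝ) :
    0 ≤ attErr S := by
  rw [attErr_eq]
  linarith [le_of_abs_le (SO3_abs_apply_le h 0 0), le_of_abs_le (SO3_abs_apply_le h 1 1),
    le_of_abs_le (SO3_abs_apply_le h 2 2)]

theorem attVec_dot_self_le {S : Mat3} (h : S ∈ Matrix.specialOrthogonalGroup (Fin 3) ℝ) :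
    attVec S ⬝ᵥ attVec S ≤ 2 * attErr S := by
  rw [attVec_dot_self h]
  nlinarith [attErr_nonneg h]

theorem attErr_le_attVec_dot_self {S : Mat3} (h : S ∈ Matrix.specialOrthogonalGroup (Fin 3) ℝ)
    (h1 : attErr S ≤ 1) : attErr S ≤ attVec S ⬝ᵥ attVec S := by
  rw [attVec_dot_self h]
  nlinarith [attErr_nonneg h]

/-- The entry `S 2 2` is the cosine between the actual and the desired thrust axis; this is how the
attitude error bounds the error of the thrust. -/
theorem one_sub_le_attErr {S : Mat3} (h : S ∈ Matrix.specialOrthogonalGroup (Fin 3) ℝ) :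
    1 - S 2 2 ≤ 2 * attErr S := by
  rw [attErr_eq]
  linarith [le_of_abs_le (SO3_abs_apply_le h 0 0), le_of_abs_le (SO3_abs_apply_le h 1 1)]

/-- The matrix `½ (tr(S) I - Sᵀ)`, which maps the angular velocity error to `ė_R`. -/
noncomputable def attJac (S : Mat3) : Mat3 := (1 / 2 : ℝ) • (S.trace • 1 - Sᵀ)

theorem attErr_deriv (S : Mat3) (w : V3) : -(1 / 2) * (S * hat w).trace = attVec S ⬝ᵥ w := by
  simp [trace, attVec, vee, dotProduct, hat, Matrix.mul_apply, Fin.sum_univ_three]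
  ring

theorem attVec_deriv (S : Mat3) (w : V3) :
    (1 / 2 : ℝ) • vee (S * hat w - (S * hat w)ᵀ) = attJac S *ᵥ w := by
  ext i
  fin_cases i <;>
    simp [attJac, trace, vee, hat, Matrix.mul_apply, mulVec, dotProduct, Fin.sum_univ_three,
      Matrix.one_apply] <;> ring

theorem absSum_attJac_le {S : Mat3} (h : S ∈ Matrix.specialOrthogonalGroup (Fin 3) ℝ) (w : V3) :
    absSum (attJac S *ᵥ w) ≤ 6 * absSum w := by
  have hS := SO3_abs_apply_le h
  have hE : ∀ i j, |attJac S i j| ≤ 2 := by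
    intro i j
    have h1 : attJac S i j = 1 / 2 * ((S 0 0 + S 1 1 + S 2 2) * (1 : Mat3) i j - S j i) := by
      simp [attJac, trace, Fin.sum_univ_three]
    have h2 : |(S 0 0 + S 1 1 + S 2 2) * (1 : Mat3) i j| ≤ 3 := by
      rw [abs_mul]
      have h3 : |(1 : Mat3) i j| ≤ 1 := by
        rw [Matrix.one_apply]
        split_ifs <;> simp
      have h4 : |S 0 0 + S 1 1 + S 2 2| ≤ 3 :=
        (abs_add_three _ _ _).trans (by linarith [hS 0 0, hS 1 1, hS 2 2])
      nlinarith [abs_nonneg ((1 : Mat3) i j), abs_nonneg (S 0 0 + S 1 1 + S 2 2)]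
    rw [h1, abs_mul]
    have h5 := abs_sub ((S 0 0 + S 1 1 + S 2 2) * (1 : Mat3) i j) (S j i)
    rw [abs_of_pos (by norm_num : (0 : ℝ) < 1 / 2)]
    linarith [hS j i]
  have h1 : ∀ i, |(attJac S *ᵥ w) i| ≤ 2 * absSum w := by
    intro i
    rw [mulVec, dotProduct, absSum, Finset.mul_sum]
    refine (Finset.abs_sum_le_sum_abs _ _).trans (Finset.sum_le_sum fun j _ ↦ ?_)
    rw [abs_mul]
    exact mul_le_mul_of_nonneg_right (hE i j) (abs_nonneg _)
  calc absSum (attJac S *ᵥ w) ≤ ∑ _i : Fin 3, 2 * absSum w := Finset.sum_le_sum fun i _ ↦ h1 i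
    _ = 6 * absSum w := by
      simp
      ring

theorem frame_apply (b b1 : V3) (i j : Fin 3) :
    frame b b1 i j = (![-((len (crossProduct b (crossProduct b b1)))⁻¹ •
        crossProduct b (crossProduct b b1)),
      (len (crossProduct b b1))⁻¹ • crossProduct b b1, b] : Fin 3 → V3) j i := rfl

/-- For a unit vector `b` and `c = b × b1`, which is perpendicular to it, `b × c` is as long as `c`.
So both normalizations divide by the same length, and `-(b × c)`, `c`, `b` is a right-handed
orthogonal triple. -/
theorem frame_mem {b b1 : V3} (hb : b ⬝ᵥ b = 1) (hbb : crossProduct b b1 ≠ 0) :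
    frame b b1 ∈ Matrix.specialOrthogonalGroup (Fin 3) ℝ := by
  set c := crossProduct b b1 with hc
  have hL := len_pos hbb
  have hLs := len_sq c
  have hbc : b ⬝ᵥ c = 0 := dot_self_cross b b1
  have hcb : c ⬝ᵥ b = 0 := by rw [dotProduct_comm, hbc]
  have hd : crossProduct b c ⬝ᵥ crossProduct b c = c ⬝ᵥ c := by
    rw [cross_dot_cross, hb, hbc, hcb]
    ring
  have hlen : len (crossProduct b c) = len c := by rw [len, len, hd]
  have hbd : b ⬝ᵥ crossProduct b c = 0 := dot_self_cross b c
  have hdb : crossProduct b c ⬝ᵥ b = 0 := by rw [dotProduct_comm, hbd]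
  have hcd : c ⬝ᵥ crossProduct b c = 0 := dot_cross_self b c
  have hdc : crossProduct b c ⬝ᵥ c = 0 := by rw [dotProduct_comm, hcd]
  have hone : (len c)⁻¹ * ((len c)⁻¹ * (c ⬝ᵥ c)) = 1 := by
    rw [← hLs]
    field_simp
  have hF : frame b b1 = (Matrix.of ![-((len c)⁻¹ • crossProduct b c), (len c)⁻¹ • c, b])ᵀ := by
    rw [frame, ← hc, hlen]
  rw [mem_SO3_iff, hF]
  constructor
  · ext i j
    rw [transpose_transpose, mul_apply]
    change (![-((len c)⁻¹ • crossProduct b c), (len c)⁻¹ • c, b] : Fin 3 → V3) i ⬝ᵥ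
      (![-((len c)⁻¹ • crossProduct b c), (len c)⁻¹ • c, b] : Fin 3 → V3) j = _
    fin_cases i <;> fin_cases j <;>
      simp [hb, hbc, hcb, hd, hbd, hdb, hcd, hdc, hone]
  · rw [det_transpose]
    change Matrix.det ![-((len c)⁻¹ • crossProduct b c), (len c)⁻¹ • c, b] = 1
    rw [← triple_product_eq_det]
    have h1 : crossProduct ((len c)⁻¹ • c) b = -((len c)⁻¹ • crossProduct b c) := by
      rw [LinearMap.map_smul, LinearMap.smul_apply, ← cross_anticomm b c, smul_neg]
    rw [h1, neg_dotProduct_neg, smul_dotProduct, dotProduct_smul, hd]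
    exact hone

/-- The columns of a frame have at most unit length, also where it is not well defined. -/
theorem frame_col_le {b b1 : V3} (hb : b ⬝ᵥ b ≤ 1) (j : Fin 3) :
    (frame b b1)ᵀ j ⬝ᵥ (frame b b1)ᵀ j ≤ 1 := by
  have key : ∀ u : V3, ((len u)⁻¹ • u) ⬝ᵥ ((len u)⁻¹ • u) ≤ 1 := by
    intro u
    rw [smul_dotProduct, dotProduct_smul, smul_eq_mul, smul_eq_mul, ← len_sq]
    rcases eq_or_ne (len u) 0 with h | h
    · simp [h]
    · apply le_of_eq
      field_simp
  rw [frame, transpose_transpose]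
  fin_cases j
  · change (-((len (crossProduct b (crossProduct b b1)))⁻¹ • crossProduct b (crossProduct b b1))) ⬝ᵥ
      (-((len (crossProduct b (crossProduct b b1)))⁻¹ • crossProduct b (crossProduct b b1))) ≤ 1
    rw [neg_dotProduct_neg]
    exact key _
  · exact key _
  · exact hb

/-- This gives the sign of `attFun` also where the command degenerates: there columns of the frame
may vanish, since the inverse of a zero length is zero. -/
theorem trace_transpose_mul_le {A R : Mat3} (hA : ∀ j, Aᵀ j ⬝ᵥ Aᵀ j ≤ 1)
    (h : R ∈ Matrix.specialOrthogonalGroup (Fin 3) ℝ) : (Aᵀ * R).trace ≤ 3 := by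
  have hR : ∀ j, Rᵀ j ⬝ᵥ Rᵀ j = 1 := by
    intro j
    have h1 := congrFun (congrFun (SO3_transpose_mul h) j) j
    rwa [mul_apply, one_apply_eq] at h1
  have h1 : (Aᵀ * R).trace = ∑ j, Aᵀ j ⬝ᵥ Rᵀ j := rfl
  have h2 : ∀ j, Aᵀ j ⬝ᵥ Rᵀ j ≤ 1 := by
    intro j
    have h3 := dot_self_nonneg (Aᵀ j - Rᵀ j)
    rw [sub_dotProduct, dotProduct_sub, dotProduct_sub, dotProduct_comm (Rᵀ j) (Aᵀ j)] at h3
    linarith [hA j, hR j]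
  rw [h1, Fin.sum_univ_three]
  linarith [h2 0, h2 1, h2 2]

end Rotations

/-! ### Lyapunov function of the attitude error -/

section Attitude

/-- Lyapunov function of the attitude dynamics. -/
noncomputable def attLyap (J : Mat3) (c2 kI : ℝ) (ΔR : V3) (S : Mat3) (w eI : V3) : ℝ :=
  1 / 2 * (w ⬝ᵥ (J *ᵥ w)) + attErr S + c2 * (attVec S ⬝ᵥ (J *ᵥ w))
    + kI / 2 * ((eI - kI⁻¹ • ΔR) ⬝ᵥ (eI - kI⁻¹ • ΔR))

/-- Rate of change of `attLyap` along the attitude dynamics. -/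
noncomputable def attRate (J : Mat3) (c2 : ℝ) (S : Mat3) (w : V3) : ℝ :=
  -(w ⬝ᵥ w) - c2 * (attVec S ⬝ᵥ attVec S) - c2 * (attVec S ⬝ᵥ w)
    + c2 * ((attJac S *ᵥ w) ⬝ᵥ (J *ᵥ w))

theorem hasDerivWithinAt_dot {ι : Type} [Fintype ι] {f g : ℝ → ι → ℝ} {f' g' : ι → ℝ} {s : Set ℝ}
    {t : ℝ} (hf : HasDerivWithinAt f f' s t) (hg : HasDerivWithinAt g g' s t) :
    HasDerivWithinAt (fun τ ↦ f τ ⬝ᵥ g τ) (f' ⬝ᵥ g t + f t ⬝ᵥ g') s t := by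
  rw [hasDerivWithinAt_pi] at hf hg
  have h := HasDerivWithinAt.fun_sum (u := Finset.univ) fun i _ ↦ (hf i).mul (hg i)
  refine h.congr_deriv ?_
  simp only [dotProduct, ← Finset.sum_add_distrib]

theorem hasDerivWithinAt_mulVec {ι κ : Type} [Fintype ι] [Fintype κ] (A : Matrix κ ι ℝ)
    {f : ℝ → ι → ℝ} {f' : ι → ℝ} {s : Set ℝ} {t : ℝ} (hf : HasDerivWithinAt f f' s t) :
    HasDerivWithinAt (fun τ ↦ A *ᵥ f τ) (A *ᵥ f') s t := by
  rw [hasDerivWithinAt_pi] at hf ⊢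
  intro i
  exact HasDerivWithinAt.fun_sum (u := Finset.univ) fun j _ ↦ (hf j).const_mul (A i j)

theorem hasDerivWithinAt_cross {f g : ℝ → V3} {f' g' : V3} {s : Set ℝ} {t : ℝ}
    (hf : HasDerivWithinAt f f' s t) (hg : HasDerivWithinAt g g' s t) :
    HasDerivWithinAt (fun τ ↦ crossProduct (f τ) (g τ))
      (crossProduct f' (g t) + crossProduct (f t) g') s t := by
  rw [hasDerivWithinAt_pi] at hf hg ⊢
  intro i
  fin_cases i
  all_goals simp only [cross_apply]
  · refine (((hf 1).mul (hg 2)).sub ((hf 2).mul (hg 1))).congr_deriv ?_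
    simp
    ring
  · refine (((hf 2).mul (hg 0)).sub ((hf 0).mul (hg 2))).congr_deriv ?_
    simp
    ring
  · refine (((hf 0).mul (hg 1)).sub ((hf 1).mul (hg 0))).congr_deriv ?_
    simp
    ring

theorem hasDerivWithinAt_attErr {S : ℝ → Mat3} {w : V3} {s : Set ℝ} {t : ℝ}
    (hS : ∀ a b, HasDerivWithinAt (fun τ ↦ S τ a b) ((S t * hat w) a b) s t) :
    HasDerivWithinAt (fun τ ↦ attErr (S τ)) (attVec (S t) ⬝ᵥ w) s t := by
  simp only [attErr_eq, ← attErr_deriv]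
  refine (((((hasDerivWithinAt_const t s (3 : ℝ)).sub (hS 0 0)).sub (hS 1 1)).sub (hS 2 2)).const_mul
    (1 / 2 : ℝ)).congr_deriv ?_
  rw [trace, Fin.sum_univ_three]
  simp only [diag_apply]
  ring

theorem hasDerivWithinAt_attVec {S : ℝ → Mat3} {w : V3} {s : Set ℝ} {t : ℝ}
    (hS : ∀ a b, HasDerivWithinAt (fun τ ↦ S τ a b) ((S t * hat w) a b) s t) :
    HasDerivWithinAt (fun τ ↦ attVec (S τ)) (attJac (S t) *ᵥ w) s t := by
  rw [← attVec_deriv, hasDerivWithinAt_pi]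
  intro i
  have h := fun a b ↦ ((hS a b).sub (hS b a)).const_mul (1 / 2 : ℝ)
  fin_cases i
  · exact h 2 1
  · exact h 0 2
  · exact h 1 0

/-- The deviation `z` of the integral term enters the power of the moment as `-kI * (z ⬝ᵥ (w + c2 •
attVec))`. Since `w + c2 • attVec` is the rate of `eI`, the integral energy cancels it. -/
theorem hasDerivWithinAt_attLyap {J : Mat3} (hJ : Jᵀ = J) {c2 kI : ℝ} (hkI : kI ≠ 0) {ΔR : V3}
    {S : ℝ → Mat3} {w eI : ℝ → V3} {w' : V3} {s : Set ℝ} {t : ℝ}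
    (hS : ∀ a b, HasDerivWithinAt (fun τ ↦ S τ a b) ((S t * hat (w t)) a b) s t)
    (hw : HasDerivWithinAt w w' s t)
    (hJw : J *ᵥ w' = -attVec (S t) - w t - kI • eI t + ΔR)
    (he : HasDerivWithinAt eI (w t + c2 • attVec (S t)) s t) :
    HasDerivWithinAt (fun τ ↦ attLyap J c2 kI ΔR (S τ) (w τ) (eI τ))
      (attRate J c2 (S t) (w t)) s t := by
  have h1 := (hasDerivWithinAt_dot hw (hasDerivWithinAt_mulVec J hw)).const_mul (1 / 2 : ℝ)
  have h2 := hasDerivWithinAt_attErr hS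
  have h3 := (hasDerivWithinAt_dot (hasDerivWithinAt_attVec hS)
    (hasDerivWithinAt_mulVec J hw)).const_mul c2
  have h4 := (hasDerivWithinAt_dot (he.sub_const (kI⁻¹ • ΔR))
    (he.sub_const (kI⁻¹ • ΔR))).const_mul (kI / 2)
  refine (((h1.add h2).add h3).add h4).congr_deriv ?_
  have h5 : J *ᵥ w' = -attVec (S t) - w t - kI • (eI t - kI⁻¹ • ΔR) := by
    rw [hJw, smul_sub, smul_inv_smul₀ hkI]
    abel
  rw [attRate, dotProduct_mulVec_comm hJ w' (w t), h5]
  generalize eI t - kI⁻¹ • ΔR = z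
  simp only [dotProduct_sub, dotProduct_neg, add_dotProduct, dotProduct_add, smul_dotProduct,
    dotProduct_smul, smul_eq_mul, dotProduct_comm z (w t), dotProduct_comm z (attVec (S t)),
    dotProduct_comm (attVec (S t)) (w t)]
  ring

/-- The attitude Lyapunov function is positive definite and dissipates. -/
theorem exists_attLyap_bounds {J : Mat3} (hJ : J.PosDef) :
    ∃ c2 > 0, ∃ a > 0, ∃ b > 0, ∀ S ∈ Matrix.specialOrthogonalGroup (Fin 3) ℝ, ∀ w : V3,
      attRate J c2 S w ≤ -(1 / 2) * (w ⬝ᵥ w) - c2 / 2 * (attVec S ⬝ᵥ attVec S) ∧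
      ∀ kI ΔR eI,
        a * (w ⬝ᵥ w) + 1 / 2 * attErr S + kI / 2 * ((eI - kI⁻¹ • ΔR) ⬝ᵥ (eI - kI⁻¹ • ΔR))
          ≤ attLyap J c2 kI ΔR S w eI ∧
        attLyap J c2 kI ΔR S w eI
          ≤ b * (w ⬝ᵥ w + attErr S) + kI / 2 * ((eI - kI⁻¹ • ΔR) ⬝ᵥ (eI - kI⁻¹ • ΔR)) := by
  obtain ⟨j, hj, hJj⟩ := exists_lower_bound_of_posDef hJ
  set B := absSumMat J with hB
  have hB0 : 0 ≤ B := absSumMat_nonneg J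
  -- The first bound keeps the terms `c2 * |w| ^ 2` of the rate below half of `|w| ^ 2`; the other
  -- two let the kinetic energy and `attErr` dominate the cross term.
  set c2 := min (1 / (1 + 36 * B)) (min (j / (6 * B + 1)) (1 / (6 * B + 1))) with hc2
  have hc20 : 0 < c2 := by positivity
  have hb1 : c2 * (1 + 36 * B) ≤ 1 := by
    rw [← le_div_iff₀ (by positivity)]
    exact min_le_left _ _
  have hb2 : c2 * (6 * B + 1) ≤ j := by
    rw [← le_div_iff₀ (by positivity)]
    exact (min_le_right _ _).trans (min_le_left _ _)
  have hb3 : c2 * (6 * B + 1) ≤ 1 := by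
    rw [← le_div_iff₀ (by positivity)]
    exact (min_le_right _ _).trans (min_le_right _ _)
  refine ⟨c2, hc20, j / 4, by positivity, 3 * B + 2, by positivity, fun S hS w ↦ ?_⟩
  have hw2 : absSum w ^ 2 ≤ 3 * (w ⬝ᵥ w) := by
    have := absSum_sq_le_card_mul w
    rwa [Fintype.card_fin] at this
  have hv2 : absSum (attVec S) ^ 2 ≤ 3 * (attVec S ⬝ᵥ attVec S) := by
    have := absSum_sq_le_card_mul (attVec S)
    rwa [Fintype.card_fin] at this
  have hw0 := absSum_nonneg w
  have hv0 := absSum_nonneg (attVec S)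
  have hww := dot_self_nonneg w
  have hvv := dot_self_nonneg (attVec S)
  have hΨ := attErr_nonneg hS
  have hvΨ := attVec_dot_self_le hS
  constructor
  · have h1 := abs_dotProduct_mulVec_le J (attJac S *ᵥ w) w
    have h2 := absSum_attJac_le hS w
    have h3 : absSum (attJac S *ᵥ w) * absSum w ≤ 18 * (w ⬝ᵥ w) := by nlinarith
    have h4 : (attJac S *ᵥ w) ⬝ᵥ (J *ᵥ w) ≤ B * (18 * (w ⬝ᵥ w)) :=
      (le_abs_self _).trans (h1.trans (mul_le_mul_of_nonneg_left h3 hB0))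
    have h5 : -(attVec S ⬝ᵥ w) ≤ 1 / 2 * (attVec S ⬝ᵥ attVec S) + 1 / 2 * (w ⬝ᵥ w) := by
      have := dot_self_nonneg (attVec S + w)
      rw [add_dotProduct, dotProduct_add, dotProduct_add, dotProduct_comm w (attVec S)] at this
      linarith
    rw [attRate]
    have h6 := mul_le_mul_of_nonneg_left h4 hc20.le
    have h7 := mul_le_mul_of_nonneg_left h5 hc20.le
    have h8 := mul_le_mul_of_nonneg_right hb1 hww
    linarith
  · intro kI ΔR eI
    have h1 := abs_dotProduct_mulVec_le J (attVec S) w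
    have h2 : absSum (attVec S) * absSum w ≤ 3 / 2 * (attVec S ⬝ᵥ attVec S) + 3 / 2 * (w ⬝ᵥ w) := by
      nlinarith [sq_nonneg (absSum (attVec S) - absSum w)]
    have h3 : |attVec S ⬝ᵥ (J *ᵥ w)| ≤ B * (3 * attErr S + 3 / 2 * (w ⬝ᵥ w)) :=
      h1.trans (mul_le_mul_of_nonneg_left (by linarith) hB0)
    have h4 := abs_le.1 h3
    have h5 := abs_dotProduct_mulVec_le J w w
    have h6 : w ⬝ᵥ (J *ᵥ w) ≤ B * (3 * (w ⬝ᵥ w)) :=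
      (le_abs_self _).trans (h5.trans (mul_le_mul_of_nonneg_left (by nlinarith) hB0))
    have h7 := hJj w
    have k1 := mul_le_mul_of_nonneg_left h4.1 hc20.le
    have k2 := mul_le_mul_of_nonneg_left h4.2 hc20.le
    have k3 := mul_le_mul_of_nonneg_right hb2 hww
    have k4 := mul_le_mul_of_nonneg_right hb3 hΨ
    have k5 := mul_le_mul_of_nonneg_right hb3 hww
    have m1 := mul_nonneg hc20.le hww
    have m2 := mul_nonneg hc20.le hΨ
    have m3 := mul_nonneg hB0 hww
    have m4 := mul_nonneg hB0 hΨ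
    rw [attLyap]
    constructor
    · linarith
    · linarith

end Attitude

end QuadCable

namespace QuadCable

/-! ### Momenta and kinetic energy of quadrotor and links -/

section Mechanics

variable {n : ℕ} (p : Params n)

/-- Total momentum for the velocity `u` of the quadrotor and the velocities `r i` of the link
directions. -/
noncomputable def baseMom (u : V3) (r : Fin n → V3) : V3 := M00 p • u + ∑ i, M0 p i • r i

/-- Momentum conjugate to the direction of link `i`. -/
noncomputable def linkMom (u : V3) (r : Fin n → V3) (i : Fin n) : V3 :=
  M0 p i • u + ∑ j, Mij p i j • r j

/-- Twice the kinetic energy of the translation and of the links. -/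
noncomputable def massForm (u : V3) (r : Fin n → V3) : ℝ :=
  u ⬝ᵥ baseMom p u r + ∑ i, r i ⬝ᵥ linkMom p u r i

theorem baseMom_apply (u : V3) (r : Fin n → V3) (h : Fin 3) :
    baseMom p u r h = momSeq p (extSeq (u h) fun i ↦ r i h) 0 := by
  rw [← sum_massCoeff_mul, sum_range_succ_fin]
  simp [baseMom, massCoeff_zero_zero, massCoeff_zero_succ]

theorem linkMom_apply (u : V3) (r : Fin n → V3) (i : Fin n) (h : Fin 3) :
    linkMom p u r i h = momSeq p (extSeq (u h) fun i ↦ r i h) (i + 1) := by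
  rw [← sum_massCoeff_mul, sum_range_succ_fin]
  simp [linkMom, massCoeff_succ_zero, massCoeff_succ_succ]

theorem massForm_eq (u : V3) (r : Fin n → V3) :
    massForm p u r = ∑ h, ∑ j ∈ Finset.range (n + 1),
      extSeq (u h) (fun i ↦ r i h) j * momSeq p (extSeq (u h) fun i ↦ r i h) j := by
  simp only [sum_range_succ_fin, extSeq_zero, extSeq_succ, ← baseMom_apply, ← linkMom_apply,
    Finset.sum_add_distrib, massForm, dotProduct]
  rw [Finset.sum_comm]

/-- The mass matrix is symmetric, which turns the rate of `massForm` into twice the power of the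
rates of the momenta. -/
theorem mom_symm (u u' : V3) (r r' : Fin n → V3) :
    u' ⬝ᵥ baseMom p u r + ∑ i, r' i ⬝ᵥ linkMom p u r i
      = u ⬝ᵥ baseMom p u' r' + ∑ i, r i ⬝ᵥ linkMom p u' r' i := by
  simp only [baseMom, linkMom, dotProduct_add, dotProduct_smul, dotProduct_sum, smul_eq_mul,
    Finset.sum_add_distrib]
  have h1 : ∑ i, ∑ j, Mij p i j * (r' i ⬝ᵥ r j) = ∑ i, ∑ j, Mij p i j * (r i ⬝ᵥ r' j) := by
    rw [Finset.sum_comm]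
    refine Finset.sum_congr rfl fun i _ ↦ Finset.sum_congr rfl fun j _ ↦ ?_
    rw [dotProduct_comm (r' j) (r i), Mij, Mij, max_comm]
    ring
  rw [h1, dotProduct_comm u' u]
  simp only [fun i ↦ dotProduct_comm (r' i) u, fun i ↦ dotProduct_comm (r i) u']
  ring

/-- A bound for the coefficients of the momenta. -/
noncomputable def massTotal : ℝ := M00 p + ∑ i, M0 p i + ∑ i, ∑ j, Mij p i j

variable {p}

theorem Params.Physical.M0_pos (hp : p.Physical) (i : Fin n) : 0 < M0 p i :=
  mul_pos (hp.outerMass_pos i) (hp.l_pos i)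

theorem Params.Physical.Mij_pos (hp : p.Physical) (i j : Fin n) : 0 < Mij p i j :=
  mul_pos (mul_pos (hp.outerMass_pos _) (hp.l_pos i)) (hp.l_pos j)

/-- Each of the three coordinate directions carries its own copy of the scalar chain, so the
one-dimensional energy bound applies to each of them. -/
theorem Params.Physical.exists_massForm_bound (hp : p.Physical) :
    ∃ c > 0, ∀ (u : V3) (r : Fin n → V3), c * (‖u‖ ^ 2 + ‖r‖ ^ 2) ≤ massForm p u r := by
  obtain ⟨c, hc, hb⟩ := hp.exists_kinetic_bound
  refine ⟨c / 2, by positivity, fun u r ↦ ?_⟩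
  have h0 : ∀ h, c * (∑ j ∈ Finset.range (n + 1), |extSeq (u h) (fun i ↦ r i h) j|) ^ 2
      ≤ massForm p u r := by
    intro h
    refine (hb _).trans ?_
    rw [massForm_eq]
    refine Finset.single_le_sum (f := fun h ↦ ∑ j ∈ Finset.range (n + 1),
      extSeq (u h) (fun i ↦ r i h) j * momSeq p (extSeq (u h) fun i ↦ r i h) j)
      (fun h _ ↦ (hb _).trans' ?_) (Finset.mem_univ h)
    positivity
  have hF : 0 ≤ massForm p u r := (h0 0).trans' (by positivity)
  have h1 : ∀ h j, j < n + 1 → |extSeq (u h) (fun i ↦ r i h) j| ≤ Real.sqrt (massForm p u r / c) := by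
    intro h j hj
    apply Real.le_sqrt_of_sq_le
    rw [le_div_iff₀' hc]
    refine (mul_le_mul_of_nonneg_left (pow_le_pow_left₀ (abs_nonneg _) ?_ 2) hc.le).trans (h0 h)
    exact Finset.single_le_sum (f := fun j ↦ |extSeq (u h) (fun i ↦ r i h) j|)
      (fun j _ ↦ abs_nonneg _) (Finset.mem_range.2 hj)
  have h2 : ‖u‖ ≤ Real.sqrt (massForm p u r / c) :=
    (pi_norm_le_iff_of_nonneg (Real.sqrt_nonneg _)).2 fun h ↦ h1 h 0 (by omega)
  have h3 : ‖r‖ ≤ Real.sqrt (massForm p u r / c) :=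
    (pi_norm_le_iff_of_nonneg (Real.sqrt_nonneg _)).2 fun i ↦
      (pi_norm_le_iff_of_nonneg (Real.sqrt_nonneg _)).2 fun h ↦ by
        simpa using h1 h (i + 1) (by omega)
  have h4 : Real.sqrt (massForm p u r / c) ^ 2 = massForm p u r / c :=
    Real.sq_sqrt (by positivity)
  have h5 := pow_le_pow_left₀ (norm_nonneg _) h2 2
  have h6 := pow_le_pow_left₀ (norm_nonneg _) h3 2
  rw [h4, le_div_iff₀' hc] at h5 h6
  linarith

theorem Params.Physical.massTotal_nonneg (hp : p.Physical) : 0 ≤ massTotal p :=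
  add_nonneg (add_nonneg hp.M00_pos.le (Finset.sum_nonneg fun i _ ↦ (hp.M0_pos i).le))
    (Finset.sum_nonneg fun i _ ↦ Finset.sum_nonneg fun j _ ↦ (hp.Mij_pos i j).le)

theorem Params.Physical.norm_baseMom_le (hp : p.Physical) (u : V3) (r : Fin n → V3) :
    ‖baseMom p u r‖ ≤ massTotal p * (‖u‖ + ‖r‖) := by
  have h1 : ‖∑ i, M0 p i • r i‖ ≤ (∑ i, M0 p i) * ‖r‖ := by
    rw [Finset.sum_mul]
    refine (norm_sum_le _ _).trans (Finset.sum_le_sum fun i _ ↦ ?_)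
    rw [norm_smul, Real.norm_of_nonneg (hp.M0_pos i).le]
    exact mul_le_mul_of_nonneg_left (norm_le_pi_norm r i) (hp.M0_pos i).le
  have h2 : ‖M00 p • u‖ = M00 p * ‖u‖ := by rw [norm_smul, Real.norm_of_nonneg hp.M00_pos.le]
  have h3 : 0 ≤ ∑ i, M0 p i := Finset.sum_nonneg fun i _ ↦ (hp.M0_pos i).le
  have h4 : 0 ≤ ∑ i, ∑ j, Mij p i j :=
    Finset.sum_nonneg fun i _ ↦ Finset.sum_nonneg fun j _ ↦ (hp.Mij_pos i j).le
  have h5 := norm_add_le (M00 p • u) (∑ i, M0 p i • r i)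
  have h6 := hp.M00_pos.le
  rw [baseMom, massTotal]
  nlinarith [norm_nonneg u, norm_nonneg r, mul_nonneg h3 (norm_nonneg u),
    mul_nonneg h4 (norm_nonneg u), mul_nonneg h4 (norm_nonneg r), mul_nonneg h6 (norm_nonneg r)]

theorem Params.Physical.norm_linkMom_le (hp : p.Physical) (u : V3) (r : Fin n → V3) (i : Fin n) :
    ‖linkMom p u r i‖ ≤ massTotal p * (‖u‖ + ‖r‖) := by
  have h1 : ‖∑ j, Mij p i j • r j‖ ≤ (∑ j, Mij p i j) * ‖r‖ := by
    rw [Finset.sum_mul]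
    refine (norm_sum_le _ _).trans (Finset.sum_le_sum fun j _ ↦ ?_)
    rw [norm_smul, Real.norm_of_nonneg (hp.Mij_pos i j).le]
    exact mul_le_mul_of_nonneg_left (norm_le_pi_norm r j) (hp.Mij_pos i j).le
  have h2 : ‖M0 p i • u‖ = M0 p i * ‖u‖ := by rw [norm_smul, Real.norm_of_nonneg (hp.M0_pos i).le]
  have h3 : M0 p i ≤ ∑ i, M0 p i :=
    Finset.single_le_sum (fun i _ ↦ (hp.M0_pos i).le) (Finset.mem_univ i)
  have h4 : ∑ j, Mij p i j ≤ ∑ i, ∑ j, Mij p i j :=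
    Finset.single_le_sum (f := fun i ↦ ∑ j, Mij p i j)
      (fun i _ ↦ Finset.sum_nonneg fun j _ ↦ (hp.Mij_pos i j).le) (Finset.mem_univ i)
  have h5 := norm_add_le (M0 p i • u) (∑ j, Mij p i j • r j)
  have h6 := hp.M00_pos.le
  have h7 : 0 ≤ ∑ j, Mij p i j := Finset.sum_nonneg fun j _ ↦ (hp.Mij_pos i j).le
  have h8 : M0 p i ≤ massTotal p := by rw [massTotal]; linarith
  have h9 : ∑ j, Mij p i j ≤ massTotal p := by rw [massTotal]; linarith [hp.M0_pos i]
  rw [linkMom]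
  linarith [mul_le_mul_of_nonneg_right h8 (norm_nonneg u),
    mul_le_mul_of_nonneg_right h9 (norm_nonneg r)]

theorem hasDerivWithinAt_baseMom {u : ℝ → V3} {r : ℝ → Fin n → V3} {u' : V3} {r' : Fin n → V3}
    {s : Set ℝ} {t : ℝ} (hu : HasDerivWithinAt u u' s t)
    (hr : ∀ i, HasDerivWithinAt (fun τ ↦ r τ i) (r' i) s t) :
    HasDerivWithinAt (fun τ ↦ baseMom p (u τ) (r τ)) (baseMom p u' r') s t :=
  (hu.const_smul (M00 p)).add
    (HasDerivWithinAt.fun_sum (u := Finset.univ) fun i _ ↦ (hr i).const_smul (M0 p i))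

theorem hasDerivWithinAt_linkMom {u : ℝ → V3} {r : ℝ → Fin n → V3} {u' : V3} {r' : Fin n → V3}
    {s : Set ℝ} {t : ℝ} (hu : HasDerivWithinAt u u' s t)
    (hr : ∀ i, HasDerivWithinAt (fun τ ↦ r τ i) (r' i) s t) (i : Fin n) :
    HasDerivWithinAt (fun τ ↦ linkMom p (u τ) (r τ) i) (linkMom p u' r' i) s t :=
  (hu.const_smul (M0 p i)).add
    (HasDerivWithinAt.fun_sum (u := Finset.univ) fun j _ ↦ (hr j).const_smul (Mij p i j))

theorem hasDerivWithinAt_massForm {u : ℝ → V3} {r : ℝ → Fin n → V3} {u' : V3} {r' : Fin n → V3}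
    {s : Set ℝ} {t : ℝ} (hu : HasDerivWithinAt u u' s t)
    (hr : ∀ i, HasDerivWithinAt (fun τ ↦ r τ i) (r' i) s t) :
    HasDerivWithinAt (fun τ ↦ massForm p (u τ) (r τ))
      (2 * (u t ⬝ᵥ baseMom p u' r' + ∑ i, r t i ⬝ᵥ linkMom p u' r' i)) s t := by
  have h1 := hasDerivWithinAt_dot hu (hasDerivWithinAt_baseMom (p := p) hu hr)
  have h2 := HasDerivWithinAt.fun_sum (u := Finset.univ) fun i _ ↦
    hasDerivWithinAt_dot (hr i) (hasDerivWithinAt_linkMom (p := p) hu hr i)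
  refine (h1.add h2).congr_deriv ?_
  rw [Finset.sum_add_distrib]
  linarith [mom_symm p (u t) u' (r t) r']

end Mechanics

/-! ### Reduced dynamics and the translational Lyapunov function -/

section Reduced

variable {n : ℕ} (p : Params n)

/-- Velocity of the link directions. -/
noncomputable def linkVel (st : State n) (i : Fin n) : V3 := crossProduct (st.ω i) (st.q i)

/-- Momenta conjugate to the linearized coordinates. -/
noncomputable def momErr (st : State n) : XIdx n → ℝ :=
  Sum.elim (baseMom p st.v (linkVel st))
    fun ic ↦ (Cᵀ *ᵥ crossProduct (st.q ic.1) (linkMom p st.v (linkVel st) ic.1)) ic.2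

/-- Time derivative of `posErr`. -/
noncomputable def posRate (st : State n) : XIdx n → ℝ :=
  Sum.elim st.v fun ic ↦ (Cᵀ *ᵥ crossProduct e3 (linkVel st ic.1)) ic.2

/-- The part of the rate of the link momenta that is quadratic in the velocities. -/
noncomputable def gyroRate (st : State n) : XIdx n → ℝ :=
  Sum.elim 0 fun ic ↦
    (Cᵀ *ᵥ crossProduct (linkVel st ic.1) (linkMom p st.v (linkVel st) ic.1)) ic.2

/-- Deviation of the integral force from the disturbance. -/
noncomputable def integralGap (kz : ℝ) (Δx : V3) (st : State n) : V3 :=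
  Δx - kz • (st.ex ∘ Sum.inl)

/-- Lyapunov function of the translational dynamics. -/
noncomputable def transLyap (Y : Matrix (XIdx n) (XIdx n) ℝ) (ε kz : ℝ) (Δx : V3) (st : State n) :
    ℝ :=
  1 / 2 * massForm p st.v (linkVel st) + 1 / 2 * ((st.x - p.xd) ⬝ᵥ (st.x - p.xd))
    + ∑ i, weight p i * (1 - st.q i ⬝ᵥ e3) + ε * (posErr p st ⬝ᵥ (Y *ᵥ momErr p st))
    + (2 * kz)⁻¹ * (integralGap kz Δx st ⬝ᵥ integralGap kz Δx st)

/-- Nonlinear remainder of the rate of the cross term. -/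
noncomputable def crossRem (Y : Matrix (XIdx n) (XIdx n) ℝ) (st : State n) : ℝ :=
  posErr p st ⬝ᵥ (Y *ᵥ gyroRate p st) + posRate st ⬝ᵥ (Y *ᵥ momErr p st)
    - velErr st ⬝ᵥ (Y *ᵥ (linM p *ᵥ velErr st))

/-- Dynamics at time `t` of the state `s` in which the attitude is replaced by the attitude error
`R_cᵀ R`, with angular velocity error `w`; here `a`, `b`, `w'` are accelerations, and `d` is the
deviation of the thrust from the ideal thrust. -/
structure ReducedAt (k : Gains n) (Δx ΔR : V3) (s : ℝ → State n) (w : ℝ → V3) (t : ℝ)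
    (a : V3) (b : Fin n → V3) (d w' : V3) : Prop where
  valid : (s t).Valid
  x_deriv : HasDerivWithinAt (fun τ ↦ (s τ).x) (s t).v (Ici 0) t
  v_deriv : HasDerivWithinAt (fun τ ↦ (s τ).v) a (Ici 0) t
  q_deriv : ∀ i, HasDerivWithinAt (fun τ ↦ (s τ).q i) (linkVel (s t) i) (Ici 0) t
  ω_deriv : ∀ i, HasDerivWithinAt (fun τ ↦ (s τ).ω i) (crossProduct ((s t).q i) (b i)) (Ici 0) t
  linkVel_deriv : ∀ i, HasDerivWithinAt (fun τ ↦ linkVel (s τ) i) (b i) (Ici 0) t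
  R_deriv : ∀ i j, HasDerivWithinAt (fun τ ↦ (s τ).R i j) (((s t).R * hat (w t)) i j) (Ici 0) t
  ex_deriv : HasDerivWithinAt (fun τ ↦ (s τ).ex) ((k.P * clB p)ᵀ *ᵥ z1 p (s t)) (Ici 0) t
  eI_deriv : HasDerivWithinAt (fun τ ↦ (s τ).eI) (w t + k.c2 • attVec (s t).R) (Ici 0) t
  w_deriv : HasDerivWithinAt w w' (Ici 0) t
  base : baseMom p a b = idealThrust p k (s t) + d + (M00 p * p.g) • e3 + Δx
  link : ∀ i, crossProduct ((s t).q i) (linkMom p a b i - weight p i • e3) = 0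
  deviation : d ⬝ᵥ d ≤ 4 * (idealThrust p k (s t) ⬝ᵥ idealThrust p k (s t)) * attErr (s t).R
  rotation : p.J *ᵥ w' = -(k.kR • attVec (s t).R) - k.kΩ • w t - k.kI • (s t).eI + ΔR

theorem sat_of_abs_le {ι : Type} {σ : ℝ} {y : ι → ℝ} {i : ι} (h : |y i| ≤ σ) : sat σ y i = y i := by
  rw [sat, min_eq_left (abs_le.1 h).2, max_eq_right (abs_le.1 h).1]

/-- The ideal thrust of the design while the integral force is not saturated. -/
theorem idealThrust_design (Y : Matrix (XIdx n) (XIdx n) ℝ) (ε₀ κ kz kI c2 δ : ℝ) {st : State n}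
    (h : ∀ i, |st.ex (Sum.inl i)| ≤ 4 * δ / kz) :
    idealThrust p (design p Y ε₀ κ kz kI c2 δ) st
      = -(st.x - p.xd) - κ • st.v - kz • (st.ex ∘ Sum.inl) - (M00 p * p.g) • e3 := by
  have h1 : sat (4 * δ / kz) st.ex ∘ Sum.inl = st.ex ∘ Sum.inl := by
    ext i
    exact sat_of_abs_le (h i)
  have h2 : posErr p st ∘ Sum.inl = st.x - p.xd := rfl
  have h3 : velErr st ∘ Sum.inl = st.v := rfl
  simp only [idealThrust, design, gainMat_zero_mulVec, h1, h2, h3, one_smul]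

variable {p}

theorem hasDerivWithinAt_posErr {s : ℝ → State n} {t : ℝ}
    (hx : HasDerivWithinAt (fun τ ↦ (s τ).x) (s t).v (Ici 0) t)
    (hq : ∀ i, HasDerivWithinAt (fun τ ↦ (s τ).q i) (linkVel (s t) i) (Ici 0) t) :
    HasDerivWithinAt (fun τ ↦ posErr p (s τ)) (posRate (s t)) (Ici 0) t := by
  rw [hasDerivWithinAt_pi]
  rintro (i | ic)
  · exact (hasDerivWithinAt_pi.1 (hx.sub_const p.xd)) i
  · have h := hasDerivWithinAt_mulVec Cᵀ
      (hasDerivWithinAt_cross (hasDerivWithinAt_const t (Ici 0) e3) (hq ic.1))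
    refine ((hasDerivWithinAt_pi.1 h) ic.2).congr_deriv ?_
    simp [posRate]

/-- The tension acts along the link and drops out of the cross product with `q`; the weight leaves a
multiple of `e3 × q`, which is exactly the linear restoring term. All nonlinearity of the rate is
therefore in `gyroRate`. Adding `x - xd` to the base force compensates the unit position stiffness
contained in `stiff`. -/
theorem hasDerivWithinAt_momErr {s : ℝ → State n} {t : ℝ} {a : V3} {b : Fin n → V3}
    (hv : HasDerivWithinAt (fun τ ↦ (s τ).v) a (Ici 0) t)
    (hq : ∀ i, HasDerivWithinAt (fun τ ↦ (s τ).q i) (linkVel (s t) i) (Ici 0) t)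
    (hr : ∀ i, HasDerivWithinAt (fun τ ↦ linkVel (s τ) i) (b i) (Ici 0) t)
    (hl : ∀ i, crossProduct ((s t).q i) (linkMom p a b i - weight p i • e3) = 0) :
    HasDerivWithinAt (fun τ ↦ momErr p (s τ))
      (baseForce (baseMom p a b + (s t).x - p.xd) - stiff p *ᵥ posErr p (s t)
        + gyroRate p (s t)) (Ici 0) t := by
  rw [hasDerivWithinAt_pi]
  rintro (i | ic)
  · refine ((hasDerivWithinAt_pi.1 (hasDerivWithinAt_baseMom (p := p) hv hr)) i).congr_deriv ?_
    simp [baseForce, stiff_mulVec, gyroRate, posErr]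
  · have h := hasDerivWithinAt_mulVec Cᵀ
      (hasDerivWithinAt_cross (hq ic.1) (hasDerivWithinAt_linkMom (p := p) hv hr ic.1))
    refine ((hasDerivWithinAt_pi.1 h) ic.2).congr_deriv ?_
    have h1 : crossProduct ((s t).q ic.1) (linkMom p a b ic.1)
        = -(weight p ic.1 • crossProduct e3 ((s t).q ic.1)) := by
      have := hl ic.1
      rw [map_sub, sub_eq_zero, map_smul] at this
      rw [this, ← smul_neg, cross_anticomm]
    simp [baseForce, stiff_mulVec, gyroRate, posErr, h1, mulVec_add, mulVec_neg, mulVec_smul]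
    ring

/-- Rate of the translational Lyapunov function along the closed loop. -/
theorem ReducedAt.hasDerivWithinAt_transLyap (hp : p.Physical) {Y : Matrix (XIdx n) (XIdx n) ℝ}
    {ε₀ κ kz kI c2 δ : ℝ} (hκ : κ ≠ 0) (hkz : kz ≠ 0) {Δx ΔR : V3} {s : ℝ → State n} {w : ℝ → V3}
    {t : ℝ} {a : V3} {b : Fin n → V3} {d w' : V3}
    (h : ReducedAt p (design p Y ε₀ κ kz kI c2 δ) Δx ΔR s w t a b d w')
    (hsat : ∀ i, |(s t).ex (Sum.inl i)| ≤ 4 * δ / kz) :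
    HasDerivWithinAt (fun τ ↦ transLyap p Y (ε₀ / κ) kz Δx (s τ))
      (-dissRate p Y ε₀ κ (posErr p (s t)) (velErr (s t)) + (s t).v ⬝ᵥ d
        + ε₀ / κ * (posErr p (s t) ⬝ᵥ (Y *ᵥ baseForce d)) + ε₀ / κ * crossRem p Y (s t))
      (Ici 0) t := by
  set st := s t with hst
  have hex : HasDerivWithinAt (fun τ ↦ (s τ).ex) (velErr st + (ε₀ / κ) • (Yᵀ *ᵥ posErr p st))
      (Ici 0) t := by
    rw [← hp.integral_action]
    exact h.ex_deriv
  have hy : HasDerivWithinAt (fun τ ↦ integralGap kz Δx (s τ))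
      (-(kz • (st.v + (ε₀ / κ) • ((Yᵀ *ᵥ posErr p st) ∘ Sum.inl)))) (Ici 0) t := by
    rw [hasDerivWithinAt_pi] at hex ⊢
    intro i
    refine (((hex (Sum.inl i)).const_mul kz).const_sub (Δx i)).congr_deriv ?_
    simp [velErr]
    ring
  have h1 := (hasDerivWithinAt_massForm (p := p) h.v_deriv h.linkVel_deriv).const_mul (1 / 2 : ℝ)
  have h2 := (hasDerivWithinAt_dot (h.x_deriv.sub_const p.xd)
    (h.x_deriv.sub_const p.xd)).const_mul (1 / 2 : ℝ)
  have h3 := HasDerivWithinAt.fun_sum (u := Finset.univ) fun i _ ↦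
    ((hasDerivWithinAt_dot (h.q_deriv i) (hasDerivWithinAt_const t (Ici 0) e3)).const_sub
      (1 : ℝ)).const_mul (weight p i)
  have hpos := hasDerivWithinAt_posErr (p := p) h.x_deriv h.q_deriv
  have hmom := hasDerivWithinAt_momErr h.v_deriv h.q_deriv h.linkVel_deriv h.link
  have h4 := (hasDerivWithinAt_dot hpos (hasDerivWithinAt_mulVec Y hmom)).const_mul (ε₀ / κ)
  have h5 := (hasDerivWithinAt_dot hy hy).const_mul (2 * kz)⁻¹
  refine ((((h1.add h2).add h3).add h4).add h5).congr_deriv ?_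
  -- The link force without the weight is parallel to the link and does no work, because `linkVel`
  -- is perpendicular to `q`.
  have hpow : ∑ i, linkVel st i ⬝ᵥ linkMom p a b i = ∑ i, weight p i * (linkVel st i ⬝ᵥ e3) := by
    refine Finset.sum_congr rfl fun i _ ↦ ?_
    have k1 : linkVel st i ⬝ᵥ (linkMom p a b i - weight p i • e3) = 0 := by
      have k2 := triple_product_permutation (st.ω i) (st.q i) (linkMom p a b i - weight p i • e3)
      rw [h.link i, dotProduct_zero] at k2
      have k3 := triple_product_permutation (st.q i) (linkMom p a b i - weight p i • e3) (st.ω i)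
      rw [linkVel, dotProduct_comm, ← k3, ← k2]
    rw [dotProduct_sub, dotProduct_smul, smul_eq_mul, sub_eq_zero] at k1
    exact k1
  have hbase : baseMom p a b
      = integralGap kz Δx st - κ • st.v - (st.x - p.xd) + d := by
    rw [h.base, idealThrust_design p Y ε₀ κ kz kI c2 δ hsat, integralGap]
    abel
  -- With this, the terms that contain the integral gap, from the energy and from the cross term,
  -- cancel against the rate of its own square.
  have hYT : ∀ u : V3, ((Yᵀ *ᵥ posErr p st) ∘ Sum.inl) ⬝ᵥ u = posErr p st ⬝ᵥ (Y *ᵥ baseForce u) := by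
    intro u
    rw [← dotProduct_baseForce, mulVec_transpose, dotProduct_mulVec]
  have hb2 : baseForce (n := n) (baseMom p a b + st.x - p.xd)
      = baseForce (integralGap kz Δx st) - κ • baseForce st.v + baseForce d := by
    rw [hbase]
    ext (i | ic)
    · simp [baseForce]
      ring
    · simp [baseForce]
  have hvel : velErr st ∘ Sum.inl = st.v := rfl
  simp only [← hst, hb2, hpow]
  rw [hbase, dissRate, crossDiss, crossRem, hvel]
  generalize integralGap kz Δx st = y
  simp only [mulVec_add, mulVec_sub, mulVec_smul, dotProduct_add, dotProduct_sub, dotProduct_smul,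
    smul_eq_mul, dotProduct_neg, neg_dotProduct, smul_dotProduct, add_dotProduct, hYT,
    dotProduct_zero, add_zero, mul_neg, Finset.sum_neg_distrib, mul_sub, mul_add,
    dotProduct_comm y ((Yᵀ *ᵥ posErr p st) ∘ Sum.inl), dotProduct_comm y st.v,
    dotProduct_comm st.x st.v, dotProduct_comm p.xd st.v, sub_dotProduct]
  field_simp
  ring

end Reduced

end QuadCable

namespace QuadCable

/-! ### Sizes of the errors and comparison with the linearization -/

section Sizes

variable {n : ℕ} (p : Params n)

/-- Size of the position error and of the link errors. -/
noncomputable def posSize (st : State n) : ℝ := ‖st.x - p.xd‖ + ‖st.q - fun _ ↦ e3‖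

/-- Size of the velocity and of the link angular velocities. -/
noncomputable def velSize (st : State n) : ℝ := ‖st.v‖ + ‖st.ω‖

theorem posSize_nonneg (st : State n) : 0 ≤ posSize p st := by rw [posSize]; positivity

theorem velSize_nonneg (st : State n) : 0 ≤ velSize st := by rw [velSize]; positivity

theorem norm_link_sub_le (st : State n) (i : Fin n) : ‖st.q i - e3‖ ≤ ‖st.q - fun _ ↦ e3‖ :=
  norm_le_pi_norm (st.q - fun _ ↦ e3) i

theorem norm_link_sub_le_posSize (st : State n) (i : Fin n) : ‖st.q i - e3‖ ≤ posSize p st := by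
  have := norm_link_sub_le st i
  rw [posSize]
  linarith [norm_nonneg (st.x - p.xd)]

theorem norm_omega_le_velSize (st : State n) (i : Fin n) : ‖st.ω i‖ ≤ velSize st := by
  have := norm_le_pi_norm st.ω i
  rw [velSize]
  linarith [norm_nonneg st.v]

theorem norm_e3 : ‖e3‖ ≤ 1 := by
  refine (pi_norm_le_iff_of_nonneg zero_le_one).2 fun i ↦ ?_
  fin_cases i <;> simp [e3]

theorem State.Valid.norm_q_le {st : State n} (h : st.Valid) (i : Fin n) : ‖st.q i‖ ≤ 1 := by
  have h1 := norm_sq_le_dot_self (st.q i)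
  rw [h.q_unit i] at h1
  exact (sq_le_one_iff₀ (norm_nonneg _)).1 h1

theorem State.Valid.cross_linkVel {st : State n} (h : st.Valid) (i : Fin n) :
    crossProduct (st.q i) (linkVel st i) = st.ω i := by
  rw [linkVel, cross_cross_dot, h.q_unit i, h.q_perp i, one_smul, zero_smul, sub_zero]

theorem State.Valid.linkVel_dot_self {st : State n} (h : st.Valid) (i : Fin n) :
    linkVel st i ⬝ᵥ linkVel st i = st.ω i ⬝ᵥ st.ω i := by
  rw [linkVel, cross_dot_cross, h.q_unit i, dotProduct_comm (st.ω i) (st.q i), h.q_perp i]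
  ring

theorem State.Valid.norm_linkVel_le {st : State n} (h : st.Valid) :
    ‖linkVel st‖ ≤ 2 * ‖st.ω‖ := by
  refine (pi_norm_le_iff_of_nonneg (by positivity)).2 fun i ↦ ?_
  have h1 := norm_cross_le (st.ω i) (st.q i)
  have h2 := mul_le_mul (norm_le_pi_norm st.ω i) (h.norm_q_le i) (norm_nonneg _) (norm_nonneg _)
  rw [linkVel]
  linarith

theorem State.Valid.norm_omega_le {st : State n} (h : st.Valid) : ‖st.ω‖ ≤ 2 * ‖linkVel st‖ := by
  refine (pi_norm_le_iff_of_nonneg (by positivity)).2 fun i ↦ ?_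
  have h1 := norm_cross_le (st.q i) (linkVel st i)
  have h2 := mul_le_mul (h.norm_q_le i) (norm_le_pi_norm (linkVel st) i) (norm_nonneg _) zero_le_one
  rw [h.cross_linkVel] at h1
  linarith

theorem State.Valid.one_sub_dot {st : State n} (h : st.Valid) (i : Fin n) :
    1 - st.q i ⬝ᵥ e3 = 1 / 2 * ((st.q i - e3) ⬝ᵥ (st.q i - e3)) := by
  have h1 : e3 ⬝ᵥ e3 = 1 := by simp [e3, dotProduct, Fin.sum_univ_three]
  rw [sub_dotProduct, dotProduct_sub, dotProduct_sub, h.q_unit i, h1, dotProduct_comm e3 (st.q i)]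
  ring

theorem absSum_le_card_mul {ι : Type} [Fintype ι] {z : ι → ℝ} {M : ℝ} (h : ∀ j, |z j| ≤ M) :
    absSum z ≤ Fintype.card ι * M := by
  have := Finset.sum_le_card_nsmul Finset.univ (fun j ↦ |z j|) M fun j _ ↦ h j
  simpa [absSum] using this

theorem abs_C_transpose_mulVec_le (u : V3) (c : Fin 2) : |(Cᵀ *ᵥ u) c| ≤ ‖u‖ := by
  have h : (Cᵀ *ᵥ u) c = u (Fin.castSucc c) := by
    fin_cases c <;> simp [C, mulVec, dotProduct, Fin.sum_univ_three]
  rw [h]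
  exact abs_apply_le_norm u _

/-- Number of linearized coordinates. -/
noncomputable def dim (n : ℕ) : ℝ := Fintype.card (XIdx n)

theorem dim_nonneg (n : ℕ) : 0 ≤ dim n := Nat.cast_nonneg _

theorem absSum_elim_le {u : V3} {f : Fin n → V3} {M : ℝ} (hu : ‖u‖ ≤ M) (hf : ∀ i, ‖f i‖ ≤ M) :
    absSum (Sum.elim u fun ic : Fin n × Fin 2 ↦ (Cᵀ *ᵥ f ic.1) ic.2) ≤ dim n * M := by
  apply absSum_le_card_mul
  rintro (i | ic)
  · exact (abs_apply_le_norm u i).trans hu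
  · exact (abs_C_transpose_mulVec_le _ _).trans (hf ic.1)

theorem cross_e3_eq (q : V3) : crossProduct e3 q = crossProduct e3 (q - e3) := by
  rw [map_sub, cross_self, sub_zero]

theorem absSum_posErr_le (st : State n) : absSum (posErr p st) ≤ dim n * (2 * posSize p st) := by
  have h0 := norm_nonneg (st.q - fun _ ↦ e3)
  have h1 := norm_nonneg (st.x - p.xd)
  refine absSum_elim_le (f := fun i ↦ crossProduct e3 (st.q i)) (by rw [posSize]; linarith)
    fun i ↦ ?_
  rw [cross_e3_eq]
  have h2 := norm_cross_le e3 (st.q i - e3)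
  have h3 := mul_le_mul norm_e3 (norm_link_sub_le st i) (norm_nonneg _) zero_le_one
  rw [posSize]
  linarith

variable {p}

theorem absSum_velErr_le (st : State n) : absSum (velErr st) ≤ dim n * velSize st := by
  have h0 := norm_nonneg st.v
  have h1 := norm_nonneg st.ω
  exact absSum_elim_le (f := fun i ↦ st.ω i) (by rw [velSize]; linarith)
    fun i ↦ norm_omega_le_velSize st i

theorem State.Valid.norm_linkMom_le {st : State n} (h : st.Valid) (hp : p.Physical) (i : Fin n) :
    ‖linkMom p st.v (linkVel st) i‖ ≤ massTotal p * (2 * velSize st) := by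
  refine (hp.norm_linkMom_le _ _ i).trans (mul_le_mul_of_nonneg_left ?_ hp.massTotal_nonneg)
  rw [velSize]
  linarith [h.norm_linkVel_le, norm_nonneg st.v]

theorem State.Valid.norm_baseMom_le {st : State n} (h : st.Valid) (hp : p.Physical) :
    ‖baseMom p st.v (linkVel st)‖ ≤ massTotal p * (2 * velSize st) := by
  refine (hp.norm_baseMom_le _ _).trans (mul_le_mul_of_nonneg_left ?_ hp.massTotal_nonneg)
  rw [velSize]
  linarith [h.norm_linkVel_le, norm_nonneg st.v]

theorem State.Valid.absSum_momErr_le {st : State n} (h : st.Valid) (hp : p.Physical) :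
    absSum (momErr p st) ≤ dim n * (2 * (massTotal p * (2 * velSize st))) := by
  have h0 : 0 ≤ massTotal p * (2 * velSize st) :=
    mul_nonneg hp.massTotal_nonneg (by linarith [velSize_nonneg st])
  refine absSum_elim_le
    (f := fun i ↦ crossProduct (st.q i) (linkMom p st.v (linkVel st) i))
    ((h.norm_baseMom_le hp).trans (by linarith)) fun i ↦ (norm_cross_le _ _).trans ?_
  have h1 := mul_le_mul (h.norm_q_le i) (h.norm_linkMom_le hp i) (norm_nonneg _) zero_le_one
  linarith

theorem State.Valid.absSum_gyroRate_le {st : State n} (h : st.Valid) (hp : p.Physical) :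
    absSum (gyroRate p st) ≤ dim n * (8 * massTotal p * velSize st ^ 2) := by
  have h0 : 0 ≤ 8 * massTotal p * velSize st ^ 2 := by
    have := hp.massTotal_nonneg
    positivity
  refine absSum_elim_le (u := 0)
    (f := fun i ↦ crossProduct (linkVel st i) (linkMom p st.v (linkVel st) i))
    (by simpa using h0) fun i ↦ (norm_cross_le _ _).trans ?_
  have h2 : ‖linkVel st i‖ ≤ 2 * velSize st := by
    refine ((norm_le_pi_norm (linkVel st) i).trans h.norm_linkVel_le).trans ?_
    rw [velSize]
    linarith [norm_nonneg st.v]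
  have h1 := mul_le_mul h2 (h.norm_linkMom_le hp i) (norm_nonneg _)
    (by linarith [velSize_nonneg st])
  nlinarith

theorem State.Valid.absSum_posRate_sub_le {st : State n} (h : st.Valid) :
    absSum (posRate st - velErr st) ≤ dim n * (4 * (posSize p st * velSize st)) := by
  have h0 : 0 ≤ 4 * (posSize p st * velSize st) := by
    have := mul_nonneg (posSize_nonneg p st) (velSize_nonneg st)
    linarith
  have h1 : posRate st - velErr st = Sum.elim (0 : V3) fun ic : Fin n × Fin 2 ↦
      (Cᵀ *ᵥ crossProduct (e3 - st.q ic.1) (linkVel st ic.1)) ic.2 := by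
    ext (i | ic)
    · simp [posRate, velErr]
    · simp [posRate, velErr, map_sub, h.cross_linkVel, mulVec_sub]
  rw [h1]
  refine absSum_elim_le (f := fun i ↦ crossProduct (e3 - st.q i) (linkVel st i))
    (by simpa using h0) fun i ↦ (norm_cross_le _ _).trans ?_
  have h2 : ‖linkVel st i‖ ≤ 2 * velSize st := by
    refine ((norm_le_pi_norm (linkVel st) i).trans h.norm_linkVel_le).trans ?_
    rw [velSize]
    linarith [norm_nonneg st.v]
  have h3 : ‖e3 - st.q i‖ ≤ posSize p st := by
    rw [norm_sub_rev]
    exact norm_link_sub_le_posSize p st i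
  have h4 := mul_le_mul h3 h2 (norm_nonneg _) (posSize_nonneg p st)
  linarith

/-- The linearized momentum is the true one with each link direction replaced by `e3`. In this form
its difference to `momErr` visibly contains a factor `q - e3`. -/
theorem linM_mulVec_velErr (st : State n) :
    linM p *ᵥ velErr st = Sum.elim (baseMom p st.v fun i ↦ crossProduct (st.ω i) e3)
      fun ic ↦ (Cᵀ *ᵥ crossProduct e3 (linkMom p st.v (fun i ↦ crossProduct (st.ω i) e3) ic.1))
        ic.2 := by
  have hX : dirX (velErr st) = extSeq (st.v 0) fun i ↦ (crossProduct (st.ω i) e3) 0 := by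
    rw [dirX]
    congr 1
    ext i
    simp [velErr, C, e3, mulVec, dotProduct, Fin.sum_univ_three, cross_apply]
  have hY : dirY (velErr st) = extSeq (st.v 1) fun i ↦ (crossProduct (st.ω i) e3) 1 := by
    rw [dirY]
    congr 1
    ext i
    simp [velErr, C, e3, mulVec, dotProduct, Fin.sum_univ_three, cross_apply]
  have h0 : ∀ i : Fin n, (crossProduct (st.ω i) e3) 2 = 0 := by
    intro i
    simp [e3, cross_apply]
  ext (i | ⟨i, c⟩)
  · fin_cases i
    · change dirX (linM p *ᵥ velErr st) 0 = baseMom p st.v (fun i ↦ crossProduct (st.ω i) e3) 0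
      rw [dirX_linM_mulVec _ _ (by omega), hX, baseMom_apply]
    · change dirY (linM p *ᵥ velErr st) 0 = baseMom p st.v (fun i ↦ crossProduct (st.ω i) e3) 1
      rw [dirY_linM_mulVec _ _ (by omega), hY, baseMom_apply]
    · change (linM p *ᵥ velErr st) (Sum.inl 2)
        = baseMom p st.v (fun i ↦ crossProduct (st.ω i) e3) 2
      rw [linM_mulVec_two]
      simp [baseMom, h0, velErr]
  · fin_cases c
    · have h1 := dirY_succ (linM p *ᵥ velErr st) i
      rw [dirY_linM_mulVec _ _ (by omega), hY, ← linkMom_apply] at h1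
      change (linM p *ᵥ velErr st) (Sum.inr (i, 0)) = _
      rw [← neg_inj, ← h1]
      simp [C, e3, mulVec, dotProduct, Fin.sum_univ_three, cross_apply]
    · have h1 := dirX_succ (linM p *ᵥ velErr st) i
      rw [dirX_linM_mulVec _ _ (by omega), hX, ← linkMom_apply] at h1
      change (linM p *ᵥ velErr st) (Sum.inr (i, 1)) = _
      rw [← h1]
      simp [C, e3, mulVec, dotProduct, Fin.sum_univ_three, cross_apply]

theorem baseMom_sub (u u' : V3) (r r' : Fin n → V3) :
    baseMom p u r - baseMom p u' r' = baseMom p (u - u') (r - r') := by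
  simp only [baseMom, smul_sub, Pi.sub_apply, Finset.sum_sub_distrib]
  abel

theorem linkMom_sub (u u' : V3) (r r' : Fin n → V3) (i : Fin n) :
    linkMom p u r i - linkMom p u' r' i = linkMom p (u - u') (r - r') i := by
  simp only [linkMom, smul_sub, Pi.sub_apply, Finset.sum_sub_distrib]
  abel

theorem State.Valid.absSum_momErr_sub_le {st : State n} (h : st.Valid) (hp : p.Physical) :
    absSum (momErr p st - linM p *ᵥ velErr st)
      ≤ dim n * (8 * massTotal p * (posSize p st * velSize st)) := by
  have hm := hp.massTotal_nonneg
  have hP := posSize_nonneg p st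
  have hV := velSize_nonneg st
  set r : Fin n → V3 := linkVel st - fun i ↦ crossProduct (st.ω i) e3 with hr
  have hri : ∀ i, ‖r i‖ ≤ 2 * (posSize p st * velSize st) := by
    intro i
    have h1 : r i = crossProduct (st.ω i) (st.q i - e3) := by
      rw [map_sub]
      rfl
    rw [h1]
    refine (norm_cross_le _ _).trans ?_
    have h2 := mul_le_mul (norm_omega_le_velSize st i) (norm_link_sub_le_posSize p st i)
      (norm_nonneg _) hV
    linarith
  have hrn : ‖r‖ ≤ 2 * (posSize p st * velSize st) :=
    (pi_norm_le_iff_of_nonneg (by positivity)).2 hri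
  have h1 : momErr p st - linM p *ᵥ velErr st = Sum.elim (baseMom p 0 r)
      fun ic ↦ (Cᵀ *ᵥ (crossProduct (st.q ic.1 - e3) (linkMom p st.v (linkVel st) ic.1)
        + crossProduct e3 (linkMom p 0 r ic.1))) ic.2 := by
    rw [linM_mulVec_velErr]
    have h2 := baseMom_sub (p := p) st.v st.v (linkVel st) fun i ↦ crossProduct (st.ω i) e3
    rw [sub_self, ← hr] at h2
    ext (i | ic)
    · rw [← h2]
      rfl
    · have h3 := linkMom_sub (p := p) st.v st.v (linkVel st)
        (fun i ↦ crossProduct (st.ω i) e3) ic.1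
      rw [sub_self, ← hr] at h3
      rw [Pi.sub_apply, Sum.elim_inr, Sum.elim_inr, ← h3]
      simp [momErr, mulVec_sub, map_sub]
  rw [h1]
  refine absSum_elim_le (f := fun i ↦ crossProduct (st.q i - e3) (linkMom p st.v (linkVel st) i)
        + crossProduct e3 (linkMom p 0 r i)) ?_ fun i ↦ ?_
  · refine (hp.norm_baseMom_le _ _).trans ?_
    rw [norm_zero, zero_add]
    nlinarith [mul_le_mul_of_nonneg_left hrn hm, mul_nonneg hm (mul_nonneg hP hV)]
  · refine (norm_add_le _ _).trans ?_
    have h2 := norm_cross_le (st.q i - e3) (linkMom p st.v (linkVel st) i)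
    have h3 := norm_cross_le e3 (linkMom p 0 r i)
    have h4 := mul_le_mul (norm_link_sub_le_posSize p st i) (h.norm_linkMom_le hp i)
      (norm_nonneg _) hP
    have h5 := mul_le_mul norm_e3 (hp.norm_linkMom_le 0 r i) (norm_nonneg _) zero_le_one
    rw [norm_zero, zero_add] at h5
    have h6 := mul_le_mul_of_nonneg_left hrn hm
    linarith

/-- The nonlinear remainder is of third order. -/
theorem Params.Physical.exists_crossRem_bound (hp : p.Physical) (Y : Matrix (XIdx n) (XIdx n) ℝ) :
    ∃ c ≥ 0, ∀ st : State n, st.Valid →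
      |crossRem p Y st| ≤ c * (posSize p st * velSize st ^ 2) := by
  have hm := hp.massTotal_nonneg
  have hB := absSumMat_nonneg Y
  have hd := dim_nonneg n
  refine ⟨absSumMat Y * (dim n * dim n * (40 * massTotal p)), by positivity, fun st h ↦ ?_⟩
  have hP := posSize_nonneg p st
  have hV := velSize_nonneg st
  have h1 := abs_dotProduct_mulVec_le Y (posErr p st) (gyroRate p st)
  have h2 := abs_dotProduct_mulVec_le Y (posRate st - velErr st) (momErr p st)
  have h3 := abs_dotProduct_mulVec_le Y (velErr st) (momErr p st - linM p *ᵥ velErr st)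
  have e1 := mul_le_mul (absSum_posErr_le p st) (h.absSum_gyroRate_le hp) (absSum_nonneg _)
    (by positivity)
  have e2 := mul_le_mul (h.absSum_posRate_sub_le (p := p)) (h.absSum_momErr_le hp)
    (absSum_nonneg _) (by positivity)
  have e3 := mul_le_mul (absSum_velErr_le st) (h.absSum_momErr_sub_le hp) (absSum_nonneg _)
    (by positivity)
  have k1 := mul_le_mul_of_nonneg_left e1 hB
  have k2 := mul_le_mul_of_nonneg_left e2 hB
  have k3 := mul_le_mul_of_nonneg_left e3 hB
  -- Each product now has a factor of second order: `gyroRate`, or a difference between a true and a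
  -- linearized quantity.
  have hsum : crossRem p Y st = posErr p st ⬝ᵥ (Y *ᵥ gyroRate p st)
      + (posRate st - velErr st) ⬝ᵥ (Y *ᵥ momErr p st)
      + velErr st ⬝ᵥ (Y *ᵥ (momErr p st - linM p *ᵥ velErr st)) := by
    rw [crossRem, sub_dotProduct, mulVec_sub, dotProduct_sub]
    ring
  rw [hsum]
  refine (abs_add_three _ _ _).trans ((add_le_add_three (h1.trans k1) (h2.trans k2)
    (h3.trans k3)).trans (le_of_eq ?_))
  ring

/-- With `q 2` between `1 / 2` and `1` on the unit sphere, `1 - q 2 ≤ q 0 ^ 2 + q 1 ^ 2 ≤ |q 0| + |q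
1|`. So the horizontal components, the only ones in `posErr`, control the link error; near an
inverted link they would not. -/
theorem State.Valid.posSize_le {st : State n} (h : st.Valid) (hq : ‖st.q - fun _ ↦ e3‖ ≤ 1 / 2) :
    posSize p st ≤ 3 * absSum (posErr p st) := by
  have h0 := absSum_nonneg (posErr p st)
  have h1 : ‖st.x - p.xd‖ ≤ absSum (posErr p st) :=
    (pi_norm_le_iff_of_nonneg h0).2 fun i ↦ abs_le_absSum (posErr p st) (Sum.inl i)
  have h2 : ‖st.q - fun _ ↦ e3‖ ≤ 2 * absSum (posErr p st) := by
    refine (pi_norm_le_iff_of_nonneg (by positivity)).2 fun i ↦ ?_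
    have k1 : |st.q i 1| ≤ absSum (posErr p st) := by
      have := abs_le_absSum (posErr p st) (Sum.inr (i, 0))
      simpa [posErr, C, e3, mulVec, dotProduct, Fin.sum_univ_three, cross_apply] using this
    have k2 : |st.q i 0| ≤ absSum (posErr p st) := by
      have := abs_le_absSum (posErr p st) (Sum.inr (i, 1))
      simpa [posErr, C, e3, mulVec, dotProduct, Fin.sum_univ_three, cross_apply] using this
    have k3 := (abs_apply_le_norm (st.q i - e3) 2).trans ((norm_link_sub_le st i).trans hq)
    have k4 := h.q_unit i
    have k5 := (abs_apply_le_norm (st.q i) 0).trans (h.norm_q_le i)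
    have k6 := (abs_apply_le_norm (st.q i) 1).trans (h.norm_q_le i)
    have e2 : e3 2 = 1 := rfl
    rw [dotProduct, Fin.sum_univ_three] at k4
    rw [Pi.sub_apply, e2] at k3
    have k7 : |st.q i 2 - 1| ≤ |st.q i 0| + |st.q i 1| := by
      have m1 := (abs_le.1 k3).1
      have m2 : st.q i 2 ≤ 1 := le_of_abs_le ((abs_apply_le_norm (st.q i) 2).trans (h.norm_q_le i))
      rw [abs_of_nonpos (by linarith)]
      nlinarith [abs_mul_abs_self (st.q i 0), abs_mul_abs_self (st.q i 1), abs_nonneg (st.q i 0),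
        abs_nonneg (st.q i 1)]
    refine (pi_norm_le_iff_of_nonneg (by positivity)).2 fun j ↦ ?_
    rw [Real.norm_eq_abs]
    fin_cases j
    · simp [e3]
      linarith
    · simp [e3]
      linarith
    · change |st.q i 2 - 1| ≤ _
      linarith
  rw [posSize]
  linarith

/-- Since `ω` is perpendicular to `q` and `q 2 ≥ 1 / 2`, the horizontal components of `ω` bound the
vertical one, which `velErr` does not see. -/
theorem State.Valid.velSize_le {st : State n} (h : st.Valid) (hq : ‖st.q - fun _ ↦ e3‖ ≤ 1 / 2) :
    velSize st ≤ 3 * absSum (velErr st) := by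
  have h0 := absSum_nonneg (velErr st)
  have h1 : ‖st.v‖ ≤ absSum (velErr st) :=
    (pi_norm_le_iff_of_nonneg h0).2 fun i ↦ abs_le_absSum (velErr st) (Sum.inl i)
  have h2 : ‖st.ω‖ ≤ 2 * absSum (velErr st) := by
    refine (pi_norm_le_iff_of_nonneg (by positivity)).2 fun i ↦ ?_
    have k1 : |st.ω i 0| ≤ absSum (velErr st) := by
      have := abs_le_absSum (velErr st) (Sum.inr (i, 0))
      simpa [velErr, C, mulVec, dotProduct, Fin.sum_univ_three] using this
    have k2 : |st.ω i 1| ≤ absSum (velErr st) := by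
      have := abs_le_absSum (velErr st) (Sum.inr (i, 1))
      simpa [velErr, C, mulVec, dotProduct, Fin.sum_univ_three] using this
    have k3 := fun j ↦ (abs_apply_le_norm (st.q i - e3) j).trans ((norm_link_sub_le st i).trans hq)
    have m0 : |st.q i 0| ≤ 1 / 2 := by simpa [e3] using k3 0
    have m1 : |st.q i 1| ≤ 1 / 2 := by simpa [e3] using k3 1
    have m2 : |st.q i 2 - 1| ≤ 1 / 2 := k3 2
    have k4 := h.q_perp i
    rw [dotProduct, Fin.sum_univ_three] at k4
    have k5 : |st.q i 2| * |st.ω i 2| ≤ 1 / 2 * |st.ω i 0| + 1 / 2 * |st.ω i 1| := by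
      rw [← abs_mul, show st.q i 2 * st.ω i 2 = -(st.q i 0 * st.ω i 0 + st.q i 1 * st.ω i 1) by
        linarith, abs_neg]
      refine (abs_add_le _ _).trans (add_le_add ?_ ?_)
      · rw [abs_mul]
        exact mul_le_mul_of_nonneg_right m0 (abs_nonneg _)
      · rw [abs_mul]
        exact mul_le_mul_of_nonneg_right m1 (abs_nonneg _)
    have k6 : 1 / 2 ≤ |st.q i 2| := by
      have := (abs_le.1 m2).1
      exact le_trans (by linarith) (le_abs_self _)
    have k7 : 1 / 2 * |st.ω i 2| ≤ |st.q i 2| * |st.ω i 2| :=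
      mul_le_mul_of_nonneg_right k6 (abs_nonneg _)
    refine (pi_norm_le_iff_of_nonneg (by positivity)).2 fun j ↦ ?_
    rw [Real.norm_eq_abs]
    fin_cases j
    · exact k1.trans (by linarith)
    · exact k2.trans (by linarith)
    · change |st.ω i 2| ≤ _
      linarith
  rw [velSize]
  linarith

end Sizes

end QuadCable

namespace QuadCable

/-! ### Coercivity and decay of the Lyapunov function, bounds for accelerations -/

section Estimates

variable {n : ℕ} {p : Params n}

theorem Params.Physical.exists_weight_bound (hp : p.Physical) : ∃ c > 0, ∀ i, c ≤ weight p i := by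
  rcases isEmpty_or_nonempty (Fin n) with h | h
  · exact ⟨1, one_pos, fun i ↦ (h.false i).elim⟩
  · obtain ⟨i, hi⟩ := Finite.exists_min (weight p)
    exact ⟨weight p i, hp.weight_pos i, hi⟩

/-- The translational Lyapunov function is positive definite. -/
theorem Params.Physical.exists_transLyap_bounds (hp : p.Physical)
    (Y : Matrix (XIdx n) (XIdx n) ℝ) :
    ∃ r > 0, ∃ c > 0, ∃ b > 0, ∀ ε, 0 ≤ ε → ε ≤ r → ∀ (kz : ℝ) (Δx : V3) (st : State n), st.Valid →
      c * (posSize p st ^ 2 + velSize st ^ 2)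
          + (2 * kz)⁻¹ * (integralGap kz Δx st ⬝ᵥ integralGap kz Δx st)
        ≤ transLyap p Y ε kz Δx st ∧
      transLyap p Y ε kz Δx st ≤ b * (posSize p st ^ 2 + velSize st ^ 2)
          + (2 * kz)⁻¹ * (integralGap kz Δx st ⬝ᵥ integralGap kz Δx st) := by
  obtain ⟨ck, hck, hkin⟩ := hp.exists_massForm_bound
  obtain ⟨w0, hw0, hweight⟩ := hp.exists_weight_bound
  have hm := hp.massTotal_nonneg
  have hB := absSumMat_nonneg Y
  have hd := dim_nonneg n
  set k1 := 8 * absSumMat Y * dim n * dim n * massTotal p with hk1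
  have hk1n : 0 ≤ k1 := by positivity
  -- Half of `massForm` exceeds `cm * W ^ 2`, because `W ^ 2 ≤ 8 * (‖v‖ ^ 2 + ‖linkVel‖ ^ 2)`; the
  -- potential energies exceed `cm * P ^ 2`, because `P ^ 2` is at most twice the sum of the two
  -- squares. The cross term takes half of `cm`.
  set cm := min (ck / 16) (min 1 w0 / 4) with hcm
  have hcm0 : 0 < cm := by positivity
  have hcm1 : cm ≤ ck / 16 := min_le_left _ _
  have hcm2 : 4 * cm ≤ 1 := by
    have h1 : cm ≤ min 1 w0 / 4 := min_le_right _ _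
    have h2 : min 1 w0 ≤ 1 := min_le_left _ _
    linarith
  have hcm3 : 4 * cm ≤ w0 := by
    have h1 : cm ≤ min 1 w0 / 4 := min_le_right _ _
    have h2 : min 1 w0 ≤ w0 := min_le_right _ _
    linarith
  have hws : 0 ≤ ∑ i, weight p i := Finset.sum_nonneg fun i _ ↦ (hp.weight_pos i).le
  refine ⟨cm / (k1 + 1), by positivity, cm / 2, by positivity,
    (3 + 6 * n) * massTotal p + 3 / 2 + 3 / 2 * ∑ i, weight p i + cm, by positivity,
    fun ε hε0 hε kz Δx st h ↦ ?_⟩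
  have hP := posSize_nonneg p st
  have hV := velSize_nonneg st
  set P := posSize p st with hPdef
  set W := velSize st with hWdef
  have hx0 := norm_nonneg (st.x - p.xd)
  have hq0 := norm_nonneg (st.q - fun _ ↦ e3)
  have hv0 := norm_nonneg st.v
  have ho0 := norm_nonneg st.ω
  have hl0 := norm_nonneg (linkVel st)
  have hcross : |ε * (posErr p st ⬝ᵥ (Y *ᵥ momErr p st))| ≤ cm / 2 * (P ^ 2 + W ^ 2) := by
    rw [abs_mul, abs_of_nonneg hε0]
    have h1 := abs_dotProduct_mulVec_le Y (posErr p st) (momErr p st)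
    have h2 := mul_le_mul (absSum_posErr_le p st) (h.absSum_momErr_le hp) (absSum_nonneg _)
      (by positivity)
    have h3 : |posErr p st ⬝ᵥ (Y *ᵥ momErr p st)| ≤ k1 * (P * W) := by
      refine h1.trans ((mul_le_mul_of_nonneg_left h2 hB).trans (le_of_eq ?_))
      rw [hk1]
      ring
    have h4 : ε * k1 ≤ cm := by
      have h5 : ε * (k1 + 1) ≤ cm := by rwa [← le_div_iff₀ (by positivity)]
      linarith
    calc ε * |posErr p st ⬝ᵥ (Y *ᵥ momErr p st)| ≤ ε * (k1 * (P * W)) :=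
          mul_le_mul_of_nonneg_left h3 hε0
      _ = (ε * k1) * (P * W) := by ring
      _ ≤ cm * (P * W) := mul_le_mul_of_nonneg_right h4 (by positivity)
      _ ≤ cm / 2 * (P ^ 2 + W ^ 2) := by nlinarith [sq_nonneg (P - W)]
  have hU : ∑ i, weight p i * (1 - st.q i ⬝ᵥ e3)
      = ∑ i, weight p i * (1 / 2 * ((st.q i - e3) ⬝ᵥ (st.q i - e3))) :=
    Finset.sum_congr rfl fun i _ ↦ by rw [h.one_sub_dot]
  have hUnn : ∀ i, 0 ≤ weight p i * (1 / 2 * ((st.q i - e3) ⬝ᵥ (st.q i - e3))) := fun i ↦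
    mul_nonneg (hp.weight_pos i).le (by linarith [dot_self_nonneg (st.q i - e3)])
  have hUlow : w0 / 2 * ‖st.q - fun _ ↦ e3‖ ^ 2 ≤ ∑ i, weight p i * (1 - st.q i ⬝ᵥ e3) := by
    rw [hU]
    set U := ∑ i, weight p i * (1 / 2 * ((st.q i - e3) ⬝ᵥ (st.q i - e3))) with hUdef
    have hU0 : 0 ≤ U := Finset.sum_nonneg fun i _ ↦ hUnn i
    have h1 : ‖st.q - fun _ ↦ e3‖ ≤ Real.sqrt (2 * U / w0) := by
      refine (pi_norm_le_iff_of_nonneg (Real.sqrt_nonneg _)).2 fun i ↦ Real.le_sqrt_of_sq_le ?_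
      rw [le_div_iff₀ hw0]
      have h2 := Finset.single_le_sum (fun i _ ↦ hUnn i) (Finset.mem_univ i)
      have h3 := norm_sq_le_dot_self (st.q i - e3)
      have h4 := mul_le_mul_of_nonneg_right (hweight i) (dot_self_nonneg (st.q i - e3))
      have h5 := mul_le_mul_of_nonneg_left h3 hw0.le
      change ‖st.q i - e3‖ ^ 2 * w0 ≤ 2 * U
      linarith
    have h2 := pow_le_pow_left₀ hq0 h1 2
    rw [Real.sq_sqrt (by positivity), le_div_iff₀ hw0] at h2
    linarith
  have hUup : ∑ i, weight p i * (1 - st.q i ⬝ᵥ e3) ≤ (∑ i, weight p i) * (3 / 2 * P ^ 2) := by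
    rw [hU, Finset.sum_mul]
    refine Finset.sum_le_sum fun i _ ↦ mul_le_mul_of_nonneg_left ?_ (hp.weight_pos i).le
    have h1 := dot_self_le (st.q i - e3)
    have h2 := pow_le_pow_left₀ (norm_nonneg _) (norm_link_sub_le_posSize p st i) 2
    linarith
  have hKlow := hkin st.v (linkVel st)
  have hKup : massForm p st.v (linkVel st) ≤ (6 + 12 * n) * massTotal p * W ^ 2 := by
    rw [massForm]
    have h1 : st.v ⬝ᵥ baseMom p st.v (linkVel st) ≤ 3 * (W * (massTotal p * (2 * W))) :=
      (le_abs_self _).trans ((abs_dot_le _ _).trans (mul_le_mul_of_nonneg_left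
        (mul_le_mul (by rw [hWdef, velSize]; linarith) (h.norm_baseMom_le hp) (norm_nonneg _) hV)
        (by norm_num)))
    have h2 : ∀ i, linkVel st i ⬝ᵥ linkMom p st.v (linkVel st) i
        ≤ 3 * ((2 * W) * (massTotal p * (2 * W))) := fun i ↦
      (le_abs_self _).trans ((abs_dot_le _ _).trans (mul_le_mul_of_nonneg_left
        (mul_le_mul ((norm_le_pi_norm (linkVel st) i).trans (h.norm_linkVel_le.trans (by
          rw [hWdef, velSize]; linarith))) (h.norm_linkMom_le hp i) (norm_nonneg _) (by positivity))
        (by norm_num)))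
    have h3 := Finset.sum_le_card_nsmul Finset.univ _ _ fun i _ ↦ h2 i
    rw [Finset.card_univ, Fintype.card_fin, nsmul_eq_mul] at h3
    linarith
  have hWsq : W ^ 2 ≤ 8 * (‖st.v‖ ^ 2 + ‖linkVel st‖ ^ 2) := by
    have h1 := pow_le_pow_left₀ ho0 h.norm_omega_le 2
    rw [hWdef, velSize]
    nlinarith [sq_nonneg (‖st.v‖ - ‖st.ω‖), sq_nonneg ‖st.v‖]
  have hPsq : P ^ 2 ≤ 2 * ‖st.x - p.xd‖ ^ 2 + 2 * ‖st.q - fun _ ↦ e3‖ ^ 2 := by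
    rw [hPdef, posSize]
    nlinarith [sq_nonneg (‖st.x - p.xd‖ - ‖st.q - fun _ ↦ e3‖)]
  have hxlow := norm_sq_le_dot_self (st.x - p.xd)
  have hxup : (st.x - p.xd) ⬝ᵥ (st.x - p.xd) ≤ 3 * P ^ 2 := by
    have h1 := dot_self_le (st.x - p.xd)
    have h2 := pow_le_pow_left₀ hx0 (show ‖st.x - p.xd‖ ≤ P by rw [hPdef, posSize]; linarith) 2
    linarith
  have hc := abs_le.1 hcross
  rw [transLyap]
  constructor
  · have e1 : cm * W ^ 2 ≤ 1 / 2 * massForm p st.v (linkVel st) := by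
      have h1 := mul_le_mul_of_nonneg_left hWsq hcm0.le
      have h2 := mul_le_mul_of_nonneg_right hcm1
        (by positivity : 0 ≤ 8 * (‖st.v‖ ^ 2 + ‖linkVel st‖ ^ 2))
      linarith
    have e2 : cm * P ^ 2 ≤ 1 / 2 * ((st.x - p.xd) ⬝ᵥ (st.x - p.xd))
        + ∑ i, weight p i * (1 - st.q i ⬝ᵥ e3) := by
      have h1 := mul_le_mul_of_nonneg_left hPsq hcm0.le
      have h2 := mul_le_mul_of_nonneg_right hcm2 (sq_nonneg ‖st.x - p.xd‖)
      have h3 := mul_le_mul_of_nonneg_right hcm3 (sq_nonneg ‖st.q - fun _ ↦ e3‖)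
      linarith
    linarith
  · have e1 : 0 ≤ (3 + 6 * n) * massTotal p * P ^ 2 := by positivity
    have e2 : 0 ≤ (3 / 2 + 3 / 2 * ∑ i, weight p i) * W ^ 2 := by positivity
    have e3 : 0 ≤ cm / 2 * (P ^ 2 + W ^ 2) := by positivity
    linarith

/-- Decay of the translational Lyapunov function near the hanging configuration, up to the square
of the thrust deviation `d`. -/
theorem Params.Physical.exists_decay (hp : p.Physical) (Y : Matrix (XIdx n) (XIdx n) ℝ) {ε₀ c : ℝ}
    (hε₀ : 0 < ε₀) (hc : 0 < c)
    (hdiss : ∀ κ, 1 ≤ κ → ∀ pos vel : XIdx n → ℝ,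
      κ / 6 * absSum (vel ∘ Sum.inl) ^ 2 + ε₀ / κ * c * (absSum pos + absSum vel) ^ 2
        ≤ dissRate p Y ε₀ κ pos vel) :
    ∃ r > 0, ∃ b ≥ 0, ∀ κ, 1 ≤ κ → ∀ st : State n, st.Valid → ‖st.q - (fun _ ↦ e3)‖ ≤ 1 / 2 →
      posSize p st ≤ r → ∀ d : V3,
      -dissRate p Y ε₀ κ (posErr p st) (velErr st) + st.v ⬝ᵥ d
        + ε₀ / κ * (posErr p st ⬝ᵥ (Y *ᵥ baseForce d)) + ε₀ / κ * crossRem p Y st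
      ≤ -(ε₀ / κ * (c / 18) * (posSize p st ^ 2 + velSize st ^ 2)) + b * (d ⬝ᵥ d) := by
  obtain ⟨cr, hcr, hrem⟩ := hp.exists_crossRem_bound Y
  set B := absSumMat Y with hBdef
  have hB : 0 ≤ B := absSumMat_nonneg Y
  -- For positions below this radius the third-order remainder is at most `c / 4 * W ^ 2`. The
  -- number `27 / 2` completes the square of `3 * A * ‖d‖` against `κ / 6 * A ^ 2`, the other
  -- summand that of the cross term. Neither the radius nor the factor depends on `κ`.
  refine ⟨c / (36 * (cr + 1)), by positivity, 27 / 2 + ε₀ * (9 * B ^ 2 / c), by positivity,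
    fun κ hκ st h hq hr d ↦ ?_⟩
  have hκ0 : 0 < κ := by linarith
  set ε := ε₀ / κ with hε
  have hε0 : 0 < ε := by positivity
  have hε1 : ε ≤ ε₀ := div_le_self hε₀.le hκ
  set P := absSum (posErr p st) with hPdef
  set W := absSum (velErr st) with hWdef
  have hP : 0 ≤ P := absSum_nonneg _
  have hW : 0 ≤ W := absSum_nonneg _
  have hd0 := norm_nonneg d
  have hdd := norm_sq_le_dot_self d
  have h1 := hdiss κ hκ (posErr p st) (velErr st)
  rw [← hε] at h1
  set A := absSum (velErr st ∘ Sum.inl : V3) with hAdef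
  have hA : 0 ≤ A := absSum_nonneg _
  have hvA : ‖st.v‖ ≤ A :=
    (pi_norm_le_iff_of_nonneg hA).2 fun i ↦ abs_le_absSum (velErr st ∘ Sum.inl : V3) i
  have h2 : st.v ⬝ᵥ d ≤ κ / 6 * A ^ 2 + 27 / 2 * (d ⬝ᵥ d) := by
    have k1 := (le_abs_self _).trans (abs_dot_le st.v d)
    have k2 := mul_le_mul_of_nonneg_right hvA hd0
    have k3 := mul_le_mul_of_nonneg_right hκ (sq_nonneg A)
    nlinarith [sq_nonneg (A - 9 * ‖d‖)]
  have h3 : ε * (posErr p st ⬝ᵥ (Y *ᵥ baseForce d))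
      ≤ ε * (c / 4 * P ^ 2) + ε₀ * (9 * B ^ 2 / c) * (d ⬝ᵥ d) := by
    have k1 := (le_abs_self _).trans (abs_dotProduct_mulVec_le Y (posErr p st) (baseForce d))
    have k2 : absSum (baseForce (n := n) d) ≤ 3 * ‖d‖ := by
      rw [absSum_baseForce]
      have := absSum_le_card_mul (abs_apply_le_norm d)
      simpa using this
    have k3 : B * (P * (3 * ‖d‖)) ≤ c / 4 * P ^ 2 + 9 * B ^ 2 / c * ‖d‖ ^ 2 := by
      have : 0 ≤ c / 4 * (P - 6 * B / c * ‖d‖) ^ 2 := by positivity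
      have e : c / 4 * (P - 6 * B / c * ‖d‖) ^ 2
          = c / 4 * P ^ 2 + 9 * B ^ 2 / c * ‖d‖ ^ 2 - B * (P * (3 * ‖d‖)) := by
        field_simp
        ring
      linarith
    have k4 : posErr p st ⬝ᵥ (Y *ᵥ baseForce d) ≤ c / 4 * P ^ 2 + 9 * B ^ 2 / c * ‖d‖ ^ 2 :=
      k1.trans ((mul_le_mul_of_nonneg_left (mul_le_mul_of_nonneg_left k2 hP) hB).trans k3)
    have k5 : 9 * B ^ 2 / c * ‖d‖ ^ 2 ≤ 9 * B ^ 2 / c * (d ⬝ᵥ d) :=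
      mul_le_mul_of_nonneg_left hdd (by positivity)
    have k6 := mul_le_mul_of_nonneg_left (k4.trans (add_le_add_right k5 _)) hε0.le
    have k7 : 0 ≤ 9 * B ^ 2 / c * (d ⬝ᵥ d) := mul_nonneg (by positivity) (dot_self_nonneg d)
    have k8 := mul_le_mul_of_nonneg_right hε1 k7
    linarith
  have hPs := h.posSize_le (p := p) hq
  have hVs := h.velSize_le hq
  have hP0 := posSize_nonneg p st
  have hV0 := velSize_nonneg st
  have h4 : ε * crossRem p Y st ≤ ε * (c / 4 * W ^ 2) := by
    refine mul_le_mul_of_nonneg_left ((le_abs_self _).trans ((hrem st h).trans ?_)) hε0.le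
    have k1 : posSize p st * (36 * (cr + 1)) ≤ c := by rwa [← le_div_iff₀ (by positivity)]
    have k2 : cr * posSize p st ≤ c / 36 := by nlinarith
    have k3 := pow_le_pow_left₀ hV0 hVs 2
    calc cr * (posSize p st * velSize st ^ 2) = (cr * posSize p st) * velSize st ^ 2 := by ring
      _ ≤ c / 36 * (3 * W) ^ 2 := mul_le_mul k2 k3 (sq_nonneg _) (by positivity)
      _ = c / 4 * W ^ 2 := by ring
  have h5 : ε * (c / 18) * (posSize p st ^ 2 + velSize st ^ 2)
      ≤ ε * c * (P + W) ^ 2 - ε * (c / 4 * P ^ 2) - ε * (c / 4 * W ^ 2) := by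
    have k1 := pow_le_pow_left₀ hP0 hPs 2
    have k2 := pow_le_pow_left₀ hV0 hVs 2
    have k3 : 0 ≤ ε * c := by positivity
    have k4 : posSize p st ^ 2 + velSize st ^ 2 ≤ 9 * (P ^ 2 + W ^ 2) := by linarith
    have k5 := mul_le_mul_of_nonneg_left k4 k3
    have k6 : 0 ≤ ε * c * (P * W) := by positivity
    have k7 : 0 ≤ ε * c * (P ^ 2 + W ^ 2) := by positivity
    linarith
  linarith

/-- The accelerations are bounded in terms of the force. -/
theorem Params.Physical.exists_acceleration_bound (hp : p.Physical) :
    ∃ c > 0, ∀ (q : Fin n → V3) (a : V3) (b : Fin n → V3) (W : ℝ), 0 ≤ W →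
      (∀ i, q i ⬝ᵥ q i = 1) →
      (∀ i, crossProduct (q i) (linkMom p a b i - weight p i • e3) = 0) →
      (∀ i, |b i ⬝ᵥ q i| ≤ W) → ‖a‖ + ‖b‖ ≤ c * (1 + ‖baseMom p a b‖ + W) := by
  obtain ⟨ck, hck, hkin⟩ := hp.exists_massForm_bound
  have hm := hp.massTotal_nonneg
  have hws : 0 ≤ ∑ i, weight p i := Finset.sum_nonneg fun i _ ↦ (hp.weight_pos i).le
  set m := massTotal p with hmdef
  set g := ∑ i, weight p i with hg
  set C := 3 + n * (3 * m + 3 * g) with hC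
  have hC0 : 0 ≤ C := by positivity
  refine ⟨2 * C / ck + 1, by positivity, fun q a b W hW hq hl hb ↦ ?_⟩
  have ha0 := norm_nonneg a
  have hb0 := norm_nonneg b
  set X := ‖a‖ + ‖b‖ with hX
  have hX0 : 0 ≤ X := by positivity
  set F := ‖baseMom p a b‖ with hF
  have hF0 : 0 ≤ F := norm_nonneg _
  -- If the bound fails, then `X ≥ 1`, so terms without a factor `X` may be multiplied by it. The
  -- energy inequality becomes `ck / 2 * X ^ 2 ≤ C * (X * N)`, which bounds `X`.
  by_contra! hcon
  set N := 1 + F + W with hN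
  have hN1 : 1 ≤ N := by linarith
  have hCN : 0 ≤ 2 * C / ck * N := by positivity
  have hX1 : 1 ≤ X := by linarith
  have h1 := hkin a b
  have h2 : a ⬝ᵥ baseMom p a b ≤ 3 * (X * F) :=
    (le_abs_self _).trans ((abs_dot_le _ _).trans (mul_le_mul_of_nonneg_left
      (mul_le_mul_of_nonneg_right (by linarith) hF0) (by norm_num)))
  have h3 : ∀ i, b i ⬝ᵥ linkMom p a b i ≤ 3 * g * X + 3 * (m * X + g) * W := by
    intro i
    set L := linkMom p a b i - weight p i • e3 with hL
    have hgi : weight p i ≤ g :=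
      Finset.single_le_sum (fun i _ ↦ (hp.weight_pos i).le) (Finset.mem_univ i)
    -- The constraint force is along the link, so its product with `b i` involves only the component
    -- of `b i` along `q i`, which is bounded by `W`.
    have k1 : L = (q i ⬝ᵥ L) • q i := by
      have := cross_cross_dot (q i) (q i) L
      rw [hl i, map_zero, hq i, one_smul] at this
      exact (sub_eq_zero.1 this.symm).symm
    have k2 : linkMom p a b i = (q i ⬝ᵥ L) • q i + weight p i • e3 := by
      rw [← k1, hL, sub_add_cancel]
    have hbi : ‖b i‖ ≤ X := (norm_le_pi_norm b i).trans (by linarith)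
    have hqn : ‖q i‖ ≤ 1 := by
      have := norm_sq_le_dot_self (q i)
      rw [hq i] at this
      exact (sq_le_one_iff₀ (norm_nonneg _)).1 this
    have hLn : ‖L‖ ≤ m * X + g := by
      have j1 := hp.norm_linkMom_le a b i
      have j2 : ‖weight p i • e3‖ ≤ g := by
        rw [norm_smul, Real.norm_of_nonneg (hp.weight_pos i).le]
        nlinarith [norm_e3, (hp.weight_pos i).le]
      exact (norm_sub_le _ _).trans (add_le_add j1 j2)
    have k3 : |q i ⬝ᵥ L| ≤ 3 * (m * X + g) := by
      have := mul_le_mul hqn hLn (norm_nonneg _) zero_le_one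
      linarith [abs_dot_le (q i) L]
    have k4 : weight p i * (b i ⬝ᵥ e3) ≤ 3 * g * X := by
      have j1 : b i ⬝ᵥ e3 ≤ 3 * X := by
        have := mul_le_mul hbi norm_e3 (norm_nonneg _) hX0
        linarith [(le_abs_self _).trans (abs_dot_le (b i) e3)]
      have j2 := mul_le_mul_of_nonneg_left j1 (hp.weight_pos i).le
      have j3 := mul_le_mul_of_nonneg_right hgi hX0
      linarith
    have k5 : (q i ⬝ᵥ L) * (b i ⬝ᵥ q i) ≤ 3 * (m * X + g) * W := by
      refine (le_abs_self _).trans ?_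
      rw [abs_mul]
      exact mul_le_mul k3 (hb i) (abs_nonneg _) (by positivity)
    rw [k2, dotProduct_add, dotProduct_smul, dotProduct_smul, smul_eq_mul, smul_eq_mul]
    linarith
  have h4 := Finset.sum_le_card_nsmul Finset.univ _ _ fun i _ ↦ h3 i
  rw [Finset.card_univ, Fintype.card_fin, nsmul_eq_mul] at h4
  have h5 : massForm p a b ≤ 3 * (X * F) + n * (3 * g * X + 3 * (m * X + g) * W) := add_le_add h2 h4
  have h6 : ck / 2 * X ^ 2 ≤ ck * (‖a‖ ^ 2 + ‖b‖ ^ 2) := by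
    rw [hX]
    nlinarith [sq_nonneg (‖a‖ - ‖b‖)]
  have hn0 : (0 : ℝ) ≤ n := Nat.cast_nonneg n
  have h7 : 3 * (X * F) + n * (3 * g * X + 3 * (m * X + g) * W) ≤ C * (X * N) := by
    have j1 : 3 * g * X + 3 * (m * X + g) * W ≤ (3 * m + 3 * g) * (X * N) := by
      have i1 : 0 ≤ g * W * (X - 1) := mul_nonneg (by positivity) (by linarith)
      have i2 : 0 ≤ g * X * F := by positivity
      have i3 : 0 ≤ m * X * (1 + F) := by positivity
      rw [hN]
      linarith
    have j2 := mul_le_mul_of_nonneg_left j1 hn0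
    have j3 : X * F ≤ X * N := mul_le_mul_of_nonneg_left (by linarith) hX0
    rw [hC]
    linarith
  have h8 : ck / 2 * X ^ 2 ≤ C * (X * N) := by linarith
  have h9 : ck / 2 * X ≤ C * N := by
    have : X * (ck / 2 * X) ≤ X * (C * N) := by linarith
    exact le_of_mul_le_mul_left this (by linarith)
  have h10 : X ≤ 2 * C / ck * N := by
    rw [div_mul_eq_mul_div, le_div_iff₀ hck]
    linarith
  linarith

end Estimates

end QuadCable

namespace QuadCable

/-! ### Choice of the parameters -/

section Tuning

variable {n : ℕ} {p : Params n}

theorem link_force_eq {q L : V3} {g : ℝ} (hq : q ⬝ᵥ q = 1)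
    (h : crossProduct q (L - g • e3) = 0) : L = (q ⬝ᵥ (L - g • e3)) • q + g • e3 := by
  have := cross_cross_dot q q (L - g • e3)
  rw [h, map_zero, hq, one_smul] at this
  exact sub_eq_iff_eq_add.1 (sub_eq_zero.1 this.symm).symm

/-- All masses except the quadrotor hang on the first link, so `baseMom - m • a` is the force
transmitted through it. -/
theorem linkMom_first {n : ℕ} (p : Params (n + 1)) (a : V3) (b : Fin (n + 1) → V3) :
    linkMom p a b 0 = p.l 0 • (baseMom p a b - p.m • a) := by
  have h0 : outerMass p 0 = M00 p - p.m := by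
    have : Finset.Ici (0 : Fin (n + 1)) = Finset.univ := by
      ext i
      simp
    rw [outerMass, this, M00]
    ring
  have h1 : ∀ j, Mij p 0 j = p.l 0 * M0 p j := by
    intro j
    rw [Mij, M0, max_eq_right (Fin.zero_le j)]
    ring
  simp only [linkMom, baseMom, h1, M0, h0, smul_add, smul_sub, Finset.smul_sum, smul_smul]
  rw [add_sub_right_comm, ← sub_smul]
  congr 2
  ring

/-- Near the hanging configuration each component of the acceleration is nearly a multiple of the
force. -/
theorem Params.Physical.exists_acceleration_close (hp : p.Physical) {F η : ℝ} (hF : 0 < F)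
    (hη : 0 < η) :
    ∃ r > 0, ∀ (st : State n) (a : V3) (b : Fin n → V3), st.Valid →
      (∀ i, crossProduct (st.q i) (linkMom p a b i - weight p i • e3) = 0) →
      (∀ i, b i ⬝ᵥ st.q i = -(st.ω i ⬝ᵥ st.ω i)) → posSize p st ≤ r → velSize st ≤ r →
      ‖baseMom p a b‖ ≤ F → ∀ h, ∃ μ, 0 < μ ∧ μ ≤ M00 p ∧ |μ * a h - baseMom p a b h| ≤ η := by
  obtain ⟨c, hc, hacc⟩ := hp.exists_acceleration_bound
  have hm := hp.massTotal_nonneg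
  set X := c * (4 + F) with hX
  have hX0 : 0 < X := by positivity
  have hkn : ∀ i, 0 ≤ 3 * (massTotal p * X + weight p i) / p.l i := fun i ↦ by
    have := hp.weight_pos i
    have := hp.l_pos i
    positivity
  have hks : 0 ≤ ∑ i, 3 * (massTotal p * X + weight p i) / p.l i :=
    Finset.sum_nonneg fun i _ ↦ hkn i
  set K := 1 + massTotal p * (3 * (1 + X)) + ∑ i, 3 * (massTotal p * X + weight p i) / p.l i with hK
  have hK0 : 0 < K := by positivity
  refine ⟨min 1 (η / K), by positivity, fun st a b h hl hb hP hV hFb j ↦ ?_⟩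
  have hP0 := posSize_nonneg p st
  have hV0 := velSize_nonneg st
  have hV1 : velSize st ≤ 1 := hV.trans (min_le_left _ _)
  have hPK : posSize p st * K ≤ η := by
    rw [← le_div_iff₀ hK0]
    exact hP.trans (min_le_right _ _)
  set r := min 1 (η / K) with hr
  have hr0 : 0 < r := by positivity
  have hrK : r * K ≤ η := by
    rw [← le_div_iff₀ hK0]
    exact min_le_right _ _
  have hbq : ∀ i, |b i ⬝ᵥ st.q i| ≤ 3 * r := by
    intro i
    rw [hb i, abs_neg, abs_of_nonneg (dot_self_nonneg _)]
    have k1 := dot_self_le (st.ω i)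
    have k2 := pow_le_pow_left₀ (norm_nonneg _) (norm_omega_le_velSize st i) 2
    nlinarith
  have hab : ‖a‖ + ‖b‖ ≤ X := by
    refine (hacc st.q a b 3 (by norm_num) h.q_unit hl fun i ↦ ?_).trans ?_
    · have : r ≤ 1 := min_le_left _ _
      linarith [hbq i]
    · rw [hX]
      exact mul_le_mul_of_nonneg_left (by linarith) hc.le
  have hbi : ∀ i, ‖b i‖ ≤ X := fun i ↦
    (norm_le_pi_norm b i).trans (by linarith [norm_nonneg a])
  -- Horizontally, quadrotor and cable exchange force only through the first link, which is nearly
  -- vertical. To leading order the force accelerates the quadrotor alone, whence `μ = m`. Without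
  -- links, `baseMom` is exactly `M00 • a`.
  have hhor : ∀ j, e3 j = 0 → ∃ μ, 0 < μ ∧ μ ≤ M00 p ∧ |μ * a j - baseMom p a b j| ≤ η := by
    intro j hj
    rcases n with _ | n
    · refine ⟨M00 p, hp.M00_pos, le_rfl, ?_⟩
      simp [baseMom, hη.le]
    · refine ⟨p.m, hp.m_pos, ?_, ?_⟩
      · rw [M00]
        linarith [Finset.sum_nonneg fun i (_ : i ∈ Finset.univ) ↦ (hp.mL_pos i).le]
      · have k1 := link_force_eq (h.q_unit 0) (hl 0)
        set ν := st.q 0 ⬝ᵥ (linkMom p a b 0 - weight p 0 • e3) with hν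
        have k2 := congrFun k1 j
        rw [linkMom_first] at k2
        simp only [Pi.smul_apply, Pi.add_apply, Pi.sub_apply, smul_eq_mul, hj, mul_zero,
          add_zero] at k2
        have hw := hp.weight_pos 0
        have k3 : |ν| ≤ 3 * (massTotal p * X + weight p 0) := by
          have j1 : ‖linkMom p a b 0 - weight p 0 • e3‖ ≤ massTotal p * X + weight p 0 := by
            refine (norm_sub_le _ _).trans (add_le_add ((hp.norm_linkMom_le a b 0).trans
              (mul_le_mul_of_nonneg_left hab hm)) ?_)
            rw [norm_smul, Real.norm_of_nonneg hw.le]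
            nlinarith [norm_e3]
          have j2 := mul_le_mul (h.norm_q_le 0) j1 (norm_nonneg _) zero_le_one
          linarith [abs_dot_le (st.q 0) (linkMom p a b 0 - weight p 0 • e3)]
        have k4 : |st.q 0 j| ≤ r := by
          have j1 := (abs_apply_le_norm (st.q 0 - e3) j).trans (norm_link_sub_le_posSize p st 0)
          rw [Pi.sub_apply, hj, sub_zero] at j1
          exact j1.trans hP
        have hl0 := hp.l_pos 0
        have k5 : p.l 0 * |p.m * a j - baseMom p a b j|
            ≤ 3 * (massTotal p * X + weight p 0) * r := by
          rw [abs_sub_comm, ← abs_of_pos hl0, ← abs_mul, k2, abs_mul]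
          exact mul_le_mul k3 k4 (abs_nonneg _) (by positivity)
        have k6 : |p.m * a j - baseMom p a b j|
            ≤ 3 * (massTotal p * X + weight p 0) / p.l 0 * r := by
          rw [div_mul_eq_mul_div, le_div_iff₀ hl0]
          linarith
        have k7 : 3 * (massTotal p * X + weight p 0) / p.l 0 ≤ K := by
          have := Finset.single_le_sum (fun i _ ↦ hkn i) (Finset.mem_univ 0)
          have : 0 ≤ massTotal p * (3 * (1 + X)) := by positivity
          linarith
        have := mul_le_mul_of_nonneg_right k7 hr0.le
        linarith
  fin_cases j
  · exact hhor 0 rfl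
  · exact hhor 1 rfl
  -- Vertically all masses move together: `b i` has the small component `-|ω i| ^ 2` along `q i`,
  -- and `q i` is close to `e3`.
  · refine ⟨M00 p, hp.M00_pos, le_rfl, ?_⟩
    have k1 : M00 p * a 2 - baseMom p a b 2 = -∑ i, M0 p i * b i 2 := by
      simp [baseMom]
    change |M00 p * a 2 - baseMom p a b 2| ≤ η
    rw [k1, abs_neg]
    have k2 : ∀ i, |b i 2| ≤ 3 * (1 + X) * r := by
      intro i
      have j1 : b i 2 = b i ⬝ᵥ st.q i - b i ⬝ᵥ (st.q i - e3) := by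
        rw [dotProduct_sub]
        simp [e3, dotProduct, Fin.sum_univ_three]
      rw [j1]
      have j2 := abs_dot_le (b i) (st.q i - e3)
      have j3 := mul_le_mul (hbi i) ((norm_link_sub_le_posSize p st i).trans hP)
        (norm_nonneg _) hX0.le
      linarith [abs_sub (b i ⬝ᵥ st.q i) (b i ⬝ᵥ (st.q i - e3)), hbq i]
    have k3 : |∑ i, M0 p i * b i 2| ≤ (∑ i, M0 p i) * (3 * (1 + X) * r) := by
      rw [Finset.sum_mul]
      refine (Finset.abs_sum_le_sum_abs _ _).trans (Finset.sum_le_sum fun i _ ↦ ?_)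
      rw [abs_mul, abs_of_pos (hp.M0_pos i)]
      exact mul_le_mul_of_nonneg_left (k2 i) (hp.M0_pos i).le
    have k4 : ∑ i, M0 p i ≤ massTotal p := by
      have h4 : 0 ≤ ∑ i, ∑ j, Mij p i j :=
        Finset.sum_nonneg fun i _ ↦ Finset.sum_nonneg fun j _ ↦ (hp.Mij_pos i j).le
      rw [massTotal]
      linarith [hp.M00_pos]
    have k5 := mul_le_mul_of_nonneg_right k4 (by positivity : 0 ≤ 3 * (1 + X) * r)
    have k6 : massTotal p * (3 * (1 + X)) ≤ K := by linarith
    have k7 := mul_le_mul_of_nonneg_right k6 hr0.le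
    linarith

/-- Parameters of the design. -/
structure Tuning where
  Y : ℕ → ℕ → ℝ
  ε₀ : ℝ
  κ : ℝ
  kz : ℝ
  kI : ℝ
  c2 : ℝ
  /-- weight of the attitude in the Lyapunov function -/
  lam : ℝ

variable (p) in
/-- The gains of the design. -/
noncomputable def Tuning.gains (T : Tuning) (δ : ℝ) : Gains n :=
  design p (crossMat n T.Y) T.ε₀ T.κ T.kz T.kI T.c2 δ

variable (p) in
/-- Lyapunov function of the closed loop. -/
noncomputable def Tuning.lyap (T : Tuning) (Δx ΔR : V3) (st : State n) (w : V3) : ℝ :=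
  transLyap p (crossMat n T.Y) (T.ε₀ / T.κ) T.kz Δx st
    + T.lam * attLyap p.J T.c2 T.kI ΔR st.R w st.eI

variable (p) in
/-- The resultant of the ideal thrust, the weight and the disturbance. -/
noncomputable def Tuning.forceGap (T : Tuning) (Δx : V3) (st : State n) : V3 :=
  integralGap T.kz Δx st - T.κ • st.v - (st.x - p.xd)

/-- Level of the Lyapunov function that bounds the region of the analysis. -/
noncomputable def Tuning.level (T : Tuning) (δ : ℝ) : ℝ := 7 / 4 * δ ^ 2 / T.kz

variable (p) in
/-- Size of the tracking errors. -/
noncomputable def sizeSq (st : State n) (w : V3) : ℝ :=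
  posSize p st ^ 2 + velSize st ^ 2 + w ⬝ᵥ w + attErr st.R

variable (p) in
/-- Requirements on the parameters for the disturbance bounds `δ` and `δR` and the margin `η`. -/
structure Tuning.Good (T : Tuning) (δ δR η : ℝ) : Prop where
  Y_pos : 0 < T.Y 0 0
  ε₀_pos : 0 < T.ε₀
  κ_pos : 0 < T.κ
  kz_pos : 0 < T.kz
  kI_pos : 0 < T.kI
  c2_pos : 0 < T.c2
  lam_pos : 0 < T.lam
  admissible : (T.gains p δ).Admissible p δ
  coercive : ∃ c > 0, ∃ b > 0, ∀ (Δx ΔR : V3) (st : State n) (w : V3), st.Valid →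
    c * sizeSq p st w + (2 * T.kz)⁻¹ * (integralGap T.kz Δx st ⬝ᵥ integralGap T.kz Δx st)
        + T.lam * (T.kI / 2 * ((st.eI - T.kI⁻¹ • ΔR) ⬝ᵥ (st.eI - T.kI⁻¹ • ΔR)))
      ≤ T.lyap p Δx ΔR st w ∧
    T.lyap p Δx ΔR st w ≤
      b * sizeSq p st w + (2 * T.kz)⁻¹ * (integralGap T.kz Δx st ⬝ᵥ integralGap T.kz Δx st)
        + T.lam * (T.kI / 2 * ((st.eI - T.kI⁻¹ • ΔR) ⬝ᵥ (st.eI - T.kI⁻¹ • ΔR)))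
  small : ∀ (Δx ΔR : V3) (st : State n) (w : V3), ‖Δx‖ ≤ δ → st.Valid →
    T.lyap p Δx ΔR st w ≤ T.level δ →
      posSize p st ≤ 1 / 2 ∧ velSize st ≤ 1 ∧ attErr st.R ≤ 1 ∧
        ∀ i, |st.ex (Sum.inl i)| ≤ 4 * δ / T.kz
  decay : ∃ c > 0, ∀ (Δx ΔR : V3) (s : ℝ → State n) (w : ℝ → V3) (t : ℝ) (a : V3) (b : Fin n → V3)
    (d w' : V3), 0 ≤ t → ‖Δx‖ ≤ δ → ReducedAt p (T.gains p δ) Δx ΔR s w t a b d w' →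
    T.lyap p Δx ΔR (s t) (w t) ≤ T.level δ → ‖T.forceGap p Δx (s t)‖ ≤ δ + 1 →
    ∃ V', HasDerivWithinAt (fun τ ↦ T.lyap p Δx ΔR (s τ) (w τ)) V' (Ici 0) t ∧
      V' ≤ -(c * sizeSq p (s t) (w t))
  -- The Lyapunov function makes the velocity small, but not `κ` times the velocity, since `κ` is
  -- chosen last and large. The barrier controls the force that contains this product, component by
  -- component.
  barrier : ∀ (Δx ΔR : V3) (s : ℝ → State n) (w : ℝ → V3) (t : ℝ) (a : V3) (b : Fin n → V3)
    (d w' : V3), 0 ≤ t → ‖Δx‖ ≤ δ → ReducedAt p (T.gains p δ) Δx ΔR s w t a b d w' →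
    T.lyap p Δx ΔR (s t) (w t) ≤ T.level δ → ‖T.forceGap p Δx (s t)‖ ≤ δ + 1 →
    ∃ g', HasDerivWithinAt (fun τ ↦ T.forceGap p Δx (s τ)) g' (Ici 0) t ∧
      ∀ i, (η ≤ T.forceGap p Δx (s t) i → g' i < 0) ∧ (T.forceGap p Δx (s t) i ≤ -η → 0 < g' i)
  start : ∃ ρ > 0, ∀ (Δx ΔR : V3) (st : State n) (w : V3), ‖Δx‖ ≤ δ → ‖ΔR‖ ≤ δR → st.Valid →
    st.ex = 0 → st.eI = 0 → sizeSq p st w < ρ → T.lyap p Δx ΔR st w < T.level δ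

/-- The identity `linkVel ⬝ᵥ q = 0` is differentiated. -/
theorem ReducedAt.dot_q {k : Gains n} {Δx ΔR : V3} {s : ℝ → State n} {w : ℝ → V3} {t : ℝ}
    {a : V3} {b : Fin n → V3} {d w' : V3} (h : ReducedAt p k Δx ΔR s w t a b d w') (ht : 0 ≤ t)
    (i : Fin n) : b i ⬝ᵥ (s t).q i = -((s t).ω i ⬝ᵥ (s t).ω i) := by
  have h1 := hasDerivWithinAt_dot (h.linkVel_deriv i) (h.q_deriv i)
  have h2 : (fun τ ↦ linkVel (s τ) i ⬝ᵥ (s τ).q i) = fun _ ↦ 0 := by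
    ext τ
    rw [linkVel, dotProduct_comm, dot_cross_self]
  rw [h2] at h1
  have h3 := (uniqueDiffOn_Ici (0 : ℝ) t ht).eq_deriv _ h1 (hasDerivWithinAt_const t (Ici 0) 0)
  rw [h.valid.linkVel_dot_self] at h3
  linarith

theorem Tuning.idealThrust_eq (T : Tuning) {δ : ℝ} {Δx : V3} {st : State n}
    (hsat : ∀ i, |st.ex (Sum.inl i)| ≤ 4 * δ / T.kz) :
    idealThrust p (T.gains p δ) st = T.forceGap p Δx st - Δx - (M00 p * p.g) • e3 := by
  rw [Tuning.gains, idealThrust_design p _ _ _ _ _ _ _ hsat, Tuning.forceGap, integralGap]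
  abel

/-- Derivative of the resultant force along the closed loop. -/
theorem ReducedAt.hasDerivWithinAt_forceGap (hp : p.Physical) {T : Tuning} {δ : ℝ} {Δx ΔR : V3}
    {s : ℝ → State n} {w : ℝ → V3} {t : ℝ} {a : V3} {b : Fin n → V3} {d w' : V3}
    (h : ReducedAt p (T.gains p δ) Δx ΔR s w t a b d w') :
    HasDerivWithinAt (fun τ ↦ T.forceGap p Δx (s τ))
      (-(T.kz • ((s t).v + (T.ε₀ / T.κ) • (((crossMat n T.Y)ᵀ *ᵥ posErr p (s t)) ∘ Sum.inl)))
        - T.κ • a - (s t).v) (Ici 0) t := by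
  have hex : HasDerivWithinAt (fun τ ↦ (s τ).ex)
      (velErr (s t) + (T.ε₀ / T.κ) • ((crossMat n T.Y)ᵀ *ᵥ posErr p (s t))) (Ici 0) t := by
    rw [← hp.integral_action]
    exact h.ex_deriv
  have hy : HasDerivWithinAt (fun τ ↦ integralGap T.kz Δx (s τ))
      (-(T.kz • ((s t).v + (T.ε₀ / T.κ) • (((crossMat n T.Y)ᵀ *ᵥ posErr p (s t)) ∘ Sum.inl))))
      (Ici 0) t := by
    rw [hasDerivWithinAt_pi] at hex ⊢
    intro i
    refine (((hex (Sum.inl i)).const_mul T.kz).const_sub (Δx i)).congr_deriv ?_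
    simp [velErr]
    ring
  exact (hy.sub (h.v_deriv.const_smul T.κ)).sub (h.x_deriv.sub_const p.xd)

set_option maxHeartbeats 1000000 in
/-- Parameters of the design that meet all requirements exist. -/
theorem Params.Physical.exists_tuning (hp : p.Physical) {δ δR η : ℝ} (hδ : 0 < δ) (hδR : 0 < δR)
    (hη : 0 < η) (hη1 : η ≤ 1) : ∃ T : Tuning, T.Good p δ δR η := by
  obtain ⟨Y, hY, rA, hrA, cA, hcA, hA⟩ := hp.exists_admissible
  obtain ⟨rV, hrV, cV, hcV, bV, hbV, hV⟩ := hp.exists_transLyap_bounds (crossMat n Y)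
  obtain ⟨c2, hc2, aR, haR, bR, hbR, hR⟩ := exists_attLyap_bounds hp.J_pos
  -- The order of the choices is `ε₀`, `A`, `lam`, the radius `rS`, the level `v`, `kz`, `kI`, `κ`.
  -- Nothing before `κ` depends on it, because the weight of the cross term is `ε₀ / κ ≤ ε₀` and the
  -- estimates hold for all `κ ≥ 1`.
  obtain ⟨ε₀, hε₀⟩ : ∃ x, x = min rA rV := ⟨_, rfl⟩
  have hε₀0 : 0 < ε₀ := by
    rw [hε₀]
    positivity
  have hεA : ε₀ ≤ rA := hε₀ ▸ min_le_left _ _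
  have hεV : ε₀ ≤ rV := hε₀ ▸ min_le_right _ _
  obtain ⟨rD, hrD, bD, hbD, hD⟩ := hp.exists_decay (crossMat n Y) hε₀0 hcA
    fun κ hκ ↦ (hA ε₀ hε₀0 hεA κ hκ).1
  obtain ⟨rB, hrB, hB⟩ := hp.exists_acceleration_close (F := δ + 2) (η := η / 4) (by positivity)
    (by positivity)
  have hM := hp.M00_pos
  have hg := hp.g_pos
  -- This bounds the squared length of the ideal thrust while the resultant force has norm at most
  -- `δ + 1`; the factor 3 converts the maximum norm.
  obtain ⟨A, hAdef⟩ : ∃ x, x = 3 * (2 * δ + 1 + M00 p * p.g) ^ 2 := ⟨_, rfl⟩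
  have hA0 : 0 < A := by
    rw [hAdef]
    positivity
  -- With this weight `lam * c2 / 4` exceeds `4 * bD * A`, the factor with which `attErr` enters
  -- through the deviation of the thrust.
  obtain ⟨lam, hlam⟩ : ∃ x, x = 16 * bD * A / c2 + 1 := ⟨_, rfl⟩
  have hlam0 : 0 < lam := by
    rw [hlam]
    positivity
  obtain ⟨rS, hrS⟩ : ∃ x, x = min (1 / 2) (min rD rB) := ⟨_, rfl⟩
  have hS1 : rS ≤ 1 / 2 := hrS ▸ min_le_left _ _
  have hSD : rS ≤ rD := hrS ▸ (min_le_right _ _).trans (min_le_left _ _)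
  have hSB : rS ≤ rB := hrS ▸ (min_le_right _ _).trans (min_le_right _ _)
  have hrS0 : 0 < rS := by
    rw [hrS]
    positivity
  -- Below the level `v` the sizes are at most `rS`, and `attErr` is so small that the deviation of
  -- the thrust is at most `η / 4`.
  obtain ⟨v, hv⟩ : ∃ x, x = min (cV * rS ^ 2) (lam * min (1 / 2) ((η / 4) ^ 2 / (8 * A))) := ⟨_, rfl⟩
  have v1 : v ≤ cV * rS ^ 2 := hv ▸ min_le_left _ _
  have v2 : v ≤ lam * min (1 / 2) ((η / 4) ^ 2 / (8 * A)) := hv ▸ min_le_right _ _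
  have hv0 : 0 < v := by
    rw [hv]
    positivity
  obtain ⟨kz, hkz⟩ : ∃ x, x = 7 / 4 * δ ^ 2 / v := ⟨_, rfl⟩
  have hkz0 : 0 < kz := by
    rw [hkz]
    positivity
  have hlevel : 7 / 4 * δ ^ 2 / kz = v := by
    rw [hkz]
    field_simp
  -- For `eI = 0` the integral energy of the attitude is then at most `δ ^ 2 / (8 * kz)`.
  obtain ⟨kI, hkI⟩ : ∃ x, x = 12 * lam * δR ^ 2 * kz / δ ^ 2 := ⟨_, rfl⟩
  have hkI0 : 0 < kI := by
    rw [hkI]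
    positivity
  have hYn := absSumMat_nonneg (crossMat n Y)
  have hdim := dim_nonneg n
  obtain ⟨Kb, hKb⟩ : ∃ x, x = kz * (1 + ε₀ * (absSumMat (crossMat n Y) * (2 * dim n * 3))) + 1 := ⟨_, rfl⟩
  have hKb0 : 0 < Kb := by
    rw [hKb]
    positivity
  -- `Kb` bounds all terms in the rate of the resultant force other than `-κ • a`; the latter has to
  -- dominate where a component of the force is at least `η` in absolute value.
  obtain ⟨κ, hκ⟩ : ∃ x, x = max 1 (4 * M00 p * Kb / η) := ⟨_, rfl⟩
  have hκ1 : 1 ≤ κ := hκ ▸ le_max_left _ _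
  have hκ0 : 0 < κ := by
    rw [hκ]
    positivity
  have hκ2 : 4 * M00 p * Kb ≤ κ * η := by
    rw [← div_le_iff₀ hη, hκ]
    exact le_max_right _ _
  obtain ⟨T, rfl, rfl, rfl, rfl, rfl, rfl, rfl⟩ : ∃ T : Tuning, T.Y = Y ∧ T.ε₀ = ε₀ ∧ T.κ = κ ∧
      T.kz = kz ∧ T.kI = kI ∧ T.c2 = c2 ∧ T.lam = lam :=
    ⟨⟨Y, ε₀, κ, kz, kI, c2, lam⟩, rfl, rfl, rfl, rfl, rfl, rfl, rfl⟩
  have hε1 : T.ε₀ / T.κ ≤ T.ε₀ := div_le_self hε₀0.le hκ1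
  have hεp : 0 < T.ε₀ / T.κ := by positivity
  have hbound : ∀ (Δx ΔR : V3) (st : State n) (w : V3), st.Valid →
      cV * (posSize p st ^ 2 + velSize st ^ 2) + T.lam * (aR * (w ⬝ᵥ w) + 1 / 2 * attErr st.R)
        + (2 * T.kz)⁻¹ * (integralGap T.kz Δx st ⬝ᵥ integralGap T.kz Δx st)
        + T.lam * (T.kI / 2 * ((st.eI - T.kI⁻¹ • ΔR) ⬝ᵥ (st.eI - T.kI⁻¹ • ΔR))) ≤ T.lyap p Δx ΔR st w ∧
      T.lyap p Δx ΔR st w ≤ bV * (posSize p st ^ 2 + velSize st ^ 2)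
        + T.lam * (bR * (w ⬝ᵥ w + attErr st.R))
        + (2 * T.kz)⁻¹ * (integralGap T.kz Δx st ⬝ᵥ integralGap T.kz Δx st)
        + T.lam * (T.kI / 2 * ((st.eI - T.kI⁻¹ • ΔR) ⬝ᵥ (st.eI - T.kI⁻¹ • ΔR))) := by
    intro Δx ΔR st w h
    have h1 := hV _ hεp.le (hε1.trans hεV) T.kz Δx st h
    have h2 := (hR st.R h.R_mem w).2 T.kI ΔR st.eI
    have h3 := mul_le_mul_of_nonneg_left h2.1 hlam0.le
    have h4 := mul_le_mul_of_nonneg_left h2.2 hlam0.le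
    have h5 : T.lyap p Δx ΔR st w = transLyap p (crossMat n T.Y) (T.ε₀ / T.κ) T.kz Δx st
      + T.lam * attLyap p.J T.c2 T.kI ΔR st.R w st.eI := rfl
    rw [h5]
    constructor <;> linarith [h1.1, h1.2]
  have hnn : ∀ (Δx ΔR : V3) (st : State n) (w : V3), st.Valid → 0 ≤ posSize p st ^ 2 ∧
      0 ≤ velSize st ^ 2 ∧ 0 ≤ w ⬝ᵥ w ∧ 0 ≤ attErr st.R ∧
      0 ≤ (2 * T.kz)⁻¹ * (integralGap T.kz Δx st ⬝ᵥ integralGap T.kz Δx st) ∧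
      0 ≤ T.lam * (T.kI / 2 * ((st.eI - T.kI⁻¹ • ΔR) ⬝ᵥ (st.eI - T.kI⁻¹ • ΔR))) := fun Δx ΔR st w h ↦
    ⟨sq_nonneg _, sq_nonneg _, dot_self_nonneg w, attErr_nonneg h.R_mem,
      mul_nonneg (by positivity) (dot_self_nonneg _),
      mul_nonneg hlam0.le (mul_nonneg (by positivity) (dot_self_nonneg _))⟩
  have hsmall : ∀ (Δx ΔR : V3) (st : State n) (w : V3), ‖Δx‖ ≤ δ → st.Valid →
      T.lyap p Δx ΔR st w ≤ v → posSize p st ≤ rS ∧ velSize st ≤ rS ∧ attErr st.R ≤ 1 ∧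
        8 * A * attErr st.R ≤ 2 * (η / 4) ^ 2 ∧ ∀ i, |st.ex (Sum.inl i)| ≤ 4 * δ / T.kz := by
    intro Δx ΔR st w hΔ h hl
    obtain ⟨n1, n2, n3, n4, n5, n6⟩ := hnn Δx ΔR st w h
    have h1 := (hbound Δx ΔR st w h).1
    have m1 : 0 ≤ T.lam * (aR * (w ⬝ᵥ w) + 1 / 2 * attErr st.R) := by positivity
    have m2 : 0 ≤ cV * (posSize p st ^ 2 + velSize st ^ 2) := by positivity
    have h2 : posSize p st ^ 2 + velSize st ^ 2 ≤ rS ^ 2 :=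
      le_of_mul_le_mul_left (by linarith) hcV
    have h3 : 1 / 2 * attErr st.R ≤ min (1 / 2) ((η / 4) ^ 2 / (8 * A)) := by
      refine le_of_mul_le_mul_left ?_ hlam0
      have : 0 ≤ T.lam * (aR * (w ⬝ᵥ w)) := by positivity
      linarith
    have h4 := h3.trans (min_le_left _ _)
    have h5 := h3.trans (min_le_right _ _)
    rw [le_div_iff₀ (by positivity)] at h5
    refine ⟨abs_le_of_sq_le_sq' (by linarith) hrS0.le |>.2,
      abs_le_of_sq_le_sq' (by linarith) hrS0.le |>.2, by linarith, by linarith, fun i ↦ ?_⟩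
    have h6 : (2 * T.kz)⁻¹ * (integralGap T.kz Δx st ⬝ᵥ integralGap T.kz Δx st) ≤ 7 / 4 * δ ^ 2 / T.kz := by
      rw [hlevel]
      linarith
    rw [inv_mul_le_iff₀ (by positivity)] at h6
    have h7 : 2 * T.kz * (7 / 4 * δ ^ 2 / T.kz) = 7 / 2 * δ ^ 2 := by
      field_simp
      ring
    rw [h7] at h6
    -- The level gives `|gap| ^ 2 ≤ 7 / 2 * δ ^ 2`. Together with `‖Δx‖ ≤ δ` the integral force is
    -- at most `3 * δ`, below saturation.
    have h8 : ‖integralGap T.kz Δx st‖ ≤ 2 * δ := by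
      refine abs_le_of_sq_le_sq' ?_ (by positivity) |>.2
      have h12 : (2 * δ) ^ 2 = 4 * δ ^ 2 := by ring
      linarith [norm_sq_le_dot_self (integralGap T.kz Δx st), sq_nonneg δ]
    have h9 := (abs_apply_le_norm _ i).trans h8
    have h10 := (abs_apply_le_norm Δx i).trans hΔ
    have h11 : integralGap T.kz Δx st i = Δx i - T.kz * st.ex (Sum.inl i) := by simp [integralGap]
    have h14 : |st.ex (Sum.inl i)| * T.kz = |T.kz * st.ex (Sum.inl i)| := by
      rw [abs_mul, abs_of_pos hkz0, mul_comm]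
    rw [le_div_iff₀ hkz0, h14]
    rw [h11] at h9
    have h12 := abs_le.1 h9
    have h13 := abs_le.1 h10
    exact abs_le.2 ⟨by linarith, by linarith⟩
  have hdev : ∀ (Δx ΔR : V3) (s : ℝ → State n) (w : ℝ → V3) (t : ℝ) (a : V3) (b : Fin n → V3)
      (d w' : V3), ‖Δx‖ ≤ δ → ReducedAt p (T.gains p δ) Δx ΔR s w t a b d w' →
      T.lyap p Δx ΔR (s t) (w t) ≤ v → ‖T.forceGap p Δx (s t)‖ ≤ δ + 1 →
      d ⬝ᵥ d ≤ 4 * A * attErr (s t).R := by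
    intro Δx ΔR s w t a b d w' hΔ h hl hG
    obtain ⟨-, -, -, -, hsat⟩ := hsmall Δx ΔR (s t) (w t) hΔ h.valid hl
    refine h.deviation.trans (mul_le_mul_of_nonneg_right ?_ (attErr_nonneg h.valid.R_mem))
    rw [T.idealThrust_eq (Δx := Δx) hsat]
    set B := T.forceGap p Δx (s t) - Δx - (M00 p * p.g) • e3 with hBdef
    have h1 : ‖B‖ ≤ 2 * δ + 1 + M00 p * p.g := by
      have k1 : ‖(M00 p * p.g) • e3‖ ≤ M00 p * p.g := by
        rw [norm_smul, Real.norm_of_nonneg (by positivity)]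
        exact mul_le_of_le_one_right (by positivity) norm_e3
      have k2 := norm_sub_le (T.forceGap p Δx (s t) - Δx) ((M00 p * p.g) • e3)
      have k3 := norm_sub_le (T.forceGap p Δx (s t)) Δx
      linarith
    have h2 := dot_self_le B
    have h3 := pow_le_pow_left₀ (norm_nonneg _) h1 2
    linarith
  refine ⟨T, hY, hε₀0, hκ0, hkz0, hkI0, hc2, hlam0,
    (hA T.ε₀ hε₀0 hεA T.κ hκ1).2 T.kz T.kI T.c2 δ hkz0 hkI0 hc2 hδ, ?_, ?_, ?_, ?_, ?_⟩
  · refine ⟨min cV (T.lam * min aR (1 / 2)), by positivity, bV + T.lam * bR, by positivity,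
      fun Δx ΔR st w h ↦ ?_⟩
    obtain ⟨n1, n2, n3, n4, n5, n6⟩ := hnn Δx ΔR st w h
    obtain ⟨h1, h2⟩ := hbound Δx ΔR st w h
    have k1 : min cV (T.lam * min aR (1 / 2)) ≤ cV := min_le_left _ _
    have k2 : min cV (T.lam * min aR (1 / 2)) ≤ T.lam * aR := (min_le_right _ _).trans
      (mul_le_mul_of_nonneg_left (min_le_left _ _) hlam0.le)
    have k3 : min cV (T.lam * min aR (1 / 2)) ≤ T.lam * (1 / 2) := (min_le_right _ _).trans
      (mul_le_mul_of_nonneg_left (min_le_right _ _) hlam0.le)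
    have j1 := mul_le_mul_of_nonneg_right k1 (add_nonneg n1 n2)
    have j2 := mul_le_mul_of_nonneg_right k2 n3
    have j3 := mul_le_mul_of_nonneg_right k3 n4
    have j4 : 0 ≤ bV * (w ⬝ᵥ w + attErr st.R) := by positivity
    have j5 : 0 ≤ T.lam * bR * (posSize p st ^ 2 + velSize st ^ 2) := by positivity
    rw [sizeSq]
    constructor
    · refine le_trans ?_ h1
      linarith
    · refine h2.trans ?_
      linarith
  · intro Δx ΔR st w hΔ h hl
    rw [Tuning.level, hlevel] at hl
    obtain ⟨h1, h2, h3, -, h5⟩ := hsmall Δx ΔR st w hΔ h hl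
    exact ⟨h1.trans hS1, by linarith, h3, h5⟩
  · refine ⟨min (T.ε₀ / T.κ * (cA / 18)) (min (T.lam / 2) (T.lam * T.c2 / 4)), by positivity,
      fun Δx ΔR s w t a b d w' ht hΔ h hl hG ↦ ?_⟩
    rw [Tuning.level, hlevel] at hl
    obtain ⟨h1, h2, h3, -, hsat⟩ := hsmall Δx ΔR (s t) (w t) hΔ h.valid hl
    obtain ⟨n1, n2, n3, n4, -, -⟩ := hnn Δx ΔR (s t) (w t) h.valid
    have hJ : p.Jᵀ = p.J := by
      simpa [Matrix.IsHermitian, conjTranspose_eq_transpose_of_trivial] using hp.J_pos.isHermitian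
    have hrot : p.J *ᵥ w' = -attVec (s t).R - w t - T.kI • (s t).eI + ΔR := by
      have := h.rotation
      simpa [Tuning.gains, design] using this
    have d1 := h.hasDerivWithinAt_transLyap hp hκ0.ne' hkz0.ne' hsat
    have d2 : HasDerivWithinAt
        (fun τ ↦ T.lam * attLyap p.J T.c2 T.kI ΔR (s τ).R (w τ) (s τ).eI)
        (T.lam * attRate p.J T.c2 (s t).R (w t)) (Ici 0) t := (hasDerivWithinAt_attLyap hJ hkI0.ne' h.R_deriv h.w_deriv hrot
      h.eI_deriv).const_mul T.lam
    refine ⟨_, d1.add d2, ?_⟩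
    have hq : ‖(s t).q - fun _ ↦ e3‖ ≤ 1 / 2 := by
      rw [posSize] at h1
      linarith [norm_nonneg ((s t).x - p.xd)]
    have e1 := hD T.κ hκ1 (s t) h.valid hq (h1.trans hSD) d
    have e2 := mul_le_mul_of_nonneg_left (hR (s t).R h.valid.R_mem (w t)).1 hlam0.le
    have e3 := mul_le_mul_of_nonneg_left (hdev Δx ΔR s w t a b d w' hΔ h hl hG) hbD
    have e4 := mul_le_mul_of_nonneg_left (attErr_le_attVec_dot_self h.valid.R_mem h3)
      (by positivity : 0 ≤ T.lam * (T.c2 / 2))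
    have e5 : T.lam * T.c2 / 4 = 4 * bD * A + T.c2 / 4 := by
      rw [hlam]
      field_simp
      ring
    have e6 : 4 * bD * A * attErr (s t).R ≤ T.lam * T.c2 / 4 * attErr (s t).R :=
      mul_le_mul_of_nonneg_right (by linarith) n4
    have k1 : min (T.ε₀ / T.κ * (cA / 18)) (min (T.lam / 2) (T.lam * T.c2 / 4)) ≤ T.ε₀ / T.κ * (cA / 18) :=
      min_le_left _ _
    have k2 : min (T.ε₀ / T.κ * (cA / 18)) (min (T.lam / 2) (T.lam * T.c2 / 4)) ≤ T.lam / 2 :=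
      (min_le_right _ _).trans (min_le_left _ _)
    have k3 : min (T.ε₀ / T.κ * (cA / 18)) (min (T.lam / 2) (T.lam * T.c2 / 4)) ≤ T.lam * T.c2 / 4 :=
      (min_le_right _ _).trans (min_le_right _ _)
    have j1 := mul_le_mul_of_nonneg_right k1 (add_nonneg n1 n2)
    have j2 := mul_le_mul_of_nonneg_right k2 n3
    have j3 := mul_le_mul_of_nonneg_right k3 n4
    rw [sizeSq]
    linarith
  · intro Δx ΔR s w t a b d w' ht hΔ h hl hG
    rw [Tuning.level, hlevel] at hl
    obtain ⟨h1, h2, h3, h4, hsat⟩ := hsmall Δx ΔR (s t) (w t) hΔ h.valid hl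
    have n4 := attErr_nonneg h.valid.R_mem
    refine ⟨_, h.hasDerivWithinAt_forceGap hp, ?_⟩
    have hd1 := hdev Δx ΔR s w t a b d w' hΔ h hl hG
    have hd2 : ‖d‖ ≤ η / 4 := by
      refine abs_le_of_sq_le_sq' ?_ (by positivity) |>.2
      linarith [norm_sq_le_dot_self d]
    have hbase : baseMom p a b = T.forceGap p Δx (s t) + d := by
      rw [h.base, T.idealThrust_eq (Δx := Δx) hsat]
      abel
    have hF : ‖baseMom p a b‖ ≤ δ + 2 := by
      rw [hbase]
      have := norm_add_le (T.forceGap p Δx (s t)) d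
      linarith
    have hvn : ‖(s t).v‖ ≤ 1 := by
      rw [velSize] at h2
      linarith [norm_nonneg (s t).ω]
    intro i
    have hYi : |((crossMat n T.Y)ᵀ *ᵥ posErr p (s t)) (Sum.inl i)|
        ≤ absSumMat (crossMat n T.Y) * (2 * dim n * 3) := by
      have k1 : ((crossMat n T.Y)ᵀ *ᵥ posErr p (s t)) (Sum.inl i)
          = posErr p (s t) ⬝ᵥ (crossMat n T.Y *ᵥ baseForce (Pi.single i 1)) := by
        rw [dotProduct_mulVec, dotProduct_baseForce, mulVec_transpose, dotProduct_single_one]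
        rfl
      rw [k1]
      refine (abs_dotProduct_mulVec_le _ _ _).trans (mul_le_mul_of_nonneg_left ?_ hYn)
      have k2 : absSum (Pi.single i 1 : V3) ≤ 3 := by
        have : ∀ j, |(Pi.single i 1 : V3) j| ≤ 1 := by
          intro j
          rw [Pi.single_apply]
          split_ifs <;> simp
        have := absSum_le_card_mul this
        simpa using this
      have k3 : absSum (posErr p (s t)) ≤ 2 * dim n := by
        refine (absSum_posErr_le p (s t)).trans ?_
        linarith [mul_le_mul_of_nonneg_left (h1.trans hS1) hdim]
      rw [absSum_baseForce]
      exact mul_le_mul k3 k2 (absSum_nonneg _) (by positivity)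
    have hrest : |T.kz * ((s t).v i + T.ε₀ / T.κ * ((crossMat n T.Y)ᵀ *ᵥ posErr p (s t)) (Sum.inl i))
        + (s t).v i| ≤ Kb := by
      have k1 := (abs_apply_le_norm (s t).v i).trans hvn
      have k2 : |T.ε₀ / T.κ * ((crossMat n T.Y)ᵀ *ᵥ posErr p (s t)) (Sum.inl i)|
          ≤ T.ε₀ * (absSumMat (crossMat n T.Y) * (2 * dim n * 3)) := by
        rw [abs_mul, abs_of_pos hεp]
        exact mul_le_mul hε1 hYi (abs_nonneg _) hε₀0.le
      rw [hKb]
      refine (abs_add_le _ _).trans (add_le_add ?_ k1)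
      rw [abs_mul, abs_of_pos hkz0]
      exact mul_le_mul_of_nonneg_left ((abs_add_le _ _).trans (add_le_add k1 k2)) hkz0.le
    obtain ⟨μ, hμ0, hμM, hμ⟩ := hB (s t) a b h.valid h.link (fun i ↦ h.dot_q ht i)
      (h1.trans hSB) (h2.trans hSB) hF i
    have hval : (-(T.kz • ((s t).v + (T.ε₀ / T.κ) •
        (((crossMat n T.Y)ᵀ *ᵥ posErr p (s t)) ∘ Sum.inl))) - T.κ • a - (s t).v) i
        = -(T.kz * ((s t).v i + T.ε₀ / T.κ * ((crossMat n T.Y)ᵀ *ᵥ posErr p (s t)) (Sum.inl i))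
          + (s t).v i) - T.κ * a i := by
      simp
      ring
    rw [hval]
    have hbi : baseMom p a b i = T.forceGap p Δx (s t) i + d i := by
      rw [hbase]
      rfl
    have hdi := abs_le.1 ((abs_apply_le_norm d i).trans hd2)
    rw [hbi] at hμ
    have hμ' := abs_le.1 hμ
    have hr' := abs_le.1 hrest
    -- A component of the resultant force of at least `η` leaves `μ * a i ≥ η / 2` after two errors
    -- of `η / 4`. As `μ ≤ M00`, the choice of `κ` gives `κ * a i ≥ 2 * Kb`.
    have hkey : ∀ x, η / 2 ≤ μ * x → 2 * Kb ≤ T.κ * x := by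
      intro x hx
      have x0 : 0 < x := by
        by_contra! hx0
        linarith [mul_nonpos_of_nonneg_of_nonpos hμ0.le hx0]
      have k1 : η / 2 ≤ M00 p * x := hx.trans (mul_le_mul_of_nonneg_right hμM x0.le)
      have k2 := mul_le_mul_of_nonneg_left k1 hκ0.le
      have k3 : M00 p * (2 * Kb) ≤ M00 p * (T.κ * x) := by linarith
      exact le_of_mul_le_mul_left k3 hM
    constructor
    · intro hi
      have := hkey (a i) (by linarith)
      linarith
    · intro hi
      have := hkey (-a i) (by linarith)
      linarith
  -- In units of `δ ^ 2 / kz`, the level `7 / 4` consists of `3 / 2` for the gap `Δx`, as `Δx ⬝ᵥ Δx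
  -- ≤ 3 * δ ^ 2`, of `1 / 8` for the term of `eI`, and of `1 / 8` for the initial errors.
  · refine ⟨δ ^ 2 / (8 * T.kz * (bV + T.lam * bR)), by positivity,
      fun Δx ΔR st w hΔ hΔR h hex heI hs ↦ ?_⟩
    rw [Tuning.level]
    refine (hbound Δx ΔR st w h).2.trans_lt ?_
    obtain ⟨n1, n2, n3, n4, -, -⟩ := hnn Δx ΔR st w h
    rw [lt_div_iff₀ (by positivity)] at hs
    have e1 : integralGap T.kz Δx st = Δx := by
      rw [integralGap, hex]
      ext i
      simp
    have e2 : (st.eI - T.kI⁻¹ • ΔR) ⬝ᵥ (st.eI - T.kI⁻¹ • ΔR) = T.kI⁻¹ * (T.kI⁻¹ * (ΔR ⬝ᵥ ΔR)) := by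
      rw [heI, zero_sub, neg_dotProduct_neg, smul_dotProduct, dotProduct_smul, smul_eq_mul,
        smul_eq_mul]
    have e3 : Δx ⬝ᵥ Δx ≤ 3 * δ ^ 2 := by
      have := dot_self_le Δx
      have := pow_le_pow_left₀ (norm_nonneg _) hΔ 2
      linarith
    have e4 : ΔR ⬝ᵥ ΔR ≤ 3 * δR ^ 2 := by
      have := dot_self_le ΔR
      have := pow_le_pow_left₀ (norm_nonneg _) hΔR 2
      linarith
    have e5 : (2 * T.kz)⁻¹ * (Δx ⬝ᵥ Δx) ≤ 3 / 2 * δ ^ 2 / T.kz := by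
      rw [inv_mul_le_iff₀ (by positivity)]
      have : 2 * T.kz * (3 / 2 * δ ^ 2 / T.kz) = 3 * δ ^ 2 := by
        field_simp
      linarith
    have e6 : T.lam * (T.kI / 2 * (T.kI⁻¹ * (T.kI⁻¹ * (ΔR ⬝ᵥ ΔR)))) ≤ 1 / 8 * δ ^ 2 / T.kz := by
      have k1 : T.lam * (T.kI / 2 * (T.kI⁻¹ * (T.kI⁻¹ * (ΔR ⬝ᵥ ΔR)))) = T.lam / (2 * T.kI) * (ΔR ⬝ᵥ ΔR) := by
        field_simp
      have k2 : T.lam / (2 * T.kI) * (3 * δR ^ 2) = 1 / 8 * δ ^ 2 / T.kz := by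
        rw [hkI]
        field_simp
        ring
      rw [k1, ← k2]
      exact mul_le_mul_of_nonneg_left e4 (by positivity)
    rw [e1, e2]
    have e7 : 0 < 8 * T.kz * (bV + T.lam * bR) := by positivity
    have e8 : (bV + T.lam * bR) * sizeSq p st w < 1 / 8 * δ ^ 2 / T.kz := by
      rw [lt_div_iff₀ hkz0]
      linarith
    have e9 : bV * (posSize p st ^ 2 + velSize st ^ 2) + T.lam * (bR * (w ⬝ᵥ w + attErr st.R))
        ≤ (bV + T.lam * bR) * sizeSq p st w := by
      have j4 : 0 ≤ bV * (w ⬝ᵥ w + attErr st.R) := by positivity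
      have j5 : 0 ≤ T.lam * bR * (posSize p st ^ 2 + velSize st ^ 2) := by positivity
      rw [sizeSq]
      linarith
    have e10 : 7 / 4 * δ ^ 2 / T.kz
        = 1 / 8 * δ ^ 2 / T.kz + 3 / 2 * δ ^ 2 / T.kz + 1 / 8 * δ ^ 2 / T.kz := by ring
    change _ < 7 / 4 * δ ^ 2 / T.kz
    linarith

end Tuning

end QuadCable

namespace QuadCable

/-! ### Coordinates of the reduced dynamics and smoothness -/

section Coordinates

variable {n : ℕ}

/-- Coordinates of the reduced dynamics: `x`, `v`, `q`, `ω`, `e_𝐱`, the attitude error, its angular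
velocity, and `e_I`. -/
abbrev Coord (n : ℕ) : Type :=
  V3 × V3 × (Fin n → V3) × (Fin n → V3) × (XIdx n → ℝ) × (Fin 3 → Fin 3 → ℝ) × V3 × V3

/-- The reduced state, whose attitude is the attitude error. -/
def Coord.state (Y : Coord n) : State n :=
  ⟨Y.1, Y.2.1, Y.2.2.1, Y.2.2.2.1, Matrix.of Y.2.2.2.2.2.1, Y.2.2.2.2.1, Y.2.2.2.2.2.2.2⟩

/-- The angular velocity error. -/
def Coord.rate (Y : Coord n) : V3 := Y.2.2.2.2.2.2.1

@[fun_prop]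
theorem contDiff_cross {E : Type*} [NormedAddCommGroup E] [NormedSpace ℝ E] {m : WithTop ℕ∞}
    {f g : E → V3} (hf : ContDiff ℝ m f) (hg : ContDiff ℝ m g) :
    ContDiff ℝ m fun x ↦ crossProduct (f x) (g x) := by
  rw [contDiff_pi] at hf hg ⊢
  intro i
  fin_cases i <;> simp [cross_apply] <;> fun_prop

variable (p : Params n) {m : WithTop ℕ∞}

theorem contDiff_posErr : ContDiff ℝ m fun Y : Coord n ↦ posErr p Y.state := by
  refine contDiff_pi.2 ?_
  rintro (i | i) <;> simp only [Coord.state, posErr, mulVec, dotProduct, Sum.elim_inl,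
    Sum.elim_inr] <;> fun_prop

theorem contDiff_velErr : ContDiff ℝ m fun Y : Coord n ↦ velErr Y.state := by
  refine contDiff_pi.2 ?_
  rintro (i | i) <;> simp only [Coord.state, velErr, mulVec, dotProduct, Sum.elim_inl,
    Sum.elim_inr] <;> fun_prop

theorem contDiff_linkVel (i : Fin n) : ContDiff ℝ m fun Y : Coord n ↦ linkVel Y.state i := by
  simp only [Coord.state, linkVel]
  fun_prop

theorem contDiff_linkMom (i : Fin n) :
    ContDiff ℝ m fun Y : Coord n ↦ linkMom p Y.state.v (linkVel Y.state) i := by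
  simp only [Coord.state, linkVel, linkMom]
  fun_prop

theorem contDiff_baseMom :
    ContDiff ℝ m fun Y : Coord n ↦ baseMom p Y.state.v (linkVel Y.state) := by
  simp only [Coord.state, linkVel, baseMom]
  fun_prop

theorem contDiff_momErr : ContDiff ℝ m fun Y : Coord n ↦ momErr p Y.state := by
  refine contDiff_pi.2 ?_
  rintro (i | i)
  · exact contDiff_pi.1 (contDiff_baseMom p) i
  · have h : ContDiff ℝ m fun Y : Coord n ↦
        crossProduct (Y.state.q i.1) (linkMom p Y.state.v (linkVel Y.state) i.1) := by
      refine contDiff_cross ?_ (contDiff_linkMom p i.1)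
      simp only [Coord.state]
      fun_prop
    simp only [momErr, mulVec, dotProduct, Sum.elim_inr]
    fun_prop

theorem contDiff_integralGap (kz : ℝ) (Δx : V3) :
    ContDiff ℝ m fun Y : Coord n ↦ integralGap kz Δx Y.state := by
  refine contDiff_pi.2 fun i ↦ ?_
  simp only [integralGap, Coord.state, Pi.sub_apply, Pi.smul_apply, Function.comp_apply,
    smul_eq_mul]
  fun_prop

theorem contDiff_dot {E ι : Type*} [Fintype ι] [NormedAddCommGroup E] [NormedSpace ℝ E]
    {f g : E → ι → ℝ} (hf : ContDiff ℝ m f) (hg : ContDiff ℝ m g) :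
    ContDiff ℝ m fun x ↦ f x ⬝ᵥ g x := by
  simp only [dotProduct]
  fun_prop

theorem contDiff_mulVec {E ι κ : Type*} [Fintype ι] [Fintype κ] [NormedAddCommGroup E]
    [NormedSpace ℝ E] (A : Matrix κ ι ℝ) {f : E → ι → ℝ} (hf : ContDiff ℝ m f) :
    ContDiff ℝ m fun x ↦ A *ᵥ f x := by
  refine contDiff_pi.2 fun i ↦ ?_
  simp only [mulVec, dotProduct]
  fun_prop

theorem contDiff_transLyap (Y : Matrix (XIdx n) (XIdx n) ℝ) (ε kz : ℝ) (Δx : V3) :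
    ContDiff ℝ m fun Z : Coord n ↦ transLyap p Y ε kz Δx Z.state := by
  have h1 : ContDiff ℝ m fun Z : Coord n ↦ massForm p Z.state.v (linkVel Z.state) := by
    refine ContDiff.add (contDiff_dot (by simp only [Coord.state]; fun_prop) (contDiff_baseMom p))
      (ContDiff.sum fun i _ ↦ contDiff_dot (contDiff_linkVel i) (contDiff_linkMom p i))
  have h2 : ContDiff ℝ m fun Z : Coord n ↦ Z.state.x - p.xd := by
    simp only [Coord.state]
    fun_prop
  have h3 : ContDiff ℝ m fun Z : Coord n ↦ ∑ i, weight p i * (1 - Z.state.q i ⬝ᵥ e3) := by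
    simp only [Coord.state, dotProduct]
    fun_prop
  have h4 := contDiff_dot (contDiff_posErr (m := m) p) (contDiff_mulVec Y (contDiff_momErr p))
  have h5 := contDiff_dot (contDiff_integralGap (n := n) (m := m) kz Δx)
    (contDiff_integralGap kz Δx)
  have h6 := contDiff_dot h2 h2
  simp only [transLyap]
  fun_prop

theorem contDiff_attLyap (c2 kI : ℝ) (ΔR : V3) :
    ContDiff ℝ m fun Z : Coord n ↦ attLyap p.J c2 kI ΔR Z.state.R Z.rate Z.state.eI := by
  have h1 : ContDiff ℝ m fun Z : Coord n ↦ Z.rate := by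
    simp only [Coord.rate]
    fun_prop
  have h2 : ContDiff ℝ m fun Z : Coord n ↦ attErr Z.state.R := by
    simp only [attErr_eq, Coord.state, Matrix.of_apply]
    fun_prop
  have h3 : ContDiff ℝ m fun Z : Coord n ↦ attVec Z.state.R := by
    refine contDiff_pi.2 fun i ↦ ?_
    fin_cases i <;> simp [attVec, vee, Coord.state] <;> fun_prop
  have h4 : ContDiff ℝ m fun Z : Coord n ↦ Z.state.eI - kI⁻¹ • ΔR := by
    simp only [Coord.state]
    fun_prop
  have h5 := contDiff_mulVec p.J h1
  have h6 := contDiff_dot h1 h5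
  have h7 := contDiff_dot h3 h5
  have h8 := contDiff_dot h4 h4
  simp only [attLyap]
  fun_prop

theorem contDiff_lyap (T : Tuning) (Δx ΔR : V3) :
    ContDiff ℝ m fun Z : Coord n ↦ T.lyap p Δx ΔR Z.state Z.rate :=
  (contDiff_transLyap p _ _ _ Δx).add (contDiff_const.mul (contDiff_attLyap p _ _ ΔR))

theorem contDiff_forceGap (T : Tuning) (Δx : V3) :
    ContDiff ℝ m fun Z : Coord n ↦ T.forceGap p Δx Z.state := by
  have h1 : ContDiff ℝ m fun Z : Coord n ↦ Z.state.x - p.xd := by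
    simp only [Coord.state]
    fun_prop
  have h2 : ContDiff ℝ m fun Z : Coord n ↦ T.κ • Z.state.v := by
    simp only [Coord.state]
    fun_prop
  exact ((contDiff_integralGap _ Δx).sub h2).sub h1

end Coordinates

/-! ### A corrected integral term whose rate is quadratic -/

section Drift

variable {n : ℕ} {p : Params n}

variable (p) in
/-- Approximation of the link errors by multiples of the momenta, whose rate is the link error. -/
noncomputable def linkAngle (st : State n) : XIdx n → ℝ :=
  Sum.elim 0 fun ic ↦ -((weight p ic.1)⁻¹ * momErr p st (Sum.inr ic))

variable (p) in
/-- The quadratic terms of the rate of `linkAngle`. -/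
noncomputable def gyroAngle (st : State n) : XIdx n → ℝ :=
  Sum.elim 0 fun ic ↦ (weight p ic.1)⁻¹ * gyroRate p st (Sum.inr ic)

/-- The position error enters the rate of the force components of `ex` with the factor `Y 0 0`. As
this is not zero, the integral of `x - xd` can be read off from these components. -/
theorem crossMat_transpose_baseForce (Y : ℕ → ℕ → ℝ) (u : V3) :
    ((crossMat n Y)ᵀ *ᵥ baseForce u) ∘ Sum.inl = Y 0 0 • u := by
  rw [crossMat, fromBlocks_transpose, fromBlocks_mulVec]
  ext i
  simp [baseForce, smul_mulVec]

variable (p) in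
/-- Integral of the position error, up to quadratic terms. -/
noncomputable def Tuning.posEst (T : Tuning) (Δx : V3) (st : State n) : V3 :=
  (T.ε₀ / T.κ * T.Y 0 0)⁻¹ • (-(T.kz⁻¹ • integralGap T.kz Δx st) - (st.x - p.xd)
    - (T.ε₀ / T.κ) • (((crossMat n T.Y)ᵀ *ᵥ linkAngle p st) ∘ Sum.inl))

variable (p) in
/-- The integral term without the parts that integrate linear terms. -/
noncomputable def Tuning.drift (T : Tuning) (Δx : V3) (st : State n) : XIdx n → ℝ :=
  st.ex - posErr p st
    - (T.ε₀ / T.κ) • ((crossMat n T.Y)ᵀ *ᵥ (baseForce (T.posEst p Δx st) + linkAngle p st))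

variable (p) in
/-- Rate of `drift`. -/
noncomputable def Tuning.driftRate (T : Tuning) (st : State n) : XIdx n → ℝ :=
  -(posRate st - velErr st) - (T.ε₀ / T.κ) • ((crossMat n T.Y)ᵀ *ᵥ
    (baseForce ((T.Y 0 0)⁻¹ • (((crossMat n T.Y)ᵀ *ᵥ gyroAngle p st) ∘ Sum.inl))
      - gyroAngle p st))

theorem contDiff_drift {m : WithTop ℕ∞} (T : Tuning) (Δx : V3) :
    ContDiff ℝ m fun Z : Coord n ↦ T.drift p Δx Z.state := by
  have h1 : ContDiff ℝ m fun Z : Coord n ↦ linkAngle p Z.state := by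
    refine contDiff_pi.2 ?_
    rintro (i | i)
    · simp only [linkAngle, Sum.elim_inl]
      fun_prop
    · simp only [linkAngle, Sum.elim_inr]
      have := contDiff_pi.1 (contDiff_momErr (m := m) p) (Sum.inr i)
      fun_prop
  have h2 := contDiff_mulVec (crossMat n T.Y)ᵀ h1
  have h3 : ContDiff ℝ m fun Z : Coord n ↦ T.posEst p Δx Z.state := by
    have h4 := contDiff_integralGap (n := n) (m := m) T.kz Δx
    have h5 : ContDiff ℝ m fun Z : Coord n ↦ Z.state.x - p.xd := by
      simp only [Coord.state]
      fun_prop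
    have h6 : ContDiff ℝ m fun Z : Coord n ↦
        ((crossMat n T.Y)ᵀ *ᵥ linkAngle p Z.state) ∘ (Sum.inl : Fin 3 → XIdx n) :=
      contDiff_pi.2 fun i ↦ contDiff_pi.1 h2 (Sum.inl i)
    simp only [Tuning.posEst]
    fun_prop
  have h4 : ContDiff ℝ m fun Z : Coord n ↦ baseForce (n := n) (T.posEst p Δx Z.state) := by
    refine contDiff_pi.2 ?_
    rintro (i | i)
    · exact contDiff_pi.1 h3 i
    · exact contDiff_const
  have h5 := contDiff_mulVec (crossMat n T.Y)ᵀ (h4.add h1)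
  have h6 := contDiff_posErr (m := m) p
  have h7 : ContDiff ℝ m fun Z : Coord n ↦ Z.state.ex := by
    simp only [Coord.state]
    fun_prop
  simp only [Tuning.drift]
  fun_prop

/-- The link components of `ex` do not act on the thrust, so the Lyapunov function does not see
them. But each linear term of their rate is a total derivative: `velErr` comes from `posErr`, the
link angles from the link momenta divided by the weights, and `x - xd` from the force components of
`ex`. After these are subtracted, only terms quadratic in the errors remain. -/
theorem ReducedAt.hasDerivWithinAt_drift (hp : p.Physical) {T : Tuning} {δ : ℝ}
    (hY : T.Y 0 0 ≠ 0) (hε : T.ε₀ / T.κ ≠ 0) (hkz : T.kz ≠ 0) {Δx ΔR : V3}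
    {s : ℝ → State n} {w : ℝ → V3} {t : ℝ} {a : V3} {b : Fin n → V3} {d w' : V3}
    (h : ReducedAt p (T.gains p δ) Δx ΔR s w t a b d w') :
    HasDerivWithinAt (fun τ ↦ T.drift p Δx (s τ)) (T.driftRate p (s t)) (Ici 0) t := by
  set ε := T.ε₀ / T.κ with hεdef
  set Yt := (crossMat n T.Y)ᵀ with hYt
  set st := s t with hst
  have hex : HasDerivWithinAt (fun τ ↦ (s τ).ex) (velErr st + ε • (Yt *ᵥ posErr p st))
      (Ici 0) t := by
    rw [hYt, ← hp.integral_action]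
    exact h.ex_deriv
  have hpos := hasDerivWithinAt_posErr (p := p) h.x_deriv h.q_deriv
  have hmom := hasDerivWithinAt_momErr h.v_deriv h.q_deriv h.linkVel_deriv h.link
  have hang : HasDerivWithinAt (fun τ ↦ linkAngle p (s τ))
      (posErr p st - baseForce (st.x - p.xd) - gyroAngle p st) (Ici 0) t := by
    rw [hasDerivWithinAt_pi] at hmom ⊢
    rintro (i | i)
    · refine (hasDerivWithinAt_const t (Ici 0) (0 : ℝ)).congr_deriv ?_
      simp [posErr, baseForce, gyroAngle]
    · refine ((hmom (Sum.inr i)).const_mul (weight p i.1)⁻¹).fun_neg.congr_deriv ?_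
      have hw := (hp.weight_pos i.1).ne'
      simp [baseForce, stiff_mulVec, gyroAngle]
      field_simp
      ring
  have hy : HasDerivWithinAt (fun τ ↦ -(T.kz⁻¹ • integralGap T.kz Δx (s τ)))
      (st.v + ε • ((Yt *ᵥ posErr p st) ∘ Sum.inl)) (Ici 0) t := by
    rw [hasDerivWithinAt_pi] at hex ⊢
    intro i
    have h1 : (fun τ ↦ (-(T.kz⁻¹ • integralGap T.kz Δx (s τ))) i)
        = fun τ ↦ (s τ).ex (Sum.inl i) - T.kz⁻¹ * Δx i := by
      ext τ
      simp [integralGap]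
      field_simp
      ring
    rw [h1]
    exact (hex (Sum.inl i)).sub_const _
  have hYang := hasDerivWithinAt_mulVec Yt hang
  have hYinl : HasDerivWithinAt (fun τ ↦ (Yt *ᵥ linkAngle p (s τ)) ∘ (Sum.inl : Fin 3 → XIdx n))
      ((Yt *ᵥ (posErr p st - baseForce (st.x - p.xd) - gyroAngle p st)) ∘ Sum.inl) (Ici 0) t :=
    hasDerivWithinAt_pi.2 fun i ↦ hasDerivWithinAt_pi.1 hYang (Sum.inl i)
  have hX : HasDerivWithinAt (fun τ ↦ T.posEst p Δx (s τ))
      ((st.x - p.xd) + (T.Y 0 0)⁻¹ • ((Yt *ᵥ gyroAngle p st) ∘ Sum.inl)) (Ici 0) t := by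
    refine (((hy.sub (h.x_deriv.sub_const p.xd)).sub (hYinl.const_smul ε)).const_smul
      (ε * T.Y 0 0)⁻¹).congr_deriv ?_
    have h1 := crossMat_transpose_baseForce (n := n) T.Y (st.x - p.xd)
    rw [← hYt] at h1
    ext i
    have h2 := congrFun h1 i
    simp only [Function.comp_apply, Pi.smul_apply, smul_eq_mul] at h2
    simp only [mulVec_sub, Pi.smul_apply, Pi.sub_apply, Pi.add_apply, Function.comp_apply,
      smul_eq_mul, h2]
    rw [← hst]
    field_simp
    ring
  have hXb : HasDerivWithinAt (fun τ ↦ baseForce (n := n) (T.posEst p Δx (s τ)))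
      (baseForce ((st.x - p.xd) + (T.Y 0 0)⁻¹ • ((Yt *ᵥ gyroAngle p st) ∘ Sum.inl)))
      (Ici 0) t := by
    rw [hasDerivWithinAt_pi] at hX ⊢
    rintro (i | i)
    · exact hX i
    · exact hasDerivWithinAt_const _ _ _
  refine ((hex.sub hpos).sub ((hasDerivWithinAt_mulVec Yt (hXb.add hang)).const_smul
    ε)).congr_deriv ?_
  have hb : ∀ u u' : V3, baseForce (n := n) (u + u') = baseForce u + baseForce u' := by
    intro u u'
    ext (i | i) <;> simp [baseForce]
  rw [Tuning.driftRate, hb, ← hYt, ← hεdef, ← hst]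
  simp only [mulVec_add, mulVec_sub, smul_add, smul_sub]
  abel

end Drift

end QuadCable

namespace QuadCable

/-! ### Bounds along curves that stay in the region of the analysis -/

section Confinement

variable {n : ℕ} {p : Params n}

theorem abs_mulVec_apply_le {ι κ : Type} [Fintype ι] [Fintype κ] (A : Matrix κ ι ℝ) (z : ι → ℝ)
    (i : κ) : |(A *ᵥ z) i| ≤ absSumMat A * absSum z := by
  rw [mulVec, dotProduct, absSumMat, Finset.sum_mul]
  refine (Finset.abs_sum_le_sum_abs _ _).trans ?_
  refine le_trans ?_ (Finset.single_le_sum (f := fun i ↦ (∑ j, |A i j|) * absSum z)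
    (fun i _ ↦ mul_nonneg (Finset.sum_nonneg fun _ _ ↦ abs_nonneg _) (absSum_nonneg z))
    (Finset.mem_univ i))
  rw [Finset.sum_mul]
  refine Finset.sum_le_sum fun j _ ↦ ?_
  rw [abs_mul]
  exact mul_le_mul_of_nonneg_left (abs_le_absSum z j) (abs_nonneg _)

theorem absSum_le_three_mul {u : V3} {M : ℝ} (h : ∀ i, |u i| ≤ M) :
    absSum (baseForce (n := n) u) ≤ 3 * M := by
  rw [absSum_baseForce]
  simpa using absSum_le_card_mul h

theorem absSum_add_le {ι : Type} [Fintype ι] (z z' : ι → ℝ) :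
    absSum (z + z') ≤ absSum z + absSum z' := by
  rw [absSum, absSum, absSum, ← Finset.sum_add_distrib]
  exact Finset.sum_le_sum fun i _ ↦ abs_add_le _ _

theorem absSum_neg {ι : Type} [Fintype ι] (z : ι → ℝ) : absSum (-z) = absSum z := by
  simp [absSum]

theorem Params.Physical.exists_angle_bounds (hp : p.Physical) : ∃ c ≥ 0, ∀ st : State n, st.Valid →
    absSum (linkAngle p st) ≤ c * velSize st ∧ absSum (gyroAngle p st) ≤ c * velSize st ^ 2 := by
  obtain ⟨w0, hw0, hw⟩ := hp.exists_weight_bound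
  have hm := hp.massTotal_nonneg
  have hd := dim_nonneg n
  have key : ∀ z : XIdx n → ℝ, ∀ z' : XIdx n → ℝ,
      (∀ i, |z' (Sum.inl i)| = 0) → (∀ i, |z' (Sum.inr i)| = (weight p i.1)⁻¹ * |z (Sum.inr i)|) →
      absSum z' ≤ w0⁻¹ * absSum z := by
    intro z z' h1 h2
    rw [absSum, absSum, Finset.mul_sum]
    refine Finset.sum_le_sum fun j _ ↦ ?_
    rcases j with i | i
    · rw [h1]
      positivity
    · rw [h2]
      exact mul_le_mul_of_nonneg_right (inv_anti₀ hw0 (hw i.1)) (abs_nonneg _)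
  refine ⟨w0⁻¹ * (dim n * (8 * massTotal p)), by positivity, fun st h ↦ ⟨?_, ?_⟩⟩
  · refine (key (momErr p st) _ (by simp [linkAngle]) fun i ↦ ?_).trans ?_
    · simp only [linkAngle, Sum.elim_inr, abs_neg, abs_mul,
        abs_of_pos (inv_pos.2 (hp.weight_pos i.1))]
    · rw [mul_assoc]
      refine mul_le_mul_of_nonneg_left ((h.absSum_momErr_le hp).trans ?_) (by positivity)
      have : 0 ≤ dim n * (massTotal p * velSize st) := by
        have := velSize_nonneg st
        positivity
      linarith
  · refine (key (gyroRate p st) _ (by simp [gyroAngle]) fun i ↦ ?_).trans ?_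
    · simp only [gyroAngle, Sum.elim_inr, abs_mul, abs_of_pos (inv_pos.2 (hp.weight_pos i.1))]
    · rw [mul_assoc]
      refine mul_le_mul_of_nonneg_left ((h.absSum_gyroRate_le hp).trans (le_of_eq ?_))
        (by positivity)
      ring

/-- The second order is essential: it makes the rate integrable in time by the dissipation of the
Lyapunov function. -/
theorem Params.Physical.exists_driftRate_bound (hp : p.Physical) (T : Tuning) :
    ∃ c ≥ 0, ∀ st : State n, st.Valid → ∀ j,
      |T.driftRate p st j| ≤ c * (posSize p st ^ 2 + velSize st ^ 2) := by
  obtain ⟨c, hc, hang⟩ := hp.exists_angle_bounds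
  have hd := dim_nonneg n
  set A := absSumMat (crossMat n T.Y)ᵀ with hA
  have hA0 : 0 ≤ A := absSumMat_nonneg _
  set e := |T.ε₀ / T.κ| with he
  have he0 : 0 ≤ e := abs_nonneg _
  set y := |(T.Y 0 0)⁻¹| with hy
  have hy0 : 0 ≤ y := abs_nonneg _
  refine ⟨2 * dim n + e * (A * (3 * (y * (A * c)) + c)), by positivity, fun st h j ↦ ?_⟩
  have hP := posSize_nonneg p st
  have hV := velSize_nonneg st
  set G := gyroAngle p st with hG
  have hG1 := (hang st h).2
  set z := baseForce (n := n) ((T.Y 0 0)⁻¹ • (((crossMat n T.Y)ᵀ *ᵥ G) ∘ Sum.inl)) - G with hz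
  have h1 : |(posRate st - velErr st) j| ≤ dim n * (4 * (posSize p st * velSize st)) :=
    (abs_le_absSum _ j).trans h.absSum_posRate_sub_le
  have h2 : absSum z ≤ (3 * (y * (A * c)) + c) * velSize st ^ 2 := by
    rw [hz, sub_eq_add_neg]
    refine (absSum_add_le _ _).trans ?_
    rw [absSum_neg, add_mul]
    refine add_le_add ?_ hG1
    rw [mul_assoc, mul_assoc, mul_assoc]
    refine absSum_le_three_mul fun i ↦ ?_
    rw [Pi.smul_apply, smul_eq_mul, abs_mul]
    exact mul_le_mul_of_nonneg_left ((abs_mulVec_apply_le _ _ _).trans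
      (mul_le_mul_of_nonneg_left hG1 hA0)) hy0
  have h3 : |((T.ε₀ / T.κ) • ((crossMat n T.Y)ᵀ *ᵥ z)) j|
      ≤ e * (A * ((3 * (y * (A * c)) + c) * velSize st ^ 2)) := by
    rw [Pi.smul_apply, smul_eq_mul, abs_mul]
    exact mul_le_mul_of_nonneg_left ((abs_mulVec_apply_le _ _ _).trans
      (mul_le_mul_of_nonneg_left h2 hA0)) he0
  have h4 : T.driftRate p st j
      = -((posRate st - velErr st) j) - ((T.ε₀ / T.κ) • ((crossMat n T.Y)ᵀ *ᵥ z)) j := rfl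
  rw [h4]
  refine (abs_sub _ _).trans ?_
  rw [abs_neg]
  have h5 : 0 ≤ e * (A * (3 * (y * (A * c)) + c)) * posSize p st ^ 2 := by positivity
  have h6 : 0 ≤ dim n * (posSize p st - velSize st) ^ 2 := by positivity
  linarith

/-- Everything subtracted from `ex` is linear in quantities that the Lyapunov function controls, so
bounds for `drift` carry over to `ex`. -/
theorem Params.Physical.exists_drift_close (hp : p.Physical) (T : Tuning) :
    ∃ c ≥ 0, ∀ (Δx : V3) (st : State n), st.Valid → ∀ j, |T.drift p Δx st j - st.ex j|
      ≤ c * (‖integralGap T.kz Δx st‖ + posSize p st + velSize st) := by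
  obtain ⟨c, hc, hang⟩ := hp.exists_angle_bounds
  have hd := dim_nonneg n
  set A := absSumMat (crossMat n T.Y)ᵀ with hA
  have hA0 : 0 ≤ A := absSumMat_nonneg _
  set e := |T.ε₀ / T.κ| with he
  have he0 : 0 ≤ e := abs_nonneg _
  set y := |(T.ε₀ / T.κ * T.Y 0 0)⁻¹| with hy
  have hy0 : 0 ≤ y := abs_nonneg _
  set k := |T.kz⁻¹| with hk
  have hk0 : 0 ≤ k := abs_nonneg _
  refine ⟨2 * dim n + e * (A * (3 * (y * (k + 1 + e * (A * c))) + c)), by positivity,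
    fun Δx st h j ↦ ?_⟩
  have hP := posSize_nonneg p st
  have hV := velSize_nonneg st
  set g := integralGap T.kz Δx st with hg
  have hg0 := norm_nonneg g
  set S := ‖g‖ + posSize p st + velSize st with hS
  have hS0 : 0 ≤ S := by positivity
  have hL : absSum (linkAngle p st) ≤ c * S :=
    (hang st h).1.trans (mul_le_mul_of_nonneg_left (by linarith) hc)
  have hX : ∀ i, |T.posEst p Δx st i| ≤ y * ((k + 1 + e * (A * c)) * S) := by
    intro i
    have h1 : T.posEst p Δx st i = (T.ε₀ / T.κ * T.Y 0 0)⁻¹ * (-(T.kz⁻¹ * g i)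
      - (st.x - p.xd) i - T.ε₀ / T.κ * ((crossMat n T.Y)ᵀ *ᵥ linkAngle p st) (Sum.inl i)) := rfl
    rw [h1, abs_mul]
    refine mul_le_mul_of_nonneg_left ?_ hy0
    refine (abs_sub _ _).trans ?_
    refine (add_le_add_left (abs_sub _ _) _).trans ?_
    rw [abs_neg, abs_mul, abs_mul]
    have h2 := mul_le_mul_of_nonneg_left ((abs_apply_le_norm g i).trans
      (by linarith : ‖g‖ ≤ S)) hk0
    have h3 : |(st.x - p.xd) i| ≤ S := (abs_apply_le_norm _ i).trans (by
      rw [hS, posSize]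
      linarith [norm_nonneg (st.q - fun _ ↦ e3)])
    have h4 := mul_le_mul_of_nonneg_left ((abs_mulVec_apply_le (crossMat n T.Y)ᵀ
      (linkAngle p st) (Sum.inl i)).trans (mul_le_mul_of_nonneg_left hL hA0)) he0
    linarith
  set z := baseForce (T.posEst p Δx st) + linkAngle p st with hz
  have h2 : absSum z ≤ (3 * (y * (k + 1 + e * (A * c))) + c) * S := by
    refine (absSum_add_le _ _).trans ?_
    have := absSum_le_three_mul (n := n) hX
    linarith
  have h3 : |((T.ε₀ / T.κ) • ((crossMat n T.Y)ᵀ *ᵥ z)) j|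
      ≤ e * (A * ((3 * (y * (k + 1 + e * (A * c))) + c) * S)) := by
    rw [Pi.smul_apply, smul_eq_mul, abs_mul]
    exact mul_le_mul_of_nonneg_left ((abs_mulVec_apply_le _ _ _).trans
      (mul_le_mul_of_nonneg_left h2 hA0)) he0
  have h4 : T.drift p Δx st j - st.ex j
      = -(posErr p st j) - ((T.ε₀ / T.κ) • ((crossMat n T.Y)ᵀ *ᵥ z)) j := by
    rw [Tuning.drift, Pi.sub_apply, Pi.sub_apply]
    ring
  rw [h4]
  refine (abs_sub _ _).trans ?_
  rw [abs_neg]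
  have h5 := (abs_le_absSum (posErr p st) j).trans (absSum_posErr_le p st)
  have h6 : dim n * (2 * posSize p st) ≤ 2 * dim n * S := by
    have := mul_le_mul_of_nonneg_left (by linarith : posSize p st ≤ S) hd
    linarith
  linarith

/-- The Lyapunov function controls the distance to the equilibrium. -/
theorem Tuning.Good.exists_sqrt_bound {T : Tuning} {δ δR η : ℝ} (hT : T.Good p δ δR η) :
    ∃ c ≥ 0, ∀ (Δx ΔR : V3) (st : State n) (w : V3), st.Valid → 0 ≤ T.lyap p Δx ΔR st w ∧
      sizeSq p st w ≤ c ^ 2 * T.lyap p Δx ΔR st w ∧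
      ‖integralGap T.kz Δx st‖ + posSize p st + velSize st + ‖w‖ + ‖st.eI - T.kI⁻¹ • ΔR‖
        ≤ c * Real.sqrt (T.lyap p Δx ΔR st w) := by
  obtain ⟨c, hc, b, hb, h⟩ := hT.coercive
  have hkz := hT.kz_pos
  have hkI := hT.kI_pos
  have hlam := hT.lam_pos
  set m := 1 / c + 2 * T.kz + 2 / (T.lam * T.kI) with hm
  have hm0 : 0 < m := by positivity
  have hm1 : 1 / c ≤ m := by
    have : 0 < 2 * T.kz + 2 / (T.lam * T.kI) := by positivity
    linarith
  have hm2 : 2 * T.kz ≤ m := by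
    have : 0 < 1 / c + 2 / (T.lam * T.kI) := by positivity
    linarith
  have hm3 : 2 / (T.lam * T.kI) ≤ m := by
    have : 0 < 1 / c + 2 * T.kz := by positivity
    linarith
  refine ⟨5 * Real.sqrt m, by positivity, fun Δx ΔR st w hv ↦ ?_⟩
  have h1 := (h Δx ΔR st w hv).1
  have n1 := dot_self_nonneg (integralGap T.kz Δx st)
  have n2 := dot_self_nonneg (st.eI - T.kI⁻¹ • ΔR)
  have n3 := dot_self_nonneg w
  have n4 := attErr_nonneg hv.R_mem
  set L := T.lyap p Δx ΔR st w with hL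
  have m1 : 0 ≤ (2 * T.kz)⁻¹ * (integralGap T.kz Δx st ⬝ᵥ integralGap T.kz Δx st) := by positivity
  have m2 : 0 ≤ T.lam * (T.kI / 2 * ((st.eI - T.kI⁻¹ • ΔR) ⬝ᵥ (st.eI - T.kI⁻¹ • ΔR))) := by
    positivity
  have hs0 : 0 ≤ sizeSq p st w := by
    rw [sizeSq]
    positivity
  have hcs : 0 ≤ c * sizeSq p st w := by positivity
  have hL0 : 0 ≤ L := by linarith
  have k1 : sizeSq p st w ≤ m * L := by
    have : sizeSq p st w ≤ 1 / c * L := by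
      rw [div_mul_eq_mul_div, one_mul, le_div_iff₀ hc]
      linarith
    exact this.trans (mul_le_mul_of_nonneg_right hm1 hL0)
  have k2 : integralGap T.kz Δx st ⬝ᵥ integralGap T.kz Δx st ≤ m * L := by
    have : integralGap T.kz Δx st ⬝ᵥ integralGap T.kz Δx st ≤ 2 * T.kz * L := by
      rw [← inv_mul_le_iff₀ (by positivity)]
      linarith
    exact this.trans (mul_le_mul_of_nonneg_right hm2 hL0)
  have k3 : (st.eI - T.kI⁻¹ • ΔR) ⬝ᵥ (st.eI - T.kI⁻¹ • ΔR) ≤ m * L := by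
    have : (st.eI - T.kI⁻¹ • ΔR) ⬝ᵥ (st.eI - T.kI⁻¹ • ΔR) ≤ 2 / (T.lam * T.kI) * L := by
      rw [div_mul_eq_mul_div, le_div_iff₀ (by positivity)]
      linarith
    exact this.trans (mul_le_mul_of_nonneg_right hm3 hL0)
  have key : ∀ x, x ^ 2 ≤ m * L → x ≤ Real.sqrt m * Real.sqrt L := by
    intro x hx
    rw [← Real.sqrt_mul hm0.le]
    exact Real.le_sqrt_of_sq_le hx
  have j1 := key _ ((norm_sq_le_dot_self _).trans k2)
  have j2 := key _ ((norm_sq_le_dot_self _).trans k3)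
  have j3 := key (posSize p st) (by
    rw [sizeSq] at k1
    linarith [sq_nonneg (velSize st)])
  have j4 := key (velSize st) (by
    rw [sizeSq] at k1
    linarith [sq_nonneg (posSize p st)])
  have j5 := key ‖w‖ ((norm_sq_le_dot_self _).trans (by
    rw [sizeSq] at k1
    linarith [sq_nonneg (posSize p st), sq_nonneg (velSize st)]))
  refine ⟨hL0, k1.trans (mul_le_mul_of_nonneg_right ?_ hL0), by linarith⟩
  rw [mul_pow, Real.sq_sqrt hm0.le]
  linarith

theorem antitoneOn_of_exists_hasDerivWithinAt {f : ℝ → ℝ} {T : ℝ} (hc : ContinuousOn f (Ici 0))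
    (hf : ∀ t, 0 ≤ t → t < T → ∃ f', HasDerivWithinAt f f' (Ici 0) t ∧ f' ≤ 0) :
    AntitoneOn f (Icc 0 T) := by
  refine antitoneOn_of_hasDerivWithinAt_Ici (f' := fun t ↦ derivWithin f (Ici 0) t) hc ?_ ?_
  · intro t h0 hT
    obtain ⟨f', h1, -⟩ := hf t h0 hT
    exact h1.differentiableWithinAt.hasDerivWithinAt
  · intro t h0 hT
    obtain ⟨f', h1, h2⟩ := hf t h0 hT
    rwa [h1.derivWithin (uniqueDiffOn_Ici 0 t h0)]

variable (p) in
/-- The curve `Y` satisfies the reduced dynamics at time `t`. -/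
def Follows (k : Gains n) (Δx ΔR : V3) (Y : ℝ → Coord n) (t : ℝ) : Prop :=
  ∃ a b d w', ReducedAt p k Δx ΔR (fun τ ↦ (Y τ).state) (fun τ ↦ (Y τ).rate) t a b d w'

variable (p) in
/-- Distance of the integral force to its equilibrium value. -/
noncomputable def exDist (kz : ℝ) (Δx : V3) (st : State n) : ℝ :=
  ‖st.ex - Sum.elim (kz⁻¹ • Δx) 0‖

/-- As long as a curve stays in the region of the analysis, the Lyapunov function decreases, and
the integral force remains bounded. -/
theorem Tuning.Good.exists_confinement (hp : p.Physical) {T : Tuning} {δ δR η : ℝ}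
    (hT : T.Good p δ δR η) :
    ∃ c ≥ 0, ∀ (Δx ΔR : V3) (Y : ℝ → Coord n) (t₁ : ℝ), 0 ≤ t₁ → ‖Δx‖ ≤ δ →
      ContinuousOn Y (Ici 0) → (∀ t, 0 ≤ t → (Y t).state.Valid) →
      (∀ t, 0 ≤ t → t < t₁ → Follows p (T.gains p δ) Δx ΔR Y t ∧
        T.lyap p Δx ΔR (Y t).state (Y t).rate ≤ T.level δ ∧
        ‖T.forceGap p Δx (Y t).state‖ ≤ δ + 1) →
      T.lyap p Δx ΔR (Y t₁).state (Y t₁).rate ≤ T.lyap p Δx ΔR (Y 0).state (Y 0).rate ∧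
      exDist T.kz Δx (Y t₁).state ≤ exDist T.kz Δx (Y 0).state
        + c * (Real.sqrt (T.lyap p Δx ΔR (Y 0).state (Y 0).rate)
          + T.lyap p Δx ΔR (Y 0).state (Y 0).rate) := by
  obtain ⟨cs, hcs, hsqrt⟩ := hT.exists_sqrt_bound
  obtain ⟨cD, hcD, hdrift⟩ := hp.exists_driftRate_bound T
  obtain ⟨cC, hcC, hclose⟩ := hp.exists_drift_close T
  obtain ⟨cL, hcL, hdecay⟩ := hT.decay
  have hkz := hT.kz_pos
  refine ⟨2 * cC * cs + cD / cL + cs / T.kz, by positivity,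
    fun Δx ΔR Y t₁ ht₁ hΔ hYc hv hreg ↦ ?_⟩
  set L : ℝ → ℝ := fun t ↦ T.lyap p Δx ΔR (Y t).state (Y t).rate with hL
  have hLc : ContinuousOn L (Ici 0) :=
    (contDiff_lyap (m := 0) p T Δx ΔR).continuous.comp_continuousOn hYc
  have hLd : ∀ t, 0 ≤ t → t < t₁ → ∃ L', HasDerivWithinAt L L' (Ici 0) t ∧
      L' ≤ -(cL * sizeSq p (Y t).state (Y t).rate) := by
    intro t h0 h1
    obtain ⟨⟨a, b, d, w', hr⟩, h2, h3⟩ := hreg t h0 h1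
    exact hdecay Δx ΔR _ _ t a b d w' h0 hΔ hr h2 h3
  have hsz : ∀ t, 0 ≤ t → posSize p (Y t).state ^ 2 + velSize (Y t).state ^ 2
      ≤ sizeSq p (Y t).state (Y t).rate := by
    intro t h0
    rw [sizeSq]
    linarith [dot_self_nonneg (Y t).rate, attErr_nonneg (hv t h0).R_mem]
  have hLanti : L t₁ ≤ L 0 := by
    refine antitoneOn_of_exists_hasDerivWithinAt hLc (fun t h0 h1 ↦ ?_) ⟨le_rfl, ht₁⟩
      ⟨ht₁, le_rfl⟩ ht₁
    obtain ⟨L', h2, h3⟩ := hLd t h0 h1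
    have h4 : 0 ≤ sizeSq p (Y t).state (Y t).rate := (hsz t h0).trans' (by positivity)
    exact ⟨L', h2, h3.trans (neg_nonpos.2 (by positivity))⟩
  have hL0 : ∀ t, 0 ≤ t → 0 ≤ L t := fun t h0 ↦ (hsqrt Δx ΔR _ (Y t).rate (hv t h0)).1
  have hΘ : ∀ j, |T.drift p Δx (Y t₁).state j - T.drift p Δx (Y 0).state j| ≤ cD / cL * L 0 := by
    intro j
    have hc : ContinuousOn (fun t ↦ T.drift p Δx (Y t).state j) (Ici 0) :=
      (contDiff_pi.1 (contDiff_drift (m := 0) T Δx) j).continuous.comp_continuousOn hYc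
    have hd : ∀ t, 0 ≤ t → t < t₁ → ∃ f', HasDerivWithinAt
        (fun t ↦ T.drift p Δx (Y t).state j) f' (Ici 0) t ∧
        |f'| ≤ cD * sizeSq p (Y t).state (Y t).rate := by
      intro t h0 h1
      obtain ⟨⟨a, b, d, w', hr⟩, -, -⟩ := hreg t h0 h1
      refine ⟨_, hasDerivWithinAt_pi.1 (hr.hasDerivWithinAt_drift hp hT.Y_pos.ne'
        (div_pos hT.ε₀_pos hT.κ_pos).ne' hkz.ne') j, ?_⟩
      exact (hdrift _ (hv t h0) j).trans (mul_le_mul_of_nonneg_left (hsz t h0) hcD)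
    -- Both `drift` and its negative grow at most `cD / cL` times as fast as the Lyapunov function
    -- decreases. The total change is thus bounded uniformly in time.
    have key : ∀ r : ℝ, |r| = 1 → r * (T.drift p Δx (Y t₁).state j - T.drift p Δx (Y 0).state j)
        ≤ cD / cL * L 0 := by
      intro r hr
      have hanti : AntitoneOn (fun t ↦ r * T.drift p Δx (Y t).state j + cD / cL * L t)
          (Icc 0 t₁) := by
        refine antitoneOn_of_exists_hasDerivWithinAt
          ((continuousOn_const.mul hc).add (continuousOn_const.mul hLc)) fun t h0 h1 ↦ ?_
        obtain ⟨L', h2, h3⟩ := hLd t h0 h1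
        obtain ⟨f', h4, h5⟩ := hd t h0 h1
        refine ⟨_, (h4.const_mul r).add (h2.const_mul (cD / cL)), ?_⟩
        have h6 : r * f' ≤ |f'| := (le_abs_self _).trans (by rw [abs_mul, hr, one_mul])
        have h7 := mul_le_mul_of_nonneg_left h3 (by positivity : 0 ≤ cD / cL)
        have h8 : cD / cL * -(cL * sizeSq p (Y t).state (Y t).rate)
            = -(cD * sizeSq p (Y t).state (Y t).rate) := by
          field_simp
        linarith
      have h1 := hanti ⟨le_rfl, ht₁⟩ ⟨ht₁, le_rfl⟩ ht₁
      have h2 : 0 ≤ cD / cL * L t₁ := mul_nonneg (by positivity) (hL0 t₁ ht₁)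
      simp only at h1
      linarith
    rw [abs_le]
    constructor
    · linarith [key (-1) (by simp)]
    · linarith [key 1 (by simp)]
  refine ⟨hLanti, ?_⟩
  have hgap : ∀ t, 0 ≤ t → ‖integralGap T.kz Δx (Y t).state‖ + posSize p (Y t).state
      + velSize (Y t).state ≤ cs * Real.sqrt (L t) := by
    intro t h0
    linarith [(hsqrt Δx ΔR _ (Y t).rate (hv t h0)).2.2, norm_nonneg (Y t).rate,
      norm_nonneg ((Y t).state.eI - T.kI⁻¹ • ΔR)]
  have hs0 := Real.sqrt_nonneg (L 0)
  have hs1 : Real.sqrt (L t₁) ≤ Real.sqrt (L 0) := Real.sqrt_le_sqrt hLanti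
  have hg1 := hgap t₁ ht₁
  have hg0 := hgap 0 le_rfl
  have hg1' : ‖integralGap T.kz Δx (Y t₁).state‖ + posSize p (Y t₁).state
      + velSize (Y t₁).state ≤ cs * Real.sqrt (L 0) :=
    hg1.trans (mul_le_mul_of_nonneg_left hs1 hcs)
  have hE0 : 0 ≤ exDist T.kz Δx (Y 0).state := norm_nonneg _
  have e1 : 0 ≤ cC * cs * Real.sqrt (L 0) := by positivity
  have e2 : 0 ≤ cD / cL * L 0 := mul_nonneg (by positivity) (hL0 0 le_rfl)
  have e3 : 0 ≤ cs / T.kz * Real.sqrt (L 0) := by positivity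
  have e4 : 0 ≤ (2 * cC * cs + cs / T.kz) * L 0 := mul_nonneg (by positivity) (hL0 0 le_rfl)
  have e5 : 0 ≤ cD / cL * Real.sqrt (L 0) := by positivity
  change exDist T.kz Δx (Y t₁).state ≤ exDist T.kz Δx (Y 0).state
    + (2 * cC * cs + cD / cL + cs / T.kz) * (Real.sqrt (L 0) + L 0)
  have hbase : exDist T.kz Δx (Y 0).state
      + (2 * (cC * cs * Real.sqrt (L 0)) + cD / cL * L 0 + cs / T.kz * Real.sqrt (L 0))
      ≤ exDist T.kz Δx (Y 0).state
        + (2 * cC * cs + cD / cL + cs / T.kz) * (Real.sqrt (L 0) + L 0) := by linarith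
  refine le_trans ?_ hbase
  refine (pi_norm_le_iff_of_nonneg (by positivity)).2 ?_
  rintro (i | i)
  -- The force components of `ex` are controlled through the integral gap; only the link components
  -- need `drift`.
  · have k1 : ((Y t₁).state.ex - Sum.elim (T.kz⁻¹ • Δx) 0 : XIdx n → ℝ) (Sum.inl i)
        = -(T.kz⁻¹ * integralGap T.kz Δx (Y t₁).state i) := by
      simp [integralGap]
      field_simp
      ring
    rw [k1, Real.norm_eq_abs, abs_neg, abs_mul, abs_of_pos (inv_pos.2 hkz)]
    have k2 : |integralGap T.kz Δx (Y t₁).state i| ≤ cs * Real.sqrt (L 0) :=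
      (abs_apply_le_norm _ i).trans (by
        linarith [posSize_nonneg p (Y t₁).state, velSize_nonneg (Y t₁).state])
    have k3 := mul_le_mul_of_nonneg_left k2 (inv_pos.2 hkz).le
    have k4 : T.kz⁻¹ * (cs * Real.sqrt (L 0)) = cs / T.kz * Real.sqrt (L 0) := by
      field_simp
    linarith
  · have k1 : ((Y t₁).state.ex - Sum.elim (T.kz⁻¹ • Δx) 0 : XIdx n → ℝ) (Sum.inr i)
        = (Y t₁).state.ex (Sum.inr i) := by simp
    have k2 : |(Y 0).state.ex (Sum.inr i)| ≤ exDist T.kz Δx (Y 0).state := by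
      have := norm_le_pi_norm ((Y 0).state.ex - Sum.elim (T.kz⁻¹ • Δx) 0 : XIdx n → ℝ) (Sum.inr i)
      rw [exDist]
      simpa using this
    rw [k1, Real.norm_eq_abs]
    have k3 := abs_le.1 ((hclose Δx _ (hv t₁ ht₁) (Sum.inr i)).trans
      (mul_le_mul_of_nonneg_left hg1' hcC))
    have k4 := abs_le.1 ((hclose Δx _ (hv 0 le_rfl) (Sum.inr i)).trans
      (mul_le_mul_of_nonneg_left hg0 hcC))
    have k5 := abs_le.1 (hΘ (Sum.inr i))
    have k6 := abs_le.1 k2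
    rw [abs_le]
    constructor <;> linarith [k3.1, k3.2, k4.1, k4.2, k5.1, k5.2, k6.1, k6.2]

end Confinement

end QuadCable

namespace QuadCable

/-! ### Compact regions and convergence -/

section Region

variable {n : ℕ} {p : Params n}

theorem isClosed_valid : IsClosed {Y : Coord n | Y.state.Valid} := by
  have hR : Continuous fun Y : Coord n ↦ Y.state.R := by
    simp only [Coord.state]
    fun_prop
  have h : {Y : Coord n | Y.state.Valid} = ({Y | Y.state.Rᵀ * Y.state.R = 1} ∩ {Y | Y.state.R.det = 1})
      ∩ ((⋂ i, {Y | Y.state.q i ⬝ᵥ Y.state.q i = 1}) ∩ ⋂ i, {Y | Y.state.q i ⬝ᵥ Y.state.ω i = 0}) := by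
    ext Y
    simp only [mem_ofPred_eq, mem_inter_iff, mem_iInter, ← mem_SO3_iff]
    exact ⟨fun h ↦ ⟨h.1, h.2, h.3⟩, fun h ↦ ⟨h.1, h.2.1, h.2.2⟩⟩
  rw [h]
  refine ((isClosed_eq (hR.matrix_transpose.matrix_mul hR) continuous_const).inter
    (isClosed_eq hR.matrix_det continuous_const)).inter
    ((isClosed_iInter fun i ↦ isClosed_eq ?_ continuous_const).inter
      (isClosed_iInter fun i ↦ isClosed_eq ?_ continuous_const)) <;>
  · simp only [Coord.state, dotProduct]
    fun_prop

theorem continuous_exDist (kz : ℝ) (Δx : V3) : Continuous fun Y : Coord n ↦ exDist kz Δx Y.state := by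
  simp only [exDist, Coord.state]
  fun_prop

/-- The Lyapunov function and the constraints bound all coordinates except the link components of
`ex`, for which `exDist` is needed. -/
theorem Tuning.Good.isCompact_region {T : Tuning} {δ δR η : ℝ} (hT : T.Good p δ δR η)
    (Δx ΔR : V3) (v B : ℝ) :
    IsCompact {Y : Coord n | Y.state.Valid ∧ T.lyap p Δx ΔR Y.state Y.rate ≤ v ∧
      exDist T.kz Δx Y.state ≤ B} := by
  obtain ⟨c, hc, hsqrt⟩ := hT.exists_sqrt_bound
  refine Metric.isCompact_of_isClosed_isBounded (isClosed_valid.inter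
    ((isClosed_le (contDiff_lyap (m := 0) p T Δx ΔR).continuous continuous_const).inter
      (isClosed_le (continuous_exDist _ _) continuous_const))) ?_
  obtain ⟨S, hS⟩ : ∃ S, S = c * Real.sqrt v := ⟨_, rfl⟩
  have hS0 : 0 ≤ S := by
    rw [hS]
    positivity
  obtain ⟨M, hM⟩ : ∃ M, M = S + 1 + ‖p.xd‖ + |B| + ‖(Sum.elim (T.kz⁻¹ • Δx) 0 : XIdx n → ℝ)‖
    + ‖T.kI⁻¹ • ΔR‖ := ⟨_, rfl⟩
  refine (Metric.isBounded_closedBall (x := (0 : Coord n)) (r := M)).subset fun Y hY ↦ ?_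
  obtain ⟨h, hl, he⟩ := hY
  have h1 := (hsqrt Δx ΔR _ Y.rate h).2.2
  have h2 : c * Real.sqrt (T.lyap p Δx ΔR Y.state Y.rate) ≤ S :=
    hS ▸ mul_le_mul_of_nonneg_left (Real.sqrt_le_sqrt hl) hc
  rw [posSize, velSize] at h1
  have n0 := norm_nonneg (integralGap T.kz Δx Y.state)
  have n1 := norm_nonneg (Y.state.x - p.xd)
  have n2 := norm_nonneg (Y.state.q - fun _ ↦ e3)
  have n3 := norm_nonneg Y.state.v
  have n4 := norm_nonneg Y.state.ω
  have n5 := norm_nonneg Y.rate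
  have n6 := norm_nonneg (Y.state.eI - T.kI⁻¹ • ΔR)
  have n7 := norm_nonneg p.xd
  have n8 := abs_nonneg B
  have n9 := norm_nonneg (Sum.elim (T.kz⁻¹ • Δx) 0 : XIdx n → ℝ)
  have n10 := norm_nonneg (T.kI⁻¹ • ΔR)
  have k1 : ‖Y.state.x‖ ≤ M := by
    linarith [norm_le_norm_sub_add Y.state.x p.xd]
  have k2 : ‖Y.state.q‖ ≤ M :=
    ((pi_norm_le_iff_of_nonneg zero_le_one).2 h.norm_q_le).trans (by linarith)
  have k3 : ‖Y.state.ex‖ ≤ M := by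
    rw [exDist] at he
    linarith [norm_le_norm_sub_add Y.state.ex (Sum.elim (T.kz⁻¹ • Δx) 0), le_abs_self B]
  have k4 : ‖Y.2.2.2.2.2.1‖ ≤ M := by
    refine (((pi_norm_le_iff_of_nonneg zero_le_one).2 fun i ↦
      (pi_norm_le_iff_of_nonneg zero_le_one).2 fun j ↦ ?_)).trans (by linarith : (1 : ℝ) ≤ M)
    exact SO3_abs_apply_le h.R_mem i j
  have k5 : ‖Y.state.eI‖ ≤ M := by
    linarith [norm_le_norm_sub_add Y.state.eI (T.kI⁻¹ • ΔR)]
  have k6 : ‖Y.state.v‖ ≤ M := by linarith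
  have k7 : ‖Y.state.ω‖ ≤ M := by linarith
  have k8 : ‖Y.rate‖ ≤ M := by linarith
  rw [mem_closedBall_zero_iff]
  simp only [norm_prod_le_iff]
  exact ⟨k1, k6, k2, k7, k3, k4, k8, k5⟩

/-- Along the reduced dynamics velocities are bounded on compact sets. -/
theorem Tuning.Good.exists_velocity_bound (hp : p.Physical) {T : Tuning} {δ δR η : ℝ}
    (hT : T.Good p δ δR η) {Δx : V3} (hΔ : ‖Δx‖ ≤ δ) (ΔR : V3) {K : Set (Coord n)}
    (hK : IsCompact K) (hKl : ∀ Y ∈ K, T.lyap p Δx ΔR Y.state Y.rate ≤ T.level δ) :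
    ∃ M, ∀ (Y : ℝ → Coord n) (t : ℝ), 0 ≤ t → Y t ∈ K → Follows p (T.gains p δ) Δx ΔR Y t →
      ∃ Y', HasDerivWithinAt Y Y' (Ici 0) t ∧ ‖Y'‖ ≤ M := by
  obtain ⟨ca, hca, hacc⟩ := hp.exists_acceleration_bound
  set k := T.gains p δ with hk
  obtain ⟨f, hf⟩ : ∃ f : Coord n → V3, f = fun Y ↦ T.forceGap p Δx Y.state - Δx
    - (M00 p * p.g) • e3 := ⟨_, rfl⟩
  obtain ⟨w', hw'⟩ : ∃ f : Coord n → V3, f = fun Y ↦ p.J⁻¹ *ᵥ (-(k.kR • attVec Y.state.R)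
    - k.kΩ • Y.rate - k.kI • Y.state.eI + ΔR) := ⟨_, rfl⟩
  have c1 : Continuous f := by
    rw [hf]
    exact (((contDiff_forceGap (m := 0) p T Δx).continuous).sub continuous_const).sub continuous_const
  have c2 : Continuous fun Y : Coord n ↦ attVec Y.state.R := by
    refine continuous_pi fun i ↦ ?_
    fin_cases i <;> simp [attVec, vee, Coord.state] <;> fun_prop
  have c3 : Continuous fun Y : Coord n ↦ Y.rate := by
    simp only [Coord.rate]
    fun_prop
  have c4 : Continuous fun Y : Coord n ↦ Y.state.eI := by
    simp only [Coord.state]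
    fun_prop
  have c5 : Continuous w' := by
    rw [hw']
    exact continuous_const.matrix_mulVec (by fun_prop)
  have c6 : Continuous fun Y : Coord n ↦ attErr Y.state.R := by
    simp only [attErr_eq, Coord.state, Matrix.of_apply]
    fun_prop
  have c7 : Continuous fun Y : Coord n ↦ (k.P * clB p)ᵀ *ᵥ z1 p Y.state := by
    refine continuous_const.matrix_mulVec (continuous_pi ?_)
    rintro (i | i)
    · exact continuous_pi_iff.1 (contDiff_posErr (m := 0) p).continuous i
    · exact continuous_pi_iff.1 (contDiff_velErr (m := 0)).continuous i
  have c8 : Continuous fun Y : Coord n ↦ linkVel Y.state :=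
    continuous_pi fun i ↦ (contDiff_linkVel (m := 0) i).continuous
  have c9 : Continuous fun Y : Coord n ↦ fun i j ↦ (Y.state.R * hat Y.rate) i j := by
    refine continuous_pi fun i ↦ continuous_pi fun j ↦ ?_
    fin_cases j <;> simp [Matrix.mul_apply, hat, Fin.sum_univ_three, Coord.state, Coord.rate] <;>
      fun_prop
  have c10 : Continuous fun Y : Coord n ↦ Y.state.v := by
    simp only [Coord.state]
    fun_prop
  have c11 : Continuous fun Y : Coord n ↦ Y.state.ω := by
    simp only [Coord.state]
    fun_prop
  obtain ⟨M1, h1⟩ := hK.exists_bound_of_continuousOn (f := fun Y ↦ (f Y, f Y ⬝ᵥ f Y * attErr Y.state.R,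
    Y.state.ω, Y.state.v, linkVel Y.state, (k.P * clB p)ᵀ *ᵥ z1 p Y.state,
    (fun i j ↦ (Y.state.R * hat Y.rate) i j : Fin 3 → Fin 3 → ℝ), w' Y, Y.rate + k.c2 • attVec Y.state.R))
    (Continuous.continuousOn (by fun_prop))
  obtain ⟨A, hA⟩ : ∃ A, A = ca * (1 + (M1 + (1 + 4 * M1) + ‖(M00 p * p.g) • e3 + Δx‖)
    + 3 * M1 ^ 2) := ⟨_, rfl⟩
  refine ⟨M1 + 2 * A, fun Y t ht hYK hY ↦ ?_⟩
  obtain ⟨a, b, d, w₁, h⟩ := hY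
  have h2 := h1 _ hYK
  simp only [norm_prod_le_iff] at h2
  obtain ⟨b1, b2, b3, b4, b5, b6, b7, b8, b9⟩ := h2
  have hM1 : 0 ≤ M1 := (norm_nonneg _).trans b1
  have hsat := (hT.small Δx ΔR _ _ hΔ h.valid (hKl _ hYK)).2.2.2
  have hf1 : idealThrust p k (Y t).state = f (Y t) := by
    rw [hf]
    exact T.idealThrust_eq hsat
  have hdev := h.deviation
  rw [hf1] at hdev
  have hd : ‖d‖ ≤ 1 + 4 * M1 := by
    have k1 := norm_sq_le_dot_self d
    have k2 := (le_abs_self _).trans b2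
    refine abs_le_of_sq_le_sq' (?_ : ‖d‖ ^ 2 ≤ (1 + 4 * M1) ^ 2) (by positivity) |>.2
    nlinarith
  have hbase : ‖baseMom p a b‖ ≤ M1 + (1 + 4 * M1) + ‖(M00 p * p.g) • e3 + Δx‖ := by
    rw [h.base, hf1, add_assoc]
    exact (norm_add_le _ _).trans (add_le_add ((norm_add_le _ _).trans (add_le_add b1 hd)) le_rfl)
  have hab : ‖a‖ + ‖b‖ ≤ A := by
    refine (hacc _ a b (3 * M1 ^ 2) (by positivity) h.valid.q_unit h.link fun i ↦ ?_).trans ?_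
    · rw [h.dot_q ht i, abs_neg, abs_of_nonneg (dot_self_nonneg _)]
      refine (dot_self_le _).trans ?_
      have := pow_le_pow_left₀ (norm_nonneg _) ((norm_le_pi_norm (Y t).state.ω i).trans b3) 2
      linarith
    · rw [hA]
      exact mul_le_mul_of_nonneg_left (by linarith) hca.le
  have na := norm_nonneg a
  have nb := norm_nonneg b
  have hw1 : w₁ = w' (Y t) := by
    rw [hw']
    simp only
    have := congrArg (p.J⁻¹ *ᵥ ·) h.rotation
    simp only [mulVec_mulVec, Matrix.nonsing_inv_mul _ hp.J_pos.det_pos.ne'.isUnit, one_mulVec] at this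
    exact this
  refine ⟨((Y t).state.v, a, linkVel (Y t).state, fun i ↦ crossProduct ((Y t).state.q i) (b i),
    (k.P * clB p)ᵀ *ᵥ z1 p (Y t).state, fun i j ↦ ((Y t).state.R * hat (Y t).rate) i j, w₁,
    (Y t).rate + k.c2 • attVec (Y t).state.R), ?_, ?_⟩
  · exact h.x_deriv.prodMk (h.v_deriv.prodMk ((hasDerivWithinAt_pi.2 h.q_deriv).prodMk
      ((hasDerivWithinAt_pi.2 h.ω_deriv).prodMk (h.ex_deriv.prodMk
        ((hasDerivWithinAt_pi.2 fun i ↦ hasDerivWithinAt_pi.2 fun j ↦ h.R_deriv i j).prodMk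
          (h.w_deriv.prodMk h.eI_deriv))))))
  · have hA0 : 0 ≤ A := (add_nonneg na nb).trans hab
    simp only [norm_prod_le_iff]
    refine ⟨by linarith, by linarith, by linarith, ?_, by linarith, by linarith, ?_, by linarith⟩
    · refine (pi_norm_le_iff_of_nonneg (by positivity)).2 fun i ↦ (norm_cross_le _ _).trans ?_
      have := mul_le_mul (h.valid.norm_q_le i) (norm_le_pi_norm b i) (norm_nonneg _) zero_le_one
      linarith
    · rw [hw1]
      linarith

variable (p) in
/-- A smooth measure of the tracking errors. -/
noncomputable def trackSq (st : State n) (w : V3) : ℝ :=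
  (st.x - p.xd) ⬝ᵥ (st.x - p.xd) + st.v ⬝ᵥ st.v + ∑ i, (st.q i - e3) ⬝ᵥ (st.q i - e3)
    + ∑ i, st.ω i ⬝ᵥ st.ω i + w ⬝ᵥ w + attErr st.R

theorem contDiff_trackSq {m : WithTop ℕ∞} :
    ContDiff ℝ m fun Y : Coord n ↦ trackSq p Y.state Y.rate := by
  simp only [trackSq, attErr_eq, Coord.state, Coord.rate, dotProduct, Matrix.of_apply]
  fun_prop

theorem norm_sq_le_sum_dot (f : Fin n → V3) : ‖f‖ ^ 2 ≤ ∑ i, f i ⬝ᵥ f i := by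
  have h0 : 0 ≤ ∑ i, f i ⬝ᵥ f i := Finset.sum_nonneg fun i _ ↦ dot_self_nonneg _
  rw [← Real.sq_sqrt h0]
  refine pow_le_pow_left₀ (norm_nonneg _) ((pi_norm_le_iff_of_nonneg (Real.sqrt_nonneg _)).2
    fun i ↦ Real.le_sqrt_of_sq_le ((norm_sq_le_dot_self _).trans ?_)) 2
  exact Finset.single_le_sum (f := fun i ↦ f i ⬝ᵥ f i) (fun i _ ↦ dot_self_nonneg _)
    (Finset.mem_univ i)

theorem sum_dot_le (f : Fin n → V3) : ∑ i, f i ⬝ᵥ f i ≤ n * (3 * ‖f‖ ^ 2) := by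
  have := Finset.sum_le_card_nsmul Finset.univ (fun i ↦ f i ⬝ᵥ f i) (3 * ‖f‖ ^ 2) fun i _ ↦
    (dot_self_le (f i)).trans (by
      have := pow_le_pow_left₀ (norm_nonneg _) (norm_le_pi_norm f i) 2
      linarith)
  simpa using this

theorem trackSq_le {st : State n} (h : st.Valid) (w : V3) :
    trackSq p st w ≤ (3 + 3 * n) * sizeSq p st w := by
  have n1 := norm_nonneg (st.x - p.xd)
  have n2 := norm_nonneg st.v
  have n3 := norm_nonneg (st.q - fun _ ↦ e3)
  have n4 := norm_nonneg st.ω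
  have hn : (0 : ℝ) ≤ n := Nat.cast_nonneg n
  have k1 : ‖st.x - p.xd‖ ^ 2 ≤ posSize p st ^ 2 :=
    pow_le_pow_left₀ n1 (by rw [posSize]; linarith) 2
  have k2 : ‖st.v‖ ^ 2 ≤ velSize st ^ 2 := pow_le_pow_left₀ n2 (by rw [velSize]; linarith) 2
  have k3 : ‖st.q - fun _ ↦ e3‖ ^ 2 ≤ posSize p st ^ 2 :=
    pow_le_pow_left₀ n3 (by rw [posSize]; linarith) 2
  have k4 : ‖st.ω‖ ^ 2 ≤ velSize st ^ 2 := pow_le_pow_left₀ n4 (by rw [velSize]; linarith) 2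
  have h1 := dot_self_le (st.x - p.xd)
  have h2 := dot_self_le st.v
  have h3 : ∑ i, (st.q i - e3) ⬝ᵥ (st.q i - e3) ≤ n * (3 * ‖st.q - fun _ ↦ e3‖ ^ 2) := by
    have h := sum_dot_le (st.q - fun _ ↦ e3)
    simp only [Pi.sub_apply] at h
    exact h
  have h4 := sum_dot_le st.ω
  have h5 := dot_self_nonneg w
  have h6 := attErr_nonneg h.R_mem
  have k5 := mul_le_mul_of_nonneg_left k3 hn
  have k6 := mul_le_mul_of_nonneg_left k4 hn
  have k7 := mul_nonneg hn h5
  have k8 := mul_nonneg hn h6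
  rw [trackSq, sizeSq]
  linarith

theorem sizes_le_sqrt_trackSq {st : State n} (h : st.Valid) (w : V3) :
    posSize p st + velSize st + attErr st.R + ‖w‖
      ≤ 5 * Real.sqrt (trackSq p st w) + trackSq p st w := by
  have h1 := norm_sq_le_dot_self (st.x - p.xd)
  have h2 := norm_sq_le_dot_self st.v
  have h3 : ‖st.q - fun _ ↦ e3‖ ^ 2 ≤ ∑ i, (st.q i - e3) ⬝ᵥ (st.q i - e3) :=
    norm_sq_le_sum_dot (st.q - fun _ ↦ e3)
  have h4 := norm_sq_le_sum_dot st.ω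
  have h5 := norm_sq_le_dot_self w
  have h6 := attErr_nonneg h.R_mem
  have s1 := sq_nonneg ‖st.x - p.xd‖
  have s2 := sq_nonneg ‖st.v‖
  have s3 := sq_nonneg ‖st.q - fun _ ↦ e3‖
  have s4 := sq_nonneg ‖st.ω‖
  have s5 := sq_nonneg ‖w‖
  obtain ⟨f, hf⟩ : ∃ f, f = trackSq p st w := ⟨_, rfl⟩
  rw [← hf]
  rw [trackSq] at hf
  have k1 : ‖st.x - p.xd‖ ≤ Real.sqrt f := Real.le_sqrt_of_sq_le (by linarith)
  have k2 : ‖st.v‖ ≤ Real.sqrt f := Real.le_sqrt_of_sq_le (by linarith)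
  have k3 : ‖st.q - fun _ ↦ e3‖ ≤ Real.sqrt f := Real.le_sqrt_of_sq_le (by linarith)
  have k4 : ‖st.ω‖ ≤ Real.sqrt f := Real.le_sqrt_of_sq_le (by linarith)
  have k5 : ‖w‖ ≤ Real.sqrt f := Real.le_sqrt_of_sq_le (by linarith)
  rw [posSize, velSize]
  linarith

/-- A curve that stays in a compact part of the region of the analysis converges. -/
theorem Tuning.Good.tendsto_zero (hp : p.Physical) {T : Tuning} {δ δR η : ℝ}
    (hT : T.Good p δ δR η) {Δx : V3} (hΔ : ‖Δx‖ ≤ δ) {ΔR : V3} {K : Set (Coord n)}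
    (hK : IsCompact K) (hKl : ∀ Y ∈ K, T.lyap p Δx ΔR Y.state Y.rate ≤ T.level δ ∧
      ‖T.forceGap p Δx Y.state‖ ≤ δ + 1) {Y : ℝ → Coord n}
    (hY : ∀ t, 0 ≤ t → Y t ∈ K ∧ Follows p (T.gains p δ) Δx ΔR Y t) :
    Tendsto (fun t ↦ posSize p (Y t).state + velSize (Y t).state + attErr (Y t).state.R + ‖(Y t).rate‖)
      atTop (𝓝 0) := by
  obtain ⟨M, hM⟩ := hT.exists_velocity_bound hp hΔ ΔR hK fun Y hY ↦ (hKl Y hY).1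
  obtain ⟨c, hc, hdecay⟩ := hT.decay
  obtain ⟨cs, hcs, hsqrt⟩ := hT.exists_sqrt_bound
  have hv : ∀ t, 0 ≤ t → (Y t).state.Valid := fun t ht ↦ by
    obtain ⟨-, a, b, d, w', h⟩ := hY t ht
    exact h.valid
  have hsm := contDiff_trackSq (p := p) (m := 1)
  obtain ⟨L, hL⟩ := hK.exists_bound_of_continuousOn (hsm.continuous_fderiv one_ne_zero).continuousOn
  have hC : (0 : ℝ) < 3 + 3 * n := by positivity
  have hder : ∀ t, 0 ≤ t → ∃ Y', HasDerivWithinAt Y Y' (Ici 0) t ∧ ‖Y'‖ ≤ M := fun t ht ↦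
    hM Y t ht (hY t ht).1 (hY t ht).2
  choose! Y' hY' hYM using hder
  have hlyap : ∀ t, 0 ≤ t → ∃ V', HasDerivWithinAt
      (fun τ ↦ T.lyap p Δx ΔR (Y τ).state (Y τ).rate) V' (Ici 0) t ∧
      V' ≤ -(c * sizeSq p (Y t).state (Y t).rate) := fun t ht ↦ by
    obtain ⟨hYK, a, b, d, w', h⟩ := hY t ht
    exact hdecay Δx ΔR _ _ t a b d w' ht hΔ h (hKl _ hYK).1 (hKl _ hYK).2
  choose! V' hV' hVc using hlyap
  have hnn : ∀ t, 0 ≤ t → 0 ≤ trackSq p (Y t).state (Y t).rate := fun t ht ↦ by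
    have h1 := attErr_nonneg (hv t ht).R_mem
    have h2 := Finset.sum_nonneg fun i (_ : i ∈ Finset.univ) ↦ dot_self_nonneg ((Y t).state.q i - e3)
    have h3 := Finset.sum_nonneg fun i (_ : i ∈ Finset.univ) ↦ dot_self_nonneg ((Y t).state.ω i)
    rw [trackSq]
    linarith [dot_self_nonneg ((Y t).state.x - p.xd), dot_self_nonneg (Y t).state.v,
      dot_self_nonneg (Y t).rate]
  -- `trackSq` replaces the norms because it is differentiable. A multiple of it is below the rate
  -- of dissipation, and its derivative along the curve is bounded because velocities are bounded on
  -- `K`.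
  have key := tendsto_zero_of_dissipation
    (V := fun t ↦ T.lyap p Δx ΔR (Y t).state (Y t).rate) (V' := V')
    (f := fun t ↦ c / (3 + 3 * n) * trackSq p (Y t).state (Y t).rate)
    (f' := fun t ↦ c / (3 + 3 * n) *
      fderiv ℝ (fun Y : Coord n ↦ trackSq p Y.state Y.rate) (Y t) (Y' t))
    (L := c / (3 + 3 * n) * (L * M)) hV' (fun t ht ↦ (hsqrt Δx ΔR _ _ (hv t ht)).1)
    (fun t ht ↦ (hVc t ht).trans ?_) (fun t ht ↦ mul_nonneg (by positivity) (hnn t ht))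
    (fun t ht ↦ ?_) (fun t ht ↦ ?_)
  · have h0 : Tendsto (fun t ↦ trackSq p (Y t).state (Y t).rate) atTop (𝓝 0) := by
      have := key.const_mul ((3 + 3 * n) / c)
      rw [mul_zero] at this
      refine this.congr fun t ↦ ?_
      field_simp
    have h1 := ((Real.continuous_sqrt.tendsto 0).comp h0).const_mul 5 |>.add h0
    rw [Real.sqrt_zero, mul_zero, add_zero] at h1
    refine tendsto_of_tendsto_of_tendsto_of_le_of_le' tendsto_const_nhds h1 ?_ ?_
    · filter_upwards [eventually_ge_atTop 0] with t ht
      have := attErr_nonneg (hv t ht).R_mem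
      linarith [posSize_nonneg p (Y t).state, velSize_nonneg (Y t).state, norm_nonneg (Y t).rate]
    · filter_upwards [eventually_ge_atTop 0] with t ht
      exact sizes_le_sqrt_trackSq (hv t ht) _
  · have h1 := trackSq_le (p := p) (hv t ht) (Y t).rate
    rw [neg_le_neg_iff, div_mul_eq_mul_div, div_le_iff₀ hC]
    have := mul_le_mul_of_nonneg_left h1 hc.le
    linarith
  · exact ((hsm.differentiable one_ne_zero (Y t)).hasFDerivAt.comp_hasDerivWithinAt t
      (hY' t ht)).const_mul _
  · rw [abs_mul, abs_of_pos (by positivity)]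
    refine mul_le_mul_of_nonneg_left ?_ (by positivity)
    have h1 := (fderiv ℝ (fun Y : Coord n ↦ trackSq p Y.state Y.rate) (Y t)).le_opNorm (Y' t)
    have h2 := hL _ (hY t ht).1
    exact h1.trans (mul_le_mul h2 (hYM t ht) (norm_nonneg _) ((norm_nonneg _).trans h2))

end Region

end QuadCable

namespace QuadCable

/-! ### Trapping regions -/

section Trapping

variable {n : ℕ} {p : Params n}

variable (p) in
/-- Curves that start in `S` and follow the reduced dynamics do not leave the open set `G`, and
their states remain in the compact set `K`, where the command is well defined. -/
structure Tuning.Trap (T : Tuning) (δ : ℝ) (Δx ΔR : V3) (S K G : Set (Coord n)) : Prop where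
  isOpen : IsOpen G
  isCompact : IsCompact K
  mem : ∀ Y ∈ G, Y.state.Valid → Y ∈ K
  stays : ∀ (Y : ℝ → Coord n) (t₁ : ℝ), 0 ≤ t₁ → ContinuousOn Y (Ici 0) →
    (∀ t, 0 ≤ t → (Y t).state.Valid) → Y 0 ∈ S →
    (∀ t, 0 ≤ t → t < t₁ → Y t ∈ G ∧ Follows p (T.gains p δ) Δx ΔR Y t) → Y t₁ ∈ G
  valid : ∀ Y ∈ K, Y.state.Valid
  lyap_le : ∀ Y ∈ K, T.lyap p Δx ΔR Y.state Y.rate ≤ T.level δ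
  gap_le : ∀ Y ∈ K, ‖T.forceGap p Δx Y.state‖ ≤ δ + 1
  command : ∀ Y ∈ K, crossProduct p.b1d (idealThrust p (T.gains p δ) Y.state) ≠ 0

/-- The dynamics is required only while the curve is in `K`. This permits the application to an
integral curve of the cut-off field. -/
theorem Tuning.Trap.forall_mem {T : Tuning} {δ : ℝ} {Δx ΔR : V3} {S K G : Set (Coord n)}
    (h : T.Trap p δ Δx ΔR S K G) {Y : ℝ → Coord n} (hY : ContinuousOn Y (Ici 0))
    (hv : ∀ t, 0 ≤ t → (Y t).state.Valid) (h0 : Y 0 ∈ S)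
    (hf : ∀ t, 0 ≤ t → Y t ∈ K → Follows p (T.gains p δ) Δx ΔR Y t) : ∀ t, 0 ≤ t → Y t ∈ K := by
  have key := forall_mem_of_forall_Ico hY h.isOpen fun t₁ h1 hG ↦
    h.stays Y t₁ h1 hY hv h0 fun t ht ht1 ↦
      ⟨hG t ht ht1, hf t ht (h.mem _ (hG t ht ht1) (hv t ht))⟩
  exact fun t ht ↦ h.mem _ (key t ht) (hv t ht)

theorem Tuning.Trap.tendsto_zero (hp : p.Physical) {T : Tuning} {δ δR η : ℝ}
    (hT : T.Good p δ δR η) {Δx ΔR : V3} (hΔ : ‖Δx‖ ≤ δ) {S K G : Set (Coord n)}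
    (h : T.Trap p δ Δx ΔR S K G) {Y : ℝ → Coord n}
    (hY : ∀ t, 0 ≤ t → Y t ∈ K ∧ Follows p (T.gains p δ) Δx ΔR Y t) :
    Tendsto (fun t ↦ posSize p (Y t).state + velSize (Y t).state + attErr (Y t).state.R + ‖(Y t).rate‖)
      atTop (𝓝 0) :=
  hT.tendsto_zero hp hΔ h.isCompact (fun Y hY ↦ ⟨h.lyap_le Y hY, h.gap_le Y hY⟩) hY

/-- Nondegeneracy of the command becomes a condition on the effective disturbance `Δx - forceGap`,
for which the hypotheses of the theorem are made. -/
theorem Tuning.Good.cross_idealThrust {T : Tuning} {δ δR η : ℝ} (hT : T.Good p δ δR η)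
    {Δx ΔR : V3} (hΔ : ‖Δx‖ ≤ δ) {st : State n} {w : V3} (hv : st.Valid)
    (hl : T.lyap p Δx ΔR st w ≤ T.level δ) :
    crossProduct p.b1d (idealThrust p (T.gains p δ) st)
      = -crossProduct p.b1d ((M00 p * p.g) • e3 + (Δx - T.forceGap p Δx st)) := by
  rw [T.idealThrust_eq (Δx := Δx) (hT.small Δx ΔR st w hΔ hv hl).2.2.2, ← map_neg]
  congr 1
  abel

theorem Tuning.norm_forceGap_le {T : Tuning} (hκ : 0 ≤ T.κ) (Δx : V3) (st : State n) :
    ‖T.forceGap p Δx st‖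
      ≤ ‖integralGap T.kz Δx st‖ + T.κ * velSize st + posSize p st := by
  have h1 := norm_sub_le (integralGap T.kz Δx st - T.κ • st.v) (st.x - p.xd)
  have h2 := norm_sub_le (integralGap T.kz Δx st) (T.κ • st.v)
  have h3 : ‖T.κ • st.v‖ ≤ T.κ * velSize st := by
    rw [norm_smul, Real.norm_of_nonneg hκ, velSize]
    exact mul_le_mul_of_nonneg_left (by linarith [norm_nonneg st.ω]) hκ
  rw [Tuning.forceGap, posSize]
  linarith [norm_nonneg (st.q - fun _ ↦ e3)]

theorem integralGap_dot_self_le {kz : ℝ} (hkz : 0 < kz) (Δx : V3) (st : State n) :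
    integralGap kz Δx st ⬝ᵥ integralGap kz Δx st ≤ 3 * (kz * exDist kz Δx st) ^ 2 := by
  have h0 : 0 ≤ exDist kz Δx st := norm_nonneg _
  refine (dot_self_le _).trans (mul_le_mul_of_nonneg_left
    (pow_le_pow_left₀ (norm_nonneg _) ?_ 2) (by norm_num))
  refine (pi_norm_le_iff_of_nonneg (by positivity)).2 fun i ↦ ?_
  have h1 := norm_le_pi_norm (st.ex - Sum.elim (kz⁻¹ • Δx) 0 : XIdx n → ℝ) (Sum.inl i)
  have h2 : integralGap kz Δx st i
      = -(kz * (st.ex - Sum.elim (kz⁻¹ • Δx) 0 : XIdx n → ℝ) (Sum.inl i)) := by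
    simp [integralGap]
    field_simp
    ring
  rw [h2, norm_neg, norm_mul, Real.norm_of_nonneg hkz.le]
  exact mul_le_mul_of_nonneg_left h1 hkz.le

/-- Every neighbourhood of the equilibrium contains a trapping region. -/
theorem Tuning.Good.exists_trap_near (hp : p.Physical) {T : Tuning} {δ δR η : ℝ} (hδ : 0 < δ)
    (hT : T.Good p δ δR η) {Δx : V3} (hΔ : ‖Δx‖ ≤ δ) (ΔR : V3)
    (hne : crossProduct p.b1d ((M00 p * p.g) • e3 + Δx) ≠ 0) {ε : ℝ} (hε : 0 < ε) :
    ∃ S K G : Set (Coord n), T.Trap p δ Δx ΔR S K G ∧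
      (∃ ρ > 0, ∀ Y : Coord n, Y.state.Valid → sizeSq p Y.state Y.rate ≤ ρ →
        exDist T.kz Δx Y.state ≤ ρ → ‖Y.state.eI - T.kI⁻¹ • ΔR‖ ≤ ρ → Y ∈ S) ∧
      ∀ Y ∈ K, posSize p Y.state + velSize Y.state + attErr Y.state.R + ‖Y.rate‖
        + exDist T.kz Δx Y.state + ‖Y.state.eI - T.kI⁻¹ • ΔR‖ < ε := by
  obtain ⟨cs, hcs, hsqrt⟩ := hT.exists_sqrt_bound
  obtain ⟨c, hc, hconf⟩ := hT.exists_confinement hp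
  obtain ⟨c₁, hc₁, b, hb, hco⟩ := hT.coercive
  have hκ := hT.κ_pos
  have hkz := hT.kz_pos
  have hkI := hT.kI_pos
  have hlam := hT.lam_pos
  obtain ⟨γ, hγ, hγne⟩ : ∃ γ > 0, ∀ u : V3, ‖u‖ < γ →
      crossProduct p.b1d ((M00 p * p.g) • e3 + (Δx - u)) ≠ 0 := by
    have hcont : Continuous fun u : V3 ↦ crossProduct p.b1d ((M00 p * p.g) • e3 + (Δx - u)) :=
      (contDiff_cross (m := 0) contDiff_const (by fun_prop)).continuous
    have h1 : ∀ᶠ u in 𝓝 (0 : V3), crossProduct p.b1d ((M00 p * p.g) • e3 + (Δx - u)) ≠ 0 :=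
      hcont.continuousAt.eventually_ne (by simpa using hne)
    obtain ⟨γ, hγ, h2⟩ := Metric.eventually_nhds_iff.1 h1
    exact ⟨γ, hγ, fun u hu ↦ h2 (by simpa using hu)⟩
  -- `D` collects the factors by which sizes, resultant force and `exDist` are bounded in terms of
  -- `s`; then `s` makes the total smaller than `ε`, `γ` and `1`.
  obtain ⟨D, hD⟩ : ∃ D, D = cs + cs ^ 2 + 1 + 2 * c + T.κ * cs + cs := ⟨_, rfl⟩
  have hD0 : 0 < D := by
    rw [hD]
    positivity
  have hlev : 0 < T.level δ := by
    rw [Tuning.level]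
    positivity
  obtain ⟨s, hs⟩ : ∃ s, s = min (min 1 (Real.sqrt (T.level δ))) (min ε (min γ 1) / (2 * D)) :=
    ⟨_, rfl⟩
  have hs0 : 0 < s := by
    rw [hs]
    positivity
  have hs1 : s ≤ 1 := hs ▸ (min_le_left _ _).trans (min_le_left _ _)
  have hs2 : s ^ 2 ≤ T.level δ := by
    have : s ≤ Real.sqrt (T.level δ) := hs ▸ (min_le_left _ _).trans (min_le_right _ _)
    exact (Real.le_sqrt' hs0).1 this
  have hs3 : D * s ≤ min ε (min γ 1) / 2 := by
    have : s ≤ min ε (min γ 1) / (2 * D) := hs ▸ min_le_right _ _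
    rw [le_div_iff₀ (by positivity)] at this
    linarith
  have hs4 : s ^ 2 ≤ s := by nlinarith
  have hm1 : min ε (min γ 1) ≤ ε := min_le_left _ _
  have hm2 : min ε (min γ 1) ≤ γ := (min_le_right _ _).trans (min_le_left _ _)
  have hm3 : min ε (min γ 1) ≤ 1 := (min_le_right _ _).trans (min_le_right _ _)
  have hDs : D * s = cs * s + cs ^ 2 * s + s + 2 * c * s + T.κ * cs * s + cs * s := by
    rw [hD]
    ring
  -- Below the level `s ^ 2`, `exDist` grows by at most `c * (s + s ^ 2)` from an initial value
  -- below `s`.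
  obtain ⟨B, hB⟩ : ∃ B, B = s + c * (s + s ^ 2) := ⟨_, rfl⟩
  have hBs : B ≤ s + 2 * c * s := by
    rw [hB]
    linarith [mul_le_mul_of_nonneg_left hs4 hc]
  have z1 : 0 ≤ cs * s := by positivity
  have z2 : 0 ≤ cs ^ 2 * s := by positivity
  have z3 : 0 ≤ c * s := by positivity
  have z4 : 0 ≤ T.κ * cs * s := by positivity
  have hK : ∀ Y : Coord n, Y.state.Valid → T.lyap p Δx ΔR Y.state Y.rate ≤ s ^ 2 →
      attErr Y.state.R ≤ cs ^ 2 * s ∧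
      posSize p Y.state + velSize Y.state + ‖Y.rate‖ + ‖Y.state.eI - T.kI⁻¹ • ΔR‖ ≤ cs * s ∧
      ‖T.forceGap p Δx Y.state‖ < min γ 1 := by
    intro Y hv hl
    obtain ⟨h1, h2, h3⟩ := hsqrt Δx ΔR Y.state Y.rate hv
    have h4 : cs * Real.sqrt (T.lyap p Δx ΔR Y.state Y.rate) ≤ cs * s :=
      mul_le_mul_of_nonneg_left ((Real.sqrt_le_sqrt hl).trans_eq (Real.sqrt_sq hs0.le)) hcs
    have h5 := mul_le_mul_of_nonneg_left (hl.trans hs4) (sq_nonneg cs)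
    have n1 := norm_nonneg (integralGap T.kz Δx Y.state)
    have n2 := posSize_nonneg p Y.state
    have n3 := velSize_nonneg Y.state
    have n4 := norm_nonneg Y.rate
    have n5 := norm_nonneg (Y.state.eI - T.kI⁻¹ • ΔR)
    refine ⟨?_, by linarith, ?_⟩
    · rw [sizeSq] at h2
      linarith [sq_nonneg (posSize p Y.state), sq_nonneg (velSize Y.state),
        dot_self_nonneg Y.rate]
    · have h6 := T.norm_forceGap_le (p := p) hκ.le Δx Y.state
      have h7 := mul_le_mul_of_nonneg_left (by linarith : velSize Y.state ≤ cs * s) hκ.le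
      have h8 : min ε (min γ 1) ≤ min γ 1 := min_le_right _ _
      have h9 : 0 < min γ 1 := by positivity
      linarith
  refine ⟨{Y | Y.state.Valid ∧ T.lyap p Δx ΔR Y.state Y.rate < s ^ 2 ∧ exDist T.kz Δx Y.state < s},
    {Y | Y.state.Valid ∧ T.lyap p Δx ΔR Y.state Y.rate ≤ s ^ 2 ∧ exDist T.kz Δx Y.state ≤ B},
    {Y | T.lyap p Δx ΔR Y.state Y.rate < s ^ 2 ∧ exDist T.kz Δx Y.state < B},
    ⟨?_, hT.isCompact_region Δx ΔR _ _, fun Y hY hv ↦ ⟨hv, hY.1.le, hY.2.le⟩, ?_, fun Y hY ↦ hY.1,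
      fun Y hY ↦ hY.2.1.trans hs2, fun Y hY ↦ ?_, fun Y hY ↦ ?_⟩, ?_, ?_⟩
  · exact (isOpen_lt (contDiff_lyap (m := 0) p T Δx ΔR).continuous continuous_const).inter
      (isOpen_lt (continuous_exDist _ _) continuous_const)
  · rintro Y t₁ ht₁ hYc hv ⟨-, h1, h2⟩ hst
    obtain ⟨h3, h4⟩ := hconf Δx ΔR Y t₁ ht₁ hΔ hYc hv fun t h0 ht ↦ by
      obtain ⟨⟨k1, -⟩, k2⟩ := hst t h0 ht
      refine ⟨k2, k1.le.trans hs2, ?_⟩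
      linarith [(hK _ (hv t h0) k1.le).2.2, min_le_right γ 1]
    refine ⟨h3.trans_lt h1, h4.trans_lt ?_⟩
    have h5 : Real.sqrt (T.lyap p Δx ΔR (Y 0).state (Y 0).rate) ≤ s :=
      (Real.sqrt_le_sqrt h1.le).trans_eq (Real.sqrt_sq hs0.le)
    have h6 := mul_le_mul_of_nonneg_left (add_le_add h5 h1.le) hc
    rw [hB]
    linarith
  · linarith [(hK _ hY.1 hY.2.1).2.2, min_le_right γ 1]
  · rw [hT.cross_idealThrust hΔ hY.1 (hY.2.1.trans hs2), neg_ne_zero]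
    exact hγne _ ((hK _ hY.1 hY.2.1).2.2.trans_le (min_le_left _ _))
  · obtain ⟨E, hE⟩ : ∃ E, E = b + 3 / 2 * T.kz + T.lam * T.kI * (3 / 2) := ⟨_, rfl⟩
    have hE0 : 0 < E := by
      rw [hE]
      positivity
    obtain ⟨ρ, hρ⟩ : ∃ ρ, ρ = min (min 1 (s / 2)) (s ^ 2 / (2 * E)) := ⟨_, rfl⟩
    have hρ0 : 0 < ρ := by
      rw [hρ]
      positivity
    have hρ1 : ρ ≤ 1 := hρ ▸ (min_le_left _ _).trans (min_le_left _ _)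
    have hρ2 : ρ ≤ s / 2 := hρ ▸ (min_le_left _ _).trans (min_le_right _ _)
    have hρ3 : E * ρ ≤ s ^ 2 / 2 := by
      have : ρ ≤ s ^ 2 / (2 * E) := hρ ▸ min_le_right _ _
      rw [le_div_iff₀ (by positivity)] at this
      linarith
    have hρ4 : ρ ^ 2 ≤ ρ := by nlinarith
    refine ⟨ρ, hρ0, fun Y hv h1 h2 h3 ↦ ⟨hv, ?_, by linarith⟩⟩
    refine (hco Δx ΔR _ _ hv).2.trans_lt ?_
    have k1 := integralGap_dot_self_le hkz Δx Y.state
    have k2 : (T.kz * exDist T.kz Δx Y.state) ^ 2 ≤ T.kz ^ 2 * ρ := by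
      rw [mul_pow]
      exact mul_le_mul_of_nonneg_left ((pow_le_pow_left₀ (norm_nonneg _) h2 2).trans hρ4)
        (sq_nonneg _)
    have k3 : (Y.state.eI - T.kI⁻¹ • ΔR) ⬝ᵥ (Y.state.eI - T.kI⁻¹ • ΔR) ≤ 3 * ρ :=
      (dot_self_le _).trans (by
        have := pow_le_pow_left₀ (norm_nonneg _) h3 2
        linarith)
    have k4 := mul_le_mul_of_nonneg_left (k1.trans (mul_le_mul_of_nonneg_left k2 (by norm_num)))
      (by positivity : 0 ≤ (2 * T.kz)⁻¹)
    have k5 : (2 * T.kz)⁻¹ * (3 * (T.kz ^ 2 * ρ)) = 3 / 2 * T.kz * ρ := by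
      field_simp
    have k6 := mul_le_mul_of_nonneg_left k3 (by positivity : 0 ≤ T.lam * (T.kI / 2))
    have k7 := mul_le_mul_of_nonneg_left h1 hb.le
    have k8 : E * ρ = b * ρ + 3 / 2 * T.kz * ρ + T.lam * (T.kI / 2) * (3 * ρ) := by
      rw [hE]
      ring
    have k9 : 0 < s ^ 2 := by positivity
    rw [← mul_assoc T.lam]
    linarith
  · intro Y hY
    obtain ⟨h1, h2, -⟩ := hK Y hY.1 hY.2.1
    have := hY.2.2
    linarith

/-- The trapping region of the solutions whose integral terms start at zero. -/
theorem Tuning.Good.exists_trap_box (hp : p.Physical) {T : Tuning} {δ δR η : ℝ} (hδ : 0 < δ)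
    (hη : 0 < η) (hη1 : η ≤ 1 / 2) (hT : T.Good p δ δR η) {Δx ΔR : V3} (hΔ : ‖Δx‖ ≤ δ)
    (hΔR : ‖ΔR‖ ≤ δR)
    (hne : ∀ d : V3, ‖d‖ ≤ δ + 2 * η → crossProduct p.b1d ((M00 p * p.g) • e3 + d) ≠ 0) :
    ∃ S K G : Set (Coord n), T.Trap p δ Δx ΔR S K G ∧
      ∃ ρ > 0, ∀ Y : Coord n, Y.state.Valid → Y.state.ex = 0 → Y.state.eI = 0 →
        sizeSq p Y.state Y.rate < ρ → Y ∈ S := by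
  obtain ⟨c, hc, hconf⟩ := hT.exists_confinement hp
  have hκ := hT.κ_pos
  -- The resultant force starts near `Δx`, and the barrier pushes its components towards zero, so
  -- they stay between `min (Δx i) 0` and `max (Δx i) 0` up to margins. As these two numbers add up
  -- to `Δx i`, the box is invariant under `u ↦ Δx - u`, which bounds the effective disturbance by
  -- `δ + 2 * η`.
  obtain ⟨lo, hlo⟩ : ∃ f : Fin 3 → ℝ, ∀ i, f i = min (Δx i) 0 := ⟨_, fun _ ↦ rfl⟩
  obtain ⟨up, hup⟩ : ∃ f : Fin 3 → ℝ, ∀ i, f i = max (Δx i) 0 := ⟨_, fun _ ↦ rfl⟩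
  have hΔi : ∀ i, |Δx i| ≤ δ := fun i ↦ (abs_apply_le_norm Δx i).trans hΔ
  have hlo0 : ∀ i, lo i ≤ 0 ∧ lo i ≤ Δx i ∧ -δ ≤ lo i := fun i ↦ by
    rw [hlo]
    exact ⟨min_le_right _ _, min_le_left _ _, le_min (abs_le.1 (hΔi i)).1 (by linarith)⟩
  have hup0 : ∀ i, 0 ≤ up i ∧ Δx i ≤ up i ∧ up i ≤ δ := fun i ↦ by
    rw [hup]
    exact ⟨le_max_right _ _, le_max_left _ _, max_le (abs_le.1 (hΔi i)).2 hδ.le⟩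
  have hsum : ∀ i, lo i + up i = Δx i := fun i ↦ by rw [hlo, hup, min_add_max, add_zero]
  obtain ⟨B, hB⟩ : ∃ B, B = ‖(0 - Sum.elim (T.kz⁻¹ • Δx) 0 : XIdx n → ℝ)‖
    + c * (Real.sqrt (T.level δ) + T.level δ) + 1 := ⟨_, rfl⟩
  have hgapc := (contDiff_forceGap (m := 0) p T Δx).continuous
  have hbox : ∀ u : V3, (∀ i, lo i - 2 * η ≤ u i ∧ u i ≤ up i + 2 * η) →
      ‖u‖ ≤ δ + 1 ∧ ‖Δx - u‖ ≤ δ + 2 * η := by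
    intro u hu
    constructor
    · refine (pi_norm_le_iff_of_nonneg (by linarith)).2 fun i ↦ abs_le.2 ⟨?_, ?_⟩
      · linarith [(hu i).1, hlo0 i]
      · linarith [(hu i).2, hup0 i]
    · refine (pi_norm_le_iff_of_nonneg (by linarith)).2 fun i ↦ abs_le.2 ?_
      have := hu i
      have := hsum i
      have := hlo0 i
      have := hup0 i
      constructor <;> simp only [Pi.sub_apply] <;> linarith
  -- The start has the margin `η`, at which the barrier acts; the other sets have the margin `2 *
  -- η`, so the faces of the larger box are not reached.
  refine ⟨{Y | Y.state.Valid ∧ T.lyap p Δx ΔR Y.state Y.rate < T.level δ ∧ Y.state.ex = 0 ∧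
      ∀ i, lo i - η ≤ T.forceGap p Δx Y.state i ∧ T.forceGap p Δx Y.state i ≤ up i + η},
    {Y | Y.state.Valid ∧ T.lyap p Δx ΔR Y.state Y.rate ≤ T.level δ ∧ exDist T.kz Δx Y.state ≤ B} ∩
      ⋂ i, {Y | lo i - 2 * η ≤ T.forceGap p Δx Y.state i ∧
        T.forceGap p Δx Y.state i ≤ up i + 2 * η},
    {Y | T.lyap p Δx ΔR Y.state Y.rate < T.level δ ∧ exDist T.kz Δx Y.state < B} ∩
      ⋂ i, {Y | lo i - 2 * η < T.forceGap p Δx Y.state i ∧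
        T.forceGap p Δx Y.state i < up i + 2 * η},
    ⟨?_, ?_, fun Y hY hv ↦ ?_, ?_, fun Y hY ↦ hY.1.1, fun Y hY ↦ hY.1.2.1, fun Y hY ↦ ?_,
      fun Y hY ↦ ?_⟩, ?_⟩
  · refine ((isOpen_lt (contDiff_lyap (m := 0) p T Δx ΔR).continuous continuous_const).inter
      (isOpen_lt (continuous_exDist _ _) continuous_const)).inter (isOpen_iInter_of_finite fun i ↦ ?_)
    exact (isOpen_lt continuous_const ((continuous_apply i).comp hgapc)).inter
      (isOpen_lt ((continuous_apply i).comp hgapc) continuous_const)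
  · refine (hT.isCompact_region Δx ΔR _ _).inter_right (isClosed_iInter fun i ↦ ?_)
    exact (isClosed_le continuous_const ((continuous_apply i).comp hgapc)).inter
      (isClosed_le ((continuous_apply i).comp hgapc) continuous_const)
  · have h2 := mem_iInter.1 hY.2
    exact ⟨⟨hv, hY.1.1.le, hY.1.2.le⟩, mem_iInter.2 fun i ↦ ⟨(h2 i).1.le, (h2 i).2.le⟩⟩
  · rintro Y t₁ ht₁ hYc hv ⟨-, h1, h2, h3⟩ hst
    have hreg : ∀ t, 0 ≤ t → t < t₁ → Follows p (T.gains p δ) Δx ΔR Y t ∧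
        T.lyap p Δx ΔR (Y t).state (Y t).rate ≤ T.level δ ∧
        ‖T.forceGap p Δx (Y t).state‖ ≤ δ + 1 := fun t h0 ht ↦ by
      obtain ⟨⟨k1, k2⟩, k3⟩ := hst t h0 ht
      have k4 := mem_iInter.1 k2
      exact ⟨k3, k1.1.le, (hbox _ fun i ↦ ⟨(k4 i).1.le, (k4 i).2.le⟩).1⟩
    obtain ⟨h4, h5⟩ := hconf Δx ΔR Y t₁ ht₁ hΔ hYc hv hreg
    have hlev : T.lyap p Δx ΔR (Y 0).state (Y 0).rate ≤ T.level δ := h1.le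
    refine ⟨⟨h4.trans_lt h1, h5.trans_lt ?_⟩, mem_iInter.2 fun i ↦ ?_⟩
    · have h6 := mul_le_mul_of_nonneg_left (add_le_add (Real.sqrt_le_sqrt hlev) hlev) hc
      have h7 : exDist T.kz Δx (Y 0).state = ‖(0 - Sum.elim (T.kz⁻¹ • Δx) 0 : XIdx n → ℝ)‖ := by
        rw [exDist, h2]
      rw [hB, h7]
      linarith
    · have hbar : ∀ t, 0 ≤ t → t < t₁ → ∃ g',
          HasDerivWithinAt (fun τ ↦ T.forceGap p Δx (Y τ).state i) g' (Ici 0) t ∧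
          (η ≤ T.forceGap p Δx (Y t).state i → g' < 0) ∧
          (T.forceGap p Δx (Y t).state i ≤ -η → 0 < g') := fun t h0 ht ↦ by
        obtain ⟨⟨a, b, d, w', hr⟩, k2, k3⟩ := hreg t h0 ht
        obtain ⟨g', k4, k5⟩ := hT.barrier Δx ΔR _ _ t a b d w' h0 hΔ hr k2 k3
        exact ⟨g' i, hasDerivWithinAt_pi.1 k4 i, k5 i⟩
      choose! g' hg' hgu hgl using hbar
      have hgc : ContinuousOn (fun τ ↦ T.forceGap p Δx (Y τ).state i) (Ici 0) :=
        ((continuous_apply i).comp hgapc).comp_continuousOn hYc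
      have u1 := le_of_deriv_neg_at_level (c := up i + η) ht₁ hgc hg' (h3 i).2 fun t h0 ht heq ↦
        hgu t h0 ht (by linarith [hup0 i])
      have u2 := le_of_deriv_neg_at_level (c := -(lo i - η)) ht₁ hgc.neg
        (fun t h0 ht ↦ (hg' t h0 ht).neg) (neg_le_neg (h3 i).1) fun t h0 ht heq ↦
          neg_neg_of_pos (hgl t h0 ht (by
            simp only [Pi.neg_apply] at heq
            linarith [hlo0 i]))
      simp only [Pi.neg_apply] at u2
      constructor <;> linarith
  · exact (hbox _ fun i ↦ mem_iInter.1 hY.2 i).1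
  · rw [hT.cross_idealThrust hΔ hY.1.1 hY.1.2.1, neg_ne_zero]
    exact hne _ (hbox _ fun i ↦ mem_iInter.1 hY.2 i).2
  · obtain ⟨ρ, hρ, hst⟩ := hT.start
    refine ⟨min ρ ((η / (T.κ + 1)) ^ 2), by positivity, fun Y hv hex heI hs ↦
      ⟨hv, hst Δx ΔR _ _ hΔ hΔR hv hex heI (hs.trans_le (min_le_left _ _)), hex, fun i ↦ ?_⟩⟩
    have h1 := hs.trans_le (min_le_right _ _)
    have h2 := attErr_nonneg hv.R_mem
    have h3 := dot_self_nonneg Y.rate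
    have h4 := sq_nonneg (posSize p Y.state)
    have h5 := sq_nonneg (velSize Y.state)
    have h7 : 0 ≤ η / (T.κ + 1) := by positivity
    rw [sizeSq] at h1
    have h6 : posSize p Y.state ≤ η / (T.κ + 1) :=
      abs_le_of_sq_le_sq' (by linarith) h7 |>.2
    have h8 : velSize Y.state ≤ η / (T.κ + 1) :=
      abs_le_of_sq_le_sq' (by linarith) h7 |>.2
    have h9 : (T.κ + 1) * (η / (T.κ + 1)) = η := by
      field_simp
    have h10 : T.forceGap p Δx Y.state i = Δx i - T.κ * Y.state.v i - (Y.state.x - p.xd) i := by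
      simp [Tuning.forceGap, integralGap, hex]
    have h11 : |Y.state.v i| ≤ velSize Y.state := by
      have := abs_apply_le_norm Y.state.v i
      rw [velSize]
      linarith [norm_nonneg Y.state.ω]
    have h12 : |(Y.state.x - p.xd) i| ≤ posSize p Y.state := by
      have := abs_apply_le_norm (Y.state.x - p.xd) i
      rw [posSize]
      linarith [norm_nonneg (Y.state.q - fun _ ↦ e3)]
    have h13 := abs_le.1 (h11.trans h8)
    have h14 := abs_le.1 (h12.trans h6)
    have h15 := mul_le_mul_of_nonneg_left h13.1 hκ.le
    have h16 := mul_le_mul_of_nonneg_left h13.2 hκ.le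
    have := hlo0 i
    have := hup0 i
    rw [h10]
    constructor <;> linarith

/-- A compact ball in an open set leaves room around it. The margin depends only on the data, so it
is available before the gains are chosen. -/
theorem exists_margin {f : V3 → Prop} (hf : IsOpen {d | f d}) {δ : ℝ} (hδ : 0 ≤ δ)
    (h : ∀ d, ‖d‖ ≤ δ → f d) : ∃ η > 0, η ≤ 1 / 2 ∧ ∀ d, ‖d‖ ≤ δ + 2 * η → f d := by
  have h1 : Metric.closedBall (0 : V3) δ ⊆ {d | f d} := fun d hd ↦ h d (by simpa using hd)
  obtain ⟨r, hr, h2⟩ := (isCompact_closedBall (0 : V3) δ).exists_cthickening_subset_open hf h1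
  rw [cthickening_closedBall hr.le hδ] at h2
  refine ⟨min (1 / 2) (r / 2), by positivity, min_le_left _ _, fun d hd ↦ h2 ?_⟩
  rw [mem_closedBall_zero_iff]
  linarith [min_le_right (1 / 2) (r / 2)]

end Trapping

end QuadCable

namespace QuadCable

/-! ### Solving the equations of motion for the accelerations -/

section MassOperator

variable {n : ℕ} (p : Params n)

/-- The operator that determines the accelerations of the quadrotor and of the links. -/
noncomputable def massOp (q : Fin n → V3) : (V3 × (Fin n → V3)) →L[ℝ] (V3 × (Fin n → V3)) :=
  LinearMap.toContinuousLinearMap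
    -- The first term of a link gives the equation of motion perpendicular to `q i`; the second
    -- prescribes the acceleration along it, which makes the system square.
    { toFun := fun z ↦ (baseMom p z.1 z.2, fun i ↦
        crossProduct (q i) (linkMom p z.1 z.2 i) + (q i ⬝ᵥ z.2 i) • q i)
      map_add' := fun z z' ↦ by
        refine Prod.ext ?_ (funext fun i ↦ ?_)
        · simp only [baseMom, Prod.fst_add, Prod.snd_add, Pi.add_apply, smul_add,
            Finset.sum_add_distrib]
          abel
        · simp only [linkMom, Prod.fst_add, Prod.snd_add, Pi.add_apply, smul_add,
            Finset.sum_add_distrib, map_add, dotProduct_add, add_smul]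
          abel
      map_smul' := fun c z ↦ by
        refine Prod.ext ?_ (funext fun i ↦ ?_)
        · simp only [baseMom, Prod.smul_fst, Prod.smul_snd, Pi.smul_apply, smul_add,
            Finset.smul_sum, RingHom.id_apply, smul_comm c]
        · simp only [linkMom, Prod.smul_fst, Prod.smul_snd, Pi.smul_apply, smul_add,
            Finset.smul_sum, RingHom.id_apply, smul_comm c, map_smul, map_add, map_sum,
            dotProduct_smul, smul_assoc] }

theorem massOp_apply (q : Fin n → V3) (a : V3) (b : Fin n → V3) :
    massOp p q (a, b) = (baseMom p a b, fun i ↦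
      crossProduct (q i) (linkMom p a b i) + (q i ⬝ᵥ b i) • q i) := rfl

variable {p}

theorem add_smul_eq_zero {q u : V3} {r : ℝ} (hq : q ⬝ᵥ q = 1)
    (h : crossProduct q u + r • q = 0) : r = 0 ∧ crossProduct q u = 0 := by
  have h1 := congrArg (q ⬝ᵥ ·) h
  simp only [dotProduct_add, dot_self_cross, dotProduct_smul, hq, dotProduct_zero] at h1
  have h2 : r = 0 := by simpa using h1
  rw [h2, zero_smul, add_zero] at h
  exact ⟨h2, h⟩

/-- On the kernel the momentum of a link is parallel to `q i`, while `b i` is perpendicular to it,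
so the kinetic energy of `(a, b)` vanishes. -/
theorem Params.Physical.massOp_injective (hp : p.Physical) {q : Fin n → V3}
    (hq : ∀ i, q i ⬝ᵥ q i = 1) : Function.Injective (massOp p q) := by
  obtain ⟨c, hc, hb⟩ := hp.exists_massForm_bound
  refine (injective_iff_map_eq_zero _).2 fun ⟨a, b⟩ h ↦ ?_
  rw [massOp_apply, Prod.mk_eq_zero] at h
  have h1 : ∀ i, b i ⬝ᵥ linkMom p a b i = 0 := fun i ↦ by
    obtain ⟨h2, h3⟩ := add_smul_eq_zero (hq i) (congrFun h.2 i)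
    have h4 := cross_cross_dot (q i) (q i) (linkMom p a b i)
    rw [h3, map_zero, hq i, one_smul] at h4
    rw [← sub_eq_zero.1 h4.symm, dotProduct_smul, dotProduct_comm (b i), h2, smul_zero]
  have h2 : massForm p a b = 0 := by
    rw [massForm, h.1, dotProduct_zero, Finset.sum_eq_zero fun i _ ↦ h1 i, add_zero]
  have h3 := hb a b
  rw [h2] at h3
  have h4 : ‖a‖ ^ 2 + ‖b‖ ^ 2 ≤ 0 := by
    by_contra! h5
    linarith [mul_pos hc h5]
  have h5 : ‖a‖ ^ 2 = 0 := by linarith [sq_nonneg ‖a‖, sq_nonneg ‖b‖]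
  have h6 : ‖b‖ ^ 2 = 0 := by linarith [sq_nonneg ‖a‖, sq_nonneg ‖b‖]
  rw [sq_eq_zero_iff, norm_eq_zero] at h5 h6
  rw [h5, h6]
  rfl

theorem Params.Physical.exists_massOp_equiv (hp : p.Physical) {q : Fin n → V3}
    (hq : ∀ i, q i ⬝ᵥ q i = 1) :
    ∃ e : (V3 × (Fin n → V3)) ≃L[ℝ] (V3 × (Fin n → V3)), (e : _ →L[ℝ] _) = massOp p q := by
  refine ⟨(LinearEquiv.ofInjectiveEndo (massOp p q : _ →ₗ[ℝ] _)
    (hp.massOp_injective hq)).toContinuousLinearEquiv, ?_⟩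
  ext z <;> rfl

theorem Params.Physical.massOp_inverse (hp : p.Physical) {q : Fin n → V3}
    (hq : ∀ i, q i ⬝ᵥ q i = 1) (z : V3 × (Fin n → V3)) :
    massOp p q ((massOp p q).inverse z) = z := by
  obtain ⟨e, he⟩ := hp.exists_massOp_equiv hq
  rw [← he, ContinuousLinearMap.inverse_equiv]
  exact e.apply_symm_apply z

theorem contDiff_massOp {m : WithTop ℕ∞} : ContDiff ℝ m (massOp p) := by
  refine contDiff_clm_apply_iff.2 fun ⟨a, b⟩ ↦ ?_
  simp only [massOp_apply, dotProduct]
  fun_prop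

end MassOperator

/-! ### Smoothness of the command frame -/

section Frame

variable {E : Type*} [NormedAddCommGroup E] [NormedSpace ℝ E] {m : WithTop ℕ∞}

theorem contDiffAt_normalize {f : E → V3} {x : E} (hf : ContDiffAt ℝ m f x) (hx : f x ≠ 0) :
    ContDiffAt ℝ m (fun y ↦ (len (f y))⁻¹ • f y) x := by
  have h1 : ContDiffAt ℝ m (fun y ↦ f y ⬝ᵥ f y) x := by
    simp only [dotProduct]
    have := contDiffAt_pi.1 hf
    fun_prop
  have h2 : f x ⬝ᵥ f x ≠ 0 := by
    rw [← len_sq]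
    exact pow_ne_zero 2 (len_pos hx).ne'
  exact ((h1.sqrt h2).inv (len_pos hx).ne').smul hf

theorem contDiffAt_cross {f g : E → V3} {x : E} (hf : ContDiffAt ℝ m f x)
    (hg : ContDiffAt ℝ m g x) : ContDiffAt ℝ m (fun y ↦ crossProduct (f y) (g y)) x := by
  rw [contDiffAt_pi] at hf hg ⊢
  intro i
  fin_cases i <;> simp [cross_apply] <;> fun_prop

theorem cross_cross_ne_zero {b c : V3} (hb : b ⬝ᵥ b = 1) (h : crossProduct b c ≠ 0) :
    crossProduct b (crossProduct b c) ≠ 0 := by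
  intro h1
  have h2 := cross_cross_dot b b (crossProduct b c)
  rw [h1, map_zero, dot_self_cross, hb, zero_smul, one_smul, zero_sub, eq_comm, neg_eq_zero] at h2
  exact h h2

theorem contDiffAt_frame {f : E → V3} {b : V3} {x : E} (hf : ContDiffAt ℝ m f x)
    (hx : f x ⬝ᵥ f x = 1) (hb : crossProduct (f x) b ≠ 0) :
    ContDiffAt ℝ m (fun y i j ↦ frame (f y) b i j) x := by
  have h1 := contDiffAt_cross hf (contDiffAt_const (c := b))
  have h2 := contDiffAt_pi.1 (contDiffAt_normalize h1 hb)
  have h3 := contDiffAt_pi.1 (contDiffAt_normalize (contDiffAt_cross hf h1)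
    (cross_cross_ne_zero hx hb))
  rw [contDiffAt_pi] at hf
  refine contDiffAt_pi.2 fun i ↦ contDiffAt_pi.2 fun j ↦ ?_
  simp only [frame_apply]
  fin_cases j
  · exact (h3 i).neg
  · exact h2 i
  · exact hf i

theorem normalize_dot_self {A : V3} (h : A ≠ 0) :
    (-((len A)⁻¹ • A)) ⬝ᵥ (-((len A)⁻¹ • A)) = 1 := by
  have := len_pos h
  rw [neg_dotProduct, dotProduct_neg, neg_neg, smul_dotProduct, dotProduct_smul, smul_eq_mul,
    smul_eq_mul, ← len_sq]
  field_simp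

theorem ne_zero_of_cross_ne_zero {b A : V3} (h : crossProduct b A ≠ 0) : A ≠ 0 := by
  rintro rfl
  exact h (map_zero _)

theorem cross_normalize_ne_zero {b A : V3} (h : crossProduct b A ≠ 0) :
    crossProduct (-((len A)⁻¹ • A)) b ≠ 0 := by
  rw [← cross_anticomm, map_neg, neg_neg, map_smul]
  exact smul_ne_zero (inv_ne_zero (len_pos (ne_zero_of_cross_ne_zero h)).ne') h

end Frame

/-! ### Commanded attitude and deviation of the thrust -/

section Command

variable {n : ℕ} {p : Params n} {k : Gains n}

theorem Rc_mem {st : State n} (h : crossProduct p.b1d (idealThrust p k st) ≠ 0) :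
    Rc p k st ∈ Matrix.specialOrthogonalGroup (Fin 3) ℝ :=
  frame_mem (normalize_dot_self (ne_zero_of_cross_ne_zero h)) (cross_normalize_ne_zero h)

/-- The thrust deviates from the ideal thrust by an amount that is bounded by the attitude error. -/
theorem deviation_le {st : State n} (hR : st.R ∈ Matrix.specialOrthogonalGroup (Fin 3) ℝ)
    (h : crossProduct p.b1d (idealThrust p k st) ≠ 0) :
    (-(thrust p k st • (st.R *ᵥ e3)) - idealThrust p k st) ⬝ᵥ
        (-(thrust p k st • (st.R *ᵥ e3)) - idealThrust p k st)
      ≤ 4 * (idealThrust p k st ⬝ᵥ idealThrust p k st) * attErr ((Rc p k st)ᵀ * st.R) := by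
  obtain ⟨A, hA⟩ : ∃ A, A = idealThrust p k st := ⟨_, rfl⟩
  obtain ⟨S, hS⟩ : ∃ S, S = (Rc p k st)ᵀ * st.R := ⟨_, rfl⟩
  obtain ⟨r, hr⟩ : ∃ r, r = st.R *ᵥ e3 := ⟨_, rfl⟩
  have hSm : S ∈ Matrix.specialOrthogonalGroup (Fin 3) ℝ := hS ▸ SO3_mul (SO3_transpose (Rc_mem h)) hR
  have hA0 : A ≠ 0 := hA ▸ ne_zero_of_cross_ne_zero h
  have hl := len_pos hA0
  have h1 : r ⬝ᵥ r = 1 := by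
    rw [hr, dotProduct_mulVec, vecMul_mulVec, SO3_transpose_mul hR]
    simp [e3, dotProduct, Fin.sum_univ_three]
  have h2 : S 2 2 = -((len A)⁻¹ * (A ⬝ᵥ r)) := by
    rw [hS, hr, mul_apply, hA]
    simp [Rc, frame_apply, b3c, mulVec, dotProduct, Fin.sum_univ_three, e3]
    ring
  have h3 : A ⬝ᵥ r = -(len A * S 2 2) := by
    rw [h2]
    field_simp
  have h4 : S 2 2 ≤ 1 := le_of_abs_le (SO3_abs_apply_le hSm 2 2)
  have h5 : -1 ≤ S 2 2 := neg_le_of_abs_le (SO3_abs_apply_le hSm 2 2)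
  have h6 := one_sub_le_attErr hSm
  -- The applied force is the projection of `A` onto the body axis, so the deviation is the
  -- perpendicular part of `A`. Finally `1 - S 2 2 ^ 2 ≤ 2 * (1 - S 2 2) ≤ 4 * attErr`.
  have h7 : (-(thrust p k st • r) - A) ⬝ᵥ (-(thrust p k st • r) - A)
      = (A ⬝ᵥ A) * (1 - S 2 2 ^ 2) := by
    have h8 : thrust p k st = len A * S 2 2 := by rw [thrust, ← hr, ← hA, h3, neg_neg]
    rw [h8]
    simp only [neg_dotProduct, dotProduct_neg, sub_dotProduct, dotProduct_sub, smul_dotProduct,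
      dotProduct_smul, smul_eq_mul, h1, dotProduct_comm r A, h3]
    rw [← len_sq A]
    ring
  rw [← hA, ← hS, ← hr, h7, mul_comm 4, mul_assoc]
  refine mul_le_mul_of_nonneg_left ?_ (dot_self_nonneg A)
  nlinarith

end Command

/-! ### The vector field of the reduced dynamics -/

section Field

variable {n : ℕ} {p : Params n} (T : Tuning) (δ : ℝ) (Δx ΔR : V3)

variable (p) in
/-- The ideal thrust without saturation. -/
noncomputable def Tuning.force (Y : Coord n) : V3 :=
  T.forceGap p Δx Y.state - Δx - (M00 p * p.g) • e3

variable (p) in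
/-- The desired attitude. -/
noncomputable def Tuning.frame (Y : Coord n) : Fin 3 → Fin 3 → ℝ := fun i j ↦
  QuadCable.frame (-((len (T.force p Δx Y))⁻¹ • T.force p Δx Y)) p.b1d i j

variable (p) in
/-- Third body-fixed axis of the quadrotor. -/
noncomputable def Tuning.axis (Y : Coord n) : V3 :=
  (Matrix.of (T.frame p Δx Y) * Y.state.R) *ᵥ e3

variable (p) in
/-- Accelerations of the quadrotor and of the links. -/
noncomputable def Tuning.acc (Y : Coord n) : V3 × (Fin n → V3) :=
  (massOp p Y.state.q).inverse
    ((T.force p Δx Y ⬝ᵥ T.axis p Δx Y) • T.axis p Δx Y + (M00 p * p.g) • e3 + Δx,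
      fun i ↦ weight p i • crossProduct (Y.state.q i) e3
        - (Y.state.ω i ⬝ᵥ Y.state.ω i) • Y.state.q i)

variable (p) in
/-- Acceleration of the attitude error. -/
noncomputable def Tuning.spin (Y : Coord n) : V3 :=
  p.J⁻¹ *ᵥ (-((T.gains p δ).kR • attVec Y.state.R) - (T.gains p δ).kΩ • Y.rate
    - (T.gains p δ).kI • Y.state.eI + ΔR)

variable (p) in
/-- Vector field of the reduced dynamics. -/
noncomputable def Tuning.field (Y : Coord n) : Coord n :=
  (Y.state.v, (T.acc p Δx Y).1, linkVel Y.state,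
    fun i ↦ crossProduct (Y.state.q i) ((T.acc p Δx Y).2 i),
    ((T.gains p δ).P * clB p)ᵀ *ᵥ z1 p Y.state, fun i j ↦ (Y.state.R * hat Y.rate) i j,
    T.spin p δ ΔR Y, Y.rate + (T.gains p δ).c2 • attVec Y.state.R)

variable {T δ Δx ΔR} {m : WithTop ℕ∞}

/-- The saturation is omitted in `Tuning.force`, which makes the field smooth; in the region of the
analysis it agrees with the ideal thrust. -/
theorem contDiff_force : ContDiff ℝ m (T.force p Δx) :=
  ((contDiff_forceGap p T Δx).sub contDiff_const).sub contDiff_const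

theorem contDiffAt_frameCmd {Y : Coord n} (h : crossProduct p.b1d (T.force p Δx Y) ≠ 0) :
    ContDiffAt ℝ m (T.frame p Δx) Y :=
  contDiffAt_frame (contDiffAt_normalize contDiff_force.contDiffAt (ne_zero_of_cross_ne_zero h)).neg
    (normalize_dot_self (ne_zero_of_cross_ne_zero h)) (cross_normalize_ne_zero h)

theorem contDiff_attVec : ContDiff ℝ m fun Y : Coord n ↦ attVec Y.state.R := by
  refine contDiff_pi.2 fun i ↦ ?_
  fin_cases i <;> simp [attVec, vee, Coord.state] <;> fun_prop

theorem contDiff_hat : ContDiff ℝ m fun Y : Coord n ↦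
    (fun i j ↦ (Y.state.R * hat Y.rate) i j : Fin 3 → Fin 3 → ℝ) := by
  refine contDiff_pi.2 fun i ↦ contDiff_pi.2 fun j ↦ ?_
  fin_cases j <;> simp [Matrix.mul_apply, hat, Fin.sum_univ_three, Coord.state, Coord.rate] <;>
    fun_prop

theorem contDiffAt_axis {Y : Coord n} (h : crossProduct p.b1d (T.force p Δx Y) ≠ 0) :
    ContDiffAt ℝ m (T.axis p Δx) Y := by
  have h1 := fun i j ↦ contDiffAt_pi.1 (contDiffAt_pi.1 (contDiffAt_frameCmd (m := m) h) i) j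
  refine contDiffAt_pi.2 fun i ↦ ?_
  simp only [Tuning.axis, mulVec, dotProduct, Matrix.mul_apply, Matrix.of_apply, Coord.state]
  fun_prop

/-- The accelerations solve a linear system, and the inversion of operators is smooth at invertible
ones. -/
theorem contDiffAt_acc (hp : p.Physical) {Y : Coord n} (hq : ∀ i, Y.state.q i ⬝ᵥ Y.state.q i = 1)
    (h : crossProduct p.b1d (T.force p Δx Y) ≠ 0) : ContDiffAt ℝ m (T.acc p Δx) Y := by
  have h1 := contDiffAt_axis (m := m) h
  have h2 := (contDiff_force (p := p) (T := T) (Δx := Δx) (m := m)).contDiffAt (x := Y)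
  have h3 : ContDiffAt ℝ m (fun Y ↦ T.force p Δx Y ⬝ᵥ T.axis p Δx Y) Y := by
    have k1 := contDiffAt_pi.1 h1
    have k2 := contDiffAt_pi.1 h2
    simp only [dotProduct]
    fun_prop
  obtain ⟨e, he⟩ := hp.exists_massOp_equiv hq
  have h4 : ContDiffAt ℝ m (fun Y : Coord n ↦ (massOp p Y.state.q).inverse) Y := by
    refine ContDiffAt.comp Y (g := ContinuousLinearMap.inverse) ?_
      (f := fun Y : Coord n ↦ massOp p Y.state.q) ?_
    · rw [← he]
      exact contDiffAt_map_inverse e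
    · refine (contDiff_massOp.comp (g := massOp p) (f := fun Y : Coord n ↦ Y.state.q) ?_).contDiffAt
      simp only [Coord.state]
      fun_prop
  refine h4.clm_apply (ContDiffAt.prodMk (by fun_prop) (ContDiff.contDiffAt ?_))
  simp only [Coord.state, dotProduct]
  fun_prop

theorem contDiff_spin : ContDiff ℝ m (T.spin p δ ΔR (n := n)) := by
  refine contDiff_mulVec _ ?_
  have h1 := contDiff_attVec (n := n) (m := m)
  have h2 : ContDiff ℝ m fun Y : Coord n ↦ Y.rate := by
    simp only [Coord.rate]
    fun_prop
  have h3 : ContDiff ℝ m fun Y : Coord n ↦ Y.state.eI := by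
    simp only [Coord.state]
    fun_prop
  fun_prop

theorem contDiffAt_field (hp : p.Physical) {Y : Coord n}
    (hq : ∀ i, Y.state.q i ⬝ᵥ Y.state.q i = 1) (h : crossProduct p.b1d (T.force p Δx Y) ≠ 0) :
    ContDiffAt ℝ m (T.field p δ Δx ΔR) Y := by
  have h1 := contDiffAt_acc (m := m) hp hq h
  have h2 : ContDiff ℝ m fun Y : Coord n ↦ linkVel Y.state := contDiff_pi.2 contDiff_linkVel
  have h3 : ContDiff ℝ m fun Y : Coord n ↦ ((T.gains p δ).P * clB p)ᵀ *ᵥ z1 p Y.state := by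
    refine contDiff_mulVec _ (contDiff_pi.2 ?_)
    rintro (i | i)
    · exact contDiff_pi.1 (contDiff_posErr p) i
    · exact contDiff_pi.1 contDiff_velErr i
  have h4 : ContDiff ℝ m fun Y : Coord n ↦ Y.rate + (T.gains p δ).c2 • attVec Y.state.R := by
    have h5 := contDiff_attVec (n := n) (m := m)
    simp only [Coord.rate]
    fun_prop
  have h5 : ContDiffAt ℝ m
      (fun Y ↦ fun i ↦ crossProduct (Y.state.q i) ((T.acc p Δx Y).2 i)) Y := by
    refine contDiffAt_pi.2 fun i ↦ contDiffAt_cross (ContDiff.contDiffAt ?_)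
      (contDiffAt_pi.1 h1.snd i)
    simp only [Coord.state]
    fun_prop
  refine ContDiffAt.prodMk (ContDiff.contDiffAt ?_) (h1.fst.prodMk (h2.contDiffAt.prodMk
    (h5.prodMk (h3.contDiffAt.prodMk (contDiff_hat.contDiffAt.prodMk
      (contDiff_spin.contDiffAt.prodMk h4.contDiffAt))))))
  simp only [Coord.state]
  fun_prop

end Field

end QuadCable

namespace QuadCable

/-! ### Existence of solutions of the reduced dynamics -/

section Existence

variable {n : ℕ} {p : Params n} {T : Tuning} {δ δR η : ℝ} {Δx ΔR : V3}

theorem acc_base (hp : p.Physical) {Y : Coord n} (hq : ∀ i, Y.state.q i ⬝ᵥ Y.state.q i = 1) :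
    baseMom p (T.acc p Δx Y).1 (T.acc p Δx Y).2
      = (T.force p Δx Y ⬝ᵥ T.axis p Δx Y) • T.axis p Δx Y + (M00 p * p.g) • e3 + Δx :=
  congrArg Prod.fst (hp.massOp_inverse hq _)

/-- The equation of a link has a part along `q i` and a part perpendicular to it, which hold
separately. -/
theorem acc_link (hp : p.Physical) {Y : Coord n} (hq : ∀ i, Y.state.q i ⬝ᵥ Y.state.q i = 1)
    (i : Fin n) :
    Y.state.q i ⬝ᵥ (T.acc p Δx Y).2 i = -(Y.state.ω i ⬝ᵥ Y.state.ω i) ∧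
    crossProduct (Y.state.q i)
      (linkMom p (T.acc p Δx Y).1 (T.acc p Δx Y).2 i - weight p i • e3) = 0 := by
  have h := congrFun (congrArg Prod.snd (hp.massOp_inverse hq
    ((T.force p Δx Y ⬝ᵥ T.axis p Δx Y) • T.axis p Δx Y + (M00 p * p.g) • e3 + Δx,
      fun i ↦ weight p i • crossProduct (Y.state.q i) e3
        - (Y.state.ω i ⬝ᵥ Y.state.ω i) • Y.state.q i))) i
  change crossProduct (Y.state.q i) (linkMom p (T.acc p Δx Y).1 (T.acc p Δx Y).2 i)
    + (Y.state.q i ⬝ᵥ (T.acc p Δx Y).2 i) • Y.state.q i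
    = weight p i • crossProduct (Y.state.q i) e3
      - (Y.state.ω i ⬝ᵥ Y.state.ω i) • Y.state.q i at h
  have h1 : crossProduct (Y.state.q i)
      (linkMom p (T.acc p Δx Y).1 (T.acc p Δx Y).2 i - weight p i • e3)
      + (Y.state.q i ⬝ᵥ (T.acc p Δx Y).2 i + Y.state.ω i ⬝ᵥ Y.state.ω i) • Y.state.q i = 0 := by
    rw [map_sub, map_smul, add_smul, sub_add_eq_add_sub, ← add_assoc, h]
    abel
  obtain ⟨h2, h3⟩ := add_smul_eq_zero (hq i) h1
  exact ⟨eq_neg_of_add_eq_zero_left h2, h3⟩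

/-- The state of the closed loop with given reduced state. -/
noncomputable def Coord.full (p : Params n) (k : Gains n) (Y : Coord n) : State n :=
  { Y.state with R := Rc p k Y.state * Y.state.R }

theorem idealThrust_full (k : Gains n) (Y : Coord n) :
    idealThrust p k (Y.full p k) = idealThrust p k Y.state := rfl

theorem Rc_full (k : Gains n) (Y : Coord n) : Rc p k (Y.full p k) = Rc p k Y.state := rfl

theorem Coord.full_valid {k : Gains n} {Y : Coord n} (hv : Y.state.Valid)
    (hc : crossProduct p.b1d (idealThrust p k Y.state) ≠ 0) : (Y.full p k).Valid :=
  ⟨SO3_mul (Rc_mem hc) hv.R_mem, hv.q_unit, hv.q_perp⟩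

theorem Rc_transpose_mul_full {k : Gains n} {Y : Coord n}
    (hc : crossProduct p.b1d (idealThrust p k Y.state) ≠ 0) :
    (Rc p k (Y.full p k))ᵀ * (Y.full p k).R = Y.state.R := by
  change (Rc p k Y.state)ᵀ * (Rc p k Y.state * Y.state.R) = Y.state.R
  rw [← Matrix.mul_assoc, SO3_transpose_mul (Rc_mem hc), Matrix.one_mul]

theorem of_frame_eq {Y : Coord n} (hf : idealThrust p (T.gains p δ) Y.state = T.force p Δx Y) :
    Matrix.of (T.frame p Δx Y) = Rc p (T.gains p δ) Y.state := by
  rw [Rc, b3c, hf]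
  rfl

theorem axis_eq {Y : Coord n} (hf : idealThrust p (T.gains p δ) Y.state = T.force p Δx Y) :
    T.axis p Δx Y = (Y.full p (T.gains p δ)).R *ᵥ e3 := by
  rw [Tuning.axis, of_frame_eq hf]
  rfl

/-- With `ω̇ = q × b` this is the product rule for `ω × q`. The result is `b` because `b` has the
centripetal component along `q`. -/
theorem linkVel_rate {q ω b : V3} (hq : q ⬝ᵥ q = 1) (hω : q ⬝ᵥ ω = 0)
    (hb : q ⬝ᵥ b = -(ω ⬝ᵥ ω)) :
    crossProduct (crossProduct q b) q + crossProduct ω (crossProduct ω q) = b := by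
  rw [← cross_anticomm, cross_cross_dot, cross_cross_dot, hq, hb, dotProduct_comm ω q, hω]
  simp

/-- A solution of the vector field of the reduced dynamics satisfies the reduced dynamics. -/
theorem reducedAt_of_hasDerivAt (hp : p.Physical) {Y : ℝ → Coord n} {t : ℝ}
    (hv : (Y t).state.Valid) (hf : idealThrust p (T.gains p δ) (Y t).state = T.force p Δx (Y t))
    (hc : crossProduct p.b1d (idealThrust p (T.gains p δ) (Y t).state) ≠ 0)
    (hY : HasDerivAt Y (T.field p δ Δx ΔR (Y t)) t) :
    ReducedAt p (T.gains p δ) Δx ΔR (fun τ ↦ (Y τ).state) (fun τ ↦ (Y τ).rate) t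
      (T.acc p Δx (Y t)).1 (T.acc p Δx (Y t)).2
      (-(thrust p (T.gains p δ) ((Y t).full p (T.gains p δ))
        • (((Y t).full p (T.gains p δ)).R *ᵥ e3)) - idealThrust p (T.gains p δ) (Y t).state)
      (T.spin p δ ΔR (Y t)) := by
  have h0 := hY.hasDerivWithinAt (s := Ici 0)
  have hx := h0.fst
  have h1 := h0.snd
  have hvel := h1.fst
  have h2 := h1.snd
  have hq := hasDerivWithinAt_pi.1 h2.fst
  have h3 := h2.snd
  have hω := hasDerivWithinAt_pi.1 h3.fst
  have h4 := h3.snd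
  have hex := h4.fst
  have h5 := h4.snd
  have hR := fun i ↦ hasDerivWithinAt_pi.1 (hasDerivWithinAt_pi.1 h5.fst i)
  have h6 := h5.snd
  have hl := fun i ↦ acc_link (T := T) (Δx := Δx) hp hv.q_unit i
  have hdev := deviation_le (Coord.full_valid hv hc).R_mem (by rwa [idealThrust_full])
  rw [Rc_transpose_mul_full hc, idealThrust_full] at hdev
  refine ⟨hv, hx, hvel, hq, hω, fun i ↦ ?_, hR, hex, h6.snd, h6.fst, ?_, fun i ↦ (hl i).2, hdev, ?_⟩
  · refine (hasDerivWithinAt_cross (hω i) (hq i)).congr_deriv ?_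
    exact linkVel_rate (hv.q_unit i) (hv.q_perp i) (hl i).1
  · rw [acc_base hp hv.q_unit, thrust, idealThrust_full, ← axis_eq hf, hf]
    simp only [neg_smul, neg_neg]
    abel
  · rw [Tuning.spin, mulVec_mulVec, Matrix.mul_nonsing_inv _ hp.J_pos.det_pos.ne'.isUnit, one_mulVec]

theorem eq_of_hasDerivAt_zero {f : ℝ → ℝ} (h : ∀ t, HasDerivAt f 0 t) (t : ℝ) : f t = f 0 :=
  is_const_of_deriv_eq_zero (fun t ↦ (h t).differentiableAt) (fun t ↦ (h t).deriv) t 0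

/-- The constraints are preserved by multiples of the vector field. -/
theorem valid_of_hasDerivAt {Y : ℝ → Coord n} {χ : ℝ → ℝ}
    (hY : ∀ t, HasDerivAt Y (χ t • T.field p δ Δx ΔR (Y t)) t) (h0 : (Y 0).state.Valid) (t : ℝ) :
    (Y t).state.Valid := by
  have hq : ∀ t i, HasDerivWithinAt (fun τ ↦ (Y τ).state.q i) (χ t • linkVel (Y t).state i) univ t :=
    fun t i ↦ hasDerivWithinAt_pi.1 (hY t).hasDerivWithinAt.snd.snd.fst i
  have hω : ∀ t i, HasDerivWithinAt (fun τ ↦ (Y τ).state.ω i)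
      (χ t • crossProduct ((Y t).state.q i) ((T.acc p Δx (Y t)).2 i)) univ t :=
    fun t i ↦ hasDerivWithinAt_pi.1 (hY t).hasDerivWithinAt.snd.snd.snd.fst i
  have hR : ∀ t i j, HasDerivAt (fun τ ↦ (Y τ).state.R i j)
      (χ t * ((Y t).state.R * hat (Y t).rate) i j) t := fun t i j ↦
    (hasDerivWithinAt_pi.1 (hasDerivWithinAt_pi.1
      (hY t).hasDerivWithinAt.snd.snd.snd.snd.snd.fst i) j).hasDerivAt univ_mem
  -- As `Ṙ` is a multiple of `R * hat w` with a skew matrix `hat w`, this product is constant by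
  -- algebra alone; for `Rᵀ * R` orthogonality would already be needed.
  have hrow : (Y t).state.R * (Y t).state.Rᵀ = 1 := by
    rw [← SO3_mul_transpose h0.R_mem]
    ext i j
    refine eq_of_hasDerivAt_zero (f := fun t ↦ ((Y t).state.R * (Y t).state.Rᵀ) i j) (fun t ↦ ?_) t
    simp only [Matrix.mul_apply, Fin.sum_univ_three, transpose_apply]
    refine ((((hR t i 0).mul (hR t j 0)).add ((hR t i 1).mul (hR t j 1))).add
      ((hR t i 2).mul (hR t j 2))).congr_deriv ?_
    simp [Matrix.mul_apply, Fin.sum_univ_three, hat]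
    ring
  have hdet : (Y t).state.R.det = 1 := by
    rw [← (mem_SO3_iff.1 h0.R_mem).2]
    refine eq_of_hasDerivAt_zero (f := fun t ↦ (Y t).state.R.det) (fun t ↦ ?_) t
    simp only [det_fin_three]
    have hm : ∀ i j k, HasDerivAt
        (fun τ ↦ (Y τ).state.R 0 i * (Y τ).state.R 1 j * (Y τ).state.R 2 k) _ t :=
      fun i j k ↦ ((hR t 0 i).mul (hR t 1 j)).mul (hR t 2 k)
    refine ((((((hm 0 1 2).sub (hm 0 2 1)).sub (hm 1 0 2)).add (hm 1 2 0)).add (hm 2 0 1)).sub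
      (hm 2 1 0)).congr_deriv ?_
    simp [Matrix.mul_apply, Fin.sum_univ_three, hat]
    ring
  refine ⟨mem_SO3_iff.2 ⟨mul_eq_one_comm.1 hrow, hdet⟩, fun i ↦ ?_, fun i ↦ ?_⟩
  · rw [← h0.q_unit i]
    refine eq_of_hasDerivAt_zero (f := fun t ↦ (Y t).state.q i ⬝ᵥ (Y t).state.q i) (fun t ↦ ?_) t
    refine ((hasDerivWithinAt_dot (hq t i) (hq t i)).hasDerivAt univ_mem).congr_deriv ?_
    rw [smul_dotProduct, dotProduct_smul, linkVel, dot_cross_self, dotProduct_comm, dot_cross_self]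
    simp
  · rw [← h0.q_perp i]
    refine eq_of_hasDerivAt_zero (f := fun t ↦ (Y t).state.q i ⬝ᵥ (Y t).state.ω i) (fun t ↦ ?_) t
    refine ((hasDerivWithinAt_dot (hq t i) (hω t i)).hasDerivAt univ_mem).congr_deriv ?_
    rw [smul_dotProduct, dotProduct_smul, linkVel, dot_self_cross, dotProduct_comm, dot_self_cross]
    simp

/-- Solutions of the reduced dynamics that start in a trapping region exist for all times. -/
theorem Tuning.Trap.exists_curve (hp : p.Physical) (hT : T.Good p δ δR η) (hΔ : ‖Δx‖ ≤ δ)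
    {S K G : Set (Coord n)} (h : T.Trap p δ Δx ΔR S K G) {Y₀ : Coord n} (hS : Y₀ ∈ S)
    (hv : Y₀.state.Valid) :
    ∃ Y : ℝ → Coord n, Y 0 = Y₀ ∧
      ∀ t, 0 ≤ t → Y t ∈ K ∧ HasDerivAt Y (T.field p δ Δx ΔR (Y t)) t := by
  have hf : ∀ Y ∈ K, idealThrust p (T.gains p δ) Y.state = T.force p Δx Y := fun Y hY ↦
    T.idealThrust_eq (hT.small Δx ΔR _ _ hΔ (h.valid Y hY) (h.lyap_le Y hY)).2.2.2
  -- The curve of the cut-off field is global and respects the constraints. While it is in `K` it is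
  -- a true solution, and trapping then shows that it never leaves `K`.
  obtain ⟨Y, c, h0, hc, hY⟩ := exists_cutoff_integral_curve (F := T.field p δ Δx ΔR) h.isCompact
    (fun Y hY ↦ contDiffAt_field hp (h.valid Y hY).q_unit (hf Y hY ▸ h.command Y hY)) Y₀
  have hval := valid_of_hasDerivAt (χ := fun t ↦ c (Y t)) hY (h0 ▸ hv)
  have hder : ∀ t, Y t ∈ K → HasDerivAt Y (T.field p δ Δx ΔR (Y t)) t := fun t ht ↦ by
    have := hY t
    rwa [hc _ ht, one_smul] at this
  have key := h.forall_mem (continuous_iff_continuousAt.2 fun t ↦ (hY t).continuousAt).continuousOn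
    (fun t _ ↦ hval t) (h0 ▸ hS) fun t _ htK ↦
      ⟨_, _, _, _, reducedAt_of_hasDerivAt hp (hval t) (hf _ htK) (h.command _ htK)
        (hder t htK)⟩
  exact ⟨Y, h0, fun t ht ↦ ⟨key t ht, hder t (key t ht)⟩⟩

end Existence

end QuadCable

namespace QuadCable

/-! ### Kinematics of the attitude error -/

section Kinematics

variable {t : ℝ} {s : Set ℝ}

theorem hasDerivWithinAt_matMul {A B : ℝ → Mat3} {A' B' : Mat3}
    (hA : ∀ i j, HasDerivWithinAt (fun τ ↦ A τ i j) (A' i j) s t)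
    (hB : ∀ i j, HasDerivWithinAt (fun τ ↦ B τ i j) (B' i j) s t) (i j : Fin 3) :
    HasDerivWithinAt (fun τ ↦ (A τ * B τ) i j) ((A' * B t + A t * B') i j) s t := by
  simp only [Matrix.add_apply, Matrix.mul_apply, ← Finset.sum_add_distrib]
  exact HasDerivWithinAt.fun_sum (u := Finset.univ) fun k _ ↦ (hA i k).mul (hB k j)

theorem hasDerivWithinAt_matMulVec {A : ℝ → Mat3} {u : ℝ → V3} {A' : Mat3} {u' : V3}
    (hA : ∀ i j, HasDerivWithinAt (fun τ ↦ A τ i j) (A' i j) s t)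
    (hu : HasDerivWithinAt u u' s t) :
    HasDerivWithinAt (fun τ ↦ A τ *ᵥ u τ) (A' *ᵥ u t + A t *ᵥ u') s t := by
  rw [hasDerivWithinAt_pi] at hu ⊢
  intro i
  simp only [Pi.add_apply, mulVec, dotProduct, ← Finset.sum_add_distrib]
  exact HasDerivWithinAt.fun_sum (u := Finset.univ) fun k _ ↦ (hA i k).mul (hu k)

/-- The derivative of a curve of rotations is given by its angular velocity. -/
theorem SO3_deriv_eq {C : ℝ → Mat3} {D : Mat3} (ht : 0 ≤ t)
    (hC : ∀ τ, 0 ≤ τ → C τ ∈ Matrix.specialOrthogonalGroup (Fin 3) ℝ)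
    (hD : ∀ i j, HasDerivWithinAt (fun τ ↦ C τ i j) (D i j) (Ici 0) t) :
    D = C t * hat (vee ((C t)ᵀ * D)) := by
  -- Differentiating `Cᵀ * C = 1` shows that `Cᵀ * D` is skew, so that `hat` and `vee` are inverse
  -- on it.
  have h1 : Dᵀ * C t + (C t)ᵀ * D = 0 := by
    ext i j
    have h2 := hasDerivWithinAt_matMul (A := fun τ ↦ (C τ)ᵀ) (A' := Dᵀ) (fun i j ↦ hD j i) hD i j
    have h3 : HasDerivWithinAt (fun τ ↦ ((C τ)ᵀ * C τ) i j) 0 (Ici 0) t :=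
      (hasDerivWithinAt_const t (Ici 0) ((1 : Mat3) i j)).congr
        (fun τ hτ ↦ by rw [SO3_transpose_mul (hC τ hτ)]) (by rw [SO3_transpose_mul (hC t ht)])
    exact (uniqueDiffOn_Ici (0 : ℝ) t ht).eq_deriv _ h2 h3
  have h4 : ((C t)ᵀ * D)ᵀ = -((C t)ᵀ * D) := by
    rw [transpose_mul, transpose_transpose]
    exact eq_neg_of_add_eq_zero_left h1
  rw [hat_vee h4, ← Matrix.mul_assoc, SO3_mul_transpose (hC t ht), Matrix.one_mul]

/-- Kinematics of the attitude error. -/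
theorem attitude_error_rate {C R D : Mat3} {Ω Ωc : V3}
    (hC : C ∈ Matrix.specialOrthogonalGroup (Fin 3) ℝ)
    (hR : R ∈ Matrix.specialOrthogonalGroup (Fin 3) ℝ) (hD : D = C * hat Ωc) :
    Dᵀ * R + Cᵀ * (R * hat Ω) = Cᵀ * R * hat (Ω - (Rᵀ * C) *ᵥ Ωc) := by
  have hS := SO3_mul (SO3_transpose hC) hR
  have h1 : (Cᵀ * R)ᵀ = Rᵀ * C := by rw [transpose_mul, transpose_transpose]
  have h2 := SO3_transpose_hat hS Ωc
  have h3 : hat (Ω - (Rᵀ * C) *ᵥ Ωc) = hat Ω - hat ((Rᵀ * C) *ᵥ Ωc) := by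
    ext i j
    fin_cases i <;> fin_cases j <;> simp [hat] <;> ring
  have h4 : Cᵀ * R * hat ((Rᵀ * C) *ᵥ Ωc) = hat Ωc * (Cᵀ * R) := by
    rw [← h1, ← h2]
    generalize Cᵀ * R = S at hS
    rw [← Matrix.mul_assoc, ← Matrix.mul_assoc, SO3_mul_transpose hS, Matrix.one_mul]
  rw [h3, Matrix.mul_sub, h4, hD, transpose_mul, hat_transpose]
  simp only [Matrix.mul_assoc, Matrix.neg_mul]
  abel

end Kinematics

/-! ### Trajectories satisfy the reduced dynamics -/

section Trajectory

variable {n : ℕ} {p : Params n} {k : Gains n} {Δx ΔR : V3}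

/-- The equation of motion of a link in terms of its momentum. -/
theorem link_iff {q ω : Fin n → V3} {a : V3} {b : Fin n → V3} {i : Fin n} (hq : q i ⬝ᵥ q i = 1)
    (hb : q i ⬝ᵥ b i = -(crossProduct (ω i) (q i) ⬝ᵥ crossProduct (ω i) (q i))) :
    crossProduct (q i) (linkMom p a b i - weight p i • e3) = 0 ↔
    Mij p i i • b i
        - (hat (q i) ^ 2) *ᵥ (M0 p i • a + ∑ j ∈ Finset.univ.erase i, Mij p i j • b j)
      = -((Mij p i i * len (crossProduct (ω i) (q i)) ^ 2) • q i)
        - (outerMass p i * p.g * p.l i) • ((hat (q i) ^ 2) *ᵥ e3) := by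
  have h1 : M0 p i • a + ∑ j ∈ Finset.univ.erase i, Mij p i j • b j
      = linkMom p a b i - Mij p i i • b i := by
    rw [linkMom, ← Finset.add_sum_erase _ _ (Finset.mem_univ i)]
    abel
  have hw : outerMass p i * p.g * p.l i = weight p i := rfl
  have h2 := cross_cross_dot (q i) (q i) (linkMom p a b i - weight p i • e3)
  -- A second product with `q i` loses nothing, since the first one is already perpendicular to `q
  -- i`. It brings the equation into the form with `hat (q i) ^ 2`.
  have h3 : crossProduct (q i) (linkMom p a b i - weight p i • e3) = 0 ↔
      crossProduct (q i) (crossProduct (q i) (linkMom p a b i - weight p i • e3)) = 0 := by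
    refine ⟨fun h ↦ by rw [h, map_zero], fun h ↦ ?_⟩
    have h4 := cross_cross_dot (q i) (q i)
      (crossProduct (q i) (linkMom p a b i - weight p i • e3))
    rw [h, map_zero, dot_self_cross, hq, zero_smul, one_smul, zero_sub, eq_comm, neg_eq_zero] at h4
    exact h4
  rw [h3, h1, hw, hat_sq_mulVec, hat_sq_mulVec, len_sq, ← sub_eq_zero (b := -_ - _)]
  have h5 : Mij p i i • b i
        - crossProduct (q i) (crossProduct (q i) (linkMom p a b i - Mij p i i • b i))
      - (-((Mij p i i * (crossProduct (ω i) (q i) ⬝ᵥ crossProduct (ω i) (q i))) • q i)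
        - weight p i • crossProduct (q i) (crossProduct (q i) e3))
      = -crossProduct (q i) (crossProduct (q i) (linkMom p a b i - weight p i • e3)) := by
    have h6 : crossProduct (q i) (crossProduct (q i) (b i)) = (q i ⬝ᵥ b i) • q i - b i := by
      rw [cross_cross_dot, hq, one_smul]
    simp only [map_sub, map_smul, h6, hb, smul_sub, neg_smul, smul_neg, smul_smul]
    abel
  rw [h5, neg_eq_zero]

theorem attVec_eq_eR (st : State n) : attVec ((Rc p k st)ᵀ * st.R) = eR p k st := by
  rw [attVec, eR, transpose_mul, transpose_transpose]

theorem attErr_eq_attFun (st : State n) : attErr ((Rc p k st)ᵀ * st.R) = attFun p k st := rfl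

/-- Reduced state of a state of the closed loop. -/
noncomputable def Coord.reduce (p : Params n) (k : Gains n) (st : State n) (w : V3) : Coord n :=
  (st.x, st.v, st.q, st.ω, st.ex, fun i j ↦ ((Rc p k st)ᵀ * st.R) i j, w, st.eI)

theorem Coord.reduce_valid {st : State n} (hv : st.Valid)
    (hc : crossProduct p.b1d (idealThrust p k st) ≠ 0) (w : V3) :
    (Coord.reduce p k st w).state.Valid :=
  ⟨SO3_mul (SO3_transpose (Rc_mem hc)) hv.R_mem, hv.q_unit, hv.q_perp⟩

/-- The feedforward part of the moment cancels the gyroscopic term and the rate of `RᵀR_cΩ_c`. The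
reason is that `hat w` and `hat Ω` agree on the vector `Sᵀ *ᵥ Ωc`, by which `w` and `Ω` differ. -/
theorem rotation_reduced {J S : Mat3} {Ω Ωc Ωc' Ω' τ w : V3} (hw : w = Ω - Sᵀ *ᵥ Ωc)
    (h : J *ᵥ Ω' + hat Ω *ᵥ (J *ᵥ Ω)
      = τ + crossProduct Ω (J *ᵥ Ω) - J *ᵥ (hat Ω *ᵥ (Sᵀ *ᵥ Ωc) - Sᵀ *ᵥ Ωc')) :
    J *ᵥ (Ω' - ((S * hat w)ᵀ *ᵥ Ωc + Sᵀ *ᵥ Ωc')) = τ := by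
  have h1 : (S * hat w)ᵀ *ᵥ Ωc = -(hat Ω *ᵥ (Sᵀ *ᵥ Ωc)) := by
    rw [transpose_mul, hat_transpose, ← mulVec_mulVec, neg_mulVec, hat_mulVec, hat_mulVec, hw,
      map_sub, LinearMap.sub_apply, cross_self, sub_zero]
  rw [hat_mulVec Ω (J *ᵥ Ω)] at h
  rw [h1, show Ω' - (-(hat Ω *ᵥ (Sᵀ *ᵥ Ωc)) + Sᵀ *ᵥ Ωc')
    = Ω' + (hat Ω *ᵥ (Sᵀ *ᵥ Ωc) - Sᵀ *ᵥ Ωc') by abel, mulVec_add]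
  have h2 := congrArg (· - crossProduct Ω (J *ᵥ Ω) + J *ᵥ (hat Ω *ᵥ (Sᵀ *ᵥ Ωc) - Sᵀ *ᵥ Ωc')) h
  simp only [add_sub_cancel_right] at h2
  exact h2.trans (by abel)

theorem rotation_full {J S : Mat3} {Ω Ωc Ωc' w w' τ : V3} (hΩ : Ω = w + Sᵀ *ᵥ Ωc)
    (h : J *ᵥ w' = τ) :
    J *ᵥ (w' + ((S * hat w)ᵀ *ᵥ Ωc + Sᵀ *ᵥ Ωc')) + hat Ω *ᵥ (J *ᵥ Ω)
      = τ + crossProduct Ω (J *ᵥ Ω) - J *ᵥ (hat Ω *ᵥ (Sᵀ *ᵥ Ωc) - Sᵀ *ᵥ Ωc') := by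
  have h1 : (S * hat w)ᵀ *ᵥ Ωc = -(hat Ω *ᵥ (Sᵀ *ᵥ Ωc)) := by
    rw [transpose_mul, hat_transpose, ← mulVec_mulVec, neg_mulVec, hat_mulVec, hat_mulVec, hΩ,
      map_add, LinearMap.add_apply, cross_self, add_zero]
  rw [h1, hat_mulVec Ω (J *ᵥ Ω), ← h]
  simp only [mulVec_add, mulVec_sub, mulVec_neg]
  abel

theorem Coord.eΩ_eq (st : State n) (Ω Ωc : V3) :
    eΩ p k st Ω Ωc = Ω - ((Rc p k st)ᵀ * st.R)ᵀ *ᵥ Ωc := by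
  rw [eΩ, transpose_mul, transpose_transpose]

theorem moment_eq (st : State n) (Ω Ωc Ωc' : V3) :
    moment p k st Ω Ωc Ωc' + ΔR
      = (-(k.kR • attVec ((Rc p k st)ᵀ * st.R)) - k.kΩ • eΩ p k st Ω Ωc - k.kI • st.eI + ΔR)
        + crossProduct Ω (p.J *ᵥ Ω)
        - p.J *ᵥ (hat Ω *ᵥ (((Rc p k st)ᵀ * st.R)ᵀ *ᵥ Ωc) - ((Rc p k st)ᵀ * st.R)ᵀ *ᵥ Ωc') := by
  rw [moment, attVec_eq_eR, transpose_mul, transpose_transpose]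
  abel

/-- Trajectories of the closed loop satisfy the reduced dynamics. -/
theorem IsTrajectory.follows {s : ℝ → State n} {Ω Ωc Ωc' : ℝ → V3}
    (h : IsTrajectory p k Δx ΔR s Ω Ωc Ωc') {t : ℝ} (ht : 0 ≤ t) :
    Follows p k Δx ΔR (fun t ↦ Coord.reduce p k (s t) (eΩ p k (s t) (Ω t) (Ωc t))) t := by
  obtain ⟨a, b, hv, hb, hbase, hlink⟩ := h.dynamics t ht
  obtain ⟨D, hD, hΩc⟩ := h.Ωc_eq t ht
  obtain ⟨w, hw, hrot⟩ := h.rotation t ht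
  have hval := h.valid t ht
  have hbq : ∀ i, (s t).q i ⬝ᵥ b i = -(crossProduct ((s t).ω i) ((s t).q i)
      ⬝ᵥ crossProduct ((s t).ω i) ((s t).q i)) := fun i ↦ by
    have h1 := hasDerivWithinAt_dot (hb i) (h.q_deriv t ht i)
    have h2 : (fun τ ↦ crossProduct ((s τ).ω i) ((s τ).q i) ⬝ᵥ (s τ).q i) = fun _ ↦ 0 := by
      ext τ
      rw [dotProduct_comm, dot_cross_self]
    rw [h2] at h1
    have h3 := (uniqueDiffOn_Ici (0 : ℝ) t ht).eq_deriv _ h1 (hasDerivWithinAt_const t (Ici 0) 0)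
    rw [dotProduct_comm]
    linarith
  have hDc := SO3_deriv_eq (C := fun τ ↦ Rc p k (s τ)) ht (fun τ hτ ↦ Rc_mem (h.command τ hτ)) hD
  rw [← hΩc] at hDc
  have hS : ∀ i j, HasDerivWithinAt (fun τ ↦ ((Rc p k (s τ))ᵀ * (s τ).R) i j)
      (((Rc p k (s t))ᵀ * (s t).R * hat (eΩ p k (s t) (Ω t) (Ωc t))) i j) (Ici 0) t := by
    intro i j
    refine (hasDerivWithinAt_matMul (A := fun τ ↦ (Rc p k (s τ))ᵀ) (A' := Dᵀ) (fun i j ↦ hD j i)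
      (h.R_deriv t ht) i j).congr_deriv ?_
    rw [attitude_error_rate (Rc_mem (h.command t ht)) hval.R_mem hDc]
    rfl
  have hw' : HasDerivWithinAt (fun τ ↦ eΩ p k (s τ) (Ω τ) (Ωc τ))
      (w - ((((Rc p k (s t))ᵀ * (s t).R) * hat (eΩ p k (s t) (Ω t) (Ωc t)))ᵀ *ᵥ Ωc t
        + ((Rc p k (s t))ᵀ * (s t).R)ᵀ *ᵥ Ωc' t)) (Ici 0) t := by
    simp only [Coord.eΩ_eq] at hS ⊢
    exact hw.sub (hasDerivWithinAt_matMulVec (A := fun τ ↦ ((Rc p k (s τ))ᵀ * (s τ).R)ᵀ)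
      (A' := (((Rc p k (s t))ᵀ * (s t).R) * hat (Ω t - ((Rc p k (s t))ᵀ * (s t).R)ᵀ *ᵥ Ωc t))ᵀ)
      (fun i j ↦ hS j i) (h.Ωc_deriv t ht))
  rw [moment_eq] at hrot
  have hJ := rotation_reduced (Coord.eΩ_eq (s t) (Ω t) (Ωc t)) hrot
  refine ⟨a, b, -(thrust p k (s t) • ((s t).R *ᵥ e3)) - idealThrust p k (s t), _,
    ⟨Coord.reduce_valid hval (h.command t ht) _, h.x_deriv t ht, hv, h.q_deriv t ht, fun i ↦ ?_,
      hb, hS, h.ex_deriv t ht, ?_, hw', ?_, fun i ↦ (link_iff (hval.q_unit i) (hbq i)).2 (hlink i),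
      deviation_le hval.R_mem (h.command t ht), hJ⟩⟩
  · have h1 := hasDerivWithinAt_cross (h.q_deriv t ht i) (hb i)
    rw [cross_self, zero_add] at h1
    exact h1.congr (fun τ hτ ↦ ((h.valid τ hτ).cross_linkVel i).symm) (hval.cross_linkVel i).symm
  · refine (h.eI_deriv t ht).congr_deriv ?_
    rw [← attVec_eq_eR]
    rfl
  · change baseMom p a b = idealThrust p k (s t) + _ + _ + _
    rw [baseMom, hbase]
    abel

end Trajectory

end QuadCable

namespace QuadCable

/-! ### Trajectories from solutions of the reduced dynamics -/

section Reconstruction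

variable {n : ℕ} {p : Params n} (T : Tuning) (δ : ℝ) (Δx ΔR : V3)

variable (p) in
/-- Rate of the desired attitude along the reduced dynamics. -/
noncomputable def Tuning.frameRate (Y : Coord n) : Fin 3 → Fin 3 → ℝ :=
  fderiv ℝ (T.frame p Δx) Y (T.field p δ Δx ΔR Y)

variable (p) in
/-- Desired angular velocity. -/
noncomputable def Tuning.frameVel (Y : Coord n) : V3 :=
  vee ((Matrix.of (T.frame p Δx Y))ᵀ * Matrix.of (T.frameRate p δ Δx ΔR Y))

variable {T δ Δx ΔR}

/-- The moment contains the derivative of `Ω_c`, hence two derivatives of the command along the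
solution. Smoothness of the frame and of the field makes them available. -/
theorem differentiableAt_frameVel (hp : p.Physical) {Y : Coord n}
    (hq : ∀ i, Y.state.q i ⬝ᵥ Y.state.q i = 1) (h : crossProduct p.b1d (T.force p Δx Y) ≠ 0) :
    DifferentiableAt ℝ (T.frameVel p δ Δx ΔR) Y := by
  have h1 : DifferentiableAt ℝ (T.frame p Δx) Y :=
    (contDiffAt_frameCmd (m := 1) h).differentiableAt one_ne_zero
  have h2 : DifferentiableAt ℝ (T.frameRate p δ Δx ΔR) Y :=
    (((contDiffAt_frameCmd (m := 2) h).fderiv_right (m := 1) (by norm_num)).clm_apply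
      (contDiffAt_field hp hq h)).differentiableAt one_ne_zero
  have h3 := fun i j ↦ differentiableAt_pi.1 (differentiableAt_pi.1 h1 i) j
  have h4 := fun i j ↦ differentiableAt_pi.1 (differentiableAt_pi.1 h2 i) j
  refine differentiableAt_pi.2 fun i ↦ ?_
  fin_cases i <;> simp [Tuning.frameVel, vee, Matrix.mul_apply] <;> fun_prop

theorem attitude_full_rate {C S D : Mat3} {w Ωc : V3}
    (hS : S ∈ Matrix.specialOrthogonalGroup (Fin 3) ℝ) (hD : D = C * hat Ωc) :
    D * S + C * (S * hat w) = C * S * hat (w + Sᵀ *ᵥ Ωc) := by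
  have h1 : hat (w + Sᵀ *ᵥ Ωc) = hat w + hat (Sᵀ *ᵥ Ωc) := by
    ext i j
    fin_cases i <;> fin_cases j <;> simp [hat] <;> ring
  have h2 : S * hat (Sᵀ *ᵥ Ωc) = hat Ωc * S := by
    rw [← SO3_transpose_hat hS, ← Matrix.mul_assoc, ← Matrix.mul_assoc, SO3_mul_transpose hS,
      Matrix.one_mul]
  rw [h1, Matrix.mul_add, Matrix.mul_assoc C S (hat (Sᵀ *ᵥ Ωc)), h2, hD, Matrix.mul_assoc C S,
    Matrix.mul_assoc C]
  abel

/-- Solutions of the reduced dynamics yield trajectories of the closed loop. -/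
theorem exists_isTrajectory (hp : p.Physical) {Y : ℝ → Coord n}
    (hY : ∀ t, 0 ≤ t → (Y t).state.Valid ∧
      idealThrust p (T.gains p δ) (Y t).state = T.force p Δx (Y t) ∧
      crossProduct p.b1d (idealThrust p (T.gains p δ) (Y t).state) ≠ 0 ∧
      HasDerivAt Y (T.field p δ Δx ΔR (Y t)) t) :
    ∃ Ω Ωc Ωc', IsTrajectory p (T.gains p δ) Δx ΔR (fun t ↦ (Y t).full p (T.gains p δ)) Ω Ωc Ωc' ∧
      eΩ p (T.gains p δ) ((Y 0).full p (T.gains p δ)) (Ω 0) (Ωc 0) = (Y 0).rate := by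
  obtain ⟨k, hk⟩ : ∃ k, k = T.gains p δ := ⟨_, rfl⟩
  have hred := fun t ht ↦ reducedAt_of_hasDerivAt hp (hY t ht).1 (hY t ht).2.1 (hY t ht).2.2.1
    (hY t ht).2.2.2
  have hS : ∀ t, 0 ≤ t → (Rc p k ((Y t).full p k))ᵀ * ((Y t).full p k).R = (Y t).state.R :=
    fun t ht ↦ Rc_transpose_mul_full (hk ▸ (hY t ht).2.2.1)
  have hframe : ∀ t, 0 ≤ t → Rc p k ((Y t).full p k) = Matrix.of (T.frame p Δx (Y t)) :=
    fun t ht ↦ by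
      rw [Rc_full, hk, of_frame_eq (hY t ht).2.1]
  have hforce : ∀ t, 0 ≤ t → crossProduct p.b1d (T.force p Δx (Y t)) ≠ 0 := fun t ht ↦ by
    have := (hY t ht).2.2.1
    rwa [(hY t ht).2.1] at this
  have hD : ∀ t, 0 ≤ t → ∀ i j, HasDerivWithinAt (fun τ ↦ Rc p k ((Y τ).full p k) i j)
      (T.frameRate p δ Δx ΔR (Y t) i j) (Ici 0) t := fun t ht i j ↦ by
    have h1 := ((contDiffAt_frameCmd (m := 1) (hforce t ht)).differentiableAt
      one_ne_zero).hasFDerivAt.comp_hasDerivAt t (hY t ht).2.2.2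
    have h2 := (hasDerivAt_pi.1 (hasDerivAt_pi.1 h1 i) j).hasDerivWithinAt (s := Ici 0)
    exact h2.congr (fun τ hτ ↦ by rw [hframe τ hτ]; rfl) (by rw [hframe t ht]; rfl)
  have hcom : ∀ t, 0 ≤ t → crossProduct p.b1d (idealThrust p k ((Y t).full p k)) ≠ 0 :=
    fun t ht ↦ hk ▸ (hY t ht).2.2.1
  -- The reduced field does not contain the desired angular velocity, so `Ωc` can be read off from
  -- the solution afterwards; `Ω` is then defined such that `e_Ω` is the rate of the reduced state.
  obtain ⟨Ωc, hΩc⟩ : ∃ f, f = fun t ↦ T.frameVel p δ Δx ΔR (Y t) := ⟨_, rfl⟩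
  obtain ⟨Ω, hΩ⟩ : ∃ f, f = fun t ↦ (Y t).rate + (Y t).state.Rᵀ *ᵥ Ωc t := ⟨_, rfl⟩
  have hvee : ∀ t, 0 ≤ t → Ωc t = vee ((Rc p k ((Y t).full p k))ᵀ
      * Matrix.of (T.frameRate p δ Δx ΔR (Y t))) := fun t ht ↦ by
    rw [hframe t ht, hΩc]
    rfl
  have hDc : ∀ t, 0 ≤ t → Matrix.of (T.frameRate p δ Δx ΔR (Y t))
      = Rc p k ((Y t).full p k) * hat (Ωc t) := fun t ht ↦ by
    rw [hvee t ht]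
    exact SO3_deriv_eq (C := fun τ ↦ Rc p k ((Y τ).full p k)) ht
      (fun τ hτ ↦ Rc_mem (hcom τ hτ)) (hD t ht)
  have hΩc' : ∀ t, 0 ≤ t → HasDerivWithinAt Ωc
      (fderiv ℝ (T.frameVel p δ Δx ΔR) (Y t) (T.field p δ Δx ΔR (Y t))) (Ici 0) t := fun t ht ↦ by
    rw [hΩc]
    exact ((differentiableAt_frameVel hp (hY t ht).1.q_unit
      (hforce t ht)).hasFDerivAt.comp_hasDerivAt t (hY t ht).2.2.2).hasDerivWithinAt
  have heΩ : ∀ t, 0 ≤ t → eΩ p k ((Y t).full p k) (Ω t) (Ωc t) = (Y t).rate := fun t ht ↦ by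
    rw [Coord.eΩ_eq, hS t ht, hΩ]
    simp
  rw [← hk] at hred ⊢
  refine ⟨Ω, Ωc, fun t ↦ fderiv ℝ (T.frameVel p δ Δx ΔR) (Y t) (T.field p δ Δx ΔR (Y t)),
    ⟨fun t ht ↦ Coord.full_valid (hY t ht).1 (hcom t ht), hcom, fun t ht ↦ (hred t ht).x_deriv,
      fun t ht ↦ (hred t ht).q_deriv, fun t ht i j ↦ ?_, fun t ht ↦ ?_, fun t ht ↦ ?_,
      fun t ht ↦ ⟨_, hD t ht, hvee t ht⟩, hΩc', fun t ht ↦ (hred t ht).ex_deriv, fun t ht ↦ ?_⟩,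
    heΩ 0 le_rfl⟩
  · refine (hasDerivWithinAt_matMul (A' := Matrix.of (T.frameRate p δ Δx ΔR (Y t)))
      (hD t ht) (hred t ht).R_deriv i j).congr_deriv ?_
    rw [attitude_full_rate (hY t ht).1.R_mem (hDc t ht), hΩ]
    rfl
  · have h := hred t ht
    refine ⟨_, _, h.v_deriv, h.linkVel_deriv, ?_, fun i ↦ ?_⟩
    · refine h.base.trans ?_
      abel
    · refine (link_iff (h.valid.q_unit i) ?_).1 (h.link i)
      have := h.dot_q ht i
      rw [← h.valid.linkVel_dot_self, dotProduct_comm] at this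
      exact this
  · have h := hred t ht
    have hw : HasDerivWithinAt Ω (T.spin p δ ΔR (Y t)
        + (((Y t).state.R * hat (Y t).rate)ᵀ *ᵥ Ωc t + (Y t).state.Rᵀ *ᵥ
          fderiv ℝ (T.frameVel p δ Δx ΔR) (Y t) (T.field p δ Δx ΔR (Y t)))) (Ici 0) t := by
      rw [hΩ]
      exact h.w_deriv.add (hasDerivWithinAt_matMulVec (A := fun τ ↦ (Y τ).state.Rᵀ)
        (A' := ((Y t).state.R * hat (Y t).rate)ᵀ) (fun i j ↦ h.R_deriv j i) (hΩc' t ht))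
    refine ⟨_, hw, ?_⟩
    rw [moment_eq, hS t ht, heΩ t ht]
    refine rotation_full ?_ h.rotation
    rw [hΩ]
  · refine (hred t ht).eI_deriv.congr_deriv ?_
    rw [heΩ t ht, ← attVec_eq_eR, hS t ht]

end Reconstruction

end QuadCable

namespace QuadCable

/-! ### Stability and convergence of the closed loop -/

section Main

variable {n : ℕ} {p : Params n} {T : Tuning} {δ δR η : ℝ} {Δx ΔR : V3}

theorem Follows.continuousWithinAt {k : Gains n} {Y : ℝ → Coord n} {t : ℝ}
    (hY : Follows p k Δx ΔR Y t) : ContinuousWithinAt Y (Ici 0) t := by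
  obtain ⟨a, b, d, w', h⟩ := hY
  exact (h.x_deriv.prodMk (h.v_deriv.prodMk ((hasDerivWithinAt_pi.2 h.q_deriv).prodMk
    ((hasDerivWithinAt_pi.2 h.ω_deriv).prodMk (h.ex_deriv.prodMk
      ((hasDerivWithinAt_pi.2 fun i ↦ hasDerivWithinAt_pi.2 fun j ↦ h.R_deriv i j).prodMk
        (h.w_deriv.prodMk h.eI_deriv))))))).continuousWithinAt

theorem attFun_nonneg (k : Gains n) {st : State n} (hv : st.Valid) : 0 ≤ attFun p k st := by
  have hb : b3c p k st ⬝ᵥ b3c p k st ≤ 1 := by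
    rcases eq_or_ne (idealThrust p k st) 0 with h | h
    · rw [b3c, h]
      simp
    · exact (normalize_dot_self h).le
  have h1 := trace_transpose_mul_le (A := Rc p k st) (fun j ↦ frame_col_le hb j) hv.R_mem
  rw [attFun, trace_sub]
  simp only [trace_one, Fintype.card_fin]
  push_cast
  linarith

theorem trackSize_eq (k : Gains n) (st : State n) (w : V3) :
    trackSize p k st w = posSize p st + velSize st + attFun p k st + ‖w‖ := by
  rw [trackSize, posSize, velSize]
  ring

theorem sizes_reduce (k : Gains n) (st : State n) (w : V3) :
    posSize p (Coord.reduce p k st w).state + velSize (Coord.reduce p k st w).state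
      + attErr (Coord.reduce p k st w).state.R + ‖(Coord.reduce p k st w).rate‖
      = trackSize p k st w := by
  rw [trackSize_eq]
  rfl

/-- Sizes below one exceed their squares; the factor 3 comes from `w ⬝ᵥ w ≤ 3 * ‖w‖ ^ 2`. -/
theorem sizeSq_reduce_le (k : Gains n) {st : State n} (hv : st.Valid) {w : V3} {ρ : ℝ} (hρ : ρ ≤ 1)
    (h : trackSize p k st w < ρ) :
    posSize p st ^ 2 + velSize st ^ 2 + w ⬝ᵥ w + attFun p k st < 3 * ρ := by
  have h1 := posSize_nonneg p st
  have h2 := velSize_nonneg st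
  have h3 := attFun_nonneg (p := p) k hv
  have h4 := norm_nonneg w
  rw [trackSize_eq] at h
  have h5 := dot_self_le w
  have k1 : posSize p st ^ 2 ≤ posSize p st := by
    rw [sq]
    exact mul_le_of_le_one_left h1 (by linarith)
  have k2 : velSize st ^ 2 ≤ velSize st := by
    rw [sq]
    exact mul_le_of_le_one_left h2 (by linarith)
  have k3 : ‖w‖ ^ 2 ≤ ‖w‖ := by
    rw [sq]
    exact mul_le_of_le_one_left h4 (by linarith)
  linarith

/-- The reduced state with the attitude error removed. -/
noncomputable def Coord.align (st : State n) (w : V3) : Coord n :=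
  (st.x, st.v, st.q, st.ω, st.ex, fun i j ↦ (1 : Mat3) i j, w, st.eI)

theorem Coord.align_valid {st : State n} (hv : st.Valid) (w : V3) :
    (Coord.align st w).state.Valid :=
  ⟨one_mem (Matrix.specialOrthogonalGroup (Fin 3) ℝ), hv.q_unit, hv.q_perp⟩

/-- The ideal thrust does not depend on the attitude. The state with trivial attitude error thus
certifies the command at the initial state, before `R_cᵀR` is known to be a rotation. -/
theorem idealThrust_align (k : Gains n) (st : State n) (w : V3) :
    idealThrust p k (Coord.align st w).state = idealThrust p k st := rfl

theorem sizeSq_align_le (k : Gains n) {st : State n} (hv : st.Valid) (w : V3) :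
    sizeSq p (Coord.align st w).state (Coord.align st w).rate
      ≤ posSize p st ^ 2 + velSize st ^ 2 + w ⬝ᵥ w + attFun p k st := by
  have h : attErr (Coord.align st w).state.R = 0 := by
    change attErr (1 : Mat3) = 0
    simp [attErr]
  rw [sizeSq, h]
  change posSize p st ^ 2 + velSize st ^ 2 + w ⬝ᵥ w + 0 ≤ _
  linarith [attFun_nonneg (p := p) k hv]

/-- The trapping property is applied to a constant curve at time zero, where no dynamics is
required. -/
theorem Tuning.Trap.subset {S K G : Set (Coord n)} (h : T.Trap p δ Δx ΔR S K G) {Y : Coord n}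
    (hv : Y.state.Valid) (hY : Y ∈ S) : Y ∈ K :=
  h.mem Y (h.stays (fun _ ↦ Y) 0 le_rfl continuousOn_const (fun _ _ ↦ hv) hY
    fun _ h0 h1 ↦ absurd h0 (not_le.2 h1)) hv

/-- A criterion for the convergence of the tracking errors. -/
theorem tendsto_of_trackSize {k : Gains n} {s : ℝ → State n} {w : ℝ → V3}
    (hv : ∀ t, 0 ≤ t → (s t).Valid) (hc : ∀ t, 0 ≤ t → crossProduct p.b1d (idealThrust p k (s t)) ≠ 0)
    (h : Tendsto (fun t ↦ trackSize p k (s t) (w t)) atTop (𝓝 0)) :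
    Tendsto (fun t => eR p k (s t)) atTop (𝓝 0) ∧ Tendsto w atTop (𝓝 0) ∧
    Tendsto (fun t => posErr p (s t)) atTop (𝓝 0) ∧
    Tendsto (fun t => velErr (s t)) atTop (𝓝 0) := by
  have hsz : ∀ t, 0 ≤ t → posSize p (s t) ≤ trackSize p k (s t) (w t) ∧
      velSize (s t) ≤ trackSize p k (s t) (w t) ∧ attFun p k (s t) ≤ trackSize p k (s t) (w t) ∧
      ‖w t‖ ≤ trackSize p k (s t) (w t) := fun t ht ↦ by
    have h1 := posSize_nonneg p (s t)
    have h2 := velSize_nonneg (s t)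
    have h3 := attFun_nonneg (p := p) k (hv t ht)
    have h4 := norm_nonneg (w t)
    rw [trackSize_eq]
    exact ⟨by linarith, by linarith, by linarith, by linarith⟩
  have hd := dim_nonneg n
  have habs : ∀ z : XIdx n → ℝ, ‖z‖ ≤ absSum z := fun z ↦
    (pi_norm_le_iff_of_nonneg (absSum_nonneg z)).2 fun i ↦ abs_le_absSum z i
  refine ⟨?_, ?_, ?_, ?_⟩
  · have h1 := (Real.continuous_sqrt.tendsto 0).comp (by simpa using h.const_mul 2)
    rw [Real.sqrt_zero] at h1
    refine squeeze_zero_norm' ?_ h1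
    filter_upwards [eventually_ge_atTop 0] with t ht
    have h2 := attVec_dot_self_le (SO3_mul (SO3_transpose (Rc_mem (hc t ht))) (hv t ht).R_mem)
    rw [attVec_eq_eR, attErr_eq_attFun] at h2
    refine Real.le_sqrt_of_sq_le ((norm_sq_le_dot_self _).trans (h2.trans ?_))
    linarith [(hsz t ht).2.2.1]
  · refine squeeze_zero_norm' ?_ h
    filter_upwards [eventually_ge_atTop 0] with t ht
    exact (hsz t ht).2.2.2
  · have h1 := h.const_mul (dim n * 2)
    rw [mul_zero] at h1
    refine squeeze_zero_norm' ?_ h1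
    filter_upwards [eventually_ge_atTop 0] with t ht
    refine (habs _).trans ((absSum_posErr_le p (s t)).trans ?_)
    rw [mul_assoc]
    exact mul_le_mul_of_nonneg_left (by linarith [(hsz t ht).1]) hd
  · have h1 := h.const_mul (dim n)
    rw [mul_zero] at h1
    refine squeeze_zero_norm' ?_ h1
    filter_upwards [eventually_ge_atTop 0] with t ht
    exact (habs _).trans ((absSum_velErr_le (s t)).trans
      (mul_le_mul_of_nonneg_left (hsz t ht).2.1 hd))

theorem full_reduce {k : Gains n} {st : State n} {w : V3}
    (hc : crossProduct p.b1d (idealThrust p k st) ≠ 0) :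
    (Coord.reduce p k st w).full p k = st := by
  have h : Rc p k st * ((Rc p k st)ᵀ * st.R) = st.R := by
    rw [← Matrix.mul_assoc, SO3_mul_transpose (Rc_mem hc), Matrix.one_mul]
  have h1 : idealThrust p k (Coord.reduce p k st w).state = idealThrust p k st := rfl
  have h2 : Rc p k (Coord.reduce p k st w).state = Rc p k st := by rw [Rc, Rc, b3c, b3c, h1]
  have h3 : (Coord.reduce p k st w).state.R = (Rc p k st)ᵀ * st.R := rfl
  rw [Coord.full, h2, h3, h]
  rfl

/-- Trajectories that start in a trapping region exist for all times, remain there and converge. -/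
theorem Tuning.Trap.trajectories (hp : p.Physical) (hT : T.Good p δ δR η) (hΔ : ‖Δx‖ ≤ δ)
    {S K G : Set (Coord n)} (h : T.Trap p δ Δx ΔR S K G) {s₀ : State n} {w₀ : V3} (hv : s₀.Valid)
    (ha : Coord.align s₀ w₀ ∈ S)
    (hS : (Coord.reduce p (T.gains p δ) s₀ w₀).state.Valid →
      Coord.reduce p (T.gains p δ) s₀ w₀ ∈ S) :
    (∃ s Ω Ωc Ωc', IsTrajectoryFrom p (T.gains p δ) Δx ΔR s₀ w₀ s Ω Ωc Ωc') ∧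
    ∀ s Ω Ωc Ωc', IsTrajectoryFrom p (T.gains p δ) Δx ΔR s₀ w₀ s Ω Ωc Ωc' →
      (∀ t, 0 ≤ t → Coord.reduce p (T.gains p δ) (s t) (eΩ p (T.gains p δ) (s t) (Ω t) (Ωc t)) ∈ K) ∧
      Tendsto (fun t ↦ trackSize p (T.gains p δ) (s t) (eΩ p (T.gains p δ) (s t) (Ω t) (Ωc t)))
        atTop (𝓝 0) := by
  have hc : crossProduct p.b1d (idealThrust p (T.gains p δ) s₀) ≠ 0 := by
    rw [← idealThrust_align _ s₀ w₀]
    exact h.command _ (h.subset (Coord.align_valid hv w₀) ha)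
  have hv₀ := Coord.reduce_valid hv hc w₀
  constructor
  · obtain ⟨Y, hY0, hY⟩ := h.exists_curve hp hT hΔ (hS hv₀) hv₀
    obtain ⟨Ω, Ωc, Ωc', h1, h2⟩ := exists_isTrajectory (T := T) (δ := δ) (Δx := Δx) (ΔR := ΔR) hp
      (Y := Y) fun t ht ↦ by
        obtain ⟨k1, k2⟩ := hY t ht
        exact ⟨h.valid _ k1, T.idealThrust_eq
          (hT.small Δx ΔR _ _ hΔ (h.valid _ k1) (h.lyap_le _ k1)).2.2.2, h.command _ k1, k2⟩
    refine ⟨_, Ω, Ωc, Ωc', h1, ?_, ?_⟩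
    · rw [hY0]
      exact full_reduce hc
    · rw [h2, hY0]
      rfl
  · rintro s Ω Ωc Ωc' ⟨htr, h0, hw⟩
    -- The trapping argument applies to every trajectory directly, so uniqueness of solutions plays
    -- no part.
    have hf := fun t (ht : 0 ≤ t) ↦ htr.follows ht
    have hK := h.forall_mem (fun t ht ↦ (hf t ht).continuousWithinAt)
      (fun t ht ↦ Coord.reduce_valid (htr.valid t ht) (htr.command t ht) _)
      (by
        rw [hw, h0]
        exact hS hv₀) fun t ht _ ↦ hf t ht
    refine ⟨hK, ?_⟩
    simpa only [sizes_reduce] using h.tendsto_zero hp hT hΔ fun t ht ↦ ⟨hK t ht, hf t ht⟩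

theorem Tuning.Trap.exists_bound {S K G : Set (Coord n)} (h : T.Trap p δ Δx ΔR S K G) :
    ∃ β, ∀ Y ∈ K, ‖Y.state.ex‖ ≤ β ∧ ‖Y.state.eI‖ ≤ β := by
  obtain ⟨β, hβ⟩ := h.isCompact.exists_bound_of_continuousOn
    (f := fun Y : Coord n ↦ (Y.state.ex, Y.state.eI)) (by
      simp only [Coord.state]
      fun_prop)
  exact ⟨β, fun Y hY ↦ norm_prod_le_iff.1 (hβ Y hY)⟩

/-- Convergence from the initial states that lie in a trapping region. -/
theorem Tuning.Trap.convergesFrom (hp : p.Physical) (hT : T.Good p δ δR η) (hΔ : ‖Δx‖ ≤ δ)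
    {S K G : Set (Coord n)} (h : T.Trap p δ Δx ΔR S K G) {start : ℝ → State n → Prop} {ρ : ℝ}
    (hρ : 0 < ρ) (hρ1 : ρ ≤ 1)
    (hS : ∀ (st : State n) (Y : Coord n), start ρ st → Y.state.Valid → Y.state.ex = st.ex →
      Y.state.eI = st.eI → sizeSq p Y.state Y.rate < 3 * ρ → Y ∈ S) :
    ConvergesFrom p (T.gains p δ) start Δx ΔR := by
  obtain ⟨β, hβ⟩ := h.exists_bound
  refine ⟨ρ, hρ, β, fun s₀ w₀ hv hs hst ↦ ?_⟩
  have h1 := sizeSq_reduce_le (T.gains p δ) hv hρ1 hs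
  obtain ⟨h2, h3⟩ := h.trajectories hp hT hΔ hv (w₀ := w₀)
    (hS s₀ _ hst (Coord.align_valid hv w₀) rfl rfl
      ((sizeSq_align_le (T.gains p δ) hv w₀).trans_lt h1))
    fun hr ↦ hS s₀ _ hst hr rfl rfl h1
  refine ⟨h2, fun s Ω Ωc Ωc' htr ↦ ?_⟩
  obtain ⟨h4, h5⟩ := h3 s Ω Ωc Ωc' htr
  obtain ⟨k1, k2, k3, k4⟩ := tendsto_of_trackSize htr.1.valid htr.1.command h5
  exact ⟨k1, k2, k3, k4, h5, fun t ht ↦ hβ _ (h4 t ht)⟩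

theorem Tuning.Good.lyapunovStable (hp : p.Physical) (hδ : 0 < δ) (hT : T.Good p δ δR η)
    (hΔ : ‖Δx‖ ≤ δ) (hne : crossProduct p.b1d ((M00 p * p.g) • e3 + Δx) ≠ 0) :
    LyapunovStable p (T.gains p δ) Δx ΔR := by
  intro ε hε
  obtain ⟨S, K, G, h, ⟨ρ, hρ, hS⟩, hK⟩ := hT.exists_trap_near hp hδ hΔ ΔR hne hε
  obtain ⟨r, hr0, m1, m2⟩ : ∃ r > 0, r ≤ 1 ∧ r ≤ ρ / 3 :=
    ⟨min 1 (ρ / 3), by positivity, min_le_left _ _, min_le_right _ _⟩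
  refine ⟨r, hr0, fun s₀ w₀ hv hs ↦ ?_⟩
  have n1 : 0 ≤ exDist T.kz Δx s₀ := norm_nonneg _
  have n2 := norm_nonneg (s₀.eI - T.kI⁻¹ • ΔR)
  have n3 : integralDist (T.gains p δ) Δx ΔR s₀ = exDist T.kz Δx s₀ + ‖s₀.eI - T.kI⁻¹ • ΔR‖ := rfl
  have n4 : 0 ≤ trackSize p (T.gains p δ) s₀ w₀ := by
    rw [trackSize_eq]
    linarith [posSize_nonneg p s₀, velSize_nonneg s₀, attFun_nonneg (p := p) (T.gains p δ) hv,
      norm_nonneg w₀]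
  have h1 := sizeSq_reduce_le (T.gains p δ) hv (w := w₀) m1 (by linarith)
  have h4 : exDist T.kz Δx s₀ ≤ ρ := by linarith
  have h5 : ‖s₀.eI - T.kI⁻¹ • ΔR‖ ≤ ρ := by linarith
  obtain ⟨h2, h3⟩ := h.trajectories hp hT hΔ hv (w₀ := w₀)
    (hS _ (Coord.align_valid hv w₀)
      ((sizeSq_align_le (T.gains p δ) hv w₀).trans (by linarith)) h4 h5)
    fun hr ↦ hS _ hr (h1.le.trans (by linarith)) h4 h5
  refine ⟨h2, fun s Ω Ωc Ωc' htr t ht ↦ ?_⟩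
  have h6 := hK _ ((h3 s Ω Ωc Ωc' htr).1 t ht)
  rw [trackSize_eq, integralDist, ← add_assoc]
  exact h6

end Main

end QuadCable

theorem mainTheorem5 {n : ℕ} (p : QuadCable.Params n)
    (hm : 0 < p.m) (hJ : p.J.PosDef) (hmL : ∀ i, 0 < p.mL i) (hl : ∀ i, 0 < p.l i) (hg : 0 < p.g)
    (hb1d : p.b1d ⬝ᵥ p.b1d = 1) (δ δR : ℝ) (hδ : 0 < δ) (hδR : 0 < δR) :
    ∃ k : QuadCable.Gains n, k.Admissible p δ ∧
      ∀ Δx ΔR : QuadCable.V3, ‖Δx‖ ≤ δ →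
        crossProduct p.b1d ((QuadCable.M00 p * p.g) • QuadCable.e3 + Δx) ≠ 0 →
        QuadCable.LyapunovStable p k Δx ΔR ∧
        QuadCable.ConvergesFrom p k (fun ρ st => QuadCable.integralDist k Δx ΔR st < ρ) Δx ΔR ∧
        (‖ΔR‖ ≤ δR →
          (∀ d : QuadCable.V3, ‖d‖ ≤ δ →
            crossProduct p.b1d ((QuadCable.M00 p * p.g) • QuadCable.e3 + d) ≠ 0) →
          QuadCable.ConvergesFrom p k (fun _ st => st.ex = 0 ∧ st.eI = 0) Δx ΔR) := by
  have hp : p.Physical := ⟨hm, hJ, hmL, hl, hg, hb1d⟩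
  -- The margin enters the choice of the gains, so it must not depend on the disturbances. If the
  -- command degenerates for some admissible disturbance, the last assertion is void and any margin
  -- will do.
  obtain ⟨η, hη, hη1, hmargin⟩ : ∃ η > 0, η ≤ 1 / 2 ∧
      ((∀ d : QuadCable.V3, ‖d‖ ≤ δ →
        crossProduct p.b1d ((QuadCable.M00 p * p.g) • QuadCable.e3 + d) ≠ 0) →
      ∀ d : QuadCable.V3, ‖d‖ ≤ δ + 2 * η →
        crossProduct p.b1d ((QuadCable.M00 p * p.g) • QuadCable.e3 + d) ≠ 0) := by
    by_cases h : ∀ d : QuadCable.V3, ‖d‖ ≤ δ →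
        crossProduct p.b1d ((QuadCable.M00 p * p.g) • QuadCable.e3 + d) ≠ 0
    · have hcont : Continuous fun d : QuadCable.V3 ↦
          crossProduct p.b1d ((QuadCable.M00 p * p.g) • QuadCable.e3 + d) :=
        (QuadCable.contDiff_cross (m := 0) contDiff_const (by fun_prop)).continuous
      obtain ⟨η, hη, hη1, h1⟩ := QuadCable.exists_margin
        (isOpen_ne_fun hcont continuous_const) hδ.le h
      exact ⟨η, hη, hη1, fun _ ↦ h1⟩
    · exact ⟨1 / 2, by norm_num, le_rfl, fun h' ↦ absurd h' h⟩
  obtain ⟨T, hT⟩ := hp.exists_tuning hδ hδR hη (by linarith)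
  refine ⟨T.gains p δ, hT.admissible, fun Δx ΔR hΔ hne ↦ ⟨hT.lyapunovStable hp hδ hΔ hne, ?_,
    fun hΔR hcom ↦ ?_⟩⟩
  · obtain ⟨S, K, G, h, ⟨ρ, hρ, hS⟩, -⟩ := hT.exists_trap_near hp hδ hΔ ΔR hne one_pos
    obtain ⟨r, hr0, m1, m2⟩ : ∃ r > 0, r ≤ 1 ∧ r ≤ ρ / 3 :=
      ⟨min 1 (ρ / 3), by positivity, min_le_left _ _, min_le_right _ _⟩
    refine h.convergesFrom hp hT hΔ (ρ := r) hr0 m1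
      fun st Y hst hv h1 h2 h3 ↦ hS Y hv (by linarith) ?_ ?_
    all_goals
      have n1 := norm_nonneg (st.ex - Sum.elim (T.kz⁻¹ • Δx) 0 : QuadCable.XIdx n → ℝ)
      have n2 := norm_nonneg (st.eI - T.kI⁻¹ • ΔR)
      have n3 : ‖(st.ex - Sum.elim (T.kz⁻¹ • Δx) 0 : QuadCable.XIdx n → ℝ)‖
        + ‖st.eI - T.kI⁻¹ • ΔR‖ < r := hst
    · rw [QuadCable.exDist, h1]
      linarith
    · rw [h2]
      linarith
  · obtain ⟨S, K, G, h, ρ, hρ, hS⟩ := hT.exists_trap_box hp hδ hη hη1 hΔ hΔR (hmargin hcom)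
    obtain ⟨r, hr0, m1, m2⟩ : ∃ r > 0, r ≤ 1 ∧ r ≤ ρ / 3 :=
      ⟨min 1 (ρ / 3), by positivity, min_le_left _ _, min_le_right _ _⟩
    exact h.convergesFrom hp hT hΔ (ρ := r) hr0 m1
      fun st Y hst hv h1 h2 h3 ↦ hS Y hv (h1.trans hst.1) (h2.trans hst.2) (by linarith)
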